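/- Let $V=\mathbb R^n$ with lattice $\Gamma=\mathbb Z^n$, let $\Lambda=\mathbb Z^n\subset V^*=\mathbb R^n$ be the dual lattice, and let $\mathcal A$ be a finite set of distinct hyperplanes through $0$ in $V$, each of them the zero set of a nonzero form $x_H\in\Lambda$, with $\bigcap\mathcal A=\{0\}$. Let $U_{\mathbb C}\subset V_{\mathbb C}=\mathbb C^n$ be the complement of the complexified hyperplanes. A function $f$ is *$\mathcal A$-rational* if it is a complex rational function on $V_{\mathbb C}$ without poles on $U_{\mathbb C}$. A point $t\in V^*$ is *regular* if it lies on no hyperplane $\lambda+L^\perp$, where $\lambda\in\Lambda$ and $L\subset V$ is a line that is an intersection of hyperplanes of $\mathcal A$ (for $n=1$ also $L=V$); the connected components $\Delta$ of the set of regular points are the *chambers* of $\Lambda+\check{\mathcal A}$. *Notation.* Let $\mathrm{Or}^n$ be the set of ordered linearly independent $n$-tuples $S=(H_1,\dots,H_n)$ of hyperplanes of $\mathcal A$. Let $\Omega^n$ be the space of germs at $0$ of meromorphic $n$-forms on $V_{\mathbb C}$ with poles along the hyperplanes of $\mathcal A$. For $S\in\mathrm{Or}^n$ with defining forms $x_1,\dots,x_n\in\Lambda$: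 * $b(S)=d\log x_1\wedge\dots\wedge d\log x_n\in\Omega^n$; the $\mathbb Z$-span of all $b(S)$ is the top part $OS^n$ of the Orlik–Solomon algebra, and is identified with $H^n(U_{\mathbb C},\mathbb Z)$; * $Z(S)\in H_n(U_{\mathbb C},\mathbb Z)$ is the class of the torus $|x_k|=\varepsilon_k$ $(k=1,\dots,n)$, $0<\varepsilon_1\ll\varepsilon_2\ll\dots\ll\varepsilon_n$, oriented by $(\arg x_1,\dots,\arg x_n)$; * for a chamber $\Delta$ and $t\in\Delta$, $$\mu_\Delta(S)=\frac1{\mathrm{vol}(\mathbf x)}\Big(\sum_{y\in\Lambda\cap(\mathrm{Cube}(\mathbf x)-t)}e^{y}\Big)\frac{dx_1}{1-e^{x_1}}\wedge\dots\wedge\frac{dx_n}{1-e^{x_n}}\in\Omega^n,$$ where $\mathrm{Cube}(\mathbf x)=\{\sum\lambda_kx_k\mid 0\le\lambda_k<1\}$ and $\mathrm{vol}(\mathbf x)=|\det(x_1,\dots,x_n)|$. For a meromorphic function $g$ with poles along $\mathcal A$, the pairing of $\eta\otimes C\in\Omega^n\otimes H_n(U_{\mathbb C},\mathbb Z)$ with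 $g$ is $\langle\eta\otimes C,g\rangle=(2\pi\sqrt{-1})^{-n}\int_C g\eta$, where $C$ is represented by a cycle close to $0$. In particular $\beta\otimes C\mapsto\langle\beta\otimes C,1\rangle$ is the pairing $H^n(U_{\mathbb C},\mathbb Z)\times H_n(U_{\mathbb C},\mathbb Z)\to\mathbb Z$. Let $\mathrm{diag}^n\in H^n(U_{\mathbb C},\mathbb Z)\otimes H_n(U_{\mathbb C},\mathbb Z)$ be the canonical element: $\mathrm{diag}^n=\sum_i\beta_i\otimes C_i$ with $\sum_i\langle\beta,C_i\rangle\beta_i=\beta$ for all $\beta$. A set $DB\subset\mathrm{Or}^n$ is a *diagonal basis* if $\sum_{S\in DB}b(S)\otimes Z(S)=\mathrm{diag}^n$. Finally, if $\mathbf x=(x_1,\dots,x_n)$ is a sequence of forms in $\Lambda$ representing $S$, then $\mathrm{iRes}_S\,g=\mathrm{Res}_{x_n=0}\cdots\mathrm{Res}_{x_1=0}\,g$, where $x_1,\dots,x_n$ are taken as coordinates on $V_{\mathbb C}$ and $\mathrm{Res}_{x_k=0}$ is the constant term of the Laurent expansion in $x_k$ at $0$, with the later coordinates $x_{k+1},\dots,x_n$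 fixed at generic values. **Theorem.** The element $\mathrm{diag}^n$ exists, and for every chamber $\Delta$ there is a unique homomorphism $q_\Delta:H^n(U_{\mathbb C},\mathbb Z)\to\Omega^n$ with $q_\Delta(b(S))=\mu_\Delta(S)$ for all $S\in\mathrm{Or}^n$ (with $\mu_\Delta(S)$ computed from any $t\in\Delta$). Let $f$ be $\mathcal A$-rational. 1. The Fourier series $B_f(t)=\sum_{j} e^{\langle t,j\rangle}f(j)$, where $j$ runs over $2\pi\sqrt{-1}\,\Gamma\cap U_{\mathbb C}$, converges (after integration against each test function) to a distribution $B_f$ on $V^*$, and on each chamber $\Delta$ this distribution is a polynomial function. 2. For each chamber $\Delta$, every $t\in\Delta$ and every diagonal basis $DB$, the value $B_f(t)$ of this polynomial is $$B_f(t)=\langle q_\Delta(\mathrm{diag}^n),e^{t}f\rangle,\tag{A}$$ $$B_f(t)=\sum_{S\in DB}\langle\mu_\Delta(S)\otimes Z(S),e^{t}f\rangle,\tag{B}$$ $$B_f(t)=\sum_{S\in DB}\mathrm{iRes}_S\;\frac1{\mathrm{vol}(\mathbf x)}\prod_{k=1}^n\frac{x_k}{1-e^{x_k}}\Big(\sum_{y\in\Lambda\cap(\mathrm{Cube}(\mathbf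 x)-t)}e^{y}\Big)e^{t}f,\tag{C}$$ where in (C), for each $S\in DB$, $\mathbf x=(x_1,\dots,x_n)$ is an arbitrary sequence of forms in $\Lambda$ representing $S$. -/

import Mathlib

open Filter Topology TensorProduct Set

noncomputable section

namespace MultipleBernoulli

/-! ### Integral arrangements

Coordinates are chosen so that `V = ℝⁿ`, `Γ = ℤⁿ ⊆ V`, `V* = ℝⁿ`, `Λ = ℤⁿ ⊆ V*`, the pairing being
the dot product.  A hyperplane of the arrangement is given by a defining form in `Λ`. -/

/-- The value `⟨y, z⟩` of the integral form `y` at the complex vector `z`. -/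
def evC {n : ℕ} (y : Fin n → ℤ) (z : Fin n → ℂ) : ℂ := ∑ k, (y k : ℂ) * z k

/-- The value `⟨y, v⟩` of the integral form `y` at the real vector `v`. -/
def evR {n : ℕ} (y : Fin n → ℤ) (v : Fin n → ℝ) : ℝ := ∑ k, (y k : ℝ) * v k

/-- The nonzero forms `y` and `y'` define the same hyperplane. -/
def SameHyperplane {n : ℕ} (y y' : Fin n → ℤ) : Prop :=
  y ≠ 0 ∧ y' ≠ 0 ∧ ∀ v : Fin n → ℝ, evR y v = 0 ↔ evR y' v = 0

/-- `x i`, `i ∈ ι`, are defining forms of the hyperplanes of an integral arrangement: they are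
nonzero, they define distinct hyperplanes, and the hyperplanes intersect in `0`. -/
structure IsIntegralArrangement {n : ℕ} {ι : Type*} (x : ι → Fin n → ℤ) : Prop where
  ne_zero : ∀ i, x i ≠ 0
  distinct : ∀ i j, SameHyperplane (x i) (x j) → i = j
  essential : ∀ v : Fin n → ℝ, (∀ i, evR (x i) v = 0) → v = 0

section Arrangement

variable {n : ℕ} {ι : Type*} (x : ι → Fin n → ℤ)

/-- The complement `U_ℂ` of the complexified arrangement. -/
def arrCompl : Set (Fin n → ℂ) := {z | ∀ i, evC (x i) z ≠ 0}

/-- The flat `⋂_{i ∈ I} H_i`. -/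
def flat (I : Set ι) : Submodule ℝ (Fin n → ℝ) :=
  ⨅ i ∈ I, LinearMap.ker (∑ k, (x i k : ℝ) • LinearMap.proj (R := ℝ) (φ := fun _ : Fin n => ℝ) k)

/-- The complement in `V*` of all `Λ`-translates of the hyperplanes dual to the one-dimensional
faces of the arrangement. -/
def regularSet : Set (Fin n → ℝ) :=
  {t | ∀ I : Set ι, Module.finrank ℝ (flat x I) = 1 →
    ∀ l : Fin n → ℤ, ¬ ∀ v ∈ flat x I, ∑ k, (t k - (l k : ℝ)) * v k = 0}

/-- The chambers: the connected components of the set of regular points. -/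
def chambers : Set (Set (Fin n → ℝ)) :=
  {Δ | ∃ t ∈ regularSet x, Δ = connectedComponentIn (regularSet x) t}

/-- `f` is a rational function whose poles are contained in the union of the hyperplanes (the values
of `f` on the hyperplanes are irrelevant). -/
def IsARational (f : (Fin n → ℂ) → ℂ) : Prop :=
  ∃ P Q : MvPolynomial (Fin n) ℂ, ∀ z ∈ arrCompl x,
    MvPolynomial.eval z Q ≠ 0 ∧ f z = MvPolynomial.eval z P / MvPolynomial.eval z Q

/-! ### The Fourier series -/

/-- The linear function `t` on `V_ℂ`. -/
def pair (t : Fin n → ℝ) (z : Fin n → ℂ) : ℂ := ∑ k, (t k : ℂ) * z k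

/-- The function `exp(t) f`. -/
def expMul (t : Fin n → ℝ) (f : (Fin n → ℂ) → ℂ) (z : Fin n → ℂ) : ℂ :=
  Complex.exp (pair t z) * f z

/-- The point `2π√-1 · j`. -/
def twoPiI (j : Fin n → ℤ) : Fin n → ℂ := fun k => 2 * Real.pi * Complex.I * (j k : ℂ)

/-- The distribution `T` on `V*` is the sum of the series `∑ exp⟨t, j⟩ f(j)`, where `j` runs over
the points of `2π√-1 Γ` that lie on no hyperplane of the arrangement. -/
def IsFourierSeries (f : (Fin n → ℂ) → ℂ)
    (T : Distribution (⊤ : TopologicalSpace.Opens (Fin n → ℝ)) ℂ ⊤) : Prop :=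
  ∀ φ : TestFunction (⊤ : TopologicalSpace.Opens (Fin n → ℝ)) ℝ ⊤,
    HasSum (fun j : {j : Fin n → ℤ // twoPiI j ∈ arrCompl x} =>
      ∫ t : Fin n → ℝ, (φ t : ℂ) * (Complex.exp (pair t (twoPiI j.1)) * f (twoPiI j.1))) (T φ)

/-- The restriction of the distribution `T` to `Δ` is the polynomial function `p`. -/
def RestrictsTo (T : Distribution (⊤ : TopologicalSpace.Opens (Fin n → ℝ)) ℂ ⊤)
    (Δ : Set (Fin n → ℝ)) (p : MvPolynomial (Fin n) ℂ) : Prop :=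
  ∀ φ : TestFunction (⊤ : TopologicalSpace.Opens (Fin n → ℝ)) ℝ ⊤, tsupport φ ⊆ Δ →
    T φ = ∫ t : Fin n → ℝ, (φ t : ℂ) * MvPolynomial.eval (fun k => (t k : ℂ)) p

end Arrangement

/-! ### Smooth cubical singular homology of subsets of `ℂⁿ` -/

section Homology

variable {n : ℕ}

/-- A `k`-cube in `ℂⁿ`. -/
abbrev Cube (n k : ℕ) : Type := (Fin k → unitInterval) → (Fin n → ℂ)

/-- Integral cubical `k`-chains in `ℂⁿ`. -/
abbrev Chain (n k : ℕ) : Type := Cube n k →₀ ℤ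

/-- The cube as a function on `ℝᵏ`, constant in the directions leaving the unit cube. -/
def Cube.ext {k : ℕ} (c : Cube n k) (u : Fin k → ℝ) : Fin n → ℂ :=
  c fun i => projIcc 0 1 zero_le_one (u i)

/-- The chains generated by the cubes that are smooth (up to the boundary) with image in `U`. -/
def smoothChains (U : Set (Fin n → ℂ)) (k : ℕ) : Submodule ℤ (Chain n k) :=
  Submodule.span ℤ {a | ∃ c : Cube n k,
    ContDiffOn ℝ (⊤ : ℕ∞) c.ext (Icc 0 1) ∧ (∀ u, c u ∈ U) ∧ a = Finsupp.single c 1}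

/-- The chains generated by the degenerate cubes, that is, those not depending on some
coordinate. -/
def degenerateChains (n k : ℕ) : Submodule ℤ (Chain n k) :=
  Submodule.span ℤ {a | ∃ c : Cube n k,
    (∃ i : Fin k, ∀ u u', (∀ j ≠ i, u j = u' j) → c u = c u') ∧ a = Finsupp.single c 1}

/-- The face of a cube on which the `i`th coordinate is `e`. -/
def Cube.face {k : ℕ} (c : Cube n (k + 1)) (i : Fin (k + 1)) (e : unitInterval) : Cube n k :=
  fun u => c (i.insertNth (α := fun _ => unitInterval) e u)

/-- The cubical boundary map. -/
def boundary (n : ℕ) : (k : ℕ) → Chain n k →ₗ[ℤ] Chain n (k - 1)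
  | 0 => 0
  | k + 1 => Finsupp.linearCombination ℤ fun c : Cube n (k + 1) => ∑ i : Fin (k + 1),
      (-1 : ℤ) ^ (i : ℕ) •
        (Finsupp.single (c.face i 1) (1 : ℤ) - Finsupp.single (c.face i 0) (1 : ℤ))

/-- Cycles modulo degenerate chains. -/
def cycles (U : Set (Fin n → ℂ)) (k : ℕ) : Submodule ℤ (Chain n k) :=
  smoothChains U k ⊓ (degenerateChains n (k - 1)).comap (boundary n k)

/-- Boundaries, and degenerate chains. -/
def boundaries (U : Set (Fin n → ℂ)) (k : ℕ) : Submodule ℤ (Chain n k) :=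
  (smoothChains U (k + 1)).map (boundary n (k + 1)) ⊔ (smoothChains U k ⊓ degenerateChains n k)

/-- The homology group `H_k(U, ℤ)`. -/
abbrev Homology (U : Set (Fin n → ℂ)) (k : ℕ) : Type :=
  cycles U k ⧸ (boundaries U k).comap (cycles U k).subtype

/-- The class of a cycle. -/
def homologyClass {U : Set (Fin n → ℂ)} {k : ℕ} (c : cycles U k) : Homology U k :=
  Submodule.Quotient.mk c

/-- The integral of the form `h dz₁ ∧ ⋯ ∧ dzₙ` over an `n`-cube. -/
def cubeIntegral (h : (Fin n → ℂ) → ℂ) (c : Cube n n) : ℂ :=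
  ∫ u in Icc (0 : Fin n → ℝ) 1,
    h (c.ext u) * (Matrix.of fun i j => fderiv ℝ c.ext u (Pi.single j 1) i).det

/-- The integral of the form `h dz₁ ∧ ⋯ ∧ dzₙ` over an `n`-chain. -/
def chainIntegral (h : (Fin n → ℂ) → ℂ) : Chain n n →ₗ[ℤ] ℂ :=
  Finsupp.linearCombination ℤ (cubeIntegral h)

/-- The image of a chain under the homothety with ratio `s`. -/
def scaleChain {k : ℕ} (s : ℝ) (a : Chain n k) : Chain n k :=
  Finsupp.mapDomain (fun (c : Cube n k) u => (s : ℂ) • c u) a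

end Homology

/-! ### Local meromorphic forms and the pairing -/

section Forms

variable {n : ℕ} {ι : Type*} [Fintype ι] (x : ι → Fin n → ℤ)

lemma analyticAt_evC (y : Fin n → ℤ) (w : Fin n → ℂ) : AnalyticAt ℂ (evC y) w := by
  have h : (evC y) = fun z : Fin n → ℂ =>
      (∑ k, (y k : ℂ) • ContinuousLinearMap.proj (R := ℂ) (φ := fun _ : Fin n => ℂ) k) z := by
    funext z
    simp [evC]
  rw [h]
  exact ContinuousLinearMap.analyticAt _ _

lemma evC_zero (y : Fin n → ℤ) : evC y 0 = 0 := by simp [evC]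

/-- Germs at `0` of meromorphic `n`-forms with poles along the arrangement.  An `n`-form
`h dz₁ ∧ ⋯ ∧ dzₙ` is recorded by its coefficient `h`, as a germ of functions near `0` on the
complement of the arrangement. -/
def meroForms : Submodule ℂ (Germ (𝓝[arrCompl x] 0) ℂ) where
  carrier := {φ | ∃ (N : ℕ) (F : (Fin n → ℂ) → ℂ), AnalyticAt ℂ F 0 ∧
    φ = ↑(fun z => F z / (∏ i, evC (x i) z) ^ N)}
  zero_mem' := ⟨0, fun _ => 0, analyticAt_const, by
    simp only [zero_div]; rfl⟩
  add_mem' := by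
    rintro _ _ ⟨N, F, hF, rfl⟩ ⟨M, G, hG, rfl⟩
    have hp : AnalyticAt ℂ (fun z : Fin n → ℂ => ∏ i, evC (x i) z) 0 :=
      Finset.analyticAt_fun_prod _ fun i _ => analyticAt_evC _ _
    refine ⟨N + M, fun z => F z * (∏ i, evC (x i) z) ^ M + G z * (∏ i, evC (x i) z) ^ N,
      (hF.mul (hp.pow M)).add (hG.mul (hp.pow N)), ?_⟩
    rw [← Germ.coe_add]
    refine Germ.coe_eq.2 ?_
    filter_upwards [self_mem_nhdsWithin] with z hz
    have h0 : (∏ i, evC (x i) z) ≠ 0 := Finset.prod_ne_zero_iff.2 fun i _ => hz i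
    simp only [Pi.add_apply]
    have h1 := pow_ne_zero N h0
    have h2 := pow_ne_zero M h0
    rw [pow_add, div_add_div _ _ h1 h2]
    congr 1
    ring
  smul_mem' := by
    rintro a _ ⟨N, F, hF, rfl⟩
    refine ⟨N, fun z => a * F z, analyticAt_const.mul hF, ?_⟩
    rw [← Germ.coe_smul]
    refine Germ.coe_eq.2 (Eventually.of_forall fun z => ?_)
    simp only [Pi.smul_apply, smul_eq_mul]
    ring

/-- `HasPairing x D g v`: the value of the pairing of `D ∈ Ωⁿ ⊗ H_n(U_ℂ, ℤ)` with the meromorphic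
function `g` is `v`, where `⟨η ⊗ C, g⟩ = (2π√-1)⁻ⁿ ∫_C g η`.  As `η` is only defined near `0`, the
integral is taken over a representing cycle that has been shrunk towards `0`. -/
def HasPairing (D : meroForms x ⊗[ℤ] Homology (arrCompl x) n) (g : (Fin n → ℂ) → ℂ) (v : ℂ) : Prop :=
  ∀ (m : ℕ) (η : Fin m → meroForms x) (h : Fin m → (Fin n → ℂ) → ℂ)
    (c : Fin m → cycles (arrCompl x) n),
    (∀ i, (η i : Germ (𝓝[arrCompl x] 0) ℂ) = ↑(h i)) →
    D = ∑ i, η i ⊗ₜ[ℤ] homologyClass (c i) →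
    ∀ᶠ s : ℝ in 𝓝[>] 0, ((2 * Real.pi * Complex.I) ^ n)⁻¹ *
      ∑ i, chainIntegral (fun z => g z * h i z) (scaleChain s (c i : Chain n n)) = v

/-- The set `Orⁿ` of ordered linearly independent `n`-tuples of hyperplanes. -/
def OrdTuple : Type _ :=
  {S : Fin n → ι // LinearIndependent ℝ fun (k : Fin n) (l : Fin n) => (x (S k) l : ℝ)}

variable {x}

/-- The sequence of the chosen defining forms of the hyperplanes in `S`. -/
def OrdTuple.forms (S : OrdTuple x) : Fin n → Fin n → ℤ := fun k => x (S.1 k)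

end Forms

section Cubes

variable {n : ℕ}

/-- The determinant of a sequence of `n` forms. -/
def formsDet (y : Fin n → Fin n → ℤ) : ℤ := (Matrix.of y).det

/-- The volume of the cube spanned by `n` forms, with respect to `Λ`. -/
def vol (y : Fin n → Fin n → ℤ) : ℕ := (formsDet y).natAbs

/-- The lattice points in `Cube(y) - t`, where
`Cube(y) = {∑ₖ λₖ yₖ | 0 ≤ λₖ < 1}`. -/
def cubePoints (y : Fin n → Fin n → ℤ) (t : Fin n → ℝ) : Set (Fin n → ℤ) :=
  {p | ∃ a : Fin n → ℝ, (∀ k, 0 ≤ a k ∧ a k < 1) ∧ ∀ l, (p l : ℝ) + t l = ∑ k, a k * (y k l : ℝ)}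

/-- The function `∑_{p ∈ Λ ∩ (Cube(y) - t)} exp(p)`. -/
def cubeCharacter (y : Fin n → Fin n → ℤ) (t : Fin n → ℝ) (z : Fin n → ℂ) : ℂ :=
  ∑ᶠ p ∈ cubePoints y t, Complex.exp (evC p z)

/-- The coefficient of `d log y₁ ∧ ⋯ ∧ d log yₙ`. -/
def logCoeff (y : Fin n → Fin n → ℤ) (z : Fin n → ℂ) : ℂ := (formsDet y : ℂ) * ∏ k, (evC (y k) z)⁻¹

/-- The coefficient of
`vol(y)⁻¹ (∑_{p ∈ Λ ∩ (Cube(y) - t)} exp(p)) ∏ₖ dyₖ / (1 - exp(yₖ))`. -/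
def toddCoeff (y : Fin n → Fin n → ℤ) (t : Fin n → ℝ) (z : Fin n → ℂ) : ℂ :=
  (vol y : ℂ)⁻¹ * cubeCharacter y t z *
    ((formsDet y : ℂ) * ∏ k, (1 - Complex.exp (evC (y k) z))⁻¹)

lemma cubePoints_finite (y : Fin n → Fin n → ℤ) (t : Fin n → ℝ) : (cubePoints y t).Finite := by
  set R : ℝ := ∑ l, (|t l| + ∑ k, |(y k l : ℝ)|) with hR
  refine (Set.finite_Icc (fun _ : Fin n => -⌈R⌉) (fun _ => ⌈R⌉)).subset ?_
  rintro p ⟨a, ha, hp⟩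
  have key : ∀ l, |(p l : ℝ)| ≤ R := by
    intro l
    have h1 : (p l : ℝ) = (∑ k, a k * (y k l : ℝ)) - t l := by rw [← hp l]; ring
    have h2 : |(p l : ℝ)| ≤ |t l| + ∑ k, |(y k l : ℝ)| := by
      rw [h1, sub_eq_add_neg, add_comm]
      refine (abs_add_le _ _).trans ?_
      rw [abs_neg]
      gcongr
      refine (Finset.abs_sum_le_sum_abs _ _).trans (Finset.sum_le_sum fun k _ => ?_)
      rw [abs_mul, abs_of_nonneg (ha k).1]
      exact mul_le_of_le_one_left (abs_nonneg _) (ha k).2.le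
    refine h2.trans ?_
    exact Finset.single_le_sum (f := fun l => |t l| + ∑ k, |(y k l : ℝ)|)
      (fun l _ => by positivity) (Finset.mem_univ l)
  refine ⟨fun l => ?_, fun l => ?_⟩
  · have := (neg_le_of_abs_le (key l))
    have h3 : (-(⌈R⌉ : ℤ) : ℝ) ≤ (p l : ℝ) := by linarith [Int.le_ceil R]
    exact_mod_cast h3
  · have h3 : (p l : ℝ) ≤ (⌈R⌉ : ℝ) := (le_of_abs_le (key l)).trans (Int.le_ceil R)
    exact_mod_cast h3

end Cubes

section Maps

variable {n : ℕ} {ι : Type*} [Fintype ι] {x : ι → Fin n → ℤ}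

lemma coe_mem_meroForms {F : (Fin n → ℂ) → ℂ} (hF : AnalyticAt ℂ F 0) :
    ((F : (Fin n → ℂ) → ℂ) : Germ (𝓝[arrCompl x] 0) ℂ) ∈ meroForms x :=
  ⟨0, F, hF, by simp⟩

lemma mul_div_mem_meroForms {h G : (Fin n → ℂ) → ℂ}
    (hh : (h : Germ (𝓝[arrCompl x] 0) ℂ) ∈ meroForms x) (hG : AnalyticAt ℂ G 0) (i : ι) :
    ((fun z => h z * (G z / evC (x i) z) : (Fin n → ℂ) → ℂ) : Germ (𝓝[arrCompl x] 0) ℂ) ∈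
      meroForms x := by
  classical
  obtain ⟨N, F, hF, hE⟩ := hh
  refine ⟨N + 1, fun z => F z * G z * ∏ j ∈ Finset.univ.erase i, evC (x j) z,
    (hF.mul hG).mul (Finset.analyticAt_fun_prod _ fun i _ => analyticAt_evC _ _), ?_⟩
  refine Germ.coe_eq.2 ?_
  filter_upwards [Germ.coe_eq.1 hE, self_mem_nhdsWithin] with z hz hzU
  have h0 : ∀ j, evC (x j) z ≠ 0 := hzU
  have h2 : (∏ j ∈ Finset.univ.erase i, evC (x j) z) ≠ 0 := Finset.prod_ne_zero_iff.2 fun j _ => h0 j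
  rw [hz, ← Finset.mul_prod_erase Finset.univ (fun j => evC (x j) z) (Finset.mem_univ i)]
  have h1 := h0 i
  have h3 := pow_ne_zero N (mul_ne_zero h1 h2)
  rw [div_mul_div_comm, pow_succ, div_eq_div_iff (mul_ne_zero h3 h1)
    (mul_ne_zero h3 (mul_ne_zero h1 h2))]
  ring

lemma prod_mem_meroForms (S : Fin n → ι) (G : Fin n → (Fin n → ℂ) → ℂ)
    (hG : ∀ k, AnalyticAt ℂ (G k) 0) {F : (Fin n → ℂ) → ℂ} (hF : AnalyticAt ℂ F 0) :
    ((fun z => F z * ∏ k, (G k z / evC (x (S k)) z) : (Fin n → ℂ) → ℂ) :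
      Germ (𝓝[arrCompl x] 0) ℂ) ∈ meroForms x := by
  classical
  have : ∀ s : Finset (Fin n),
      ((fun z => F z * ∏ k ∈ s, (G k z / evC (x (S k)) z) : (Fin n → ℂ) → ℂ) :
        Germ (𝓝[arrCompl x] 0) ℂ) ∈ meroForms x := by
    intro s
    induction s using Finset.induction_on with
    | empty => simpa using coe_mem_meroForms (x := x) hF
    | insert a s ha ih =>
      have h := mul_div_mem_meroForms ih (hG a) (S a)
      refine (congrArg (· ∈ meroForms x) ?_).mp h
      congr 1
      funext z
      rw [Finset.prod_insert ha]
      ring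
  exact this Finset.univ

/-- The form `b(S) = d log x₁ ∧ ⋯ ∧ d log xₙ`. -/
def logForm (S : OrdTuple x) : meroForms x :=
  ⟨(logCoeff S.forms : Germ (𝓝[arrCompl x] 0) ℂ), by
    have h := prod_mem_meroForms (x := x) S.1 (fun _ _ => 1) (fun _ => analyticAt_const)
      (F := fun _ => (formsDet S.forms : ℂ)) analyticAt_const
    simp only [one_div] at h
    exact h⟩

/-- The top degree part `OSⁿ` of the Orlik–Solomon algebra, that is, `Hⁿ(U_ℂ, ℤ)`. -/
def OS (x : ι → Fin n → ℤ) : Submodule ℤ (meroForms x) := Submodule.span ℤ (Set.range logForm)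

/-- `b(S)` as an element of `OSⁿ`. -/
def logClass (S : OrdTuple x) : OS x := ⟨logForm S, Submodule.subset_span ⟨S, rfl⟩⟩

lemma one_sub_exp_inv (w : ℂ) :
    (1 - Complex.exp w)⁻¹ = (-(dslope Complex.exp 0 w)⁻¹) / w := by
  have h := sub_smul_dslope Complex.exp 0 w
  simp only [sub_zero, smul_eq_mul, Complex.exp_zero] at h
  rw [show (1 - Complex.exp w) = -(w * dslope Complex.exp 0 w) by rw [h]; ring, inv_neg, mul_inv]
  ring

lemma analyticAt_toddFactor (y : Fin n → ℤ) :
    AnalyticAt ℂ (fun z => -(dslope Complex.exp 0 (evC y z))⁻¹) 0 := by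
  have h1 : AnalyticAt ℂ (dslope Complex.exp 0) (evC y 0) := by
    have : DifferentiableOn ℂ (dslope Complex.exp 0) Set.univ :=
      (Complex.differentiableOn_dslope Filter.univ_mem).2 Complex.differentiable_exp.differentiableOn
    exact this.analyticAt Filter.univ_mem
  have h2 : AnalyticAt ℂ (fun z => dslope Complex.exp 0 (evC y z)) 0 :=
    h1.comp (analyticAt_evC y 0)
  refine (h2.inv ?_).neg
  simp [evC_zero]

lemma analyticAt_cubeCharacter (y : Fin n → Fin n → ℤ) (t : Fin n → ℝ) :
    AnalyticAt ℂ (cubeCharacter y t) 0 := by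
  have : cubeCharacter y t = fun z =>
      ∑ p ∈ (cubePoints_finite y t).toFinset, Complex.exp (evC p z) := by
    funext z
    exact finsum_mem_eq_finite_toFinset_sum _ _
  rw [this]
  exact Finset.analyticAt_fun_sum _ fun p _ => (analyticAt_evC p 0).cexp

/-- The form `μ_Δ(S)`, where `t` is a point of `Δ`. -/
def toddForm (t : Fin n → ℝ) (S : OrdTuple x) : meroForms x :=
  ⟨(toddCoeff S.forms t : Germ (𝓝[arrCompl x] 0) ℂ), by
    have h := prod_mem_meroForms (x := x) S.1 (fun k z => -(dslope Complex.exp 0 (evC (x (S.1 k)) z))⁻¹)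
      (fun k => analyticAt_toddFactor _)
      (F := fun z => (vol S.forms : ℂ)⁻¹ * cubeCharacter S.forms t z * (formsDet S.forms : ℂ))
      ((analyticAt_const.mul (analyticAt_cubeCharacter _ _)).mul analyticAt_const)
    refine (congrArg (· ∈ meroForms x) ?_).mp h
    congr 1
    funext z
    simp only [toddCoeff, one_sub_exp_inv, OrdTuple.forms]
    ring⟩

/-- `q` is the map `q_Δ : Hⁿ(U_ℂ, ℤ) → Ωⁿ` with `μ_Δ = q_Δ ∘ b`. -/
def IsDeformation (Δ : Set (Fin n → ℝ)) (q : OS x →ₗ[ℤ] meroForms x) : Prop :=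
  ∀ t ∈ Δ, ∀ S : OrdTuple x, q (logClass S) = toddForm t S

/-! ### The torus cycles -/

/-- The matrix whose rows are the forms in `y`. -/
def formsMatrix (y : Fin n → Fin n → ℤ) : Matrix (Fin n) (Fin n) ℂ :=
  Matrix.of fun k l => (y k l : ℂ)

/-- The torus `|xₖ| = δ^(n-k)`, `k = 1, …, n`, parametrised by the arguments of the `xₖ`. -/
def torusCube (S : OrdTuple x) (δ : ℝ) : Cube n n := fun u =>
  (formsMatrix S.forms)⁻¹.mulVec fun k =>
    ((δ ^ (n - 1 - (k : ℕ)) : ℝ) : ℂ) * Complex.exp (2 * Real.pi * Complex.I * ((u k : ℝ) : ℂ))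

set_option linter.unusedSectionVars false in
lemma isUnit_formsMatrix (S : OrdTuple x) : IsUnit (formsMatrix S.forms) := by
  have h : IsUnit (Matrix.of fun k l => (x (S.1 k) l : ℝ)) :=
    Matrix.linearIndependent_rows_iff_isUnit.1 S.2
  have h2 := h.map (Complex.ofRealHom.mapMatrix (m := Fin n))
  refine (congrArg IsUnit ?_).mp h2
  ext k l
  simp [formsMatrix, OrdTuple.forms]

lemma eventually_torus_ne_zero (y : Fin n → ℤ) (hy : y ≠ 0) (S : OrdTuple x) :
    ∀ᶠ δ : ℝ in 𝓝[>] 0, ∀ u, evC y (torusCube S δ u) ≠ 0 := by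
  set M := formsMatrix S.forms with hM
  have hMu : IsUnit M.det := (Matrix.isUnit_iff_isUnit_det _).1 (isUnit_formsMatrix S)
  set a : Fin n → ℂ := Matrix.vecMul (fun l => (y l : ℂ)) M⁻¹ with ha
  have ha0 : a ≠ 0 := by
    intro h
    have h1 : Matrix.vecMul a M = fun l => (y l : ℂ) := by
      rw [ha, Matrix.vecMul_vecMul, Matrix.nonsing_inv_mul _ hMu, Matrix.vecMul_one]
    rw [h, Matrix.zero_vecMul] at h1
    apply hy
    funext l
    have h2 := congrFun h1 l
    simpa using h2.symm
  obtain ⟨K, hK, hKmax⟩ : ∃ K, a K ≠ 0 ∧ ∀ k, K < k → a k = 0 := by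
    obtain ⟨k₀, hk₀⟩ := Function.ne_iff.1 ha0
    obtain ⟨K, hK, hmax⟩ := (Finset.univ.filter fun k => a k ≠ 0).exists_max_image id
      ⟨k₀, by simpa using hk₀⟩
    refine ⟨K, by simpa using hK, fun k hk => ?_⟩
    by_contra hne
    exact absurd (hmax k (by simpa using hne)) (not_le.2 hk)
  have hApos : 0 < ‖a K‖ := norm_pos_iff.2 hK
  set B : ℝ := ∑ k, ‖a k‖ with hB
  have hB0 : 0 ≤ B := Finset.sum_nonneg fun k _ => norm_nonneg _
  have hlim : Tendsto (fun δ : ℝ => δ * B) (𝓝[>] 0) (𝓝 0) := by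
    have : Tendsto (fun δ : ℝ => δ * B) (𝓝 0) (𝓝 (0 * B)) := tendsto_id.mul_const B
    rw [zero_mul] at this
    exact this.mono_left nhdsWithin_le_nhds
  have h1 : ∀ᶠ δ : ℝ in 𝓝[>] 0, δ * B < ‖a K‖ := hlim.eventually_lt_const hApos
  have h2 : ∀ᶠ δ : ℝ in 𝓝[>] 0, δ ≤ 1 :=
    (eventually_le_nhds (zero_lt_one' ℝ)).filter_mono nhdsWithin_le_nhds
  filter_upwards [h1, h2, self_mem_nhdsWithin] with δ hδB hδ1 hδ0 u
  have hδ0 : 0 < δ := hδ0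
  set w : Fin n → ℂ := fun k =>
    ((δ ^ (n - 1 - (k : ℕ)) : ℝ) : ℂ) * Complex.exp (2 * Real.pi * Complex.I * ((u k : ℝ) : ℂ))
    with hw
  have hnorm : ∀ k, ‖w k‖ = δ ^ (n - 1 - (k : ℕ)) := by
    intro k
    have h3 : (2 * Real.pi * Complex.I * ((u k : ℝ) : ℂ)) =
        ((2 * Real.pi * (u k : ℝ) : ℝ) : ℂ) * Complex.I := by push_cast; ring
    rw [hw]
    simp only [norm_mul]
    rw [h3, Complex.norm_exp_ofReal_mul_I, mul_one, Complex.norm_real, Real.norm_of_nonneg]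
    positivity
  have heq : evC y (torusCube S δ u) = ∑ k, a k * w k := by
    change (fun l => (y l : ℂ)) ⬝ᵥ (M⁻¹.mulVec w) = a ⬝ᵥ w
    rw [Matrix.dotProduct_mulVec]
  rw [heq]
  intro h0
  rw [← Finset.add_sum_erase _ _ (Finset.mem_univ K)] at h0
  have h4 : a K * w K = -∑ k ∈ Finset.univ.erase K, a k * w k := eq_neg_of_add_eq_zero_left h0
  have h5 : ‖a K‖ * δ ^ (n - 1 - (K : ℕ)) ≤ (δ * B) * δ ^ (n - 1 - (K : ℕ)) := by
    rw [← hnorm K, ← norm_mul, h4, norm_neg, hnorm K]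
    refine (norm_sum_le _ _).trans ?_
    rw [hB, Finset.mul_sum, Finset.sum_mul]
    refine (Finset.sum_le_sum fun k hk => ?_).trans
      (Finset.sum_le_sum_of_subset_of_nonneg (Finset.erase_subset K _)
        fun k _ _ => by positivity)
    rw [norm_mul, hnorm k]
    rcases lt_or_gt_of_ne (Finset.ne_of_mem_erase hk) with hlt | hgt
    · have hlt' : (k : ℕ) < (K : ℕ) := hlt
      have hKn := K.2
      have h6 : δ ^ (n - 1 - (k : ℕ)) ≤ δ ^ (n - 1 - (K : ℕ) + 1) :=
        pow_le_pow_of_le_one hδ0.le hδ1 (by omega)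
      calc ‖a k‖ * δ ^ (n - 1 - (k : ℕ)) ≤ ‖a k‖ * δ ^ (n - 1 - (K : ℕ) + 1) := by gcongr
        _ = δ * ‖a k‖ * δ ^ (n - 1 - (K : ℕ)) := by ring
    · rw [hKmax k hgt]
      simp
  have h7 := le_of_mul_le_mul_right h5 (by positivity)
  linarith

/-- For all small `δ` the torus lies in the complement of the arrangement. -/
lemma exists_torus_radius (hx : IsIntegralArrangement x) (S : OrdTuple x) :
    ∃ δ₀ : ℝ, 0 < δ₀ ∧ ∀ δ : ℝ, 0 < δ → δ ≤ δ₀ → ∀ u, torusCube S δ u ∈ arrCompl x := by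
  have h : ∀ᶠ δ : ℝ in 𝓝[>] 0, ∀ i, ∀ u, evC (x i) (torusCube S δ u) ≠ 0 :=
    eventually_all.2 fun i => eventually_torus_ne_zero (x i) (hx.ne_zero i) S
  obtain ⟨δ₀, hδ₀, hsub⟩ := mem_nhdsGT_iff_exists_Ioc_subset.1 h
  exact ⟨δ₀, hδ₀, fun δ h1 h2 u i => hsub ⟨h1, h2⟩ i u⟩

set_option linter.unusedSectionVars false in
lemma contDiff_torus (S : OrdTuple x) (δ : ℝ) : ContDiff ℝ (⊤ : ℕ∞) fun v : Fin n → ℝ =>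
    (formsMatrix S.forms)⁻¹.mulVec fun k =>
      ((δ ^ (n - 1 - (k : ℕ)) : ℝ) : ℂ) * Complex.exp (2 * Real.pi * Complex.I * ((v k : ℝ) : ℂ)) := by
  rw [contDiff_pi]
  intro l
  simp only [Matrix.mulVec, dotProduct]
  refine ContDiff.sum fun k _ => contDiff_const.mul (contDiff_const.mul ?_)
  refine ContDiff.cexp (contDiff_const.mul ?_)
  exact Complex.ofRealCLM.contDiff.comp (contDiff_apply ℝ ℝ k)

lemma torus_mem_cycles (S : OrdTuple x) {δ : ℝ} (h : ∀ u, torusCube S δ u ∈ arrCompl x) :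
    Finsupp.single (torusCube S δ) (1 : ℤ) ∈ cycles (arrCompl x) n := by
  refine Submodule.mem_inf.2 ⟨Submodule.subset_span ⟨_, ?_, h, rfl⟩, ?_⟩
  · refine (contDiff_torus S δ).contDiffOn.congr fun v hv => ?_
    simp only [Cube.ext, torusCube]
    congr 1
    funext k
    rw [projIcc_of_mem zero_le_one ⟨hv.1 k, hv.2 k⟩]
  · rw [Submodule.mem_comap]
    suffices hb : boundary n n (Finsupp.single (torusCube S δ) (1 : ℤ)) = 0 by
      rw [hb]; exact Submodule.zero_mem _
    cases n with
    | zero => rfl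
    | succ m =>
      simp only [boundary, Finsupp.linearCombination_single, one_smul]
      refine Finset.sum_eq_zero fun i _ => ?_
      have : (torusCube S δ).face i 1 = (torusCube S δ).face i 0 := by
        funext u
        simp only [Cube.face, torusCube]
        congr 1
        funext k
        rcases Fin.eq_self_or_eq_succAbove i k with rfl | ⟨j, rfl⟩
        · simp [Complex.exp_two_pi_mul_I]
        · simp
      rw [this, sub_self, smul_zero]

/-- The cycle `|xₖ| = εₖ`, `k = 1, …, n`, where `0 < ε₁ ≪ ε₂ ≪ ⋯ ≪ εₙ`, oriented by the arguments
of the `xₖ`.  Here `εₖ = δ^(n-k)`, where `δ` is so small that for no smaller value of `δ` the torus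
meets a hyperplane of the arrangement. -/
def torusCycle (hx : IsIntegralArrangement x) (S : OrdTuple x) : cycles (arrCompl x) n :=
  ⟨Finsupp.single (torusCube S (exists_torus_radius hx S).choose) 1,
    torus_mem_cycles S ((exists_torus_radius hx S).choose_spec.2 _
      (exists_torus_radius hx S).choose_spec.1 le_rfl)⟩

/-- The class `Z(S) ∈ H_n(U_ℂ, ℤ)`. -/
def torusClass (hx : IsIntegralArrangement x) (S : OrdTuple x) : Homology (arrCompl x) n :=
  homologyClass (torusCycle hx S)

/-! ### The diagonal element and diagonal bases -/

/-- `k` is the value of the cohomology class `β` on the homology class `C`. -/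
def EvaluatesTo (β : OS x) (C : Homology (arrCompl x) n) (k : ℤ) : Prop :=
  HasPairing x ((β : meroForms x) ⊗ₜ[ℤ] C) (fun _ => 1) (k : ℂ)

/-- `D` is the canonical element `diagⁿ` of `Hⁿ(U_ℂ, ℤ) ⊗ H_n(U_ℂ, ℤ)`: if `D = ∑ᵢ βᵢ ⊗ Cᵢ`, then
`∑ᵢ ⟨β, Cᵢ⟩ βᵢ = β` for all `β ∈ Hⁿ(U_ℂ, ℤ)`. -/
def IsDiag (D : OS x ⊗[ℤ] Homology (arrCompl x) n) : Prop :=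
  ∃ (m : ℕ) (b : Fin m → OS x) (C : Fin m → Homology (arrCompl x) n),
    D = ∑ i, b i ⊗ₜ[ℤ] C i ∧
    ∀ β : OS x, ∃ k : Fin m → ℤ, (∀ i, EvaluatesTo β (C i) (k i)) ∧ ∑ i, k i • b i = β

/-- `DB` is a diagonal basis in degree `n`: `∑_{S ∈ DB} b(S) ⊗ Z(S) = diagⁿ`. -/
def IsDiagonalBasis (hx : IsIntegralArrangement x) (DB : Finset (OrdTuple x)) : Prop :=
  IsDiag (∑ S ∈ DB, logClass S ⊗ₜ[ℤ] torusClass hx S)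

end Maps

/-! ### Iterated constant terms -/

/-- The constant term at `0` of (the Laurent expansion of) a meromorphic function `g` of one
variable: if `z ^ N * g z` is analytic at `0`, it is the `N`th Taylor coefficient of this
function. -/
def constTerm (g : ℂ → ℂ) : ℂ :=
  open Classical in
  if h : ∃ N : ℕ, AnalyticAt ℂ (fun z => z ^ N * g z) 0 then
    iteratedDeriv h.choose (fun z => z ^ h.choose * g z) 0 / (h.choose.factorial : ℂ)
  else 0

/-- `Res_{wₙ=0} ⋯ Res_{w₁=0} g`, where `Res` is the constant term. -/
def iterConst : (n : ℕ) → ((Fin n → ℂ) → ℂ) → ℂ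
  | 0, g => g 0
  | n + 1, g => iterConst n fun w => constTerm fun u => g (Fin.cons (α := fun _ => ℂ) u w)

/-- The iterated residue `iRes_S g`, where `y` is a sequence of forms representing `S`: iterated
constant terms with respect to the coordinates `w₁ = y₁, …, wₙ = yₙ`, starting with `w₁`. -/
def iRes {n : ℕ} (y : Fin n → Fin n → ℤ) (g : (Fin n → ℂ) → ℂ) : ℂ :=
  iterConst n fun w => g ((formsMatrix y)⁻¹.mulVec w)

/-- `Todd(w) = w / (1 - exp(w))`. -/
def todd (w : ℂ) : ℂ := w / (1 - Complex.exp w)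

/-- The function `vol(y)⁻¹ ∏ₖ Todd(yₖ) (∑_{p ∈ Λ ∩ (Cube(y) - t)} exp(p)) exp(t) f`. -/
def toddIntegrand {n : ℕ} (y : Fin n → Fin n → ℤ) (t : Fin n → ℝ) (f : (Fin n → ℂ) → ℂ)
    (z : Fin n → ℂ) : ℂ :=
  (vol y : ℂ)⁻¹ * (∏ k, todd (evC (y k) z)) * cubeCharacter y t z * expMul t f z

/-- `y` is a sequence of forms in `Λ` representing `S`. -/
def Represents {n : ℕ} {ι : Type*} [Fintype ι] {x : ι → Fin n → ℤ} (S : OrdTuple x)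
    (y : Fin n → Fin n → ℤ) : Prop :=
  ∀ k, SameHyperplane (y k) (x (S.1 k))

end MultipleBernoulli

end

open MultipleBernoulli

noncomputable section

set_option linter.unusedSectionVars false

/-! Both sides of the formula are compared through their Fourier coefficients in `t`. For
independent forms `y` and a generic point `z` near `0`, the function `t ↦ exp⟨t, z⟩ μ_t(y)(z)` is
`Λ`-periodic: up to a constant it is the periodisation of `exp⟨τ, z⟩` restricted to the
parallelepiped spanned by `y`. Integration over the parallelepiped shows that its `j`th Fourier
coefficient is the coefficient of `b(y)` at the point `2π√-1 j - z` (`fourierCoeff_toddExp`). Two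
things follow.

Linear relations between the `b(S)` pass to the `μ(S)`: the corresponding combination of the
functions above has no Fourier coefficients, so it vanishes almost everywhere, and by continuity at
every regular `t` (`sum_toddCoeff_eq_zero`). This gives `q_Δ`; the case of a relation with two terms
shows that `μ` does not depend on the chosen defining forms.

Secondly, by Fubini on the tori `Z(S)`, the residue formula as a function of `t` has as its `j`th
Fourier coefficient the pairing of `f` with the image of the diagonal class under `b(S) ↦ b(S)(J -
z)`, `J = 2π√-1 j`. This pairing reproduces `f(J)` when `J` lies off the hyperplanes and vanishes
when `J` lies on one of them, for `f` a negative power of the product of the forms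
(`diagPairing_shiftMap_pow`). It is proved one factor at a time: dividing by `x_i` divides the value
by `x_i(J)`. For this the diagonal class is written in a dual basis whose tuples all end with the
hyperplane `i`; in the difference of the two sides the factor of `b(S)(J - z)` with a pole at
`x_i(z) = x_i(J)` cancels, so the last radius of the torus can be sent to infinity, where the
integrand decays.

If `f` is the inverse of the `N`th power of the product of the forms with `N ≥ 2`, the Fourier
series converges absolutely, and uniqueness of Fourier series gives the formula almost everywhere
(`bernSeries_eq`). Multiplication of `f` by a coordinate corresponds to a derivative in `t` on both
sides, which yields all numerators; that the denominator is a power of the product is the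
Nullstellensatz.

The underlying residue theory rests on Stokes' theorem and partial fractions: a Laurent monomial in
a basis of forms is a derivative unless all exponents are `-1`, so integrals over cycles depend only
on a residue in the span of the `b(S)`. The tuples without broken circuits give forms that span and
tori that are dual to them (`isDualBasis_nbc`), since shrinking some radii of a torus kills the
other integrals. Any diagonal basis then gives the same sums as such a dual basis, which is (B), and
(C) holds because an iterated constant term is an average over a torus with successively smaller
radii. -/

namespace MultipleBernoulli

/-! ### Stokes' theorem on smooth cubes and integrals of holomorphic forms. -/

section Stokes

open MeasureTheory

variable {n k : ℕ}

/-- The form `dz₁ ∧ ⋯ ∧ dzₙ`, complex multilinear. -/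
def volFormC (n : ℕ) : (Fin n → ℂ) [⋀^Fin n]→L[ℂ] ℂ :=
  { (Matrix.detRowAlternating : (Fin n → ℂ) [⋀^Fin n]→ₗ[ℂ] ℂ) with
    cont := by
      change Continuous fun v : Fin n → Fin n → ℂ => Matrix.det v
      exact Continuous.matrix_det continuous_id }

lemma volFormC_apply (v : Fin n → Fin n → ℂ) : volFormC n v = Matrix.det v := rfl

/-- The form `dz₁ ∧ ⋯ ∧ dzₙ`, real multilinear. -/
def volForm (n : ℕ) : (Fin n → ℂ) [⋀^Fin n]→L[ℝ] ℂ := (volFormC n).restrictScalars ℝ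

lemma volForm_apply (v : Fin n → Fin n → ℂ) : volForm n v = Matrix.det v := rfl

/-- The integral of a `k`-form over a `k`-cube. -/
def formIntegral (ω : (Fin n → ℂ) → (Fin n → ℂ) [⋀^Fin k]→L[ℝ] ℂ) (c : Cube n k) : ℂ :=
  ∫ u in Icc (0 : Fin k → ℝ) 1, ω (c.ext u) fun j => fderiv ℝ c.ext u (Pi.single j 1)

/-- The integral of a `k`-form over a `k`-chain. -/
def formChain (ω : (Fin n → ℂ) → (Fin n → ℂ) [⋀^Fin k]→L[ℝ] ℂ) : Chain n k →ₗ[ℤ] ℂ :=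
  Finsupp.linearCombination ℤ (formIntegral ω)

lemma cubeIntegral_eq_formIntegral (h : (Fin n → ℂ) → ℂ) (c : Cube n n) :
    cubeIntegral h c = formIntegral (fun z => h z • volForm n) c := by
  unfold cubeIntegral formIntegral
  congr 1
  funext u
  rw [ContinuousAlternatingMap.smul_apply, volForm_apply, smul_eq_mul, ← Matrix.det_transpose]
  rfl

lemma chainIntegral_eq_formChain (h : (Fin n → ℂ) → ℂ) :
    chainIntegral h = formChain (fun z => h z • volForm n) := by
  unfold chainIntegral formChain
  congr 1
  funext c
  exact cubeIntegral_eq_formIntegral h c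

lemma interior_unitBox : interior (Icc (0 : Fin k → ℝ) 1) = Set.pi univ fun _ => Ioo (0 : ℝ) 1 := by
  rw [← Set.pi_univ_Icc, interior_pi_set Set.finite_univ]
  simp

/-- On the boundary of the box `Cube.ext` need not be differentiable and `fderiv` carries no
information; since the boundary is a null set, `fderiv` may be replaced by the derivative within the
box. -/
lemma ae_mem_interior_unitBox :
    ∀ᵐ u ∂(volume.restrict (Icc (0 : Fin k → ℝ) 1)), u ∈ interior (Icc (0 : Fin k → ℝ) 1) := by
  have h := Measure.univ_pi_Ioo_ae_eq_Icc (μ := fun _ : Fin k => (volume : Measure ℝ))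
    (f := fun _ => 0) (g := fun _ => 1)
  have h2 : (volume.restrict (Icc (0 : Fin k → ℝ) 1)) =
      volume.restrict (interior (Icc (0 : Fin k → ℝ) 1)) := by
    rw [interior_unitBox]
    exact (Measure.restrict_congr_set h).symm
  rw [h2]
  exact ae_restrict_mem isOpen_interior.measurableSet

lemma uniqueDiffOn_unitBox : UniqueDiffOn ℝ (Icc (0 : Fin k → ℝ) 1) := by
  refine uniqueDiffOn_convex (convex_Icc _ _) ⟨fun _ => 1 / 2, ?_⟩
  rw [interior_unitBox]
  intro i _
  constructor <;> norm_num

lemma unitBox_subset_closure : Icc (0 : Fin k → ℝ) 1 ⊆ closure (interior (Icc (0 : Fin k → ℝ) 1)) := by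
  have : Icc (0 : Fin k → ℝ) 1 = closure (interior (Icc (0 : Fin k → ℝ) 1)) := by
    rw [interior_unitBox, closure_pi_set, ← Set.pi_univ_Icc]
    congr 1
    funext i
    rw [closure_Ioo (by norm_num)]
    rfl
  exact this.le

lemma formIntegral_eq_within (ω : (Fin n → ℂ) → (Fin n → ℂ) [⋀^Fin k]→L[ℝ] ℂ) (c : Cube n k) :
    formIntegral ω c = ∫ u in Icc (0 : Fin k → ℝ) 1,
      ω (c.ext u) fun j => fderivWithin ℝ c.ext (Icc 0 1) u (Pi.single j 1) := by
  refine integral_congr_ae ?_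
  filter_upwards [ae_mem_interior_unitBox] with u hu
  rw [fderivWithin_of_mem_nhds (mem_interior_iff_mem_nhds.1 hu)]

lemma ext_face (c : Cube n (k + 1)) (i : Fin (k + 1)) (e : unitInterval) (u : Fin k → ℝ) :
    (c.face i e).ext u = c.ext (i.insertNth (α := fun _ => ℝ) (e : ℝ) u) := by
  simp only [Cube.ext, Cube.face]
  congr 1
  funext j
  rcases Fin.eq_self_or_eq_succAbove i j with rfl | ⟨j, rfl⟩
  · simp
  · simp

lemma insertNth_mem_unitBox (i : Fin (k + 1)) (e : unitInterval) {u : Fin k → ℝ}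
    (hu : u ∈ Icc (0 : Fin k → ℝ) 1) :
    (i.insertNth (α := fun _ => ℝ) (e : ℝ) u) ∈ Icc (0 : Fin (k + 1) → ℝ) 1 := by
  constructor <;> intro j <;> rcases Fin.eq_self_or_eq_succAbove i j with rfl | ⟨j, rfl⟩
  · simpa using e.2.1
  · simpa using hu.1 j
  · simpa using e.2.2
  · simpa using hu.2 j

lemma hasFDerivAt_insertNth (i : Fin (k + 1)) (e : ℝ) (u : Fin k → ℝ) :
    HasFDerivAt (fun u : Fin k → ℝ => (i.insertNth (α := fun _ => ℝ) e u : Fin (k + 1) → ℝ))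
      (ContinuousLinearMap.pi fun j => i.insertNth (α := fun _ => (Fin k → ℝ) →L[ℝ] ℝ) 0
        (fun j => ContinuousLinearMap.proj j) j) u := by
  rw [hasFDerivAt_pi]
  intro j
  rcases Fin.eq_self_or_eq_succAbove i j with rfl | ⟨j, rfl⟩
  · simpa using hasFDerivAt_const e u
  · simpa using hasFDerivAt_apply j u

/-- The face is the composite of the cube with the affine inclusion of a side of the box. An
interior point of the side lies on the boundary of the larger box, hence the derivative within the
box on the right. -/
lemma fderiv_ext_face {c : Cube n (k + 1)} (hc : ContDiffOn ℝ (⊤ : ℕ∞) c.ext (Icc 0 1))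
    (i : Fin (k + 1)) (e : unitInterval) {u : Fin k → ℝ} (hu : u ∈ interior (Icc (0 : Fin k → ℝ) 1))
    (j : Fin k) :
    fderiv ℝ (c.face i e).ext u (Pi.single j 1) =
      fderivWithin ℝ c.ext (Icc 0 1) (i.insertNth (α := fun _ => ℝ) (e : ℝ) u)
        (Pi.single (i.succAbove j) 1) := by
  have h1 := (hc.differentiableOn (by simp) _
    (insertNth_mem_unitBox i e (interior_subset hu))).hasFDerivWithinAt
  have h2 := h1.comp u (hasFDerivAt_insertNth i e u).hasFDerivWithinAt
    (fun v hv => insertNth_mem_unitBox i e hv : MapsTo _ (Icc (0 : Fin k → ℝ) 1) _)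
  have h3 := h2.hasFDerivAt (mem_interior_iff_mem_nhds.1 hu)
  have h4 : (c.face i e).ext =
      c.ext ∘ fun u => (i.insertNth (α := fun _ => ℝ) (e : ℝ) u : Fin (k + 1) → ℝ) := by
    funext u
    exact ext_face c i e u
  rw [h4, h3.fderiv, ContinuousLinearMap.comp_apply]
  congr 1
  funext l
  rcases Fin.eq_self_or_eq_succAbove i l with rfl | ⟨l, rfl⟩
  · simp
  · simp [Pi.single_apply]

lemma ext_mem {U : Set (Fin n → ℂ)} {c : Cube n k} (hc : ∀ u, c u ∈ U) (u : Fin k → ℝ) :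
    c.ext u ∈ U := hc _

lemma neg_one_pow_zsmul_eq (i : ℕ) (a : ℂ) : (-1 : ℤ) ^ i • a = (-1 : ℝ) ^ i • a := by
  rcases Nat.even_or_odd i with h | h <;> simp [h.neg_one_pow]

/-- Stokes' theorem for a smooth cube. -/
theorem formIntegral_extDerivWithin {O : Set (Fin n → ℂ)} (hO : IsOpen O)
    {ω : (Fin n → ℂ) → (Fin n → ℂ) [⋀^Fin k]→L[ℝ] ℂ} (hω : ContDiffOn ℝ 1 ω O)
    {c : Cube n (k + 1)} (hc : ContDiffOn ℝ (⊤ : ℕ∞) c.ext (Icc 0 1)) (hcO : ∀ u, c u ∈ O) :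
    formIntegral (extDerivWithin ω O) c =
      ∑ i : Fin (k + 1), (-1 : ℤ) ^ (i : ℕ) •
        (formIntegral ω (c.face i 1) - formIntegral ω (c.face i 0)) := by
  classical
  set B : Set (Fin (k + 1) → ℝ) := Icc 0 1 with hB
  -- The pullback of `ω` to the box. Exterior derivatives commute with pullbacks, which reduces the
  -- claim to the divergence theorem on the box.
  set η : (Fin (k + 1) → ℝ) → (Fin (k + 1) → ℝ) [⋀^Fin k]→L[ℝ] ℂ := fun v =>
    (ω (c.ext v)).compContinuousLinearMap (fderivWithin ℝ c.ext B v) with hη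
  have hmaps : MapsTo c.ext B O := fun v _ => ext_mem hcO v
  have hd1 : ContDiffOn ℝ 1 (fderivWithin ℝ c.ext B) B :=
    hc.fderivWithin uniqueDiffOn_unitBox (by norm_cast)
  have hω1 : ContDiffOn ℝ 1 (fun v => ω (c.ext v)) B :=
    hω.comp (hc.of_le (by norm_cast)) hmaps
  have hηd : DifferentiableOn ℝ η B := fun v hv =>
    ((hω1.differentiableOn (by simp) v hv).hasFDerivWithinAt.continuousAlternatingMapCompContinuousLinearMap
      (hd1.differentiableOn (by simp) v hv).hasFDerivWithinAt).differentiableWithinAt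
  have hpull : ∀ v ∈ B, extDerivWithin η B v =
      (extDerivWithin ω O (c.ext v)).compContinuousLinearMap (fderivWithin ℝ c.ext B v) :=
    fun v hv => extDerivWithin_pullback (r := (⊤ : ℕ∞))
      (hω.differentiableOn (by simp) _ (hmaps hv)) (hc v hv)
      (by rw [minSmoothness_of_isRCLikeNormedField]; exact WithTop.coe_le_coe.2 (le_top : (2 : ℕ∞) ≤ ⊤))
      uniqueDiffOn_unitBox (unitBox_subset_closure hv) hv hmaps
  set E : Fin (k + 1) → Fin (k + 1) → ℝ := fun j => Pi.single j 1 with hE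
  -- The coefficients of the pulled back form, with alternating signs, are the components of a
  -- vector field whose divergence is the coefficient of the exterior derivative.
  set f : Fin (k + 1) → (Fin (k + 1) → ℝ) → ℂ := fun i v =>
    (-1 : ℝ) ^ (i : ℕ) • η v (i.removeNth E) with hf
  set f' : Fin (k + 1) → (Fin (k + 1) → ℝ) → (Fin (k + 1) → ℝ) →L[ℝ] ℂ := fun i v =>
    (-1 : ℝ) ^ (i : ℕ) • fderivWithin ℝ (fun v => η v (i.removeNth E)) B v with hf'
  have hηi : ∀ i : Fin (k + 1), DifferentiableOn ℝ (fun v => η v (i.removeNth E)) B := fun i v hv =>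
    ((hηd v hv).hasFDerivWithinAt.continuousAlternatingMap_apply_const
      (i.removeNth E)).differentiableWithinAt
  have hsum : ∀ v ∈ B, ∑ i, f' i v (Pi.single i 1) =
      extDerivWithin ω O (c.ext v) fun j => fderivWithin ℝ c.ext B v (Pi.single j 1) := by
    intro v hv
    have h1 := extDerivWithin_apply (hηd v hv) (uniqueDiffOn_unitBox v hv) E
    rw [hpull v hv] at h1
    refine Eq.trans (Finset.sum_congr rfl fun i _ => ?_) h1.symm
    exact (neg_one_pow_zsmul_eq (i : ℕ) _).symm
  have hcont : ContinuousOn (fun v => extDerivWithin ω O (c.ext v) fun j =>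
      fderivWithin ℝ c.ext B v (Pi.single j 1)) B := by
    have h1 : ContinuousOn (extDerivWithin ω O) O :=
      (ContinuousAlternatingMap.alternatizeUncurryFinCLM ℝ (Fin n → ℂ) ℂ).continuous.comp_continuousOn
        (hω.continuousOn_fderivWithin hO.uniqueDiffOn (by simp))
    have h2 := h1.comp hc.continuousOn hmaps
    have h3 : ContinuousOn (fun v => fun j : Fin (k + 1) =>
        fderivWithin ℝ c.ext B v (Pi.single j 1)) B :=
      continuousOn_pi.2 fun j => hd1.continuousOn.clm_apply continuousOn_const
    exact h2.eval h3
  have hdiv := integral_divergence_of_hasFDerivAt_off_countable' (0 : Fin (k + 1) → ℝ) 1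
    zero_le_one f f' ∅ countable_empty
    (fun i => ((hηi i).continuousOn.const_smul ((-1 : ℝ) ^ (i : ℕ))))
    (fun v hv i => by
      have hvi : v ∈ interior B := by
        rw [hB, interior_unitBox]; exact hv.1
      have h1 := ((hηi i v (interior_subset hvi)).hasFDerivWithinAt.hasFDerivAt
        (mem_interior_iff_mem_nhds.1 hvi)).const_smul ((-1 : ℝ) ^ (i : ℕ))
      exact h1)
    ((hcont.congr hsum).integrableOn_compact isCompact_Icc)
  rw [formIntegral_eq_within, ← setIntegral_congr_fun measurableSet_Icc hsum, hdiv]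
  refine Finset.sum_congr rfl fun i _ => ?_
  have hface : ∀ e : unitInterval,
      ∫ u in Icc ((0 : Fin (k + 1) → ℝ) ∘ i.succAbove) ((1 : Fin (k + 1) → ℝ) ∘ i.succAbove),
        f i (i.insertNth (α := fun _ => ℝ) (e : ℝ) u) =
      (-1 : ℤ) ^ (i : ℕ) • formIntegral ω (c.face i e) := by
    intro e
    have h0 : Icc ((0 : Fin (k + 1) → ℝ) ∘ i.succAbove) ((1 : Fin (k + 1) → ℝ) ∘ i.succAbove) =
      Icc (0 : Fin k → ℝ) 1 := rfl
    rw [h0, hf]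
    simp only
    rw [integral_smul, formIntegral]
    have h1 : ∫ u in Icc (0 : Fin k → ℝ) 1,
        η (i.insertNth (α := fun _ => ℝ) (e : ℝ) u) (i.removeNth E) =
        ∫ u in Icc (0 : Fin k → ℝ) 1, ω ((c.face i e).ext u)
          fun j => fderiv ℝ (c.face i e).ext u (Pi.single j 1) := by
      refine integral_congr_ae ?_
      filter_upwards [ae_mem_interior_unitBox] with u hu
      rw [ext_face]
      simp only [hη, ContinuousAlternatingMap.compContinuousLinearMap_apply]
      congr 1
      funext j
      exact (fderiv_ext_face hc i e hu j).symm
    rw [h1]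
    exact (neg_one_pow_zsmul_eq (i : ℕ) _).symm
  rw [smul_sub, ← hface 1, ← hface 0]
  rfl

lemma boundary_succ_single (c : Cube n (k + 1)) :
    boundary n (k + 1) (Finsupp.single c 1) = ∑ i : Fin (k + 1),
      (-1 : ℤ) ^ (i : ℕ) •
        (Finsupp.single (c.face i 1) (1 : ℤ) - Finsupp.single (c.face i 0) (1 : ℤ)) := by
  simp [boundary, Finsupp.linearCombination_single]

lemma formChain_single (ω : (Fin n → ℂ) → (Fin n → ℂ) [⋀^Fin k]→L[ℝ] ℂ) (c : Cube n k) :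
    formChain ω (Finsupp.single c 1) = formIntegral ω c := by
  simp [formChain, Finsupp.linearCombination_single]

/-- Stokes' theorem for smooth chains. -/
theorem formChain_extDerivWithin {O : Set (Fin n → ℂ)} (hO : IsOpen O)
    {ω : (Fin n → ℂ) → (Fin n → ℂ) [⋀^Fin k]→L[ℝ] ℂ} (hω : ContDiffOn ℝ 1 ω O)
    {a : Chain n (k + 1)} (ha : a ∈ smoothChains O (k + 1)) :
    formChain (extDerivWithin ω O) a = formChain ω (boundary n (k + 1) a) := by
  induction ha using Submodule.span_induction with
  | mem a ha =>
    obtain ⟨c, hc, hcO, rfl⟩ := ha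
    rw [formChain_single, formIntegral_extDerivWithin hO hω hc hcO, boundary_succ_single, map_sum]
    refine Finset.sum_congr rfl fun i _ => ?_
    rw [map_zsmul, map_sub, formChain_single, formChain_single]
  | zero => simp
  | add a b _ _ ha hb => simp only [map_add, ha, hb]
  | smul m a _ ha => simp only [map_smul, ha]

/-- A degenerate cube is constant along lines in the direction on which it does not depend, so one
of the vectors inserted in the form is `0`. Where the cube is not differentiable, `fderiv` is `0` by
default. -/
lemma formChain_degenerate (ω : (Fin n → ℂ) → (Fin n → ℂ) [⋀^Fin k]→L[ℝ] ℂ)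
    {a : Chain n k} (ha : a ∈ degenerateChains n k) : formChain ω a = 0 := by
  induction ha using Submodule.span_induction with
  | mem a ha =>
    obtain ⟨c, ⟨i, hi⟩, rfl⟩ := ha
    rw [formChain_single, formIntegral]
    refine integral_eq_zero_of_ae (Eventually.of_forall fun u => ?_)
    refine ContinuousAlternatingMap.map_coord_zero _ i ?_
    by_cases hd : DifferentiableAt ℝ c.ext u
    · have hline : HasDerivAt (fun t : ℝ => c.ext (u + t • Pi.single i 1))
          (fderiv ℝ c.ext u (Pi.single i 1)) 0 := by
        exact hd.hasFDerivAt.hasLineDerivAt (Pi.single i 1)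
      have hconst : (fun t : ℝ => c.ext (u + t • Pi.single i 1)) = fun _ => c.ext u := by
        funext t
        refine hi _ _ fun j hj => ?_
        simp [Pi.single_eq_of_ne hj]
      rw [hconst] at hline
      exact hline.unique (hasDerivAt_const _ _)
    · rw [fderiv_zero_of_not_differentiableAt hd]
      rfl
  | zero => simp
  | add a b _ _ ha hb => simp only [map_add, ha, hb, add_zero]
  | smul m a _ ha => simp only [map_smul, ha, smul_zero]

/-- An alternating complex form of degree `n + 1` on `ℂⁿ` vanishes: expansion of `φ ∧ dz`. -/
lemma sum_wedge_volForm_eq_zero (φ : (Fin n → ℂ) →L[ℂ] ℂ) (v : Fin (n + 1) → Fin n → ℂ) :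
    ∑ i : Fin (n + 1), (-1 : ℂ) ^ (i : ℕ) * (φ (v i) * Matrix.det (i.removeNth v)) = 0 := by
  have h1 : ContinuousAlternatingMap.alternatizeUncurryFin (φ.smulRight (volFormC n)) v = 0 := by
    refine AlternatingMap.map_linearDependent
      (ContinuousAlternatingMap.alternatizeUncurryFin
        (φ.smulRight (volFormC n))).toAlternatingMap v ?_
    intro hli
    have := hli.fintype_card_le_finrank
    simp at this
  rw [ContinuousAlternatingMap.alternatizeUncurryFin_apply] at h1
  rw [← h1]
  refine Finset.sum_congr rfl fun i _ => ?_
  rcases Nat.even_or_odd (i : ℕ) with h | h <;> simp [h.neg_one_pow, volFormC_apply]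

lemma formIntegral_congr {O : Set (Fin n → ℂ)}
    {ω ω' : (Fin n → ℂ) → (Fin n → ℂ) [⋀^Fin k]→L[ℝ] ℂ} (h : ∀ z ∈ O, ω z = ω' z) {c : Cube n k}
    (hc : ∀ u, c u ∈ O) : formIntegral ω c = formIntegral ω' c := by
  unfold formIntegral
  congr 1
  funext u
  rw [h _ (ext_mem hc u)]

lemma formChain_congr {O : Set (Fin n → ℂ)}
    {ω ω' : (Fin n → ℂ) → (Fin n → ℂ) [⋀^Fin k]→L[ℝ] ℂ} (h : ∀ z ∈ O, ω z = ω' z) {a : Chain n k}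
    (ha : a ∈ smoothChains O k) : formChain ω a = formChain ω' a := by
  induction ha using Submodule.span_induction with
  | mem a ha =>
    obtain ⟨c, -, hcO, rfl⟩ := ha
    rw [formChain_single, formChain_single, formIntegral_congr h hcO]
  | zero => simp
  | add a b _ _ ha hb => simp only [map_add, ha, hb]
  | smul m a _ ha => simp only [map_smul, ha]

lemma formChain_zero (a : Chain n k) :
    formChain (fun _ => (0 : (Fin n → ℂ) [⋀^Fin k]→L[ℝ] ℂ)) a = 0 := by
  have : formIntegral (fun _ => (0 : (Fin n → ℂ) [⋀^Fin k]→L[ℝ] ℂ)) = 0 := by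
    funext c
    simp [formIntegral]
  rw [formChain, this]
  simp

lemma chainIntegral_congr {O : Set (Fin n → ℂ)} {g h : (Fin n → ℂ) → ℂ} (H : ∀ z ∈ O, g z = h z)
    {a : Chain n n} (ha : a ∈ smoothChains O n) : chainIntegral g a = chainIntegral h a := by
  rw [chainIntegral_eq_formChain, chainIntegral_eq_formChain]
  exact formChain_congr (fun z hz => by rw [H z hz]) ha

lemma chainIntegral_degenerate (h : (Fin n → ℂ) → ℂ) {a : Chain n n}
    (ha : a ∈ degenerateChains n n) : chainIntegral h a = 0 := by
  rw [chainIntegral_eq_formChain, formChain_degenerate _ ha]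

lemma contDiffOn_smul_const_form {O : Set (Fin n → ℂ)} {h : (Fin n → ℂ) → ℂ}
    (hh : AnalyticOnNhd ℂ h O) (α : (Fin n → ℂ) [⋀^Fin k]→L[ℝ] ℂ) :
    ContDiffOn ℝ 1 (fun z => h z • α) O := by
  have h1 : ContDiffOn ℂ 1 h O := fun z hz => (hh z hz).contDiffAt.contDiffWithinAt
  exact (h1.restrict_scalars ℝ).smul contDiffOn_const

lemma extDerivWithin_smul_const_form {O : Set (Fin n → ℂ)} (hO : IsOpen O) {h : (Fin n → ℂ) → ℂ}
    (hh : AnalyticOnNhd ℂ h O) (α : (Fin n → ℂ) [⋀^Fin k]→L[ℝ] ℂ) {z : Fin n → ℂ} (hz : z ∈ O)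
    (v : Fin (k + 1) → Fin n → ℂ) :
    extDerivWithin (fun z => h z • α) O z v =
      ∑ i : Fin (k + 1), (-1 : ℂ) ^ (i : ℕ) * (fderiv ℂ h z (v i) * α (i.removeNth v)) := by
  have hd : HasFDerivAt h ((fderiv ℂ h z).restrictScalars ℝ) z :=
    (hh z hz).differentiableAt.hasFDerivAt.restrictScalars ℝ
  rw [extDerivWithin_apply (((contDiffOn_smul_const_form hh α).differentiableOn (by simp)) z hz)
    (hO.uniqueDiffOn z hz)]
  refine Finset.sum_congr rfl fun i _ => ?_
  have h2 : HasFDerivAt (fun z => (h z • α) (i.removeNth v))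
      (((fderiv ℂ h z).restrictScalars ℝ).smulRight (α (i.removeNth v))) z := by
    simp only [ContinuousAlternatingMap.smul_apply]
    exact hd.smul_const (α (i.removeNth v))
  rw [h2.hasFDerivWithinAt.fderivWithin (hO.uniqueDiffOn z hz)]
  rcases Nat.even_or_odd (i : ℕ) with h | h <;> simp [h.neg_one_pow]

/-- The integral of a holomorphic `n`-form over a boundary vanishes. -/
theorem chainIntegral_boundary {O : Set (Fin n → ℂ)} (hO : IsOpen O) {h : (Fin n → ℂ) → ℂ}
    (hh : AnalyticOnNhd ℂ h O) {a : Chain n (n + 1)} (ha : a ∈ smoothChains O (n + 1)) :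
    chainIntegral h (boundary n (n + 1) a) = 0 := by
  rw [chainIntegral_eq_formChain,
    ← formChain_extDerivWithin hO (contDiffOn_smul_const_form hh (volForm n)) ha,
    formChain_congr (ω' := fun _ => 0) (fun z hz => ?_) ha, formChain_zero]
  ext v
  rw [extDerivWithin_smul_const_form hO hh _ hz]
  exact sum_wedge_volForm_eq_zero (fderiv ℂ h z) v

/-- The integral of a partial derivative of a holomorphic function over a cycle vanishes. -/
theorem chainIntegral_fderiv {O : Set (Fin n → ℂ)} (hO : IsOpen O) {G : (Fin n → ℂ) → ℂ}
    (hG : AnalyticOnNhd ℂ G O) (e : Fin n → ℂ) {a : Chain n n} (ha : a ∈ cycles O n) :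
    chainIntegral (fun z => fderiv ℂ G z e) a = 0 := by
  cases n with
  | zero =>
    have : (fun z => fderiv ℂ G z e) = fun _ => 0 := by
      funext z
      rw [Subsingleton.elim e 0, map_zero]
    rw [this, chainIntegral_eq_formChain]
    refine (formChain_congr (ω' := fun _ => 0) (fun z _ => ?_)
      (Submodule.mem_inf.1 ha).1).trans (formChain_zero a)
    ext v
    simp
  | succ k =>
    obtain ⟨ha1, ha2⟩ := Submodule.mem_inf.1 ha
    -- The contraction of `dz` with `e`. Expanding `dG ∧ dz = 0` at a list of vectors beginning with
    -- `e` gives `d(G α) = (∂G/∂e) dz`. The boundary of the cycle is degenerate, so Stokes' theorem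
    -- finishes the proof.
    set α : (Fin (k + 1) → ℂ) [⋀^Fin k]→L[ℝ] ℂ := (volForm (k + 1)).curryLeft e with hα
    have h1 := formChain_extDerivWithin hO (contDiffOn_smul_const_form hG α) ha1
    rw [formChain_degenerate _ ha2] at h1
    rw [chainIntegral_eq_formChain, ← h1]
    refine formChain_congr (fun z hz => ?_) ha1
    ext v
    rw [extDerivWithin_smul_const_form hO hG _ hz]
    have h2 := sum_wedge_volForm_eq_zero (fderiv ℂ G z) (Fin.cons e v : Fin (k + 2) → Fin (k + 1) → ℂ)
    rw [Fin.sum_univ_succ] at h2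
    simp only [Fin.val_zero, pow_zero, Fin.cons_zero, one_mul, Fin.val_succ, Fin.cons_succ,
      pow_succ] at h2
    rw [ContinuousAlternatingMap.smul_apply, volForm_apply, smul_eq_mul]
    have h3 : (Fin.removeNth 0 (Fin.cons e v : Fin (k + 2) → Fin (k + 1) → ℂ)) = v := by
      simp
    rw [h3, add_eq_zero_iff_eq_neg] at h2
    refine h2.trans ?_
    rw [← Finset.sum_neg_distrib]
    refine Finset.sum_congr rfl fun i _ => ?_
    have h4 : (Fin.removeNth i.succ (Fin.cons e v : Fin (k + 2) → Fin (k + 1) → ℂ)) =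
        Fin.cons e (Fin.removeNth i v) := by
      funext j
      refine Fin.cases ?_ (fun j => ?_) j
      · simp [Fin.removeNth]
      · simp [Fin.removeNth]
    have h5 : α (i.removeNth v) =
        Matrix.det (Fin.cons e (Fin.removeNth i v) : Fin (k + 1) → Fin (k + 1) → ℂ) := rfl
    rw [h4, h5]
    ring

end Stokes

/-! ### Homotheties of chains, bounds and termwise integration. -/

section Scaling

open MeasureTheory

variable {n k : ℕ}

lemma cube_eq_ext (c : Cube n k) (u : Fin k → unitInterval) :
    c u = c.ext fun i => (u i : ℝ) := by
  simp [Cube.ext]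

/-- The homothety with ratio `s`, on cubes. -/
def Cube.scale (s : ℝ) (c : Cube n k) : Cube n k := fun u => (s : ℂ) • c u

lemma Cube.scale_ext (s : ℝ) (c : Cube n k) : (c.scale s).ext = fun u => (s : ℂ) • c.ext u := rfl

lemma scaleChain_single (s : ℝ) (c : Cube n k) (m : ℤ) :
    scaleChain s (Finsupp.single c m) = Finsupp.single (c.scale s) m :=
  Finsupp.mapDomain_single

lemma scaleChain_add (s : ℝ) (a b : Chain n k) :
    scaleChain s (a + b) = scaleChain s a + scaleChain s b := Finsupp.mapDomain_add

lemma scaleChain_zero (s : ℝ) : scaleChain s (0 : Chain n k) = 0 := Finsupp.mapDomain_zero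

lemma scaleChain_smul (s : ℝ) (m : ℤ) (a : Chain n k) :
    scaleChain s (m • a) = m • scaleChain s a := Finsupp.mapDomain_smul _ _

lemma scaleChain_sub (s : ℝ) (a b : Chain n k) :
    scaleChain s (a - b) = scaleChain s a - scaleChain s b :=
  map_sub (Finsupp.lmapDomain ℤ ℤ (Cube.scale (n := n) (k := k) s)) a b

lemma scaleChain_sum (s : ℝ) {α : Type*} (t : Finset α) (a : α → Chain n k) :
    scaleChain s (∑ i ∈ t, a i) = ∑ i ∈ t, scaleChain s (a i) :=
  map_sum (Finsupp.lmapDomain ℤ ℤ (Cube.scale (n := n) (k := k) s)) a t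

lemma boundary_scaleChain (s : ℝ) (a : Chain n k) :
    boundary n k (scaleChain s a) = scaleChain s (boundary n k a) := by
  cases k with
  | zero => simp [boundary, scaleChain_zero]
  | succ k =>
    induction a using Finsupp.induction_linear with
    | zero => simp [scaleChain_zero]
    | add a b ha hb => rw [scaleChain_add, map_add, map_add, ha, hb, scaleChain_add]
    | single c m =>
      rw [← mul_one m, ← smul_eq_mul, ← Finsupp.smul_single, scaleChain_smul, map_smul, map_smul,
        scaleChain_smul, scaleChain_single, boundary_succ_single, boundary_succ_single,
        scaleChain_sum]
      congr 1
      refine Finset.sum_congr rfl fun i _ => ?_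
      rw [scaleChain_smul, scaleChain_sub, scaleChain_single, scaleChain_single]
      rfl

lemma scaleChain_degenerate (s : ℝ) {a : Chain n k} (ha : a ∈ degenerateChains n k) :
    scaleChain s a ∈ degenerateChains n k := by
  induction ha using Submodule.span_induction with
  | mem a ha =>
    obtain ⟨c, ⟨i, hi⟩, rfl⟩ := ha
    rw [scaleChain_single]
    refine Submodule.subset_span ⟨_, ⟨i, fun u u' h => ?_⟩, rfl⟩
    simp only [Cube.scale, hi u u' h]
  | zero => simp [scaleChain_zero]
  | add a b _ _ ha hb => rw [scaleChain_add]; exact add_mem ha hb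
  | smul m a _ ha => rw [scaleChain_smul]; exact Submodule.smul_mem _ _ ha

lemma scaleChain_mem_smoothChains {U V : Set (Fin n → ℂ)} (s : ℝ)
    (h : ∀ z ∈ U, (s : ℂ) • z ∈ V) {a : Chain n k} (ha : a ∈ smoothChains U k) :
    scaleChain s a ∈ smoothChains V k := by
  induction ha using Submodule.span_induction with
  | mem a ha =>
    obtain ⟨c, hc, hcU, rfl⟩ := ha
    rw [scaleChain_single]
    exact Submodule.subset_span ⟨c.scale s, hc.const_smul (s : ℂ), fun u => h _ (hcU u), rfl⟩
  | zero => simp [scaleChain_zero]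
  | add a b _ _ ha hb => rw [scaleChain_add]; exact add_mem ha hb
  | smul m a _ ha => rw [scaleChain_smul]; exact Submodule.smul_mem _ _ ha

lemma scaleChain_mem_cycles {U V : Set (Fin n → ℂ)} (s : ℝ)
    (h : ∀ z ∈ U, (s : ℂ) • z ∈ V) {a : Chain n k} (ha : a ∈ cycles U k) :
    scaleChain s a ∈ cycles V k := by
  obtain ⟨h1, h2⟩ := Submodule.mem_inf.1 ha
  refine Submodule.mem_inf.2 ⟨scaleChain_mem_smoothChains s h h1, ?_⟩
  rw [Submodule.mem_comap, boundary_scaleChain]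
  exact scaleChain_degenerate s h2

lemma smoothChains_mono {U V : Set (Fin n → ℂ)} (h : U ⊆ V) :
    smoothChains U k ≤ smoothChains V k :=
  Submodule.span_mono fun _ ⟨c, hc, hcU, e⟩ => ⟨c, hc, fun u => h (hcU u), e⟩

lemma cubeIntegral_scale (h : (Fin n → ℂ) → ℂ) (s : ℝ) (c : Cube n n) :
    cubeIntegral h (c.scale s) = (s : ℂ) ^ n * cubeIntegral (fun z => h ((s : ℂ) • z)) c := by
  unfold cubeIntegral
  rw [← integral_const_mul]
  congr 1
  funext u
  rw [Cube.scale_ext]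
  have h1 : fderiv ℝ (fun u => (s : ℂ) • c.ext u) u = (s : ℂ) • fderiv ℝ c.ext u :=
    by
    have := congrFun (fderiv_const_smul_field (𝕜 := ℝ) (f := c.ext) (s : ℂ)) u
    exact this
  rw [h1]
  have h2 : (Matrix.of fun i j => ((s : ℂ) • fderiv ℝ c.ext u) (Pi.single j 1) i) =
      (s : ℂ) • (Matrix.of fun i j => fderiv ℝ c.ext u (Pi.single j 1) i) := by
    ext i j
    simp
  rw [h2, Matrix.det_smul, Fintype.card_fin]
  ring

lemma chainIntegral_single (h : (Fin n → ℂ) → ℂ) (c : Cube n n) :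
    chainIntegral h (Finsupp.single c 1) = cubeIntegral h c := by
  simp [chainIntegral, Finsupp.linearCombination_single]

lemma chainIntegral_scale (h : (Fin n → ℂ) → ℂ) (s : ℝ) (a : Chain n n) :
    chainIntegral h (scaleChain s a) =
      (s : ℂ) ^ n * chainIntegral (fun z => h ((s : ℂ) • z)) a := by
  induction a using Finsupp.induction_linear with
  | zero => simp [scaleChain_zero]
  | add a b ha hb => rw [scaleChain_add, map_add, map_add, ha, hb, mul_add]
  | single c m =>
    rw [← mul_one m, ← smul_eq_mul, ← Finsupp.smul_single, scaleChain_smul, map_smul, map_smul,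
      scaleChain_single, chainIntegral_single, chainIntegral_single, cubeIntegral_scale]
    simp only [zsmul_eq_mul]
    ring

lemma isCompact_range_ext {c : Cube n k} (hc : ContDiffOn ℝ (⊤ : ℕ∞) c.ext (Icc 0 1)) :
    IsCompact (Set.range c) := by
  have : Set.range c = c.ext '' Icc 0 1 := by
    ext z
    constructor
    · rintro ⟨u, rfl⟩
      exact ⟨fun i => (u i : ℝ), ⟨fun i => (u i).2.1, fun i => (u i).2.2⟩, (cube_eq_ext c u).symm⟩
    · rintro ⟨u, -, rfl⟩
      exact ⟨_, rfl⟩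
  rw [this]
  exact isCompact_Icc.image_of_continuousOn hc.continuousOn

/-- A smooth chain in `U` is supported in a compact subset of `U`. -/
lemma exists_compact_smoothChains {U : Set (Fin n → ℂ)} {a : Chain n k} (ha : a ∈ smoothChains U k) :
    ∃ K ⊆ U, IsCompact K ∧ a ∈ smoothChains K k := by
  induction ha using Submodule.span_induction with
  | mem a ha =>
    obtain ⟨c, hc, hcU, rfl⟩ := ha
    exact ⟨Set.range c, by rintro _ ⟨u, rfl⟩; exact hcU u, isCompact_range_ext hc,
      Submodule.subset_span ⟨c, hc, fun u => ⟨u, rfl⟩, rfl⟩⟩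
  | zero => exact ⟨∅, Set.empty_subset _, isCompact_empty, zero_mem _⟩
  | add a b _ _ ha hb =>
    obtain ⟨K, hK, hKc, haK⟩ := ha
    obtain ⟨L, hL, hLc, hbL⟩ := hb
    exact ⟨K ∪ L, Set.union_subset hK hL, hKc.union hLc,
      add_mem (smoothChains_mono Set.subset_union_left haK)
        (smoothChains_mono Set.subset_union_right hbL)⟩
  | smul m a _ ha =>
    obtain ⟨K, hK, hKc, haK⟩ := ha
    exact ⟨K, hK, hKc, Submodule.smul_mem _ _ haK⟩

/-- The chain contracted by a small homothety lies close to the origin. -/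
lemma eventually_scaleChain_mem {U W : Set (Fin n → ℂ)} (hU : ∀ s : ℝ, 0 < s → ∀ z ∈ U, (s : ℂ) • z ∈ U)
    (hW : W ∈ 𝓝 (0 : Fin n → ℂ)) {a : Chain n k} (ha : a ∈ smoothChains U k) :
    ∀ᶠ s : ℝ in 𝓝[>] 0, scaleChain s a ∈ smoothChains (U ∩ W) k := by
  obtain ⟨K, hKU, hK, haK⟩ := exists_compact_smoothChains ha
  obtain ⟨r, hr, hrW⟩ := Metric.mem_nhds_iff.1 hW
  obtain ⟨B, hB⟩ := hK.isBounded.exists_norm_le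
  have h1 : Tendsto (fun s : ℝ => s * (|B| + 1)) (𝓝[>] 0) (𝓝 0) := by
    have : Tendsto (fun s : ℝ => s * (|B| + 1)) (𝓝 0) (𝓝 (0 * (|B| + 1))) := tendsto_id.mul_const _
    rw [zero_mul] at this
    exact this.mono_left nhdsWithin_le_nhds
  filter_upwards [self_mem_nhdsWithin, h1.eventually_lt_const hr] with s hs hsr
  have hs : 0 < s := hs
  refine scaleChain_mem_smoothChains s (fun z hz => And.intro (hU s hs z (hKU hz)) (hrW ?_)) haK
  rw [Metric.mem_ball, dist_zero_right, norm_smul, Complex.norm_real, Real.norm_of_nonneg hs.le]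
  refine lt_of_le_of_lt ?_ hsr
  gcongr
  linarith [hB z hz, le_abs_self B]

lemma continuousOn_jacobian {c : Cube n k} (hc : ContDiffOn ℝ (⊤ : ℕ∞) c.ext (Icc 0 1)) (j : Fin k) :
    ContinuousOn (fun u => fderivWithin ℝ c.ext (Icc 0 1) u (Pi.single j 1)) (Icc 0 1) :=
  (hc.continuousOn_fderivWithin uniqueDiffOn_unitBox (by simp)).clm_apply continuousOn_const

lemma cubeIntegral_eq_within (h : (Fin n → ℂ) → ℂ) (c : Cube n n) :
    cubeIntegral h c = ∫ u in Icc (0 : Fin n → ℝ) 1, h (c.ext u) *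
      (Matrix.of fun i j => fderivWithin ℝ c.ext (Icc 0 1) u (Pi.single j 1) i).det := by
  refine integral_congr_ae ?_
  filter_upwards [ae_mem_interior_unitBox] with u hu
  rw [fderivWithin_of_mem_nhds (mem_interior_iff_mem_nhds.1 hu)]

lemma continuousOn_jacobian_det {c : Cube n n} (hc : ContDiffOn ℝ (⊤ : ℕ∞) c.ext (Icc 0 1)) :
    ContinuousOn (fun u =>
      (Matrix.of fun i j => fderivWithin ℝ c.ext (Icc 0 1) u (Pi.single j 1) i).det) (Icc 0 1) := by
  rw [continuousOn_iff_continuous_domRestrict]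
  refine Continuous.matrix_det ?_
  refine continuous_pi fun i => continuous_pi fun j => ?_
  have := continuousOn_iff_continuous_domRestrict.1 (continuousOn_jacobian hc j)
  exact (continuous_apply i).comp this

/-- A bound for the integral over a chain. -/
lemma exists_chainIntegral_bound {U : Set (Fin n → ℂ)} {a : Chain n n} (ha : a ∈ smoothChains U n) :
    ∃ B : ℝ, 0 ≤ B ∧ ∀ (h : (Fin n → ℂ) → ℂ) (M : ℝ), 0 ≤ M → (∀ z ∈ U, ‖h z‖ ≤ M) →
      ‖chainIntegral h a‖ ≤ B * M := by
  induction ha using Submodule.span_induction with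
  | mem a ha =>
    obtain ⟨c, hc, hcU, rfl⟩ := ha
    obtain ⟨J, hJ⟩ := isCompact_Icc.exists_bound_of_continuousOn (continuousOn_jacobian_det hc)
    refine ⟨|J| * volume.real (Icc (0 : Fin n → ℝ) 1), by positivity, fun h M hM hh => ?_⟩
    rw [chainIntegral_single, cubeIntegral_eq_within]
    have h1 := norm_setIntegral_le_of_norm_le_const (μ := volume) (s := Icc (0 : Fin n → ℝ) 1)
      (C := M * |J|) (f := fun u => h (c.ext u) *
        (Matrix.of fun i j => fderivWithin ℝ c.ext (Icc 0 1) u (Pi.single j 1) i).det)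
      isCompact_Icc.measure_lt_top (fun u hu => by
        rw [norm_mul]
        exact mul_le_mul (hh _ (ext_mem hcU u)) ((hJ u hu).trans (le_abs_self J)) (norm_nonneg _) hM)
    refine h1.trans (le_of_eq ?_)
    ring
  | zero => exact ⟨0, le_rfl, fun h M hM _ => by simp⟩
  | add a b _ _ ha hb =>
    obtain ⟨A, hA0, hA⟩ := ha
    obtain ⟨B, hB0, hB⟩ := hb
    refine ⟨A + B, add_nonneg hA0 hB0, fun h M hM hh => ?_⟩
    rw [map_add, add_mul]
    exact (norm_add_le _ _).trans (add_le_add (hA h M hM hh) (hB h M hM hh))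
  | smul m a _ ha =>
    obtain ⟨A, hA0, hA⟩ := ha
    refine ⟨‖m‖ * A, by positivity, fun h M hM hh => ?_⟩
    rw [map_smul, mul_assoc]
    exact (norm_zsmul_le _ _).trans (mul_le_mul_of_nonneg_left (hA h M hM hh) (norm_nonneg _))

lemma integrableOn_cube {U : Set (Fin n → ℂ)} {h : (Fin n → ℂ) → ℂ} (hh : ContinuousOn h U)
    {c : Cube n n} (hc : ContDiffOn ℝ (⊤ : ℕ∞) c.ext (Icc 0 1)) (hcU : ∀ u, c u ∈ U) :
    IntegrableOn (fun u => h (c.ext u) *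
      (Matrix.of fun i j => fderivWithin ℝ c.ext (Icc 0 1) u (Pi.single j 1) i).det)
      (Icc (0 : Fin n → ℝ) 1) := by
  refine ContinuousOn.integrableOn_compact isCompact_Icc ?_
  exact (hh.comp hc.continuousOn fun u _ => ext_mem hcU u).mul (continuousOn_jacobian_det hc)

lemma chainIntegral_fun_add {U : Set (Fin n → ℂ)} {g h : (Fin n → ℂ) → ℂ} (hg : ContinuousOn g U)
    (hh : ContinuousOn h U) {a : Chain n n} (ha : a ∈ smoothChains U n) :
    chainIntegral (fun z => g z + h z) a = chainIntegral g a + chainIntegral h a := by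
  induction ha using Submodule.span_induction with
  | mem a ha =>
    obtain ⟨c, hc, hcU, rfl⟩ := ha
    simp only [chainIntegral_single, cubeIntegral_eq_within]
    rw [← integral_add (integrableOn_cube hg hc hcU) (integrableOn_cube hh hc hcU)]
    congr 1
    funext u
    ring
  | zero => simp
  | add a b _ _ ha hb => simp only [map_add, ha, hb]; ring
  | smul m a _ ha => simp only [map_smul, ha, smul_add]

lemma chainIntegral_fun_const_mul (r : ℂ) (h : (Fin n → ℂ) → ℂ) (a : Chain n n) :
    chainIntegral (fun z => r * h z) a = r * chainIntegral h a := by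
  have h1 : cubeIntegral (fun z => r * h z) = fun c => r * cubeIntegral h c := by
    funext c
    simp only [cubeIntegral, mul_assoc]
    exact MeasureTheory.integral_const_mul _ _
  simp only [chainIntegral, h1, Finsupp.linearCombination_apply, Finsupp.sum, Finset.mul_sum,
    mul_smul_comm]

/-- Termwise integration of a uniformly dominated series over a chain. -/
lemma hasSum_chainIntegral {U : Set (Fin n → ℂ)} {g : ℕ → (Fin n → ℂ) → ℂ} {h : (Fin n → ℂ) → ℂ}
    (hg : ∀ d, ContinuousOn (g d) U) (M : ℕ → ℝ) (hM : Summable M)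
    (hgM : ∀ d, ∀ z ∈ U, ‖g d z‖ ≤ M d) (hh : ∀ z ∈ U, HasSum (fun d => g d z) (h z))
    {a : Chain n n} (ha : a ∈ smoothChains U n) :
    HasSum (fun d => chainIntegral (g d) a) (chainIntegral h a) := by
  induction ha using Submodule.span_induction with
  | mem a ha =>
    obtain ⟨c, hc, hcU, rfl⟩ := ha
    simp only [chainIntegral_single, cubeIntegral_eq_within]
    obtain ⟨J, hJ⟩ := isCompact_Icc.exists_bound_of_continuousOn (continuousOn_jacobian_det hc)
    -- A point of `U`, needed only to know that the bounds `M d` are nonnegative.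
    have hbase : c (fun _ => 0) ∈ U := hcU _
    refine hasSum_integral_of_dominated_convergence (fun d _ => M d * |J|)
      (fun d => (integrableOn_cube (hg d) hc hcU).aestronglyMeasurable) (fun d => ?_) ?_ ?_ ?_
    · refine (ae_restrict_mem measurableSet_Icc).mono fun u hu => ?_
      rw [norm_mul]
      exact mul_le_mul (hgM d _ (ext_mem hcU u)) ((hJ u hu).trans (le_abs_self J)) (norm_nonneg _)
        ((norm_nonneg _).trans (hgM d _ hbase))
    · exact Eventually.of_forall fun u => hM.mul_right _
    · exact integrableOn_const isCompact_Icc.measure_lt_top.ne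
    · exact Eventually.of_forall fun u => (hh _ (ext_mem hcU u)).mul_right _
  | zero => simp
  | add a b _ _ ha hb => simpa only [map_add] using ha.add hb
  | smul m a _ ha => simpa only [map_smul] using ha.const_smul m

end Scaling

/-! ### Partial fractions and residues of rational functions. -/

section Arrangement

variable {n : ℕ}

lemma evC_add (y : Fin n → ℤ) (z w : Fin n → ℂ) : evC y (z + w) = evC y z + evC y w := by
  simp [evC, mul_add, Finset.sum_add_distrib]

lemma evC_sub (y : Fin n → ℤ) (z w : Fin n → ℂ) : evC y (z - w) = evC y z - evC y w := by
  simp [evC, mul_sub, Finset.sum_sub_distrib]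

lemma evC_smul (y : Fin n → ℤ) (s : ℂ) (z : Fin n → ℂ) : evC y (s • z) = s * evC y z := by
  simp only [evC, Pi.smul_apply, smul_eq_mul, Finset.mul_sum]
  exact Finset.sum_congr rfl fun k _ => by ring

lemma continuous_evC (y : Fin n → ℤ) : Continuous (evC y) := by
  unfold evC
  fun_prop

variable {ι : Type*} {x : ι → Fin n → ℤ}

lemma smul_mem_arrCompl {s : ℂ} (hs : s ≠ 0) {z : Fin n → ℂ} (hz : z ∈ arrCompl x) :
    s • z ∈ arrCompl x := fun i => by
  rw [evC_smul]
  exact mul_ne_zero hs (hz i)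

lemma pos_smul_mem_arrCompl (s : ℝ) (hs : 0 < s) (z : Fin n → ℂ) (hz : z ∈ arrCompl x) :
    (s : ℂ) • z ∈ arrCompl x := smul_mem_arrCompl (by exact_mod_cast hs.ne') hz

lemma isOpen_arrCompl [Finite ι] : IsOpen (arrCompl x) := by
  have : arrCompl x = ⋂ i, {z | evC (x i) z ≠ 0} := by
    ext z
    simp [arrCompl]
  rw [this]
  exact isOpen_iInter_of_finite fun i => (isOpen_compl_singleton (x := (0 : ℂ))).preimage
    (continuous_evC (x i))

variable [Fintype ι]

instance : Finite (OrdTuple x) := Subtype.finite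

instance : Fintype (OrdTuple x) := Fintype.ofFinite _

/-- A functional that kills all the forms is the evaluation at a vector lying on every hyperplane,
and such a vector is `0`. -/
lemma span_forms_eq_top (hx : IsIntegralArrangement x) :
    Submodule.span ℝ (Set.range fun (i : ι) (l : Fin n) => (x i l : ℝ)) = ⊤ := by
  by_contra hne
  obtain ⟨f, hf0, hf⟩ := Submodule.exists_le_ker_of_lt_top _ (lt_top_iff_ne_top.2 hne)
  have hfv : ∀ y : Fin n → ℝ, f y = ∑ l, y l * f (Pi.single l 1) := by
    intro y
    conv_lhs => rw [← Finset.univ_sum_single y]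
    rw [map_sum]
    refine Finset.sum_congr rfl fun l _ => ?_
    rw [← smul_eq_mul, ← map_smul, ← Pi.single_smul, smul_eq_mul, mul_one]
  have hv := hx.essential (fun l => f (Pi.single l 1)) fun i => by
    have := hf (Submodule.subset_span ⟨i, rfl⟩)
    rw [LinearMap.mem_ker, hfv] at this
    exact this
  refine hf0 (LinearMap.ext fun y => ?_)
  rw [hfv]
  exact Finset.sum_eq_zero fun l _ => by rw [congrFun hv l]; simp

/-- Every independent set of hyperplanes is contained in an ordered basis. -/
lemma exists_ordTuple_of_linearIndepOn (hx : IsIntegralArrangement x) (T : Set ι)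
    (hT : LinearIndepOn ℝ (fun (i : ι) (l : Fin n) => (x i l : ℝ)) T) :
    ∃ S : OrdTuple x, ∀ i ∈ T, ∃ k, S.1 k = i := by
  obtain ⟨b, -, hTb, hsp, hb⟩ := exists_linearIndepOn_extension hT (Set.subset_univ T)
  have htop : ⊤ ≤ Submodule.span ℝ (Set.range fun i : b => fun l : Fin n => (x i l : ℝ)) := by
    rw [← span_forms_eq_top hx, Submodule.span_le]
    rintro _ ⟨i, rfl⟩
    have := hsp ⟨i, Set.mem_univ i, rfl⟩
    rwa [Set.image_eq_range] at this
  let B := Module.Basis.mk hb htop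
  let e : b ≃ Fin n := B.indexEquiv (Pi.basisFun ℝ (Fin n))
  refine ⟨⟨fun k => (e.symm k : ι), ?_⟩, fun i hi => ⟨e ⟨i, hTb hi⟩, by simp⟩⟩
  exact hb.comp e.symm e.symm.injective

lemma exists_ordTuple (hx : IsIntegralArrangement x) : Nonempty (OrdTuple x) := by
  obtain ⟨S, -⟩ := exists_ordTuple_of_linearIndepOn hx ∅ (linearIndepOn_empty _ _)
  exact ⟨S⟩

lemma OrdTuple.injective (S : OrdTuple x) : Function.Injective S.1 := fun k l h => by
  refine S.2.injective ?_
  simp only [h]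

lemma formsMatrix_mulVec (y : Fin n → Fin n → ℤ) (z : Fin n → ℂ) (k : Fin n) :
    (formsMatrix y).mulVec z k = evC (y k) z := rfl

lemma isUnit_det_formsMatrix (S : OrdTuple x) : IsUnit (formsMatrix S.forms).det :=
  (Matrix.isUnit_iff_isUnit_det _).1 (isUnit_formsMatrix S)

lemma det_formsMatrix (y : Fin n → Fin n → ℤ) : (formsMatrix y).det = (formsDet y : ℂ) := by
  have h := (Int.castRingHom ℂ).map_det (Matrix.of y)
  rw [formsDet]
  refine Eq.trans ?_ h.symm
  rfl

lemma formsDet_ne_zero (S : OrdTuple x) : (formsDet S.forms : ℂ) ≠ 0 := by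
  rw [← det_formsMatrix]
  exact (isUnit_det_formsMatrix S).ne_zero

lemma evC_inv_mulVec (S : OrdTuple x) (w : Fin n → ℂ) (k : Fin n) :
    evC (S.forms k) ((formsMatrix S.forms)⁻¹.mulVec w) = w k := by
  rw [← formsMatrix_mulVec, Matrix.mulVec_mulVec,
    Matrix.mul_nonsing_inv _ (isUnit_det_formsMatrix S), Matrix.one_mulVec]

lemma coord_eq_sum (S : OrdTuple x) (z : Fin n → ℂ) (l : Fin n) :
    z l = ∑ k, (formsMatrix S.forms)⁻¹ l k * evC (x (S.1 k)) z := by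
  have h : (formsMatrix S.forms)⁻¹.mulVec ((formsMatrix S.forms).mulVec z) = z := by
    rw [Matrix.mulVec_mulVec, Matrix.nonsing_inv_mul _ (isUnit_det_formsMatrix S),
      Matrix.one_mulVec]
  conv_lhs => rw [← h]
  rfl

/-! ### Partial fractions -/

/-- The space spanned by the functions which on the complement of the arrangement are Laurent
monomials in a basis of forms. -/
def laurentSpan (x : ι → Fin n → ℤ) : Submodule ℂ ((Fin n → ℂ) → ℂ) :=
  Submodule.span ℂ {g | ∃ (S : OrdTuple x) (e : Fin n → ℤ),
    ∀ z ∈ arrCompl x, g z = ∏ k, evC (x (S.1 k)) z ^ e k}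

/-- A generator is prescribed on the complement only and is arbitrary on the hyperplanes. Hence a
function supported on the hyperplanes is a difference of two generators. -/
lemma laurentSpan_congr (hx : IsIntegralArrangement x) {g h : (Fin n → ℂ) → ℂ}
    (hg : g ∈ laurentSpan x) (H : ∀ z ∈ arrCompl x, h z = g z) : h ∈ laurentSpan x := by
  obtain ⟨S⟩ := exists_ordTuple hx
  set m : (Fin n → ℂ) → ℂ := fun z => ∏ k, evC (x (S.1 k)) z ^ (0 : ℤ) with hm
  have h1 : m ∈ laurentSpan x := Submodule.subset_span ⟨S, 0, fun z _ => rfl⟩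
  have h2 : m + (h - g) ∈ laurentSpan x := Submodule.subset_span ⟨S, 0, fun z hz => by
    simp [hm, H z hz]⟩
  have h3 : h = g + ((m + (h - g)) - m) := by abel
  rw [h3]
  exact add_mem hg (sub_mem h2 h1)

/-- The coordinate is a combination of the forms of the basis occurring in a monomial, so the
product is a sum of monomials in the same basis. -/
lemma mul_coord_mem_laurentSpan (hx : IsIntegralArrangement x) {g : (Fin n → ℂ) → ℂ}
    (hg : g ∈ laurentSpan x) (l : Fin n) : (fun z => z l * g z) ∈ laurentSpan x := by
  induction hg using Submodule.span_induction with
  | mem g hg =>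
    obtain ⟨S, e, hge⟩ := hg
    have h1 : (∑ k, (formsMatrix S.forms)⁻¹ l k • fun z : Fin n → ℂ =>
        ∏ j, evC (x (S.1 j)) z ^ (e j + if j = k then 1 else 0)) ∈ laurentSpan x :=
      Submodule.sum_mem _ fun k _ => Submodule.smul_mem _ _ (Submodule.subset_span
        ⟨S, _, fun z _ => rfl⟩)
    refine laurentSpan_congr hx h1 fun z hz => ?_
    rw [coord_eq_sum S z l, Finset.sum_mul, Finset.sum_apply]
    refine Finset.sum_congr rfl fun k _ => ?_
    simp only [Pi.smul_apply, smul_eq_mul]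
    rw [mul_assoc]
    congr 1
    rw [hge z hz]
    simp only [zpow_add₀ (hz _), Finset.prod_mul_distrib]
    rw [mul_comm]
    congr 1
    rw [Finset.prod_eq_single k]
    · simp
    · intro j _ hj; simp [hj]
    · simp
  | zero => exact laurentSpan_congr hx (laurentSpan x).zero_mem fun z _ => by simp
  | add g h _ _ hg hh =>
    have := add_mem hg hh
    refine laurentSpan_congr hx this fun z _ => ?_
    simp [mul_add]
  | smul r g _ hg =>
    refine laurentSpan_congr hx ((laurentSpan x).smul_mem r hg) fun z _ => ?_
    simp only [Pi.smul_apply, smul_eq_mul]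
    ring

lemma mul_polynomial_mem_laurentSpan (hx : IsIntegralArrangement x) {g : (Fin n → ℂ) → ℂ}
    (hg : g ∈ laurentSpan x) (P : MvPolynomial (Fin n) ℂ) :
    (fun z => MvPolynomial.eval z P * g z) ∈ laurentSpan x := by
  induction P using MvPolynomial.induction_on with
  | C r => exact laurentSpan_congr hx ((laurentSpan x).smul_mem r hg) fun z _ => by simp
  | add P Q hP hQ =>
    refine laurentSpan_congr hx (add_mem hP hQ) fun z _ => ?_
    simp [add_mul]
  | mul_X P l hP =>
    refine laurentSpan_congr hx (mul_coord_mem_laurentSpan hx hP l) fun z _ => ?_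
    simp only [map_mul, MvPolynomial.eval_X]
    ring

/-- Induction on the set `T` of forms that may occur. If they are independent, the product is a
Laurent monomial in a basis containing them. Otherwise a relation expresses `1` as a combination of
the quotients `x_i / x_{i₀}`; multiplication by it moves one order of pole from `x_i` to `x_{i₀}`
and lowers the total order of the poles other than `x_{i₀}`. This stops when some form of `T` has
exponent `0` and can be removed. -/
lemma prod_inv_mem_laurentSpan_of_subset (hx : IsIntegralArrangement x) (T : Finset ι) :
    ∀ m : ι → ℕ, (∀ i ∉ T, m i = 0) →
      (fun z => ∏ i, (evC (x i) z ^ m i)⁻¹) ∈ laurentSpan x := by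
  classical
  induction T using Finset.strongInduction with
  | H T ih =>
    by_cases hT : LinearIndepOn ℝ (fun (i : ι) (l : Fin n) => (x i l : ℝ)) (T : Set ι)
    · intro m hm
      obtain ⟨S, hS⟩ := exists_ordTuple_of_linearIndepOn hx _ hT
      refine Submodule.subset_span ⟨S, fun k => -(m (S.1 k) : ℤ), fun z hz => ?_⟩
      beta_reduce
      rw [← Finset.prod_subset (Finset.subset_univ (Finset.univ.image S.1)),
        Finset.prod_image fun a _ b _ h => S.injective h]
      · refine Finset.prod_congr rfl fun k _ => ?_
        rw [zpow_neg, zpow_natCast]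
      · intro i _ hi
        have : i ∉ T := fun hiT => hi (by
          obtain ⟨k, rfl⟩ := hS i hiT
          exact Finset.mem_image_of_mem _ (Finset.mem_univ k))
        simp [hm i this]
    · rw [linearIndepOn_finset_iff] at hT
      push Not at hT
      obtain ⟨c, hc, i₀, hi₀, hci₀⟩ := hT
      have hrel : ∀ z, evC (x i₀) z = ∑ i ∈ T.erase i₀, (-(c i / c i₀ : ℝ) : ℂ) * evC (x i) z := by
        intro z
        have h0 : ∑ i ∈ T, (c i : ℂ) * evC (x i) z = 0 := by
          simp only [evC, Finset.mul_sum]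
          rw [Finset.sum_comm]
          refine Finset.sum_eq_zero fun l _ => ?_
          have h1 := congrFun hc l
          simp only [Finset.sum_apply, Pi.smul_apply, smul_eq_mul, Pi.zero_apply] at h1
          have h2 := congrArg (Complex.ofReal) h1
          push_cast at h2
          simp only [← mul_assoc]
          rw [← Finset.sum_mul, h2, zero_mul]
        rw [← Finset.add_sum_erase _ _ hi₀] at h0
        have hc' : (c i₀ : ℂ) ≠ 0 := by exact_mod_cast hci₀
        have h3 : evC (x i₀) z = -(c i₀ : ℂ)⁻¹ * ∑ i ∈ T.erase i₀, (c i : ℂ) * evC (x i) z := by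
          rw [eq_neg_of_add_eq_zero_right h0]
          field_simp
        rw [h3, Finset.mul_sum]
        refine Finset.sum_congr rfl fun i _ => ?_
        push_cast
        field_simp
      have key : ∀ (M : ℕ) (m : ι → ℕ), (∀ i ∉ T, m i = 0) → ∑ i ∈ T.erase i₀, m i = M →
          (fun z => ∏ i, (evC (x i) z ^ m i)⁻¹) ∈ laurentSpan x := by
        intro M
        induction M using Nat.strong_induction_on with
        | _ M ihM =>
          intro m hm hM
          by_cases hz : ∃ i ∈ T, m i = 0
          · obtain ⟨i, hiT, hi0⟩ := hz
            refine ih (T.erase i) (Finset.erase_ssubset hiT) m fun j hj => ?_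
            by_cases hji : j = i
            · rw [hji, hi0]
            · exact hm j fun hjT => hj (Finset.mem_erase.2 ⟨hji, hjT⟩)
          · push Not at hz
            have h1 : (∑ i ∈ T.erase i₀, (-(c i / c i₀ : ℝ) : ℂ) • fun z : Fin n → ℂ =>
                ∏ j, (evC (x j) z ^ (Function.update (Function.update m i₀ (m i₀ + 1)) i (m i - 1)) j)⁻¹)
                ∈ laurentSpan x := by
              refine Submodule.sum_mem _ fun i hi => Submodule.smul_mem _ _ ?_
              obtain ⟨hii₀, hiT⟩ := Finset.mem_erase.1 hi
              have hmi := hz i hiT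
              refine ihM (M - 1) ?_ _ (fun j hj => ?_) ?_
              · have : m i ≤ M := hM ▸ Finset.single_le_sum (fun _ _ => Nat.zero_le _) hi
                omega
              · have h1 : j ≠ i := fun h => hj (h ▸ hiT)
                have h2 : j ≠ i₀ := fun h => hj (h ▸ hi₀)
                simp [h1, h2, hm j hj]
              · rw [← hM, ← Finset.add_sum_erase _ _ hi, ← Finset.add_sum_erase _ m hi]
                simp only [Function.update_self]
                have : ∀ j ∈ (T.erase i₀).erase i,
                    Function.update (Function.update m i₀ (m i₀ + 1)) i (m i - 1) j = m j := by
                  intro j hj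
                  have h1 := Finset.mem_erase.1 hj
                  have h2 := Finset.mem_erase.1 h1.2
                  simp [h1.1, h2.1]
                rw [Finset.sum_congr rfl this]
                have hsum : ∑ j ∈ (T.erase i₀).erase i, m j = ((T.erase i₀).erase i).sum m := rfl
                omega
            refine laurentSpan_congr hx h1 fun z hzU => ?_
            have hone : (1 : ℂ) = ∑ i ∈ T.erase i₀, (-(c i / c i₀ : ℝ) : ℂ) *
                (evC (x i) z / evC (x i₀) z) := by
              have h2 := congrArg (· / evC (x i₀) z) (hrel z)
              simp only [div_self (hzU i₀), Finset.sum_div, mul_div_assoc] at h2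
              exact h2
            rw [Finset.sum_apply]
            conv_lhs => rw [← one_mul (∏ i, (evC (x i) z ^ m i)⁻¹), hone, Finset.sum_mul]
            refine Finset.sum_congr rfl fun i hi => ?_
            obtain ⟨hii₀, hiT⟩ := Finset.mem_erase.1 hi
            simp only [Pi.smul_apply, smul_eq_mul]
            rw [mul_assoc]
            congr 1
            have hu : i ∈ (Finset.univ : Finset ι).erase i₀ := Finset.mem_erase.2 ⟨hii₀, Finset.mem_univ _⟩
            rw [← Finset.mul_prod_erase Finset.univ _ (Finset.mem_univ i₀),
              ← Finset.mul_prod_erase _ _ hu,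
              ← Finset.mul_prod_erase Finset.univ
                (fun j => (evC (x j) z ^ (Function.update (Function.update m i₀ (m i₀ + 1)) i
                  (m i - 1)) j)⁻¹) (Finset.mem_univ i₀),
              ← Finset.mul_prod_erase _ _ hu]
            have hrest : ∀ j ∈ (Finset.univ.erase i₀).erase i,
                (evC (x j) z ^ (Function.update (Function.update m i₀ (m i₀ + 1)) i (m i - 1)) j)⁻¹ =
                (evC (x j) z ^ m j)⁻¹ := by
              intro j hj
              have h1 := Finset.mem_erase.1 hj
              have h2 := Finset.mem_erase.1 h1.2
              simp [h1.1, h2.1]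
            rw [Finset.prod_congr rfl hrest]
            have hmi : m i - 1 + 1 = m i := Nat.sub_add_cancel (Nat.one_le_iff_ne_zero.2 (hz i hiT))
            have hx0 := hzU i₀
            have hxi := hzU i
            simp only [Function.update_self, Function.update_of_ne (Ne.symm hii₀)]
            rw [pow_succ (evC (x i₀) z), ← hmi, pow_succ (evC (x i) z)]
            simp only [Nat.add_sub_cancel, mul_inv]
            field_simp
      intro m hm
      exact key _ m hm rfl

/-- Partial fraction decomposition. -/
theorem prod_inv_mem_laurentSpan (hx : IsIntegralArrangement x) (m : ι → ℕ) :
    (fun z => ∏ i, (evC (x i) z ^ m i)⁻¹) ∈ laurentSpan x :=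
  prod_inv_mem_laurentSpan_of_subset hx Finset.univ m fun i hi => absurd (Finset.mem_univ i) hi

lemma polynomial_div_mem_laurentSpan (hx : IsIntegralArrangement x) (P : MvPolynomial (Fin n) ℂ)
    (N : ℕ) : (fun z => MvPolynomial.eval z P / (∏ i, evC (x i) z) ^ N) ∈ laurentSpan x := by
  have h := mul_polynomial_mem_laurentSpan hx (prod_inv_mem_laurentSpan hx fun _ => N) P
  refine laurentSpan_congr hx h fun z _ => ?_
  rw [div_eq_mul_inv, ← Finset.prod_pow, Finset.prod_inv_distrib]

/-- The integral of `g` over cycles is given by residues in the Orlik–Solomon algebra. -/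
def HasResidues (x : ι → Fin n → ℤ) (g : (Fin n → ℂ) → ℂ) (a : OrdTuple x → ℂ) : Prop :=
  ∀ c ∈ cycles (arrCompl x) n, chainIntegral g c = ∑ S, a S * chainIntegral (logCoeff S.forms) c

lemma analyticOnNhd_monomial (S : OrdTuple x) (e : Fin n → ℤ) :
    AnalyticOnNhd ℂ (fun z => ∏ k, evC (x (S.1 k)) z ^ e k) (arrCompl x) := fun z hz =>
  Finset.analyticAt_fun_prod _ fun _ _ => (analyticAt_evC _ z).zpow (hz _)

lemma analyticOnNhd_laurentSpan {g : (Fin n → ℂ) → ℂ} (hg : g ∈ laurentSpan x) :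
    AnalyticOnNhd ℂ g (arrCompl x) := by
  induction hg using Submodule.span_induction with
  | mem g hg =>
    obtain ⟨S, e, hge⟩ := hg
    exact (analyticOnNhd_monomial S e).congr isOpen_arrCompl fun z hz => (hge z hz).symm
  | zero => exact analyticOnNhd_const
  | add g h _ _ hg hh => exact hg.add hh
  | smul r g _ hg => exact fun z hz => analyticAt_const.smul (hg z hz)

/-- If the exponent of some form is not `-1`, it can be raised by one: the monomial is then a
derivative of another monomial and integrates to `0` over cycles. If all exponents are `-1`, the
monomial is a multiple of `b(S)`. -/
lemma hasResidues_monomial (S : OrdTuple x) (e : Fin n → ℤ) :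
    ∃ a, HasResidues x (fun z => ∏ k, evC (x (S.1 k)) z ^ e k) a := by
  classical
  by_cases he : ∀ k, e k = -1
  · refine ⟨fun T => if T = S then (formsDet S.forms : ℂ)⁻¹ else 0, fun c _ => ?_⟩
    simp only [ite_mul, zero_mul, Finset.sum_ite_eq', Finset.mem_univ, if_true]
    rw [← chainIntegral_fun_const_mul]
    congr 2
    funext z
    rw [logCoeff, inv_mul_cancel_left₀ (formsDet_ne_zero S)]
    exact Finset.prod_congr rfl fun k _ => by rw [he k, zpow_neg_one]; rfl
  · push Not at he
    obtain ⟨k, hk⟩ := he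
    refine ⟨0, fun c hc => ?_⟩
    set G : (Fin n → ℂ) → ℂ := fun z =>
      ∏ l, evC (x (S.1 l)) z ^ (Function.update e k (e k + 1)) l with hG
    have hGa : AnalyticOnNhd ℂ G (arrCompl x) := analyticOnNhd_monomial S _
    have hek : ((e k + 1 : ℤ) : ℂ) ≠ 0 := by
      norm_cast
      omega
    -- The vector on which the `k`th form of `S` is `1` and the others vanish; differentiating along
    -- it acts on the `k`th factor alone.
    set v : Fin n → ℂ := (formsMatrix S.forms)⁻¹.mulVec (Pi.single k 1) with hv
    have h1 := chainIntegral_fderiv isOpen_arrCompl hGa v hc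
    have h2 : chainIntegral (fun z => ∏ k, evC (x (S.1 k)) z ^ e k) c =
        chainIntegral (fun z => ((e k + 1 : ℤ) : ℂ)⁻¹ * fderiv ℂ G z v) c := by
      refine chainIntegral_congr (fun z hz => ?_) (Submodule.mem_inf.1 hc).1
      have hline : HasDerivAt (fun t : ℂ => G (z + t • v)) (fderiv ℂ G z v) 0 :=
        (hGa z hz).differentiableAt.hasFDerivAt.hasLineDerivAt v
      have hval : ∀ t : ℂ, G (z + t • v) = (evC (x (S.1 k)) z + t) ^ (e k + 1) *
          ∏ l ∈ Finset.univ.erase k, evC (x (S.1 l)) z ^ e l := by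
        intro t
        simp only [hG]
        have hev : ∀ l, evC (x (S.1 l)) (z + t • v) = evC (x (S.1 l)) z + t * (Pi.single k 1 : Fin n → ℂ) l := by
          intro l
          rw [evC_add, evC_smul, hv]
          congr 2
          exact evC_inv_mulVec S _ l
        rw [← Finset.mul_prod_erase Finset.univ _ (Finset.mem_univ k)]
        rw [hev]
        simp only [Function.update_self, Pi.single_eq_same, mul_one]
        congr 1
        refine Finset.prod_congr rfl fun l hl => ?_
        have hlk := Finset.ne_of_mem_erase hl
        rw [hev, Function.update_of_ne hlk, Pi.single_eq_of_ne hlk, mul_zero, add_zero]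
      have hder : HasDerivAt (fun t : ℂ => G (z + t • v))
          ((((e k + 1 : ℤ) : ℂ) * (evC (x (S.1 k)) z + 0) ^ (e k + 1 - 1) * 1) *
            ∏ l ∈ Finset.univ.erase k, evC (x (S.1 l)) z ^ e l) 0 := by
        simp only [hval]
        refine HasDerivAt.mul_const ?_ _
        have hin : HasDerivAt (fun t : ℂ => evC (x (S.1 k)) z + t) 1 0 :=
          (hasDerivAt_id (0 : ℂ)).const_add _
        exact (hasDerivAt_zpow (e k + 1) (evC (x (S.1 k)) z + 0)
          (Or.inl (by rw [add_zero]; exact hz _))).comp 0 hin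
      rw [hline.unique hder, add_zero, add_sub_cancel_right, mul_one, mul_assoc,
        inv_mul_cancel_left₀ hek, Finset.mul_prod_erase Finset.univ
          (fun l => evC (x (S.1 l)) z ^ e l) (Finset.mem_univ k)]
    rw [h2, chainIntegral_fun_const_mul, h1]
    simp

theorem hasResidues_laurentSpan {g : (Fin n → ℂ) → ℂ} (hg : g ∈ laurentSpan x) :
    ∃ a, HasResidues x g a := by
  induction hg using Submodule.span_induction with
  | mem g hg =>
    obtain ⟨S, e, hge⟩ := hg
    obtain ⟨a, ha⟩ := hasResidues_monomial S e
    exact ⟨a, fun c hc => (chainIntegral_congr hge (Submodule.mem_inf.1 hc).1).trans (ha c hc)⟩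
  | zero =>
    refine ⟨0, fun c _ => ?_⟩
    have := chainIntegral_fun_const_mul 0 (fun _ : Fin n → ℂ => (0 : ℂ)) c
    simp only [zero_mul] at this
    simp only [Pi.zero_apply, zero_mul, Finset.sum_const_zero]
    exact this
  | add g h hgm hhm hg hh =>
    obtain ⟨a, ha⟩ := hg
    obtain ⟨b, hb⟩ := hh
    refine ⟨a + b, fun c hc => ?_⟩
    have := chainIntegral_fun_add (analyticOnNhd_laurentSpan hgm).continuousOn
      (analyticOnNhd_laurentSpan hhm).continuousOn (Submodule.mem_inf.1 hc).1
    refine this.trans ?_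
    rw [ha c hc, hb c hc, ← Finset.sum_add_distrib]
    exact Finset.sum_congr rfl fun S _ => by simp [add_mul]
  | smul r g _ hg =>
    obtain ⟨a, ha⟩ := hg
    refine ⟨r • a, fun c hc => ?_⟩
    refine (chainIntegral_fun_const_mul r g c).trans ?_
    rw [ha c hc, Finset.mul_sum]
    exact Finset.sum_congr rfl fun S _ => by simp [mul_assoc]

end Arrangement

/-! ### The pairing of meromorphic germs with homology classes. -/

section Pairing

variable {n : ℕ} {ι : Type*} [Fintype ι] {x : ι → Fin n → ℤ}

/-- The product of all forms of the arrangement. -/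
def formsProd (x : ι → Fin n → ℤ) (z : Fin n → ℂ) : ℂ := ∏ i, evC (x i) z

lemma formsProd_ne_zero {z : Fin n → ℂ} (hz : z ∈ arrCompl x) : formsProd x z ≠ 0 :=
  Finset.prod_ne_zero_iff.2 fun i _ => hz i

lemma formsProd_smul (s : ℂ) (z : Fin n → ℂ) :
    formsProd x (s • z) = s ^ Fintype.card ι * formsProd x z := by
  simp [formsProd, evC_smul, Finset.prod_mul_distrib]

lemma analyticOnNhd_formsProd (O : Set (Fin n → ℂ)) : AnalyticOnNhd ℂ (formsProd x) O := fun z _ =>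
  Finset.analyticAt_fun_prod _ fun _ _ => analyticAt_evC _ z

lemma continuous_formsProd : Continuous (formsProd x) := by
  unfold formsProd
  exact continuous_finsetProd _ fun i _ => continuous_evC (x i)

/-- Degree `-n` compensates the scaling of `dz₁ ∧ ⋯ ∧ dzₙ`: integrals of `b(S)` do not notice the
contraction of a chain. -/
lemma logCoeff_smul (S : OrdTuple x) {s : ℂ} (hs : s ≠ 0) (z : Fin n → ℂ) :
    s ^ n * logCoeff S.forms (s • z) = logCoeff S.forms z := by
  simp only [logCoeff, evC_smul, mul_inv, Finset.prod_mul_distrib, Finset.prod_const,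
    Finset.card_univ, Fintype.card_fin]
  have h : s ^ n * s⁻¹ ^ n = 1 := by rw [← mul_pow, mul_inv_cancel₀ hs, one_pow]
  linear_combination (formsDet S.forms : ℂ) * (∏ k, (evC (S.forms k) z)⁻¹) * h

lemma chainIntegral_logCoeff_scale (S : OrdTuple x) {s : ℝ} (hs : 0 < s) (c : Chain n n) :
    chainIntegral (logCoeff S.forms) (scaleChain s c) = chainIntegral (logCoeff S.forms) c := by
  rw [chainIntegral_scale, ← chainIntegral_fun_const_mul]
  congr 2
  funext z
  exact logCoeff_smul S (by exact_mod_cast hs.ne') z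

/-- The terms of a power series are polynomials. -/
lemma exists_polynomial_eq_multilinear {d : ℕ}
    (p : ContinuousMultilinearMap ℂ (fun _ : Fin d => Fin n → ℂ) ℂ) :
    ∃ P : MvPolynomial (Fin n) ℂ, ∀ z, MvPolynomial.eval z P = p fun _ => z := by
  refine ⟨∑ r : Fin d → Fin n, MvPolynomial.C (p fun i => Pi.single (r i) 1) *
    ∏ i, MvPolynomial.X (r i), fun z => ?_⟩
  have hz : (fun _ : Fin d => z) = fun _ => ∑ k, z k • (Pi.single k 1 : Fin n → ℂ) := by
    funext _
    conv_lhs => rw [← Finset.univ_sum_single z]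
    refine Finset.sum_congr rfl fun k _ => ?_
    rw [← Pi.single_smul, smul_eq_mul, mul_one]
  rw [hz, ContinuousMultilinearMap.map_sum]
  simp only [map_sum, map_mul, MvPolynomial.eval_C, map_prod, MvPolynomial.eval_X]
  refine Finset.sum_congr rfl fun r _ => ?_
  rw [ContinuousMultilinearMap.map_smul_univ (c := fun i => z (r i)) (m := fun i => (Pi.single (r i) 1 : Fin n → ℂ)), smul_eq_mul, mul_comm]

/-- Integrals over contracted cycles of meromorphic forms are given by residues in the
Orlik–Solomon algebra. -/
theorem exists_residues (hx : IsIntegralArrangement x) (N : ℕ) {F : (Fin n → ℂ) → ℂ}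
    (hF : AnalyticAt ℂ F 0) : ∃ a : OrdTuple x → ℂ, ∀ c ∈ cycles (arrCompl x) n,
      ∀ᶠ s : ℝ in 𝓝[>] 0, chainIntegral (fun z => F z / formsProd x z ^ N) (scaleChain s c) =
        ∑ S, a S * chainIntegral (logCoeff S.forms) c := by
  obtain ⟨p, r, hp⟩ := hF
  choose P hP using fun d => exists_polynomial_eq_multilinear (p d)
  choose a ha using fun d => hasResidues_laurentSpan (polynomial_div_mem_laurentSpan hx (P d) N)
  -- The homogeneous parts of the form; `q d` has degree `d - N * Fintype.card ι`.
  set q : ℕ → (Fin n → ℂ) → ℂ := fun d z => MvPolynomial.eval z (P d) / formsProd x z ^ N with hq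
  have hqc : ∀ d, ∀ c ∈ cycles (arrCompl x) n, chainIntegral (q d) c =
      ∑ S, a d S * chainIntegral (logCoeff S.forms) c := ha
  have hqs : ∀ d, ∀ c ∈ cycles (arrCompl x) n, ∀ s : ℝ, 0 < s →
      chainIntegral (q d) (scaleChain s c) = chainIntegral (q d) c := by
    intro d c hc s hs
    rw [hqc d _ (scaleChain_mem_cycles s (pos_smul_mem_arrCompl s hs) hc), hqc d c hc]
    simp only [chainIntegral_logCoeff_scale _ hs]
  -- The integral of `q d` over a cycle is invariant under doubling, because it is given by
  -- residues, but by homogeneity it is also multiplied by `2 ^ (n + d)` and divided by `2 ^ (N *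
  -- Fintype.card ι)`. So only the part of degree `-n` can contribute.
  have hq0 : ∀ d, n + d ≠ N * Fintype.card ι → ∀ c ∈ cycles (arrCompl x) n,
      chainIntegral (q d) c = 0 := by
    intro d hd c hc
    have h1 := hqs d c hc 2 two_pos
    rw [chainIntegral_scale] at h1
    have h2 : (fun z => q d (((2 : ℝ) : ℂ) • z)) =
        fun z => ((2 : ℂ) ^ d / 2 ^ (N * Fintype.card ι)) * q d z := by
      funext z
      have h3 : MvPolynomial.eval (((2 : ℝ) : ℂ) • z) (P d) = 2 ^ d * MvPolynomial.eval z (P d) := by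
        rw [hP, hP]
        have := (p d).map_smul_univ (fun _ => (2 : ℂ)) fun _ => z
        simpa using this
      simp only [hq, formsProd_smul, h3, mul_pow, ← pow_mul]
      rw [mul_comm (Fintype.card ι) N]
      push_cast
      rw [mul_div_mul_comm]
    rw [h2, chainIntegral_fun_const_mul, ← mul_assoc] at h1
    by_contra hne
    have h4 := mul_right_cancel₀ hne (h1.trans (one_mul _).symm)
    have h5 : (2 : ℂ) ^ (n + d) = 2 ^ (N * Fintype.card ι) := by
      have : (2 : ℂ) ^ (N * Fintype.card ι) ≠ 0 := pow_ne_zero _ two_ne_zero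
      push_cast at h4
      field_simp at h4
      rw [pow_add]
      exact h4
    have h6 : (2 : ℕ) ^ (n + d) = 2 ^ (N * Fintype.card ι) := by exact_mod_cast h5
    exact hd (Nat.pow_right_injective le_rfl h6)
  -- Once the cycle is contracted into a ball of convergence the power series of `F` is integrated
  -- term by term; the terms themselves do not change under the contraction.
  have hsum : ∀ c ∈ cycles (arrCompl x) n, ∀ᶠ s : ℝ in 𝓝[>] 0,
      HasSum (fun d => chainIntegral (q d) c)
        (chainIntegral (fun z => F z / formsProd x z ^ N) (scaleChain s c)) := by
    intro c hc
    obtain ⟨ρ, hρ0, hρ⟩ := ENNReal.lt_iff_exists_nnreal_btwn.1 hp.r_pos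
    have hρ0' : 0 < (ρ : ℝ) := by exact_mod_cast hρ0
    filter_upwards [eventually_scaleChain_mem pos_smul_mem_arrCompl
      (Metric.ball_mem_nhds (0 : Fin n → ℂ) hρ0') (Submodule.mem_inf.1 hc).1,
      self_mem_nhdsWithin] with s hs hs0
    obtain ⟨K, hKU, hK, hsK⟩ := exists_compact_smoothChains hs
    have hcont : ContinuousOn (fun z => (formsProd x z ^ N)⁻¹) K :=
      (continuous_formsProd.pow N).continuousOn.inv₀ fun z hz =>
        pow_ne_zero _ (formsProd_ne_zero (hKU hz).1)
    obtain ⟨B, hB⟩ := hK.exists_bound_of_continuousOn hcont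
    have hrad : (ρ : ENNReal) < p.radius := hρ.trans_le hp.r_le
    have hM := (p.summable_norm_mul_pow hrad).mul_right |B|
    have := hasSum_chainIntegral (U := K) (g := q) (h := fun z => F z / formsProd x z ^ N)
      (fun d => by
        simp only [hq, div_eq_mul_inv]
        exact (MvPolynomial.continuous_eval (P d)).continuousOn.mul hcont) _ hM
      (fun d z hz => by
        simp only [hq, div_eq_mul_inv, norm_mul]
        refine mul_le_mul ?_ ((hB z hz).trans (le_abs_self B)) (norm_nonneg _) (by positivity)
        rw [hP]
        refine ((p d).le_opNorm _).trans ?_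
        simp only [Finset.prod_const, Finset.card_univ, Fintype.card_fin]
        have hz1 := (hKU hz).2
        rw [Metric.mem_ball, dist_zero_right] at hz1
        gcongr)
      (fun z hz => by
        have hz1 := (hKU hz).2
        rw [Metric.mem_ball, dist_zero_right] at hz1
        have h1 := hp.hasSum (y := z) (by
          rw [Metric.mem_eball, edist_zero_right]
          refine lt_trans ?_ hρ
          rw [enorm_eq_nnnorm]
          exact_mod_cast hz1)
        rw [zero_add] at h1
        simp only [hq, hP]
        exact h1.div_const _) hsK
    simpa only [hqs _ c hc s hs0] using this
  -- The part of degree `-n` exists only if the order of the poles is at least `n`; otherwise all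
  -- residues are `0`.
  by_cases hn : n ≤ N * Fintype.card ι
  · refine ⟨a (N * Fintype.card ι - n), fun c hc => ?_⟩
    filter_upwards [hsum c hc] with s hs
    rw [← hqc _ c hc]
    exact hs.unique (hasSum_single _ fun d hd => hq0 d (by omega) c hc)
  · refine ⟨0, fun c hc => ?_⟩
    filter_upwards [hsum c hc] with s hs
    simp only [Pi.zero_apply, zero_mul, Finset.sum_const_zero]
    refine hs.unique ?_
    have : (fun d => chainIntegral (q d) c) = fun _ => 0 := by
      funext d
      exact hq0 d (by omega) c hc
    rw [this]
    exact hasSum_zero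

/-- Functions with the same germ have the same integrals over contracted chains. -/
lemma chainIntegral_scale_congr {g h : (Fin n → ℂ) → ℂ}
    (H : (g : Germ (𝓝[arrCompl x] 0) ℂ) = h) {c : Chain n n}
    (hc : c ∈ smoothChains (arrCompl x) n) :
    ∀ᶠ s : ℝ in 𝓝[>] 0, chainIntegral g (scaleChain s c) = chainIntegral h (scaleChain s c) := by
  have h1 : {z | z ∈ arrCompl x → g z = h z} ∈ 𝓝 (0 : Fin n → ℂ) :=
    eventually_nhdsWithin_iff.1 (Germ.coe_eq.1 H)
  filter_upwards [eventually_scaleChain_mem pos_smul_mem_arrCompl h1 hc] with s hs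
  exact chainIntegral_congr (fun z hz => hz.2 hz.1) hs

/-- The residues of a meromorphic form. -/
lemma exists_residues_form (hx : IsIntegralArrangement x) (η : meroForms x) :
    ∃ a : OrdTuple x → ℂ, ∀ h : (Fin n → ℂ) → ℂ, (η : Germ (𝓝[arrCompl x] 0) ℂ) = h →
      ∀ c ∈ cycles (arrCompl x) n, ∀ᶠ s : ℝ in 𝓝[>] 0, chainIntegral h (scaleChain s c) =
        ∑ S, a S * chainIntegral (logCoeff S.forms) c := by
  obtain ⟨N, F, hF, hη⟩ := η.2
  obtain ⟨a, ha⟩ := exists_residues hx N hF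
  refine ⟨a, fun h hh c hc => ?_⟩
  filter_upwards [ha c hc, chainIntegral_scale_congr (hh.symm.trans hη)
    (Submodule.mem_inf.1 hc).1] with s h1 h2
  exact h2.trans h1

lemma analyticOnNhd_logCoeff (S : OrdTuple x) : AnalyticOnNhd ℂ (logCoeff S.forms) (arrCompl x) :=
  fun z hz => analyticAt_const.mul (Finset.analyticAt_fun_prod _ fun k _ =>
    (analyticAt_evC _ z).inv (hz (S.1 k)))

lemma chainIntegral_boundaries {U : Set (Fin n → ℂ)} (hU : IsOpen U) {h : (Fin n → ℂ) → ℂ}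
    (hh : AnalyticOnNhd ℂ h U) {c : Chain n n} (hc : c ∈ boundaries U n) : chainIntegral h c = 0 := by
  obtain ⟨a, ha, b, hb, rfl⟩ := Submodule.mem_sup.1 hc
  obtain ⟨e, he, rfl⟩ := ha
  rw [map_add, chainIntegral_boundary hU hh he, chainIntegral_degenerate h (Submodule.mem_inf.1 hb).2,
    add_zero]

/-- The pairing of a homology class with `b(S)`. -/
def logPairing (S : OrdTuple x) : Homology (arrCompl x) n →ₗ[ℤ] ℂ :=
  Submodule.liftQ _ ((LinearMap.mulLeft ℤ ((2 * Real.pi * Complex.I) ^ n)⁻¹) ∘ₗ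
    (chainIntegral (logCoeff S.forms)) ∘ₗ (cycles (arrCompl x) n).subtype) fun c hc => by
      rw [LinearMap.mem_ker]
      exact (congrArg (((2 * Real.pi * Complex.I) ^ n)⁻¹ * ·) (chainIntegral_boundaries
        isOpen_arrCompl (analyticOnNhd_logCoeff S) (Submodule.mem_comap.1 hc))).trans (mul_zero _)

lemma logPairing_apply (S : OrdTuple x) (c : cycles (arrCompl x) n) :
    logPairing S (homologyClass c) =
      ((2 * Real.pi * Complex.I) ^ n)⁻¹ * chainIntegral (logCoeff S.forms) (c : Chain n n) := rfl

lemma homologyClass_surjective {U : Set (Fin n → ℂ)} {k : ℕ} (C : Homology U k) :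
    ∃ c : cycles U k, homologyClass c = C := Submodule.Quotient.mk_surjective _ C

lemma exists_analytic_rep (η : meroForms x) : ∃ (h : (Fin n → ℂ) → ℂ) (W : Set (Fin n → ℂ)),
    (η : Germ (𝓝[arrCompl x] 0) ℂ) = h ∧ W ∈ 𝓝 0 ∧ IsOpen W ∧
      AnalyticOnNhd ℂ h (arrCompl x ∩ W) := by
  obtain ⟨N, F, hF, hη⟩ := η.2
  refine ⟨_, {z | AnalyticAt ℂ F z}, hη, (isOpen_analyticAt ℂ F).mem_nhds hF,
    isOpen_analyticAt ℂ F, fun z hz => ?_⟩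
  exact AnalyticAt.div hz.2 ((analyticOnNhd_formsProd Set.univ z trivial).pow N)
    (pow_ne_zero _ (formsProd_ne_zero hz.1))

lemma exists_rep (η : meroForms x) :
    ∃ h : (Fin n → ℂ) → ℂ, (η : Germ (𝓝[arrCompl x] 0) ℂ) = h :=
  let ⟨h, _, hh, _⟩ := exists_analytic_rep η
  ⟨h, hh⟩

/-- The coefficients of the residue of a meromorphic form. -/
def residueCoeff (hx : IsIntegralArrangement x) (η : meroForms x) : OrdTuple x → ℂ :=
  (exists_residues_form hx η).choose

/-- The pairing of a meromorphic form with homology classes. -/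
def pairingFun (hx : IsIntegralArrangement x) (η : meroForms x) :
    Homology (arrCompl x) n →ₗ[ℤ] ℂ :=
  ∑ S, (LinearMap.mulLeft ℤ (residueCoeff hx η S)) ∘ₗ logPairing S

lemma eventually_eq_pairingFun (hx : IsIntegralArrangement x) (η : meroForms x)
    {h : (Fin n → ℂ) → ℂ} (hh : (η : Germ (𝓝[arrCompl x] 0) ℂ) = h) (c : cycles (arrCompl x) n) :
    ∀ᶠ s : ℝ in 𝓝[>] 0, ((2 * Real.pi * Complex.I) ^ n)⁻¹ *
      chainIntegral h (scaleChain s (c : Chain n n)) = pairingFun hx η (homologyClass c) := by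
  filter_upwards [(exists_residues_form hx η).choose_spec h hh c c.2] with s hs
  rw [hs, pairingFun, LinearMap.sum_apply, Finset.mul_sum]
  refine Finset.sum_congr rfl fun S _ => ?_
  rw [LinearMap.comp_apply, logPairing_apply, LinearMap.mulLeft_apply, residueCoeff]
  ring

/-- The coefficients selected by `residueCoeff` need not be additive in the form. The resulting
functional is, because its values are integrals over contracted cycles. -/
lemma pairingFun_add (hx : IsIntegralArrangement x) (η θ : meroForms x) :
    pairingFun hx (η + θ) = pairingFun hx η + pairingFun hx θ := by
  refine LinearMap.ext fun C => ?_
  obtain ⟨c, rfl⟩ := homologyClass_surjective C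
  obtain ⟨h, V, hh, hV, -, hha⟩ := exists_analytic_rep η
  obtain ⟨g, W, hg, hW, -, hga⟩ := exists_analytic_rep θ
  have hadd : ((η + θ : meroForms x) : Germ (𝓝[arrCompl x] 0) ℂ) =
      ((fun z => h z + g z : (Fin n → ℂ) → ℂ) : Germ (𝓝[arrCompl x] 0) ℂ) := by
    rw [Submodule.coe_add, hh, hg]
    rfl
  have hc := (Submodule.mem_inf.1 c.2).1
  obtain ⟨s, h1, h2, h3, h4⟩ := ((eventually_eq_pairingFun hx η hh c).and
    ((eventually_eq_pairingFun hx θ hg c).and ((eventually_eq_pairingFun hx (η + θ) hadd c).and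
      (eventually_scaleChain_mem pos_smul_mem_arrCompl (Filter.inter_mem hV hW) hc)))).exists
  rw [LinearMap.add_apply, ← h1, ← h2, ← h3, chainIntegral_fun_add
    (hha.continuousOn.mono fun z hz => ⟨hz.1, hz.2.1⟩)
    (hga.continuousOn.mono fun z hz => ⟨hz.1, hz.2.2⟩) h4, mul_add]

/-- The pairing of meromorphic forms with homology classes. -/
def pairing (hx : IsIntegralArrangement x) : meroForms x →ₗ[ℤ] Homology (arrCompl x) n →ₗ[ℤ] ℂ :=
  AddMonoidHom.toIntLinearMap <| AddMonoidHom.mk' (pairingFun hx) (pairingFun_add hx)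

lemma eventually_eq_pairing (hx : IsIntegralArrangement x) (η : meroForms x)
    {h : (Fin n → ℂ) → ℂ} (hh : (η : Germ (𝓝[arrCompl x] 0) ℂ) = h) (c : cycles (arrCompl x) n) :
    ∀ᶠ s : ℝ in 𝓝[>] 0, ((2 * Real.pi * Complex.I) ^ n)⁻¹ *
      chainIntegral h (scaleChain s (c : Chain n n)) = pairing hx η (homologyClass c) :=
  eventually_eq_pairingFun hx η hh c

/-- The integrals over contracted cycles are eventually constant, so a mere limit determines the
pairing. This lets estimates as `s → 0` be used. -/
lemma pairing_eq_of_tendsto (hx : IsIntegralArrangement x) (η : meroForms x)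
    {h : (Fin n → ℂ) → ℂ} (hh : (η : Germ (𝓝[arrCompl x] 0) ℂ) = h) (c : cycles (arrCompl x) n)
    {L : ℂ} (hL : Tendsto (fun s : ℝ => ((2 * Real.pi * Complex.I) ^ n)⁻¹ *
      chainIntegral h (scaleChain s (c : Chain n n))) (𝓝[>] 0) (𝓝 L)) :
    pairing hx η (homologyClass c) = L :=
  tendsto_nhds_unique (tendsto_nhds_of_eventually_eq (eventually_eq_pairing hx η hh c)) hL

lemma pairing_eq_of_eventually (hx : IsIntegralArrangement x) (η : meroForms x)
    {h : (Fin n → ℂ) → ℂ} (hh : (η : Germ (𝓝[arrCompl x] 0) ℂ) = h) (c : cycles (arrCompl x) n)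
    {L : ℂ} (hL : ∀ᶠ s : ℝ in 𝓝[>] 0, ((2 * Real.pi * Complex.I) ^ n)⁻¹ *
      chainIntegral h (scaleChain s (c : Chain n n)) = L) :
    pairing hx η (homologyClass c) = L :=
  pairing_eq_of_tendsto hx η hh c (tendsto_nhds_of_eventually_eq hL)

lemma pairing_logForm (hx : IsIntegralArrangement x) (S : OrdTuple x)
    (C : Homology (arrCompl x) n) : pairing hx (logForm S) C = logPairing S C := by
  obtain ⟨c, rfl⟩ := homologyClass_surjective C
  refine pairing_eq_of_eventually hx _ (h := logCoeff S.forms) rfl c ?_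
  filter_upwards [self_mem_nhdsWithin] with s hs
  rw [chainIntegral_logCoeff_scale S hs, logPairing_apply]

/-- The pairing is determined by the residue. -/
lemma exists_pairing_eq_sum (hx : IsIntegralArrangement x) (η : meroForms x) :
    ∃ a : OrdTuple x → ℂ, ∀ C, pairing hx η C = ∑ S, a S * pairing hx (logForm S) C := by
  refine ⟨residueCoeff hx η, fun C => ?_⟩
  simp only [pairing_logForm]
  change pairingFun hx η C = _
  simp [pairingFun]

/-- `pairing` is constructed as a `ℤ`-bilinear map, homology being integral; complex homogeneity in
the form is recovered from the integrals. -/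
lemma pairing_smul (hx : IsIntegralArrangement x) (r : ℂ) (η : meroForms x)
    (C : Homology (arrCompl x) n) : pairing hx (r • η) C = r * pairing hx η C := by
  obtain ⟨c, rfl⟩ := homologyClass_surjective C
  obtain ⟨h, hh⟩ := exists_rep η
  refine pairing_eq_of_eventually hx _ (h := fun z => r * h z) ?_ c ?_
  · rw [Submodule.coe_smul, hh]
    rfl
  · filter_upwards [eventually_eq_pairing hx η hh c] with s hs
    rw [chainIntegral_fun_const_mul, ← hs]
    ring

lemma mul_mem_meroForms {φ ψ : Germ (𝓝[arrCompl x] (0 : Fin n → ℂ)) ℂ} (hφ : φ ∈ meroForms x)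
    (hψ : ψ ∈ meroForms x) : φ * ψ ∈ meroForms x := by
  obtain ⟨N, F, hF, rfl⟩ := hφ
  obtain ⟨M, G, hG, rfl⟩ := hψ
  refine ⟨N + M, fun z => F z * G z, hF.mul hG, ?_⟩
  rw [← Germ.coe_mul]
  congr 1
  funext z
  simp only [Pi.mul_apply, pow_add]
  rw [div_mul_div_comm]

/-- Multiplication by a meromorphic function. -/
def meroMul (γ : meroForms x) : meroForms x →ₗ[ℤ] meroForms x :=
  AddMonoidHom.toIntLinearMap <| AddMonoidHom.mk'
    (fun η => ⟨(γ : Germ (𝓝[arrCompl x] 0) ℂ) * η, mul_mem_meroForms γ.2 η.2⟩) fun η θ => by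
      ext1
      simp [mul_add]

lemma coe_meroMul (γ η : meroForms x) :
    (meroMul γ η : Germ (𝓝[arrCompl x] (0 : Fin n → ℂ)) ℂ) = γ * η := rfl

/-- The pairing of `Ωⁿ ⊗ H_n` with a meromorphic function. -/
def tensorPairing (hx : IsIntegralArrangement x) (γ : meroForms x) :
    meroForms x ⊗[ℤ] Homology (arrCompl x) n →ₗ[ℤ] ℂ :=
  TensorProduct.lift (pairing hx ∘ₗ meroMul γ)

lemma tensorPairing_tmul (hx : IsIntegralArrangement x) (γ η : meroForms x)
    (C : Homology (arrCompl x) n) :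
    tensorPairing hx γ (η ⊗ₜ C) = pairing hx (meroMul γ η) C := rfl

lemma exists_sum_tmul_homologyClass {M : Type*} [AddCommGroup M]
    (D : M ⊗[ℤ] Homology (arrCompl x) n) :
    ∃ (m : ℕ) (η : Fin m → M) (c : Fin m → cycles (arrCompl x) n),
      D = ∑ i, η i ⊗ₜ[ℤ] homologyClass (c i) := by
  induction D using TensorProduct.induction_on with
  | zero => exact ⟨0, Fin.elim0, Fin.elim0, by simp⟩
  | tmul η C =>
    obtain ⟨c, rfl⟩ := homologyClass_surjective C
    exact ⟨1, fun _ => η, fun _ => c, by simp⟩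
  | add D E hD hE =>
    obtain ⟨m, η, c, rfl⟩ := hD
    obtain ⟨k, θ, e, rfl⟩ := hE
    exact ⟨m + k, Fin.append η θ, Fin.append c e, by simp [Fin.sum_univ_add]⟩

/-- `HasPairing` speaks of all presentations of `D` by forms and cycles. For each of them the
integrals eventually equal the value of one linear map on `D`; conversely a presentation exists,
which pins down `v`. -/
theorem hasPairing_iff (hx : IsIntegralArrangement x)
    {D : meroForms x ⊗[ℤ] Homology (arrCompl x) n} {g : (Fin n → ℂ) → ℂ} {γ : meroForms x}
    (hγ : (γ : Germ (𝓝[arrCompl x] (0 : Fin n → ℂ)) ℂ) = g) {v : ℂ} :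
    HasPairing x D g v ↔ tensorPairing hx γ D = v := by
  have key : ∀ (m : ℕ) (η : Fin m → meroForms x) (h : Fin m → (Fin n → ℂ) → ℂ)
      (c : Fin m → cycles (arrCompl x) n),
      (∀ i, (η i : Germ (𝓝[arrCompl x] 0) ℂ) = ↑(h i)) →
      D = ∑ i, η i ⊗ₜ[ℤ] homologyClass (c i) →
      ∀ᶠ s : ℝ in 𝓝[>] 0, ((2 * Real.pi * Complex.I) ^ n)⁻¹ *
        ∑ i, chainIntegral (fun z => g z * h i z) (scaleChain s (c i : Chain n n)) =
          tensorPairing hx γ D := by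
    intro m η h c hh hD
    have h1 : ∀ᶠ s : ℝ in 𝓝[>] 0, ∀ i, ((2 * Real.pi * Complex.I) ^ n)⁻¹ *
        chainIntegral (fun z => g z * h i z) (scaleChain s (c i : Chain n n)) =
          pairing hx (meroMul γ (η i)) (homologyClass (c i)) :=
      eventually_all.2 fun i => eventually_eq_pairing hx _ (by
        rw [coe_meroMul, hγ, hh i]
        rfl) (c i)
    filter_upwards [h1] with s hs
    rw [Finset.mul_sum, Finset.sum_congr rfl fun i _ => hs i, hD, map_sum]
    rfl
  constructor
  · intro H
    obtain ⟨m, η, c, hD⟩ := exists_sum_tmul_homologyClass D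
    choose h hh using fun i => exists_rep (η i)
    obtain ⟨s, h1, h2⟩ := ((key m η h c hh hD).and (H m η h c hh hD)).exists
    exact h1.symm.trans h2
  · rintro rfl
    exact key

end Pairing

/-! ### Tori in general position and their classes. -/

section Torus

open MeasureTheory

variable {n : ℕ} {ι : Type*} [Fintype ι] {x : ι → Fin n → ℤ}

/-- The point with polar coordinates `ρ`, `2πu`. -/
def polar (ρ u : Fin n → ℝ) : Fin n → ℂ := fun k =>
  (ρ k : ℂ) * Complex.exp (2 * Real.pi * Complex.I * (u k : ℂ))

lemma norm_polar (ρ u : Fin n → ℝ) (k : Fin n) : ‖polar ρ u k‖ = |ρ k| := by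
  have h3 : (2 * Real.pi * Complex.I * ((u k : ℝ) : ℂ)) =
      ((2 * Real.pi * (u k : ℝ) : ℝ) : ℂ) * Complex.I := by push_cast; ring
  rw [polar, norm_mul, h3, Complex.norm_exp_ofReal_mul_I, mul_one, Complex.norm_real,
    Real.norm_eq_abs]

lemma polar_smul (s : ℝ) (ρ u : Fin n → ℝ) : polar (s • ρ) u = (s : ℂ) • polar ρ u := by
  funext k
  simp [polar, mul_assoc]

/-- The torus `|xₖ| = ρₖ`, `k = 1, …, n`. -/
def radTorus (S : OrdTuple x) (ρ : Fin n → ℝ) : Cube n n := fun u =>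
  (formsMatrix S.forms)⁻¹.mulVec (polar ρ fun k => (u k : ℝ))

lemma radTorus_scale (S : OrdTuple x) (ρ : Fin n → ℝ) (s : ℝ) :
    (radTorus S ρ).scale s = radTorus S (s • ρ) := by
  funext u
  rw [Cube.scale, radTorus, radTorus, polar_smul, Matrix.mulVec_smul]

/-- The coefficients of the form `y` in the basis given by `S`. -/
def formCoeffs (S : OrdTuple x) (y : Fin n → ℤ) : Fin n → ℂ :=
  Matrix.vecMul (fun l => (y l : ℂ)) (formsMatrix S.forms)⁻¹

lemma evC_mulVec_inv (S : OrdTuple x) (y : Fin n → ℤ) (w : Fin n → ℂ) :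
    evC y ((formsMatrix S.forms)⁻¹.mulVec w) = ∑ k, formCoeffs S y k * w k := by
  change (fun l => (y l : ℂ)) ⬝ᵥ ((formsMatrix S.forms)⁻¹.mulVec w) = formCoeffs S y ⬝ᵥ w
  rw [Matrix.dotProduct_mulVec]
  rfl

lemma evC_eq_sum_formCoeffs (S : OrdTuple x) (y : Fin n → ℤ) (z : Fin n → ℂ) :
    evC y z = ∑ k, formCoeffs S y k * evC (x (S.1 k)) z := by
  have h : (formsMatrix S.forms)⁻¹.mulVec ((formsMatrix S.forms).mulVec z) = z := by
    rw [Matrix.mulVec_mulVec, Matrix.nonsing_inv_mul _ (isUnit_det_formsMatrix S),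
      Matrix.one_mulVec]
  conv_lhs => rw [← h]
  rw [evC_mulVec_inv]
  rfl

lemma formCoeffs_ne_zero (S : OrdTuple x) {y : Fin n → ℤ} (hy : y ≠ 0) : formCoeffs S y ≠ 0 := by
  intro h
  have h1 : Matrix.vecMul (formCoeffs S y) (formsMatrix S.forms) = fun l => (y l : ℂ) := by
    rw [formCoeffs, Matrix.vecMul_vecMul, Matrix.nonsing_inv_mul _ (isUnit_det_formsMatrix S),
      Matrix.vecMul_one]
  rw [h, Matrix.zero_vecMul] at h1
  apply hy
  funext l
  have h2 := congrFun h1 l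
  simpa using h2.symm

/-- In the linear form with coefficients `a`, the last variable dominates when `|wₖ| = ρₖ`. -/
def Dominates (a : Fin n → ℂ) (ρ : Fin n → ℝ) : Prop :=
  ∃ K, (∀ k, K < k → a k = 0) ∧ ∑ k ∈ Finset.Iio K, ‖a k‖ * ρ k < ‖a K‖ * ρ K

/-- Only the absolute values of the `w k` enter, so this bounds a form from below uniformly over a
whole torus. -/
lemma Dominates.lower_bound {a : Fin n → ℂ} {ρ : Fin n → ℝ} {K : Fin n}
    (hK : ∀ k, K < k → a k = 0) {w : Fin n → ℂ} (hw : ∀ k, ‖w k‖ = ρ k) :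
    ‖a K‖ * ρ K - ∑ k ∈ Finset.Iio K, ‖a k‖ * ρ k ≤ ‖∑ k, a k * w k‖ := by
  have h1 : ∑ k, a k * w k = a K * w K + ∑ k ∈ Finset.Iio K, a k * w k := by
    rw [← Finset.add_sum_erase _ _ (Finset.mem_univ K)]
    congr 1
    symm
    refine Finset.sum_subset (fun k hk => Finset.mem_erase.2
      ⟨(Finset.mem_Iio.1 hk).ne, Finset.mem_univ _⟩) fun k hk hk' => ?_
    have h2 := Finset.ne_of_mem_erase hk
    rw [hK k (lt_of_le_of_ne (not_lt.1 fun h => hk' (Finset.mem_Iio.2 h)) h2.symm), zero_mul]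
  have h2 : ‖∑ k ∈ Finset.Iio K, a k * w k‖ ≤ ∑ k ∈ Finset.Iio K, ‖a k‖ * ρ k :=
    (norm_sum_le _ _).trans (le_of_eq (Finset.sum_congr rfl fun k _ => by rw [norm_mul, hw]))
  rw [h1]
  have h3 := norm_sub_norm_le (a K * w K) (-∑ k ∈ Finset.Iio K, a k * w k)
  rw [sub_neg_eq_add, norm_neg, norm_mul, hw] at h3
  linarith

lemma Dominates.ne_zero {a : Fin n → ℂ} {ρ : Fin n → ℝ} (h : Dominates a ρ) {w : Fin n → ℂ}
    (hw : ∀ k, ‖w k‖ = ρ k) : ∑ k, a k * w k ≠ 0 := by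
  obtain ⟨K, hK, hlt⟩ := h
  have := Dominates.lower_bound hK hw
  intro h0
  rw [h0, norm_zero] at this
  linarith

/-- Together with the vanishing of the later coefficients this identifies the index in `Dominates`
as that of the last nonzero coefficient, independently of the radii. -/
lemma Dominates.unique {a : Fin n → ℂ} {ρ : Fin n → ℝ} (hρ : ∀ k, 0 < ρ k) {K : Fin n}
    (hlt : ∑ k ∈ Finset.Iio K, ‖a k‖ * ρ k < ‖a K‖ * ρ K) : a K ≠ 0 := by
  intro h
  rw [h, norm_zero, zero_mul] at hlt
  exact absurd hlt (not_lt.2 (Finset.sum_nonneg fun k _ => mul_nonneg (norm_nonneg _) (hρ k).le))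

/-- The radii for which the torus is in general position: in each form of the arrangement the last
variable dominates. -/
def torusDomain (S : OrdTuple x) : Set (Fin n → ℝ) :=
  {ρ | (∀ k, 0 < ρ k) ∧ ∀ i, Dominates (formCoeffs S (x i)) ρ}

/-- The dominating index of a form is the same for all admissible radii, and for a fixed index
domination is a strict linear inequality in the radii. -/
lemma convex_torusDomain (S : OrdTuple x) : Convex ℝ (torusDomain S) := by
  intro ρ hρ σ hσ a b ha hb hab
  have hpos : ∀ k, 0 < (a • ρ + b • σ) k := by
    intro k
    have h1 := hρ.1 k
    have h2 := hσ.1 k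
    simp only [Pi.add_apply, Pi.smul_apply, smul_eq_mul]
    rcases ha.eq_or_lt with rfl | ha
    · rw [zero_add] at hab
      rw [hab]
      linarith
    · nlinarith [mul_pos ha h1, mul_nonneg hb h2.le]
  refine ⟨hpos, fun i => ?_⟩
  obtain ⟨K, hK, h1⟩ := hρ.2 i
  obtain ⟨L, hL, h2⟩ := hσ.2 i
  have hKL : K = L := by
    have h3 := Dominates.unique hρ.1 h1
    have h4 := Dominates.unique hσ.1 h2
    rcases lt_trichotomy K L with h | h | h
    · exact absurd (hK L h) h4
    · exact h
    · exact absurd (hL K h) h3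
  subst hKL
  refine ⟨K, hK, ?_⟩
  have h3 : ∑ k ∈ Finset.Iio K, ‖formCoeffs S (x i) k‖ * (a • ρ + b • σ) k =
      a * ∑ k ∈ Finset.Iio K, ‖formCoeffs S (x i) k‖ * ρ k +
      b * ∑ k ∈ Finset.Iio K, ‖formCoeffs S (x i) k‖ * σ k := by
    rw [Finset.mul_sum, Finset.mul_sum, ← Finset.sum_add_distrib]
    refine Finset.sum_congr rfl fun k _ => ?_
    simp only [Pi.add_apply, Pi.smul_apply, smul_eq_mul]
    ring
  rw [h3]
  simp only [Pi.add_apply, Pi.smul_apply, smul_eq_mul]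
  rcases ha.eq_or_lt with rfl | ha
  · rw [zero_add] at hab
    rw [hab]
    linarith
  · nlinarith [mul_lt_mul_of_pos_left h1 ha, mul_le_mul_of_nonneg_left h2.le hb]

lemma smul_mem_torusDomain (S : OrdTuple x) {ρ : Fin n → ℝ} (hρ : ρ ∈ torusDomain S) {s : ℝ}
    (hs : 0 < s) : s • ρ ∈ torusDomain S := by
  refine ⟨fun k => mul_pos hs (hρ.1 k), fun i => ?_⟩
  obtain ⟨K, hK, h1⟩ := hρ.2 i
  refine ⟨K, hK, ?_⟩
  have h3 : ∑ k ∈ Finset.Iio K, ‖formCoeffs S (x i) k‖ * (s • ρ) k =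
      s * ∑ k ∈ Finset.Iio K, ‖formCoeffs S (x i) k‖ * ρ k := by
    rw [Finset.mul_sum]
    refine Finset.sum_congr rfl fun k _ => ?_
    simp only [Pi.smul_apply, smul_eq_mul]
    ring
  rw [h3]
  simp only [Pi.smul_apply, smul_eq_mul]
  nlinarith [mul_lt_mul_of_pos_left h1 hs]

lemma exists_last_ne_zero {a : Fin n → ℂ} (ha : a ≠ 0) : ∃ K, a K ≠ 0 ∧ ∀ k, K < k → a k = 0 := by
  classical
  obtain ⟨k₀, hk₀⟩ := Function.ne_iff.1 ha
  obtain ⟨K, hK, hmax⟩ := (Finset.univ.filter fun k => a k ≠ 0).exists_max_image id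
    ⟨k₀, by simpa using hk₀⟩
  refine ⟨K, by simpa using hK, fun k hk => ?_⟩
  by_contra hne
  exact absurd (hmax k (by simpa using hne)) (not_le.2 hk)

/-- Every radius before the place `K` of the last nonzero coefficient is at most `δ` times the
radius at `K`, so this coefficient wins as soon as `δ * B < ‖a K‖`. -/
lemma eventually_dominates_pow {a : Fin n → ℂ} (ha : a ≠ 0) :
    ∀ᶠ δ : ℝ in 𝓝[>] 0, Dominates a fun k => δ ^ (n - 1 - (k : ℕ)) := by
  obtain ⟨K, hK, hmax⟩ := exists_last_ne_zero ha
  set B : ℝ := ∑ k ∈ Finset.Iio K, ‖a k‖ with hB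
  have hlim : Tendsto (fun δ : ℝ => δ * B) (𝓝[>] 0) (𝓝 0) := by
    have : Tendsto (fun δ : ℝ => δ * B) (𝓝 0) (𝓝 (0 * B)) := tendsto_id.mul_const B
    rw [zero_mul] at this
    exact this.mono_left nhdsWithin_le_nhds
  filter_upwards [hlim.eventually_lt_const (norm_pos_iff.2 hK),
    (eventually_le_nhds (zero_lt_one' ℝ)).filter_mono nhdsWithin_le_nhds,
    self_mem_nhdsWithin] with δ hδB hδ1 hδ0
  have hδ0 : 0 < δ := hδ0
  refine ⟨K, hmax, ?_⟩
  calc ∑ k ∈ Finset.Iio K, ‖a k‖ * δ ^ (n - 1 - (k : ℕ))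
      ≤ ∑ k ∈ Finset.Iio K, ‖a k‖ * (δ * δ ^ (n - 1 - (K : ℕ))) := by
        refine Finset.sum_le_sum fun k hk => ?_
        have hkK : (k : ℕ) < (K : ℕ) := Fin.lt_def.1 (Finset.mem_Iio.1 hk)
        have hKn := K.2
        gcongr
        rw [← pow_succ']
        exact pow_le_pow_of_le_one hδ0.le hδ1 (by omega)
    _ = (δ * B) * δ ^ (n - 1 - (K : ℕ)) := by
        rw [← Finset.sum_mul, hB]; ring
    _ < ‖a K‖ * δ ^ (n - 1 - (K : ℕ)) := by gcongr

lemma eventually_pow_mem_torusDomain (hx : IsIntegralArrangement x) (S : OrdTuple x) :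
    ∀ᶠ δ : ℝ in 𝓝[>] 0, (fun k : Fin n => δ ^ (n - 1 - (k : ℕ))) ∈ torusDomain S := by
  have h : ∀ᶠ δ : ℝ in 𝓝[>] 0, ∀ i, Dominates (formCoeffs S (x i)) fun k => δ ^ (n - 1 - (k : ℕ)) :=
    eventually_all.2 fun i => eventually_dominates_pow (formCoeffs_ne_zero S (hx.ne_zero i))
  filter_upwards [h, self_mem_nhdsWithin] with δ hδ hδ0
  exact ⟨fun k => pow_pos hδ0 _, hδ⟩

lemma radTorus_mem_arrCompl (S : OrdTuple x) {ρ : Fin n → ℝ} (hρ : ρ ∈ torusDomain S)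
    (u : Fin n → unitInterval) : radTorus S ρ u ∈ arrCompl x := fun i => by
  rw [radTorus, evC_mulVec_inv]
  exact (hρ.2 i).ne_zero fun k => by rw [norm_polar, abs_of_pos (hρ.1 k)]

/-! ### Deformation of tori -/

lemma contDiff_polar {E : Type*} [NormedAddCommGroup E] [NormedSpace ℝ E] {r v : E → Fin n → ℝ}
    (hr : ContDiff ℝ (⊤ : ℕ∞) r) (hv : ContDiff ℝ (⊤ : ℕ∞) v) :
    ContDiff ℝ (⊤ : ℕ∞) fun e => polar (r e) (v e) := by
  rw [contDiff_pi]
  intro k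
  refine ContDiff.mul ?_ (ContDiff.cexp (contDiff_const.mul ?_))
  · exact Complex.ofRealCLM.contDiff.comp (contDiff_pi.1 hr k)
  · exact Complex.ofRealCLM.contDiff.comp (contDiff_pi.1 hv k)

lemma contDiff_mulVec {E : Type*} [NormedAddCommGroup E] [NormedSpace ℝ E]
    (M : Matrix (Fin n) (Fin n) ℂ) {w : E → Fin n → ℂ} (hw : ContDiff ℝ (⊤ : ℕ∞) w) :
    ContDiff ℝ (⊤ : ℕ∞) fun e => M.mulVec (w e) := by
  rw [contDiff_pi]
  intro l
  simp only [Matrix.mulVec, dotProduct]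
  exact ContDiff.sum fun k _ => contDiff_const.mul (contDiff_pi.1 hw k)

/-- The deformation of tori along the path of radii `r`. -/
def torusHomotopy (S : OrdTuple x) (r : ℝ → Fin n → ℝ) : Cube n (n + 1) := fun u =>
  radTorus S (r (u 0)) (Fin.tail u)

lemma contDiffOn_torusHomotopy (S : OrdTuple x) {r : ℝ → Fin n → ℝ} (hr : ContDiff ℝ (⊤ : ℕ∞) r) :
    ContDiffOn ℝ (⊤ : ℕ∞) (torusHomotopy S r).ext (Icc 0 1) := by
  have h : ContDiff ℝ (⊤ : ℕ∞) fun v : Fin (n + 1) → ℝ =>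
      (formsMatrix S.forms)⁻¹.mulVec (polar (r (v 0)) fun k => v k.succ) :=
    contDiff_mulVec _ (contDiff_polar (hr.comp (contDiff_apply ℝ ℝ 0))
      (contDiff_pi.2 fun k => contDiff_apply ℝ ℝ k.succ))
  refine h.contDiffOn.congr fun v hv => ?_
  simp only [Cube.ext, torusHomotopy, radTorus, Fin.tail]
  rw [projIcc_of_mem zero_le_one ⟨hv.1 0, hv.2 0⟩]
  congr 2
  funext k
  rw [projIcc_of_mem zero_le_one ⟨hv.1 k.succ, hv.2 k.succ⟩]

lemma torusHomotopy_mem {O : Set (Fin n → ℂ)} (S : OrdTuple x) {r : ℝ → Fin n → ℝ}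
    (hr : ContDiff ℝ (⊤ : ℕ∞) r) (hO : ∀ τ ∈ Icc (0 : ℝ) 1, ∀ u, radTorus S (r τ) u ∈ O) :
    Finsupp.single (torusHomotopy S r) (1 : ℤ) ∈ smoothChains O (n + 1) :=
  Submodule.subset_span ⟨_, contDiffOn_torusHomotopy S hr, fun u => hO _ (u 0).2 _, rfl⟩

lemma radTorus_congr (S : OrdTuple x) (ρ : Fin n → ℝ) {u v : Fin n → unitInterval}
    (h : ∀ k, Complex.exp (2 * Real.pi * Complex.I * ((u k : ℝ) : ℂ)) =
      Complex.exp (2 * Real.pi * Complex.I * ((v k : ℝ) : ℂ))) :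
    radTorus S ρ u = radTorus S ρ v := by
  simp only [radTorus]
  congr 1
  funext k
  simp only [polar, h k]

/-- Opposite faces in the angular directions agree by periodicity and cancel; the two ends of the
deformation remain. -/
lemma boundary_torusHomotopy (S : OrdTuple x) (r : ℝ → Fin n → ℝ) :
    boundary n (n + 1) (Finsupp.single (torusHomotopy S r) 1) =
      Finsupp.single (radTorus S (r 1)) 1 - Finsupp.single (radTorus S (r 0)) 1 := by
  rw [boundary_succ_single, Fin.sum_univ_succ, Finset.sum_eq_zero, add_zero]
  · have h : ∀ e : unitInterval, (torusHomotopy S r).face 0 e = radTorus S (r e) := by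
      intro e
      funext u
      simp [Cube.face, torusHomotopy]
    rw [h, h]
    simp
  · intro i _
    have : (torusHomotopy S r).face i.succ 1 = (torusHomotopy S r).face i.succ 0 := by
      funext u
      simp only [Cube.face, torusHomotopy]
      have h0 : ∀ e : unitInterval, (i.succ.insertNth (α := fun _ => unitInterval) e u :
          Fin (n + 1) → unitInterval) 0 = (i.succ.insertNth (α := fun _ => unitInterval) 0 u :
          Fin (n + 1) → unitInterval) 0 := by
        intro e
        rcases Fin.eq_self_or_eq_succAbove i.succ 0 with h | ⟨j, h⟩
        · exact absurd h (Fin.succ_ne_zero i).symm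
        · rw [h]; simp
      rw [h0 1]
      refine radTorus_congr S _ fun k => ?_
      simp only [Fin.tail]
      rcases Fin.eq_self_or_eq_succAbove i.succ k.succ with h | ⟨j, h⟩
      · rw [h]; simp [Complex.exp_two_pi_mul_I]
      · rw [h]; simp
    rw [this, sub_self, smul_zero]

/-- Tori deformed in the domain of holomorphy have the same integral. -/
lemma cubeIntegral_radTorus_eq {O : Set (Fin n → ℂ)} (hO : IsOpen O) {h : (Fin n → ℂ) → ℂ}
    (hh : AnalyticOnNhd ℂ h O) (S : OrdTuple x) {r : ℝ → Fin n → ℝ} (hr : ContDiff ℝ (⊤ : ℕ∞) r)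
    (hrO : ∀ τ ∈ Icc (0 : ℝ) 1, ∀ u, radTorus S (r τ) u ∈ O) :
    cubeIntegral h (radTorus S (r 1)) = cubeIntegral h (radTorus S (r 0)) := by
  have h1 := chainIntegral_boundary hO hh (torusHomotopy_mem S hr hrO)
  rw [boundary_torusHomotopy, map_sub, chainIntegral_single, chainIntegral_single] at h1
  exact sub_eq_zero.1 h1

lemma radTorus_mem_cycles {O : Set (Fin n → ℂ)} (S : OrdTuple x) {ρ : Fin n → ℝ}
    (h : ∀ u, radTorus S ρ u ∈ O) : Finsupp.single (radTorus S ρ) (1 : ℤ) ∈ cycles O n := by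
  refine Submodule.mem_inf.2 ⟨Submodule.subset_span ⟨_, ?_, h, rfl⟩, ?_⟩
  · have h1 : ContDiff ℝ (⊤ : ℕ∞) fun v : Fin n → ℝ =>
        (formsMatrix S.forms)⁻¹.mulVec (polar ρ v) :=
      contDiff_mulVec _ (contDiff_polar contDiff_const contDiff_id)
    refine h1.contDiffOn.congr fun v hv => ?_
    simp only [Cube.ext, radTorus]
    congr 2
    funext k
    rw [projIcc_of_mem zero_le_one ⟨hv.1 k, hv.2 k⟩]
  · rw [Submodule.mem_comap]
    suffices hb : boundary n n (Finsupp.single (radTorus S ρ) (1 : ℤ)) = 0 by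
      rw [hb]; exact Submodule.zero_mem _
    cases n with
    | zero => rfl
    | succ m =>
      rw [boundary_succ_single]
      refine Finset.sum_eq_zero fun i _ => ?_
      have : (radTorus S ρ).face i 1 = (radTorus S ρ).face i 0 := by
        funext u
        refine radTorus_congr S _ fun k => ?_
        rcases Fin.eq_self_or_eq_succAbove i k with rfl | ⟨j, rfl⟩
        · simp [Complex.exp_two_pi_mul_I]
        · simp
      rw [this, sub_self, smul_zero]

lemma homologyClass_radTorus_eq (S : OrdTuple x) {r : ℝ → Fin n → ℝ} (hr : ContDiff ℝ (⊤ : ℕ∞) r)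
    (hrO : ∀ τ ∈ Icc (0 : ℝ) 1, ∀ u, radTorus S (r τ) u ∈ arrCompl x)
    (c c' : cycles (arrCompl x) n) (hc : (c : Chain n n) = Finsupp.single (radTorus S (r 0)) 1)
    (hc' : (c' : Chain n n) = Finsupp.single (radTorus S (r 1)) 1) :
    homologyClass c' = homologyClass c := by
  refine (Submodule.Quotient.eq _).2 ?_
  rw [Submodule.mem_comap]
  refine Submodule.mem_sup_left ⟨_, torusHomotopy_mem S hr hrO, ?_⟩
  rw [boundary_torusHomotopy, ← hc, ← hc']
  rfl

lemma contDiff_lineMap (ρ σ : Fin n → ℝ) :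
    ContDiff ℝ (⊤ : ℕ∞) fun τ : ℝ => AffineMap.lineMap (k := ℝ) ρ σ τ := by
  simp only [AffineMap.lineMap_apply_module']
  fun_prop

/-- The class `Z(S)` is represented by any torus in general position. -/
lemma torusClass_eq (hx : IsIntegralArrangement x) (S : OrdTuple x) {ρ : Fin n → ℝ}
    (hρ : ρ ∈ torusDomain S) :
    torusClass hx S = homologyClass ⟨_, radTorus_mem_cycles S (radTorus_mem_arrCompl S hρ)⟩ := by
  set δ₀ := (exists_torus_radius hx S).choose with hδ₀
  obtain ⟨hpos, hsmall⟩ := (exists_torus_radius hx S).choose_spec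
  obtain ⟨δ, hδD, hδle, hδ0⟩ := ((eventually_pow_mem_torusDomain hx S).and
    (((eventually_le_nhds hpos).filter_mono nhdsWithin_le_nhds).and self_mem_nhdsWithin)).exists
  have hδ0 : 0 < δ := hδ0
  -- The radii used to define `Z(S)` avoid the hyperplanes but need not lie in `torusDomain`.
  -- Decreasing `δ` keeps the torus in the complement and leads into `torusDomain`, where convexity
  -- allows a straight path to `ρ`.
  have h1 : torusClass hx S =
      homologyClass ⟨_, radTorus_mem_cycles S (radTorus_mem_arrCompl S hδD)⟩ := by
    refine homologyClass_radTorus_eq S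
      (r := fun τ k => (δ + τ * (δ₀ - δ)) ^ (n - 1 - (k : ℕ))) ?_ ?_ _ _ ?_ ?_
    · exact contDiff_pi.2 fun k => ContDiff.pow (by fun_prop) _
    · intro τ hτ u
      have h2 : 0 < δ + τ * (δ₀ - δ) := by nlinarith [hτ.1, hτ.2]
      have h3 : δ + τ * (δ₀ - δ) ≤ δ₀ := by nlinarith [hτ.1, hτ.2]
      exact hsmall _ h2 h3 u
    · simp
    · simp only [one_mul, add_sub_cancel]
      rfl
  rw [h1]
  refine homologyClass_radTorus_eq S
    (r := fun τ => AffineMap.lineMap ρ (fun k : Fin n => δ ^ (n - 1 - (k : ℕ))) τ)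
    (contDiff_lineMap ρ _) (fun τ hτ u => ?_) _ _ ?_ ?_
  · refine radTorus_mem_arrCompl S ?_ u
    exact (convex_torusDomain S).segment_subset hρ hδD (lineMap_mem_segment ℝ _ _ hτ)
  · simp
  · simp

/-! ### Torus integrals as averages -/

/-- The average of `g` over the torus `|wₖ| = ρₖ`. -/
def torusAvg (g : (Fin n → ℂ) → ℂ) (ρ : Fin n → ℝ) : ℂ :=
  ∫ u in Icc (0 : Fin n → ℝ) 1, g (polar ρ u)

/-- In the coordinates `w` given by `S` one has `dz = det⁻¹ dw`, and on the torus `dwₖ = 2π√-1 wₖ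
duₖ`; the powers of `2π√-1` cancel. -/
lemma cubeIntegral_radTorus (S : OrdTuple x) (ρ : Fin n → ℝ) (h : (Fin n → ℂ) → ℂ) :
    ((2 * Real.pi * Complex.I) ^ n)⁻¹ * cubeIntegral h (radTorus S ρ) =
      (formsDet S.forms : ℂ)⁻¹ *
        torusAvg (fun w => h ((formsMatrix S.forms)⁻¹.mulVec w) * ∏ k, w k) ρ := by
  have hpi : ((2 * Real.pi * Complex.I) ^ n : ℂ) ≠ 0 := pow_ne_zero _ Complex.two_pi_I_ne_zero
  rw [inv_mul_eq_iff_eq_mul₀ hpi, torusAvg, ← mul_assoc, ← integral_const_mul]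
  refine integral_congr_ae ?_
  filter_upwards [ae_mem_interior_unitBox] with u hu
  set f : (Fin n → ℝ) → Fin n → ℂ := fun v => (formsMatrix S.forms)⁻¹.mulVec (polar ρ v) with hf
  have hext : (radTorus S ρ).ext =ᶠ[𝓝 u] f := by
    filter_upwards [isOpen_interior.mem_nhds hu] with v hv
    have hv := interior_subset hv
    simp only [Cube.ext, radTorus, hf]
    congr 2
    funext k
    rw [projIcc_of_mem zero_le_one ⟨hv.1 k, hv.2 k⟩]
  rw [hext.fderiv_eq, hext.self_of_nhds]
  have hpol : ∀ k, HasFDerivAt (fun v => polar ρ v k)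
      (((2 * Real.pi * Complex.I) * polar ρ u k) •
        (Complex.ofRealCLM.comp (ContinuousLinearMap.proj (R := ℝ) (φ := fun _ : Fin n => ℝ) k))) u := by
    intro k
    have h1 : HasFDerivAt (fun v : Fin n → ℝ => ((v k : ℝ) : ℂ))
        (Complex.ofRealCLM.comp (ContinuousLinearMap.proj (R := ℝ) (φ := fun _ : Fin n => ℝ) k)) u :=
      (Complex.ofRealCLM.comp (ContinuousLinearMap.proj (R := ℝ) (φ := fun _ : Fin n => ℝ) k)).hasFDerivAt
    have h2 := ((h1.const_mul (2 * Real.pi * Complex.I)).cexp).const_mul (ρ k : ℂ)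
    refine h2.congr_fderiv ?_
    ext v
    simp [polar]
    ring
  have hfd : ∀ i j, fderiv ℝ f u (Pi.single j 1) i =
      (formsMatrix S.forms)⁻¹ i j * ((2 * Real.pi * Complex.I) * polar ρ u j) := by
    intro i j
    have h1 : HasFDerivAt (fun v => f v i) (∑ k, (formsMatrix S.forms)⁻¹ i k •
        (((2 * Real.pi * Complex.I) * polar ρ u k) •
        (Complex.ofRealCLM.comp (ContinuousLinearMap.proj (R := ℝ) (φ := fun _ : Fin n => ℝ) k)))) u :=
      HasFDerivAt.fun_sum (u := Finset.univ) fun k _ =>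
        (hpol k).const_mul ((formsMatrix S.forms)⁻¹ i k)
    have h2 : DifferentiableAt ℝ f u := differentiableAt_pi.2 fun i =>
      (HasFDerivAt.fun_sum (u := Finset.univ) fun k _ =>
        (hpol k).const_mul ((formsMatrix S.forms)⁻¹ i k)).differentiableAt
    have h3 := (hasFDerivAt_pi'.1 h2.hasFDerivAt i).unique h1
    have h4 := congrArg (fun L => L (Pi.single j (1 : ℝ))) h3
    simp only [ContinuousLinearMap.comp_apply, ContinuousLinearMap.proj_apply] at h4
    rw [h4, sum_apply, Finset.sum_eq_single j]
    · simp
    · intro k _ hk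
      simp [Pi.single_eq_of_ne hk]
    · simp
  have hmat : (Matrix.of fun i j => fderiv ℝ f u (Pi.single j 1) i) =
      (formsMatrix S.forms)⁻¹ *
        Matrix.diagonal fun j => (2 * Real.pi * Complex.I) * polar ρ u j := by
    ext i j
    rw [Matrix.of_apply, hfd, Matrix.mul_diagonal]
  rw [hmat, Matrix.det_mul, Matrix.det_diagonal, Matrix.det_nonsing_inv, Ring.inverse_eq_inv',
    det_formsMatrix, Finset.prod_mul_distrib, Finset.prod_const, Finset.card_univ, Fintype.card_fin]
  ring

/-- The pairing with `Z(S)` is an integral over any small torus in general position. -/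
theorem pairing_torusClass (hx : IsIntegralArrangement x) (η : meroForms x)
    {h : (Fin n → ℂ) → ℂ} (hh : (η : Germ (𝓝[arrCompl x] 0) ℂ) = h) {W : Set (Fin n → ℂ)}
    (hW : IsOpen W) (hha : AnalyticOnNhd ℂ h (arrCompl x ∩ W)) (S : OrdTuple x) {ρ : Fin n → ℝ}
    (hρ : ρ ∈ torusDomain S) (hρW : ∀ s ∈ Ioc (0 : ℝ) 1, ∀ u, (s : ℂ) • radTorus S ρ u ∈ W) :
    pairing hx η (torusClass hx S) = (formsDet S.forms : ℂ)⁻¹ *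
        torusAvg (fun w => h ((formsMatrix S.forms)⁻¹.mulVec w) * ∏ k, w k) ρ := by
  rw [torusClass_eq hx S hρ, ← cubeIntegral_radTorus]
  refine pairing_eq_of_eventually hx η hh _ ?_
  have h1 : ∀ᶠ s : ℝ in 𝓝[>] 0, s ≤ 1 :=
    (eventually_le_nhds (zero_lt_one' ℝ)).filter_mono nhdsWithin_le_nhds
  filter_upwards [h1, self_mem_nhdsWithin] with s hs1 hs0
  have hs0 : 0 < s := hs0
  rw [scaleChain_single, chainIntegral_single, radTorus_scale]
  congr 1
  -- The contraction of the torus from scale `1` to scale `s` stays where `h` is holomorphic, so the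
  -- integral over the given torus is already the eventual value.
  have hr : ContDiff ℝ (⊤ : ℕ∞) fun τ : ℝ => (1 + τ * (s - 1)) • ρ := by fun_prop
  have h2 := cubeIntegral_radTorus_eq (isOpen_arrCompl.inter hW) hha S hr (fun τ hτ u => ?_)
  · simpa using h2
  · have h3 : 0 < 1 + τ * (s - 1) := by nlinarith [hτ.1, hτ.2]
    have h4 : 1 + τ * (s - 1) ≤ 1 := by nlinarith [hτ.1, hτ.2]
    refine ⟨radTorus_mem_arrCompl S (smul_mem_torusDomain S hρ h3) u, ?_⟩
    rw [← radTorus_scale]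
    exact hρW _ ⟨h3, h4⟩ u

end Torus

/-! ### Tuples without broken circuits and their dual tori. -/

section DualBasis

variable {n : ℕ} {ι : Type*} [Fintype ι] {x : ι → Fin n → ℤ}

/-- The ordered tuple with the given indices, if the determinant of its forms does not vanish. -/
def OrdTuple.ofDet (T : Fin n → ι) (h : formsDet (fun k => x (T k)) ≠ 0) : OrdTuple x :=
  ⟨T, by
    have h1 : (Matrix.of fun k l => (x (T k) l : ℝ)).det = (formsDet (fun k => x (T k)) : ℝ) := by
      refine Eq.trans ?_ (RingHom.map_det (Int.castRingHom ℝ) _).symm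
      rfl
    have h2 : IsUnit (Matrix.of fun k l => (x (T k) l : ℝ)) := by
      rw [Matrix.isUnit_iff_isUnit_det, h1, isUnit_iff_ne_zero]
      exact_mod_cast h
    exact Matrix.linearIndependent_rows_iff_isUnit.2 h2⟩

lemma formCoeffs_self (S : OrdTuple x) (p q : Fin n) :
    formCoeffs S (x (S.1 p)) q = if p = q then 1 else 0 := by
  have h := congrFun (congrFun (Matrix.mul_nonsing_inv _ (isUnit_det_formsMatrix S)) p) q
  rw [Matrix.one_apply] at h
  rw [← h]
  rfl

lemma sum_formCoeffs_mul (S : OrdTuple x) (y : Fin n → ℤ) (l : Fin n) :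
    ∑ k, formCoeffs S y k * (x (S.1 k) l : ℂ) = y l := by
  have h1 : Matrix.vecMul (formCoeffs S y) (formsMatrix S.forms) = fun l => (y l : ℂ) := by
    rw [formCoeffs, Matrix.vecMul_vecMul, Matrix.nonsing_inv_mul _ (isUnit_det_formsMatrix S),
      Matrix.vecMul_one]
  exact congrFun h1 l

lemma formCoeffs_trans (S T : OrdTuple x) (y : Fin n → ℤ) (q : Fin n) :
    formCoeffs S y q = ∑ p, formCoeffs T y p * formCoeffs S (x (T.1 p)) q := by
  have h : formCoeffs S y = Matrix.vecMul (formCoeffs T y)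
      (formsMatrix T.forms * (formsMatrix S.forms)⁻¹) := by
    rw [formCoeffs, formCoeffs, Matrix.vecMul_vecMul, ← Matrix.mul_assoc,
      Matrix.nonsing_inv_mul _ (isUnit_det_formsMatrix T), Matrix.one_mul]
  rw [h]
  rfl

/-- The indices of the forms in the span of `x_{S_1}, …, x_{S_k}`. -/
def flagSet (S : OrdTuple x) (k : Fin n) : Set ι :=
  {i | ∀ q, k < q → formCoeffs S (x i) q = 0}

lemma mem_flagSet_self (S : OrdTuple x) {l k : Fin n} : S.1 l ∈ flagSet S k ↔ l ≤ k := by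
  constructor
  · intro h
    by_contra hlk
    have := h l (not_le.1 hlk)
    rw [formCoeffs_self, if_pos rfl] at this
    exact one_ne_zero this
  · intro h q hq
    rw [formCoeffs_self, if_neg (h.trans_lt hq).ne]

lemma flagSet_subset (S T : OrdTuple x) {k : Fin n} (h : ∀ p ≤ k, T.1 p ∈ flagSet S k) :
    flagSet T k ⊆ flagSet S k := by
  intro i hi q hq
  rw [formCoeffs_trans S T]
  refine Finset.sum_eq_zero fun p _ => ?_
  rcases le_or_gt p k with hp | hp
  · rw [h p hp q hq, mul_zero]
  · rw [hi p hp, zero_mul]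

/-- With respect to the order `r` on the arrangement, each member of `S` is the least hyperplane
whose form is a combination of it and the forms that precede it. -/
def IsNbc (r : ι → ℕ) (S : OrdTuple x) : Prop :=
  ∀ k, ∀ i ∈ flagSet S k, r (S.1 k) ≤ r i

lemma logCoeff_perm (y : Fin n → Fin n → ℤ) (σ : Equiv.Perm (Fin n)) (z : Fin n → ℂ) :
    logCoeff (fun k => y (σ k)) z = (Equiv.Perm.sign σ : ℤ) * logCoeff y z := by
  have h1 : formsDet (fun k => y (σ k)) = (Equiv.Perm.sign σ : ℤ) * formsDet y :=
    Matrix.det_permute σ (Matrix.of y)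
  rw [logCoeff, logCoeff, h1, Equiv.prod_comp σ fun k => (evC (y k) z)⁻¹]
  push_cast
  ring

/-- Cramer's rule: the new row is the combination of the rows of `S` with coefficients `formCoeffs S
y`. -/
lemma formsDet_update (S : OrdTuple x) (y : Fin n → ℤ) (i : Fin n) :
    (formsDet (Function.update S.forms i y) : ℂ) = formCoeffs S y i * formsDet S.forms := by
  rw [← det_formsMatrix, ← det_formsMatrix, ← smul_eq_mul, ← Matrix.det_updateRow_sum]
  congr 1
  ext k l
  rcases eq_or_ne k i with rfl | hk
  · rw [Matrix.updateRow_self, formsMatrix, Matrix.of_apply, Function.update_self,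
      ← sum_formCoeffs_mul S y l, Finset.sum_apply]
    rfl
  · rw [Matrix.updateRow_ne hk, formsMatrix, Matrix.of_apply, Function.update_of_ne hk]
    rfl

/-- The exchange relation between logarithmic forms. -/
lemma logCoeff_eq_sum_update (S : OrdTuple x) {y : Fin n → ℤ} {z : Fin n → ℂ} (hz : z ∈ arrCompl x)
    (hy : evC y z ≠ 0) :
    logCoeff S.forms z = ∑ i, logCoeff (Function.update S.forms i y) z := by
  have h1 : ∀ i, logCoeff (Function.update S.forms i y) z =
      logCoeff S.forms z * (evC y z)⁻¹ * (formCoeffs S y i * evC (x (S.1 i)) z) := by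
    intro i
    have h2 : ∏ k, (evC (Function.update S.forms i y k) z)⁻¹ =
        (∏ k, (evC (S.forms k) z)⁻¹) * (evC y z)⁻¹ * evC (x (S.1 i)) z := by
      rw [← Finset.mul_prod_erase _ _ (Finset.mem_univ i),
        ← Finset.mul_prod_erase _ (fun k => (evC (S.forms k) z)⁻¹) (Finset.mem_univ i),
        Function.update_self, Finset.prod_congr rfl fun k hk => by
          rw [Function.update_of_ne (Finset.ne_of_mem_erase hk)]]
      have h3 : evC (x (S.1 i)) z ≠ 0 := hz _
      simp only [OrdTuple.forms]
      field_simp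
    rw [logCoeff, logCoeff, formsDet_update, h2]
    ring
  rw [Finset.sum_congr rfl fun i _ => h1 i, ← Finset.mul_sum, ← evC_eq_sum_formCoeffs, mul_assoc,
    inv_mul_cancel₀ hy, mul_one]

/-- Straightening from the last place to the first. Suppose the entries after place `K` are already
minimal, and let `m` be the least member of the flag set at `K`. The exchange relation writes `b(T)`
as the sum of the forms in which `m` replaces one entry; only entries at places `i ≤ K` contribute.
Moving `m` to place `K` makes that place minimal without disturbing the later ones. -/
lemma logForm_mem_span_nbc (r : ι → ℕ) (T : OrdTuple x) :
    logForm T ∈ Submodule.span ℤ (logForm '' {S : OrdTuple x | IsNbc r S}) := by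
  classical
  suffices H : ∀ k : ℕ, k ≤ n → ∀ T : OrdTuple x,
      (∀ l : Fin n, k ≤ l → ∀ i ∈ flagSet T l, r (T.1 l) ≤ r i) →
      logForm T ∈ Submodule.span ℤ (logForm '' {S : OrdTuple x | IsNbc r S}) from
    H n le_rfl T fun l hl => absurd l.2 (not_lt.2 hl)
  intro k
  induction k with
  | zero => exact fun _ T hT => Submodule.subset_span ⟨T, fun l => hT l (Nat.zero_le _), rfl⟩
  | succ k ih =>
    intro hk T hT
    set K : Fin n := ⟨k, hk⟩ with hKdef
    obtain ⟨m, hm, hmin⟩ := Set.exists_min_image (flagSet T K) r (Set.toFinite _)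
      ⟨T.1 K, (mem_flagSet_self T).2 le_rfl⟩
    have key : ∀ i : Fin n, ∃ e ∈ Submodule.span ℤ (logForm '' {S : OrdTuple x | IsNbc r S}),
        (e : Germ (𝓝[arrCompl x] 0) ℂ) = ↑(logCoeff (Function.update T.forms i (x m))) := by
      intro i
      by_cases ha : formCoeffs T (x m) i = 0
      · refine ⟨0, Submodule.zero_mem _, ?_⟩
        have : logCoeff (Function.update T.forms i (x m)) = 0 := by
          funext z
          rw [logCoeff, formsDet_update, ha, zero_mul, zero_mul]
          rfl
        rw [this]
        rfl
      · have hiK : i ≤ K := by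
          by_contra hlt
          exact ha (hm i (not_le.1 hlt))
        -- The swap carries `m` to place `K` and the old entry of place `K` to place `i`, at the
        -- cost of a sign.
        set σ : Equiv.Perm (Fin n) := Equiv.swap i K with hσ
        set T' : Fin n → ι := fun l => Function.update T.1 i m (σ l) with hT'
        have hforms : (fun l => x (T' l)) = fun l => Function.update T.forms i (x m) (σ l) := by
          funext l
          simp only [hT']
          rcases eq_or_ne (σ l) i with h | h
          · rw [h, Function.update_self, Function.update_self]
          · rw [Function.update_of_ne h, Function.update_of_ne h]
            rfl
        have hdet : formsDet (fun l => x (T' l)) ≠ 0 := by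
          have h1 : formsDet (fun l => x (T' l)) =
              (Equiv.Perm.sign σ : ℤ) * formsDet (Function.update T.forms i (x m)) := by
            rw [hforms]
            exact Matrix.det_permute σ (Matrix.of (Function.update T.forms i (x m)))
          rw [h1]
          refine mul_ne_zero (Units.ne_zero _) fun h2 => ?_
          have h3 := formsDet_update T (x m) i
          rw [h2, Int.cast_zero] at h3
          exact mul_ne_zero ha (formsDet_ne_zero T) h3.symm
        have hTK : T' K = m := by simp [hT', hσ]
        have hT'l : ∀ l, l ≠ K → (T' l = T.1 l ∨ T' l = T.1 K ∧ i ≤ l ∧ l ≤ K) := by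
          intro l hl
          simp only [hT', hσ]
          rcases eq_or_ne l i with rfl | hli
          · right
            rw [Equiv.swap_apply_left, Function.update_of_ne hl.symm]
            exact ⟨rfl, le_rfl, hiK⟩
          · left
            rw [Equiv.swap_apply_of_ne_of_ne hli hl, Function.update_of_ne hli]
        -- From `K` on the flags of the new tuple lie in those of the old one, so minimality
        -- persists.
        have hsub : ∀ l : Fin n, K ≤ l → flagSet (OrdTuple.ofDet T' hdet) l ⊆ flagSet T l := by
          intro l hl
          refine flagSet_subset T _ fun p hp => ?_
          change T' p ∈ _
          rcases eq_or_ne p K with rfl | hpK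
          · rw [hTK]
            exact fun q hq => hm q (hl.trans_lt hq)
          · rcases hT'l p hpK with h | ⟨h, -, -⟩
            · rw [h]
              exact (mem_flagSet_self T).2 hp
            · rw [h]
              exact (mem_flagSet_self T).2 hl
        have hgood := ih (Nat.le_of_succ_le hk) (OrdTuple.ofDet T' hdet) (by
          intro l hl j hj
          have hKl : K ≤ l := hl
          change r (T' l) ≤ r j
          have hj := hsub l hKl hj
          rcases eq_or_ne l K with rfl | hlK
          · rw [hTK]
            exact hmin j hj
          · have hlt : K < l := lt_of_le_of_ne hKl hlK.symm
            rcases hT'l l hlK with h | ⟨-, -, h⟩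
            · rw [h]
              exact hT l hlt j hj
            · exact absurd h (not_le.2 hlt))
        refine ⟨(Equiv.Perm.sign σ : ℤ) • logForm (OrdTuple.ofDet T' hdet),
          Submodule.smul_mem _ _ hgood, ?_⟩
        have h4 : logCoeff (Function.update T.forms i (x m)) = fun z =>
            ((Equiv.Perm.sign σ : ℤ) : ℂ) * logCoeff (fun l => x (T' l)) z := by
          funext z
          rw [hforms, logCoeff_perm, ← mul_assoc, ← Int.cast_mul, ← Units.val_mul, Int.units_mul_self]
          simp
        rw [h4, Submodule.coe_smul_of_tower]
        change ((Equiv.Perm.sign σ : ℤ) •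
          ((logCoeff (fun l => x (T' l)) : (Fin n → ℂ) → ℂ) : Germ (𝓝[arrCompl x] 0) ℂ)) = _
        rw [← Germ.coe_smul]
        congr 1
        funext z
        simp
    choose e he hec using key
    have hsum : logForm T = ∑ i, e i := by
      refine Subtype.ext ?_
      rw [Submodule.coe_sum, Finset.sum_congr rfl fun i _ => hec i]
      have h5 : ∑ i, ((logCoeff (Function.update T.forms i (x m)) : (Fin n → ℂ) → ℂ) :
          Germ (𝓝[arrCompl x] 0) ℂ) =
          ↑(∑ i, logCoeff (Function.update T.forms i (x m))) :=
        (map_sum (Germ.coeAddHom (𝓝[arrCompl x] (0 : Fin n → ℂ)) (M := ℂ)) _ _).symm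
      rw [h5]
      refine Germ.coe_eq.2 ?_
      filter_upwards [self_mem_nhdsWithin] with z hz
      rw [Finset.sum_apply]
      exact logCoeff_eq_sum_update T hz (hz m)
    rw [hsum]
    exact Submodule.sum_mem _ fun i _ => he i

/-- Downward induction on the place `k`. The later entries agree and lie outside the flag set of `S`
at `k`, so the count forces the first `k + 1` entries of `S'` into it. Then the `k`th entry of each
tuple lies in the flag set of the other, and minimality makes them equal. -/
lemma IsNbc.eq_of_card_le {r : ι → ℕ} (hr : Function.Injective r) {S S' : OrdTuple x}
    (hS : IsNbc r S) (hS' : IsNbc r S')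
    (h : ∀ k : Fin n, (k : ℕ) + 1 ≤ Nat.card {l : Fin n // S'.1 l ∈ flagSet S k}) : S' = S := by
  classical
  refine Subtype.ext (funext fun k => ?_)
  induction k using WellFoundedGT.induction with
  | _ k ih =>
    have hsub : {l : Fin n | S'.1 l ∈ flagSet S k} ⊆ Set.Iic k := by
      intro l hl
      by_contra hlk
      have hlk : k < l := not_le.1 hlk
      have hl : S'.1 l ∈ flagSet S k := hl
      rw [ih l hlk, mem_flagSet_self] at hl
      exact absurd hl (not_le.2 hlk)
    have heq : {l : Fin n | S'.1 l ∈ flagSet S k} = Set.Iic k := by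
      refine Set.eq_of_subset_of_ncard_le hsub ?_ (Set.toFinite _)
      have h1 : (Set.Iic k).ncard = (k : ℕ) + 1 := by
        rw [← Finset.coe_Iic, Set.ncard_coe_finset, Fin.card_Iic]
      rw [h1]
      exact h k
    have hall : ∀ l ≤ k, S'.1 l ∈ flagSet S k := fun l hl => by
      have : l ∈ {l : Fin n | S'.1 l ∈ flagSet S k} := by rw [heq]; exact hl
      exact this
    refine hr (le_antisymm (hS' k _ fun q hq => ?_) (hS k _ (hall k le_rfl)))
    have h2 := formCoeffs_trans S S' (x (S.1 k)) q
    rw [formCoeffs_self, if_neg hq.ne, Finset.sum_eq_single q] at h2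
    · rw [ih q hq, formCoeffs_self, if_pos rfl, mul_one] at h2
      exact h2.symm
    · intro p _ hpq
      rcases le_or_gt p k with hp | hp
      · rw [hall p hp q hq, mul_zero]
      · rw [ih p hp, formCoeffs_self, if_neg hpq, mul_zero]
    · simp

open MeasureTheory

/-- `Z(S)` does not meet `b(S')` if too few members of `S'` lie in some step of the flag of `S`. -/
lemma pairing_logForm_torusClass_eq_zero (hx : IsIntegralArrangement x) {S S' : OrdTuple x}
    {k : Fin n} (hk : Nat.card {l : Fin n // S'.1 l ∈ flagSet S k} ≤ k) :
    pairing hx (logForm S') (torusClass hx S) = 0 := by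
  classical
  obtain ⟨δ, hδ⟩ := (eventually_pow_mem_torusDomain hx S).exists
  set ρ : Fin n → ℝ := fun k : Fin n => δ ^ (n - 1 - (k : ℕ)) with hρdef
  have hρ : ρ ∈ torusDomain S := hδ
  clear_value ρ
  choose K hK hlt using hρ.2
  set c : ι → ℝ := fun i => ‖formCoeffs S (x i) (K i)‖ * ρ (K i) -
    ∑ q ∈ Finset.Iio (K i), ‖formCoeffs S (x i) q‖ * ρ q with hc
  have hcpos : ∀ i, 0 < c i := fun i => sub_pos.2 (hlt i)
  have hflag : ∀ i, K i ≤ k ↔ i ∈ flagSet S k := by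
    intro i
    constructor
    · exact fun h q hq => hK i q (h.trans_lt hq)
    · intro h
      by_contra hcon
      exact Dominates.unique hρ.1 (hlt i) (h _ (not_le.1 hcon))
  -- The first `k + 1` radii are multiplied by `r`. Forms in the flag set at `k` are then bounded
  -- below by a multiple of `r`, the others by constants, and the torus stays in general position.
  set ρr : ℝ → Fin n → ℝ := fun r q => if q ≤ k then r * ρ q else ρ q with hρr
  have hle : ∀ r ∈ Ioc (0 : ℝ) 1, ∀ q, ρr r q ≤ ρ q := by
    intro r hr q
    simp only [hρr]
    split_ifs
    · exact mul_le_of_le_one_left (hρ.1 q).le hr.2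
    · exact le_rfl
  have hlow : ∀ r ∈ Ioc (0 : ℝ) 1, ∀ i, (if i ∈ flagSet S k then r * c i else c i) ≤
      ‖formCoeffs S (x i) (K i)‖ * ρr r (K i) -
        ∑ q ∈ Finset.Iio (K i), ‖formCoeffs S (x i) q‖ * ρr r q := by
    intro r hr i
    split_ifs with hi
    · have hi := (hflag i).2 hi
      refine le_of_eq ?_
      rw [hc]
      simp only [hρr]
      rw [if_pos hi, mul_sub, Finset.mul_sum]
      congr 1
      · ring
      · refine Finset.sum_congr rfl fun q hq => ?_
        rw [if_pos ((Finset.mem_Iio.1 hq).le.trans hi)]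
        ring
    · have hi := fun h => hi ((hflag i).1 h)
      have h1 : ρr r (K i) = ρ (K i) := if_neg hi
      rw [h1, hc]
      refine sub_le_sub_left (Finset.sum_le_sum fun q _ => ?_) _
      exact mul_le_mul_of_nonneg_left (hle r hr q) (norm_nonneg _)
  have hdom : ∀ r ∈ Ioc (0 : ℝ) 1, ρr r ∈ torusDomain S := by
    intro r hr
    refine ⟨fun q => ?_, fun i => ⟨K i, hK i, ?_⟩⟩
    · simp only [hρr]
      split_ifs
      · exact mul_pos hr.1 (hρ.1 q)
      · exact hρ.1 q
    · have h1 := hlow r hr i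
      have h2 : 0 < if i ∈ flagSet S k then r * c i else c i := by
        split_ifs
        · exact mul_pos hr.1 (hcpos i)
        · exact hcpos i
      linarith
  set v := pairing hx (logForm S') (torusClass hx S) with hv
  set C : ℝ := ‖(formsDet S.forms : ℂ)⁻¹‖ *
    (‖(formsDet S'.forms : ℂ)‖ * (∏ l, (c (S'.1 l))⁻¹) * ∏ q, ρ q) with hC
  -- The product of the coordinates contributes `r ^ (k + 1)`, and at most `k` of the inverse forms
  -- contribute `r⁻¹`. The integral, which does not depend on `r`, is therefore `O(r)` and vanishes.
  have hbound : ∀ r ∈ Ioc (0 : ℝ) 1, ‖v‖ ≤ C * r := by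
    intro r hr
    have h1 := pairing_torusClass hx (logForm S') (h := logCoeff S'.forms) rfl isOpen_univ
      ((analyticOnNhd_logCoeff S').mono inter_subset_left) S (hdom r hr) fun _ _ _ => mem_univ _
    rw [hv, h1, norm_mul, hC, mul_assoc]
    refine mul_le_mul_of_nonneg_left ?_ (norm_nonneg _)
    rw [torusAvg]
    have hpt : ∀ u : Fin n → ℝ, ‖logCoeff S'.forms ((formsMatrix S.forms)⁻¹.mulVec (polar (ρr r) u)) *
        ∏ q, polar (ρr r) u q‖ ≤
        ‖(formsDet S'.forms : ℂ)‖ * (∏ l, (c (S'.1 l))⁻¹) * (∏ q, ρ q) * r := by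
      intro u
      have hw : ∀ q, ‖polar (ρr r) u q‖ = ρr r q := fun q => by
        rw [norm_polar, abs_of_pos ((hdom r hr).1 q)]
      have h2 : ∀ l, ‖(evC (S'.forms l) ((formsMatrix S.forms)⁻¹.mulVec (polar (ρr r) u)))⁻¹‖ ≤
          (if S'.1 l ∈ flagSet S k then r⁻¹ else 1) * (c (S'.1 l))⁻¹ := by
        intro l
        have h3 := (hlow r hr (S'.1 l)).trans (Dominates.lower_bound (hK (S'.1 l)) hw)
        rw [OrdTuple.forms, evC_mulVec_inv, norm_inv]
        split_ifs at h3 ⊢ with hi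
        · rw [← mul_inv]
          exact inv_anti₀ (mul_pos hr.1 (hcpos _)) h3
        · rw [one_mul]
          exact inv_anti₀ (hcpos _) h3
      have h4 : ∏ q, ρr r q = r ^ ((k : ℕ) + 1) * ∏ q, ρ q := by
        have : ∀ q, ρr r q = (if q ≤ k then r else 1) * ρ q := fun q => by
          simp only [hρr]
          split_ifs <;> simp
        rw [Finset.prod_congr rfl fun q _ => this q, Finset.prod_mul_distrib, Finset.prod_ite,
          Finset.prod_const, Finset.prod_const_one, mul_one]
        congr 2
        rw [← Fin.card_Iic]
        congr 1
        ext q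
        simp
      have h5 : ∏ l, (if S'.1 l ∈ flagSet S k then r⁻¹ else (1 : ℝ)) =
          (r⁻¹) ^ Nat.card {l : Fin n // S'.1 l ∈ flagSet S k} := by
        rw [Finset.prod_ite, Finset.prod_const, Finset.prod_const_one, mul_one,
          Nat.card_eq_fintype_card, Fintype.card_subtype]
      rw [norm_mul, logCoeff, norm_mul, norm_prod, norm_prod, Finset.prod_congr rfl fun q _ => hw q, h4]
      have h6 : ∏ l, ‖(evC (S'.forms l) ((formsMatrix S.forms)⁻¹.mulVec (polar (ρr r) u)))⁻¹‖ ≤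
          (r⁻¹) ^ (k : ℕ) * ∏ l, (c (S'.1 l))⁻¹ := by
        refine (Finset.prod_le_prod (fun _ _ => norm_nonneg _) fun l _ => h2 l).trans ?_
        rw [Finset.prod_mul_distrib, h5]
        refine mul_le_mul_of_nonneg_right ?_
          (Finset.prod_nonneg fun l _ => inv_nonneg.2 (hcpos _).le)
        exact pow_le_pow_right₀ ((one_le_inv₀ hr.1).2 hr.2) hk
      have hρ0 : 0 ≤ ∏ q, ρ q := Finset.prod_nonneg fun q _ => (hρ.1 q).le
      calc _ ≤ ‖(formsDet S'.forms : ℂ)‖ * ((r⁻¹) ^ (k : ℕ) * ∏ l, (c (S'.1 l))⁻¹) *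
            (r ^ ((k : ℕ) + 1) * ∏ q, ρ q) := by
            have := hr.1
            gcongr
        _ = _ := by
            have h7 : (r⁻¹) ^ (k : ℕ) * r ^ ((k : ℕ) + 1) = r := by
              rw [pow_succ, ← mul_assoc, ← mul_pow, inv_mul_cancel₀ hr.1.ne', one_pow, one_mul]
            calc _ = ‖(formsDet S'.forms : ℂ)‖ * (∏ l, (c (S'.1 l))⁻¹) * (∏ q, ρ q) *
                  ((r⁻¹) ^ (k : ℕ) * r ^ ((k : ℕ) + 1)) := by ring
              _ = _ := by rw [h7]
    have h8 := norm_setIntegral_le_of_norm_le_const (μ := volume) (s := Icc (0 : Fin n → ℝ) 1)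
      (by rw [Real.volume_Icc_pi]; simp) (fun u _ => hpt u)
    have h9 : (volume : Measure (Fin n → ℝ)).real (Icc 0 1) = 1 := by
      rw [Measure.real, Real.volume_Icc_pi]; simp
    rwa [h9, mul_one] at h8
  have hlim : Tendsto (fun r : ℝ => C * r) (𝓝[>] 0) (𝓝 0) := by
    have : Tendsto (fun r : ℝ => C * r) (𝓝 0) (𝓝 (C * 0)) := tendsto_id.const_mul C
    rw [mul_zero] at this
    exact this.mono_left nhdsWithin_le_nhds
  have : ‖v‖ ≤ 0 := ge_of_tendsto hlim (by
    filter_upwards [Ioc_mem_nhdsGT (zero_lt_one' ℝ)] with r hr using hbound r hr)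
  exact norm_le_zero_iff.1 this

/-- Multiplied by the product of the coordinates given by `S`, the coefficient of `b(S)` is the
constant `formsDet S.forms`, and the average of a constant is the constant. -/
lemma pairing_logForm_torusClass_self (hx : IsIntegralArrangement x) (S : OrdTuple x) :
    pairing hx (logForm S) (torusClass hx S) = 1 := by
  obtain ⟨δ, hδ⟩ := (eventually_pow_mem_torusDomain hx S).exists
  rw [pairing_torusClass hx (logForm S) (h := logCoeff S.forms) rfl isOpen_univ
      ((analyticOnNhd_logCoeff S).mono inter_subset_left) S hδ fun _ _ _ => mem_univ _, torusAvg,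
      setIntegral_congr_fun (g := fun _ => (formsDet S.forms : ℂ)) measurableSet_Icc]
  · have h9 : (volume : Measure (Fin n → ℝ)).real (Icc 0 1) = 1 := by
      rw [Measure.real, Real.volume_Icc_pi]; simp
    rw [setIntegral_const, h9, one_smul, inv_mul_cancel₀ (formsDet_ne_zero S)]
  · intro u _
    simp only [logCoeff]
    have h1 : ∀ k, evC (S.forms k) ((formsMatrix S.forms)⁻¹.mulVec
        (polar (fun k : Fin n => δ ^ (n - 1 - (k : ℕ))) u)) =
        polar (fun k : Fin n => δ ^ (n - 1 - (k : ℕ))) u k := fun k => evC_inv_mulVec S _ k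
    rw [Finset.prod_congr rfl fun k _ => by rw [h1 k], mul_assoc, ← Finset.prod_mul_distrib,
      Finset.prod_eq_one, mul_one]
    intro k _
    refine inv_mul_cancel₀ ?_
    rw [← norm_ne_zero_iff, norm_polar]
    exact abs_ne_zero.2 (hδ.1 k).ne'

/-- The forms `b(S)`, `S ∈ DB`, span `OSⁿ`, and the tori `Z(S)`, `S ∈ DB`, are dual to them. -/
structure IsDualBasis (hx : IsIntegralArrangement x) (DB : Finset (OrdTuple x)) : Prop where
  dual : ∀ S ∈ DB, ∀ T ∈ DB, S ≠ T → pairing hx (logForm T) (torusClass hx S) = 0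
  span : ∀ T : OrdTuple x, logForm T ∈ Submodule.span ℤ (logForm '' (DB : Set (OrdTuple x)))

-- If `Z(S)` pairs nontrivially with `b(T)`, every flag set of `S` contains enough members of `T` to
-- force `T = S`.
open Classical in
lemma isDualBasis_nbc (hx : IsIntegralArrangement x) {r : ι → ℕ} (hr : Function.Injective r) :
    IsDualBasis hx (Finset.univ.filter (IsNbc r)) where
  dual S hS T hT hne := by
    rw [Finset.mem_filter] at hS hT
    by_contra h
    refine hne (IsNbc.eq_of_card_le hr hS.2 hT.2 fun k => ?_).symm
    by_contra hk
    exact h (pairing_logForm_torusClass_eq_zero hx (k := k) (by omega))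
  span T := by
    have := logForm_mem_span_nbc r T
    simpa using this

/-- The flag set at the last place contains every hyperplane, so the last entry is the least one of
all. -/
lemma IsNbc.eq_last {r : ι → ℕ} {S : OrdTuple x} (hS : IsNbc r S) (hr : Function.Injective r)
    {i₀ : ι} (h : r i₀ = 0) {k : Fin n} (hk : ∀ l, l ≤ k) : S.1 k = i₀ := by
  refine hr (le_antisymm (hS k i₀ fun q hq => absurd hq (not_lt.2 (hk q))) ?_)
  rw [h]
  exact Nat.zero_le _

/-- There is a dual basis whose members all end with a given hyperplane. -/
theorem exists_isDualBasis (hx : IsIntegralArrangement x) (i₀ : ι) :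
    ∃ DB : Finset (OrdTuple x), IsDualBasis hx DB ∧
      ∀ S ∈ DB, ∀ k : Fin n, (∀ l, l ≤ k) → S.1 k = i₀ := by
  classical
  -- A numbering in which `i₀` comes first.
  set r : ι → ℕ := fun i => if i = i₀ then 0 else Fintype.equivFin ι i + 1 with hr
  have hinj : Function.Injective r := by
    intro i j hij
    simp only [hr] at hij
    split_ifs at hij with h1 h2 h2
    · rw [h1, h2]
    · exact (Fintype.equivFin ι).injective (Fin.ext (by omega))
  refine ⟨_, isDualBasis_nbc hx hinj, fun S hS k hk => ?_⟩
  rw [Finset.mem_filter] at hS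
  exact hS.2.eq_last hinj (by simp [hr]) hk

theorem exists_isDualBasis' (hx : IsIntegralArrangement x) : ∃ DB, IsDualBasis hx DB := by
  classical
  exact ⟨_, isDualBasis_nbc hx (r := fun i => (Fintype.equivFin ι i : ℕ))
    fun i j h => (Fintype.equivFin ι).injective (Fin.ext h)⟩

end DualBasis

/-! ### The diagonal class in terms of dual bases. -/

section Diagonal

variable {n : ℕ} {ι : Type*} [Fintype ι] {x : ι → Fin n → ℤ}

lemma IsDualBasis.exists_eq_sum {hx : IsIntegralArrangement x} {DB : Finset (OrdTuple x)}
    (h : IsDualBasis hx DB) (β : OS x) :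
    ∃ k : OrdTuple x → ℤ, (β : meroForms x) = ∑ S ∈ DB, k S • logForm S ∧
      ∀ S ∈ DB, pairing hx (β : meroForms x) (torusClass hx S) = k S := by
  classical
  have h1 : OS x ≤ Submodule.span ℤ (logForm '' (DB : Set (OrdTuple x))) := by
    refine Submodule.span_le.2 ?_
    rintro _ ⟨T, rfl⟩
    exact h.span T
  obtain ⟨k, hk⟩ : ∃ k : OrdTuple x → ℤ, ∑ S ∈ DB, k S • logForm S = (β : meroForms x) :=
    (Submodule.mem_span_image_finset_iff_exists_fun' ℤ).1 (h1 β.2)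
  refine ⟨k, hk.symm, fun S hS => ?_⟩
  rw [← hk, map_sum, LinearMap.sum_apply, Finset.sum_eq_single S]
  · rw [map_smul, LinearMap.smul_apply, pairing_logForm_torusClass_self]
    simp
  · intro T hT hTS
    rw [map_smul, LinearMap.smul_apply, h.dual S hS T hT hTS.symm, smul_zero]
  · exact fun hS' => absurd hS hS'

/-- The pairing with a class in terms of a dual basis. -/
lemma IsDualBasis.pairing_eq_sum {hx : IsIntegralArrangement x} {DB : Finset (OrdTuple x)}
    (h : IsDualBasis hx DB) (η : meroForms x) (C : Homology (arrCompl x) n) :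
    pairing hx η C =
      ∑ S ∈ DB, pairing hx η (torusClass hx S) * pairing hx (logForm S) C := by
  obtain ⟨a, ha⟩ := exists_pairing_eq_sum hx η
  have h1 : ∀ T : OrdTuple x, pairing hx (logForm T) C =
      ∑ S ∈ DB, pairing hx (logForm T) (torusClass hx S) * pairing hx (logForm S) C := by
    intro T
    obtain ⟨k, hk, hk'⟩ := h.exists_eq_sum (logClass T)
    have hk : logForm T = ∑ S ∈ DB, k S • logForm S := hk
    conv_lhs => rw [hk]
    rw [map_sum, LinearMap.sum_apply]
    refine Finset.sum_congr rfl fun S hS => ?_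
    have hk' : pairing hx (logForm T) (torusClass hx S) = k S := hk' S hS
    rw [hk', map_smul, LinearMap.smul_apply, zsmul_eq_mul]
  rw [ha C, Finset.sum_congr rfl fun T _ => by rw [h1 T, Finset.mul_sum], Finset.sum_comm]
  refine Finset.sum_congr rfl fun S _ => ?_
  rw [ha (torusClass hx S), Finset.sum_mul]
  exact Finset.sum_congr rfl fun T _ => by rw [mul_assoc]

lemma evaluatesTo_iff (hx : IsIntegralArrangement x) (β : OS x) (C : Homology (arrCompl x) n)
    (k : ℤ) : EvaluatesTo β C k ↔ pairing hx (β : meroForms x) C = k := by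
  rw [EvaluatesTo, hasPairing_iff hx (γ := ⟨_, coe_mem_meroForms (F := fun _ => 1) analyticAt_const⟩)
    rfl, tensorPairing_tmul]
  have : meroMul (⟨_, coe_mem_meroForms (x := x) (F := fun _ => 1) analyticAt_const⟩) (β : meroForms x) =
      (β : meroForms x) := by
    refine Subtype.ext ?_
    rw [coe_meroMul]
    exact one_mul _
  rw [this]

/-- A dual basis is a diagonal basis. -/
theorem IsDualBasis.isDiagonalBasis {hx : IsIntegralArrangement x} {DB : Finset (OrdTuple x)}
    (h : IsDualBasis hx DB) : IsDiagonalBasis hx DB := by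
  classical
  have hsum : ∀ {M : Type _} [AddCommMonoid M] (F : OrdTuple x → M),
      ∑ S ∈ DB, F S = ∑ i : Fin DB.card, F (DB.equivFin.symm i) := by
    intro M _ F
    rw [← Finset.sum_coe_sort DB F]
    exact (Equiv.sum_comp DB.equivFin.symm fun S => F S).symm
  refine ⟨DB.card, fun i => logClass (DB.equivFin.symm i : OrdTuple x),
    fun i => torusClass hx (DB.equivFin.symm i : OrdTuple x),
    hsum fun S => logClass S ⊗ₜ[ℤ] torusClass hx S, fun β => ?_⟩
  obtain ⟨k, hk, hk'⟩ := h.exists_eq_sum β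
  refine ⟨fun i => k (DB.equivFin.symm i), fun i => ?_, ?_⟩
  · rw [evaluatesTo_iff hx]
    exact hk' _ (DB.equivFin.symm i).2
  · refine Subtype.ext ?_
    rw [hk, hsum fun S => k S • logForm S, Submodule.coe_sum]
    rfl

/-- The value of a linear operation on the diagonal class in terms of a dual basis. -/
theorem IsDualBasis.tensorPairing_diag {hx : IsIntegralArrangement x} {DB : Finset (OrdTuple x)}
    (h : IsDualBasis hx DB) (q : OS x →ₗ[ℤ] meroForms x) (γ : meroForms x)
    {D : OS x ⊗[ℤ] Homology (arrCompl x) n} (hD : IsDiag D) :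
    tensorPairing hx γ (q.rTensor (Homology (arrCompl x) n) D) =
      ∑ S ∈ DB, pairing hx (meroMul γ (q (logClass S))) (torusClass hx S) := by
  obtain ⟨m, b, C, rfl, hC⟩ := hD
  -- Each pairing is expanded in the dual basis. After exchanging the sums, the defining property
  -- `∑ᵢ ⟨b(S), Cᵢ⟩ bᵢ = b(S)` of the diagonal removes the presentation of `D`.
  rw [map_sum, map_sum, Finset.sum_congr rfl fun i _ => by
    rw [LinearMap.rTensor_tmul, tensorPairing_tmul, h.pairing_eq_sum], Finset.sum_comm]
  refine Finset.sum_congr rfl fun S _ => ?_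
  obtain ⟨k, hk, hk'⟩ := hC (logClass S)
  rw [← hk', map_sum, map_sum, map_sum, LinearMap.sum_apply]
  refine Finset.sum_congr rfl fun i _ => ?_
  have h1 : pairing hx (logForm S) (C i) = k i := (evaluatesTo_iff hx (logClass S) (C i) (k i)).1 (hk i)
  rw [h1, map_smul, map_smul, map_smul, LinearMap.smul_apply, zsmul_eq_mul, mul_comm]

/-- A diagonal basis is a presentation of the diagonal class, and the pairing with that class is
computed by any dual basis. Diagonal bases are not asked to be dual bases themselves. -/
theorem IsDualBasis.sum_pairing_eq {hx : IsIntegralArrangement x} {DB DB' : Finset (OrdTuple x)}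
    (h : IsDualBasis hx DB) (h' : IsDiagonalBasis hx DB') (q : OS x →ₗ[ℤ] meroForms x)
    (γ : meroForms x) :
    ∑ S ∈ DB', pairing hx (meroMul γ (q (logClass S))) (torusClass hx S) =
      ∑ S ∈ DB, pairing hx (meroMul γ (q (logClass S))) (torusClass hx S) := by
  rw [← h.tensorPairing_diag q γ h', map_sum, map_sum]
  rfl

end Diagonal

/-! ### Homomorphisms defined on the Orlik–Solomon algebra. -/

section Deformations

variable {n : ℕ} {ι : Type*} [Fintype ι] {x : ι → Fin n → ℤ}

lemma coe_sum_smul_logForm (c : OrdTuple x → ℤ) :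
    ((∑ S, c S • logForm S : meroForms x) : Germ (𝓝[arrCompl x] (0 : Fin n → ℂ)) ℂ) =
      ↑(fun z => ∑ S : OrdTuple x, (c S : ℂ) * logCoeff S.forms z) := by
  have h1 : ∀ S : OrdTuple x, ((c S • logForm S : meroForms x) : Germ (𝓝[arrCompl x] 0) ℂ) =
      ↑(fun z => (c S : ℂ) * logCoeff S.forms z) := by
    intro S
    rw [Submodule.coe_smul_of_tower]
    change (c S • ((logCoeff S.forms : (Fin n → ℂ) → ℂ) : Germ (𝓝[arrCompl x] 0) ℂ)) = _
    rw [← Germ.coe_smul]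
    congr 1
    funext z
    simp
  rw [Submodule.coe_sum, Finset.sum_congr rfl fun S _ => h1 S]
  have h2 := (map_sum (Germ.coeAddHom (𝓝[arrCompl x] (0 : Fin n → ℂ)) (M := ℂ))
    (fun S : OrdTuple x => fun z => (c S : ℂ) * logCoeff S.forms z) Finset.univ).symm
  refine h2.trans ?_
  change ((∑ S : OrdTuple x, fun z => (c S : ℂ) * logCoeff S.forms z : (Fin n → ℂ) → ℂ) :
    Germ (𝓝[arrCompl x] (0 : Fin n → ℂ)) ℂ) = _
  congr 1
  funext z
  rw [Finset.sum_apply]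

/-- Linear relations between logarithmic forms hold on the whole complement. -/
lemma sum_logCoeff_eq_zero {c : OrdTuple x → ℤ} (h : ∑ S, c S • logForm S = 0) {z : Fin n → ℂ}
    (hz : z ∈ arrCompl x) : ∑ S : OrdTuple x, (c S : ℂ) * logCoeff S.forms z = 0 := by
  have h1 : (fun z => ∑ S : OrdTuple x, (c S : ℂ) * logCoeff S.forms z) =ᶠ[𝓝[arrCompl x] 0]
      fun _ => 0 := by
    refine Germ.coe_eq.1 ?_
    rw [← coe_sum_smul_logForm, h]
    rfl
  -- The relation is known for germs at `0`. The segment from `z` towards `0` enters every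
  -- neighbourhood of `0`, and homogeneity carries the relation back to `z`.
  have h2 : Tendsto (fun s : ℝ => (s : ℂ) • z) (𝓝[>] 0) (𝓝[arrCompl x] 0) := by
    refine tendsto_nhdsWithin_iff.2 ⟨?_, ?_⟩
    · have h3 : Continuous fun s : ℝ => (s : ℂ) • z := by fun_prop
      have h4 := h3.tendsto 0
      simp only [Complex.ofReal_zero, zero_smul] at h4
      exact h4.mono_left nhdsWithin_le_nhds
    · filter_upwards [self_mem_nhdsWithin] with s hs
      exact pos_smul_mem_arrCompl s hs z hz
  obtain ⟨s, h3, hs⟩ := ((h2.eventually h1).and self_mem_nhdsWithin).exists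
  have hs : 0 < s := hs
  have hs' : (s : ℂ) ≠ 0 := by exact_mod_cast hs.ne'
  have h4 : ∀ S : OrdTuple x, (c S : ℂ) * logCoeff S.forms ((s : ℂ) • z) =
      ((s : ℂ) ^ n)⁻¹ * ((c S : ℂ) * logCoeff S.forms z) := by
    intro S
    rw [← logCoeff_smul S hs' z]
    field_simp
  simp only [h4] at h3
  rw [← Finset.mul_sum] at h3
  exact (mul_eq_zero.1 h3).resolve_left (inv_ne_zero (pow_ne_zero _ hs'))

/-- A family of forms that satisfies the relations between the logarithmic forms comes from a
homomorphism. -/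
lemma exists_linearMap_of_relations (F : OrdTuple x → meroForms x)
    (h : ∀ c : OrdTuple x → ℤ, (∀ z ∈ arrCompl x,
      ∑ S : OrdTuple x, (c S : ℂ) * logCoeff S.forms z = 0) → ∑ S, c S • F S = 0) :
    ∃ q : OS x →ₗ[ℤ] meroForms x, ∀ S, q (logClass S) = F S := by
  classical
  set A : (OrdTuple x → ℤ) →ₗ[ℤ] meroForms x := Fintype.linearCombination ℤ logForm with hA
  set B : (OrdTuple x → ℤ) →ₗ[ℤ] meroForms x := Fintype.linearCombination ℤ F with hB
  have hrange : LinearMap.range A = OS x := Fintype.range_linearCombination ℤ logForm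
  -- `OS x` is the free group on the tuples modulo the relations between the `b(S)`; the family `F`
  -- satisfies them all, so its linear extension descends.
  have hker : LinearMap.ker A ≤ LinearMap.ker B := by
    intro c hc
    rw [LinearMap.mem_ker, hA, Fintype.linearCombination_apply] at hc
    rw [LinearMap.mem_ker, hB, Fintype.linearCombination_apply]
    exact h c fun z hz => sum_logCoeff_eq_zero hc hz
  set e := A.quotKerEquivRange with he
  set q := ((LinearMap.ker A).liftQ B hker) ∘ₗ e.symm.toLinearMap ∘ₗ
    (LinearEquiv.ofEq _ _ hrange.symm).toLinearMap with hq
  refine ⟨q, fun S => ?_⟩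
  have h1 : (LinearEquiv.ofEq _ _ hrange.symm) (logClass S) =
      e (Submodule.Quotient.mk (Pi.single S 1)) := by
    refine Subtype.ext ?_
    have h2 : A (Pi.single S 1) = logForm S := by
      rw [hA, Fintype.linearCombination_apply_single, one_smul]
    exact h2.symm
  rw [hq, LinearMap.comp_apply, LinearMap.comp_apply]
  change (LinearMap.ker A).liftQ B hker (e.symm ((LinearEquiv.ofEq _ _ hrange.symm) (logClass S))) = _
  rw [h1, LinearEquiv.symm_apply_apply, Submodule.liftQ_apply, hB,
    Fintype.linearCombination_apply_single, one_smul]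

lemma linearMap_ext_logClass {q q' : OS x →ₗ[ℤ] meroForms x}
    (h : ∀ S, q (logClass S) = q' (logClass S)) : q = q' := by
  refine LinearMap.ext fun β => ?_
  obtain ⟨β, hβ⟩ := β
  have hβ' := hβ
  induction hβ' using Submodule.span_induction with
  | mem β hβ' =>
    obtain ⟨S, rfl⟩ := hβ'
    exact h S
  | zero => exact (map_zero q).trans (map_zero q').symm
  | add β β' h1 h2 ih1 ih2 =>
    have h3 := congrArg₂ (· + ·) (ih1 h1) (ih2 h2)
    simp only [← map_add] at h3
    exact h3
  | smul k β h1 ih =>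
    have h3 := congrArg (k • ·) (ih h1)
    simp only [← map_smul] at h3
    exact h3

end Deformations

/-! ### The reproducing property of the diagonal class. -/

section Kernel

open MeasureTheory

variable {n : ℕ} {ι : Type*} [Fintype ι] {x : ι → Fin n → ℤ}

/-- The product of the inverses of the forms with indices in `s`. -/
def invProd (x : ι → Fin n → ℤ) (s : Multiset ι) (z : Fin n → ℂ) : ℂ :=
  (s.map fun i => (evC (x i) z)⁻¹).prod

lemma invProd_cons (i : ι) (s : Multiset ι) (z : Fin n → ℂ) :
    invProd x (i ::ₘ s) z = (evC (x i) z)⁻¹ * invProd x s z := by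
  simp [invProd]

lemma invProd_nsmul_univ (N : ℕ) (z : Fin n → ℂ) :
    invProd x (N • Finset.univ.val) z = (formsProd x z ^ N)⁻¹ := by
  rw [invProd, Multiset.map_nsmul, Multiset.prod_nsmul, ← inv_pow, formsProd, ← Finset.prod_inv_distrib]
  rfl

lemma analyticOnNhd_invProd (s : Multiset ι) : AnalyticOnNhd ℂ (invProd x s) (arrCompl x) := by
  induction s using Multiset.induction_on with
  | empty =>
    have : invProd x 0 = fun _ => 1 := by funext z; simp [invProd]
    rw [this]
    exact analyticOnNhd_const
  | cons i s ih =>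
    have : invProd x (i ::ₘ s) = fun z => (evC (x i) z)⁻¹ * invProd x s z :=
      funext fun z => invProd_cons i s z
    rw [this]
    exact fun z hz => ((analyticAt_evC _ _).inv (hz i)).mul (ih z hz)

/-- `invProd x s` as a meromorphic germ. -/
def invProdForm (x : ι → Fin n → ℤ) (s : Multiset ι) : meroForms x :=
  ⟨(invProd x s : Germ (𝓝[arrCompl x] 0) ℂ), by
    induction s using Multiset.induction_on with
    | empty =>
      have : invProd x 0 = fun _ => 1 := by funext z; simp [invProd]
      rw [this]
      exact coe_mem_meroForms analyticAt_const
    | cons i s ih =>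
      refine (congrArg (· ∈ meroForms x) ?_).mp
        (mul_div_mem_meroForms ih (G := fun _ => 1) analyticAt_const i)
      congr 1
      funext z
      rw [invProd_cons, one_div, mul_comm]⟩

/-- `J` itself may lie on hyperplanes: a form vanishing at `J` takes at `J - z` minus its value at
`z`, and the other forms remain nonzero near `J`. -/
lemma eventually_sub_mem_arrCompl (J : Fin n → ℂ) : ∀ᶠ z in 𝓝[arrCompl x] 0, J - z ∈ arrCompl x := by
  have h : ∀ i, ∀ᶠ z in 𝓝[arrCompl x] 0, evC (x i) (J - z) ≠ 0 := by
    intro i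
    by_cases hJ : evC (x i) J = 0
    · filter_upwards [self_mem_nhdsWithin] with z hz
      rw [evC_sub, hJ, zero_sub]
      exact neg_ne_zero.2 (hz i)
    · have h1 : Continuous fun z : Fin n → ℂ => evC (x i) (J - z) :=
        (continuous_evC _).comp (continuous_const.sub continuous_id)
      have h2 := h1.continuousAt (x := 0)
      have h3 : evC (x i) (J - 0) ≠ 0 := by rwa [sub_zero]
      exact (h2.eventually_ne h3).filter_mono nhdsWithin_le_nhds
  exact eventually_all.2 h

/-- The germ at `0` of `b(S)` at `J - z`. -/
def shiftForm (J : Fin n → ℂ) (S : OrdTuple x) : meroForms x :=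
  ⟨((fun z => logCoeff S.forms (J - z) : (Fin n → ℂ) → ℂ) : Germ (𝓝[arrCompl x] 0) ℂ), by
    classical
    -- A form vanishing at `J` contributes a pole along its hyperplane, the others a holomorphic
    -- factor; `G` rewrites both kinds with the denominator `x (S.1 k)`.
    set G : Fin n → (Fin n → ℂ) → ℂ := fun k z => if evC (x (S.1 k)) J = 0 then -1 else
      evC (x (S.1 k)) z * (evC (x (S.1 k)) (J - z))⁻¹ with hG
    have hGa : ∀ k, AnalyticAt ℂ (G k) 0 := by
      intro k
      by_cases hJ : evC (x (S.1 k)) J = 0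
      · have : G k = fun _ => -1 := funext fun z => if_pos hJ
        rw [this]
        exact analyticAt_const
      · have : G k = fun z => evC (x (S.1 k)) z * (evC (x (S.1 k)) (J - z))⁻¹ :=
          funext fun z => if_neg hJ
        rw [this]
        refine (analyticAt_evC _ _).mul (AnalyticAt.inv ?_ (by rwa [sub_zero]))
        have h1 : AnalyticAt ℂ (fun z : Fin n → ℂ => J - z) 0 := analyticAt_const.sub analyticAt_id
        exact (analyticAt_evC (x (S.1 k)) (J - 0)).comp_of_eq h1 rfl
    have h := prod_mem_meroForms (x := x) S.1 G hGa (F := fun _ => (formsDet S.forms : ℂ))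
      analyticAt_const
    refine (congrArg (· ∈ meroForms x) ?_).mp h
    refine Germ.coe_eq.2 ?_
    filter_upwards [self_mem_nhdsWithin] with z hz
    rw [logCoeff]
    congr 1
    refine Finset.prod_congr rfl fun k _ => ?_
    have hz : evC (x (S.1 k)) z ≠ 0 := hz _
    simp only [hG, OrdTuple.forms]
    split_ifs with hJ
    · rw [evC_sub, hJ, zero_sub, inv_neg, neg_div, one_div]
    · rw [mul_div_assoc, mul_comm, div_mul_cancel₀ _ hz]⟩

/-- Relations between the `b(S)` are identities on the entire complement and can be evaluated at `J
- z`. -/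
lemma exists_shiftMap (J : Fin n → ℂ) :
    ∃ q : OS x →ₗ[ℤ] meroForms x, ∀ S, q (logClass S) = shiftForm J S := by
  refine exists_linearMap_of_relations _ fun c hc => ?_
  have h1 : ∀ S : OrdTuple x, ((c S • shiftForm J S : meroForms x) : Germ (𝓝[arrCompl x] 0) ℂ) =
      ↑(fun z => (c S : ℂ) * logCoeff S.forms (J - z)) := by
    intro S
    rw [Submodule.coe_smul_of_tower]
    change (c S • ((fun z => logCoeff S.forms (J - z) : (Fin n → ℂ) → ℂ) :
      Germ (𝓝[arrCompl x] 0) ℂ)) = _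
    rw [← Germ.coe_smul]
    congr 1
    funext z
    simp
  refine Subtype.ext ?_
  rw [Submodule.coe_sum, Finset.sum_congr rfl fun S _ => h1 S]
  refine ((map_sum (Germ.coeAddHom (𝓝[arrCompl x] (0 : Fin n → ℂ)) (M := ℂ))
    (fun S : OrdTuple x => fun z => (c S : ℂ) * logCoeff S.forms (J - z)) Finset.univ).symm).trans ?_
  refine Germ.coe_eq.2 ?_
  filter_upwards [eventually_sub_mem_arrCompl J] with z hz
  rw [Finset.sum_apply]
  exact hc _ hz

/-- The homomorphism `b(S) ↦ b(S)(J - z)`. -/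
def shiftMap (J : Fin n → ℂ) : OS x →ₗ[ℤ] meroForms x := (exists_shiftMap J).choose

lemma shiftMap_logClass (J : Fin n → ℂ) (S : OrdTuple x) :
    shiftMap J (logClass S) = shiftForm J S := (exists_shiftMap J).choose_spec S

/-- A diagonal element. -/
def diagClass (hx : IsIntegralArrangement x) : OS x ⊗[ℤ] Homology (arrCompl x) n :=
  ∑ S ∈ (exists_isDualBasis' hx).choose, logClass S ⊗ₜ[ℤ] torusClass hx S

lemma isDiag_diagClass (hx : IsIntegralArrangement x) : IsDiag (diagClass hx) :=
  (exists_isDualBasis' hx).choose_spec.isDiagonalBasis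

/-- The pairing of the meromorphic germ `γ` with the image of the diagonal class under `q`. -/
def diagPairing (hx : IsIntegralArrangement x) (q : OS x →ₗ[ℤ] meroForms x) (γ : meroForms x) : ℂ :=
  tensorPairing hx γ (q.rTensor (Homology (arrCompl x) n) (diagClass hx))

lemma IsDualBasis.diagPairing_eq {hx : IsIntegralArrangement x} {DB : Finset (OrdTuple x)}
    (h : IsDualBasis hx DB) (q : OS x →ₗ[ℤ] meroForms x) (γ : meroForms x) :
    diagPairing hx q γ = ∑ S ∈ DB, pairing hx (meroMul γ (q (logClass S))) (torusClass hx S) :=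
  h.tensorPairing_diag q γ (isDiag_diagClass hx)

/-- A form that is small compared with `‖z‖⁻ⁿ` near `0` pairs trivially with all cycles. -/
lemma pairing_eq_zero_of_tendstoUniformlyOn (hx : IsIntegralArrangement x) {η : meroForms x}
    {h : (Fin n → ℂ) → ℂ} (hh : (η : Germ (𝓝[arrCompl x] 0) ℂ) = h)
    (hsmall : ∀ K ⊆ arrCompl x, IsCompact K →
      TendstoUniformlyOn (fun (s : ℝ) z => (s : ℂ) ^ n * h ((s : ℂ) • z)) 0 (𝓝[>] 0) K)
    (C : Homology (arrCompl x) n) : pairing hx η C = 0 := by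
  obtain ⟨c, rfl⟩ := homologyClass_surjective C
  obtain ⟨K, hKU, hK, hcK⟩ := exists_compact_smoothChains (Submodule.mem_inf.1 c.2).1
  obtain ⟨B, hB0, hB⟩ := exists_chainIntegral_bound hcK
  refine pairing_eq_of_tendsto hx η hh c ?_
  rw [← mul_zero (((2 * Real.pi * Complex.I) ^ n)⁻¹ : ℂ)]
  refine Tendsto.const_mul _ (Metric.tendsto_nhds.2 fun ε hε => ?_)
  have h1 : 0 < ε / (B + 1) := div_pos hε (by linarith)
  filter_upwards [Metric.tendstoUniformlyOn_iff.1 (hsmall K hKU hK) _ h1] with s hs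
  rw [dist_zero_right, chainIntegral_scale, ← chainIntegral_fun_const_mul]
  refine (hB _ _ h1.le fun z hz => ?_).trans_lt ?_
  · have := (hs z hz).le
    rwa [Pi.zero_apply, dist_zero_left] at this
  · rw [mul_div_assoc', div_lt_iff₀ (by linarith)]
    nlinarith

/-- `b(T)` is invariant under homotheties, so a factor tending to `0` at the origin makes the
integrals over contracted cycles tend to `0`. -/
lemma pairing_logForm_mul_eq_zero (hx : IsIntegralArrangement x) (T : OrdTuple x)
    {G : (Fin n → ℂ) → ℂ} (hG : ContinuousAt G 0) (hG0 : G 0 = 0) {η : meroForms x}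
    (hη : (η : Germ (𝓝[arrCompl x] 0) ℂ) = ↑(fun z => logCoeff T.forms z * G z))
    (C : Homology (arrCompl x) n) : pairing hx η C = 0 := by
  refine pairing_eq_zero_of_tendstoUniformlyOn hx hη (fun K hKU hK => ?_) C
  obtain ⟨B, hB⟩ := hK.exists_bound_of_continuousOn
    ((analyticOnNhd_logCoeff T).continuousOn.mono hKU)
  obtain ⟨R, hR⟩ := hK.exists_bound_of_continuousOn (f := id) continuousOn_id
  rw [Metric.tendstoUniformlyOn_iff]
  intro ε hε
  have h1 : 0 < ε / (|B| + 1) := by positivity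
  obtain ⟨δ, hδ, hδG⟩ := Metric.continuousAt_iff.1 hG _ h1
  have h2 : ∀ᶠ s : ℝ in 𝓝[>] 0, s * (|R| + 1) < δ := by
    have : Tendsto (fun s : ℝ => s * (|R| + 1)) (𝓝 0) (𝓝 (0 * (|R| + 1))) :=
      tendsto_id.mul_const _
    rw [zero_mul] at this
    exact (this.eventually_lt_const hδ).filter_mono nhdsWithin_le_nhds
  filter_upwards [h2, self_mem_nhdsWithin] with s hs hs0 z hz
  have hs0 : 0 < s := hs0
  have hs' : (s : ℂ) ≠ 0 := by exact_mod_cast hs0.ne'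
  rw [Pi.zero_apply, dist_zero_left, ← mul_assoc, logCoeff_smul T hs', norm_mul]
  have h3 : ‖G ((s : ℂ) • z)‖ < ε / (|B| + 1) := by
    have h4 := @hδG ((s : ℂ) • z) (by
      rw [dist_zero_right, norm_smul, Complex.norm_real, Real.norm_of_nonneg hs0.le]
      have h5 : ‖z‖ ≤ R := hR z hz
      have h6 := le_abs_self R
      nlinarith)
    rwa [hG0, dist_zero_right] at h4
  calc ‖logCoeff T.forms z‖ * ‖G ((s : ℂ) • z)‖ ≤ |B| * (ε / (|B| + 1)) := by
        have := (hB z hz).trans (le_abs_self B)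
        gcongr
    _ < ε := by
        rw [mul_div_assoc', div_lt_iff₀ (by positivity)]
        nlinarith

lemma diagPairing_smul (hx : IsIntegralArrangement x) (q : OS x →ₗ[ℤ] meroForms x) (c : ℂ)
    (γ : meroForms x) : diagPairing hx q (c • γ) = c * diagPairing hx q γ := by
  obtain ⟨DB, h⟩ := exists_isDualBasis' hx
  rw [h.diagPairing_eq, h.diagPairing_eq, Finset.mul_sum]
  refine Finset.sum_congr rfl fun S _ => ?_
  rw [← pairing_smul]
  congr 2
  refine Subtype.ext ?_
  obtain ⟨f, hf⟩ := exists_rep γ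
  obtain ⟨g, hg⟩ := exists_rep (q (logClass S))
  rw [coe_meroMul, Submodule.coe_smul, Submodule.coe_smul, coe_meroMul, hf, hg]
  exact congrArg (fun F : (Fin n → ℂ) → ℂ => (F : Germ (𝓝[arrCompl x] 0) ℂ))
    (funext fun z => mul_assoc c (f z) (g z))

/-- The reproducing property for logarithmic forms. -/
lemma diagPairing_shiftMap_logForm (hx : IsIntegralArrangement x) {J : Fin n → ℂ}
    (hJ : J ∈ arrCompl x) (T : OrdTuple x) :
    diagPairing hx (shiftMap J) (logForm T) = logCoeff T.forms J := by
  classical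
  obtain ⟨DB, h⟩ := exists_isDualBasis' hx
  rw [h.diagPairing_eq]
  -- As `J` is off the hyperplanes, `b(S)(J - z)` is regular at `z = 0`, and against `b(T)` only its
  -- value at `z = 0` counts.
  have h1 : ∀ S, pairing hx (meroMul (logForm T) (shiftMap J (logClass S))) (torusClass hx S) =
      logCoeff S.forms J * pairing hx (logForm T) (torusClass hx S) := by
    intro S
    rw [shiftMap_logClass]
    have hcont : ContinuousAt (fun z => logCoeff S.forms (J - z) - logCoeff S.forms J) 0 := by
      have h2 : ContinuousAt (logCoeff S.forms) (J - 0) := by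
        rw [sub_zero]
        exact (analyticOnNhd_logCoeff S J hJ).continuousAt
      have h3 : ContinuousAt (fun z : Fin n → ℂ => J - z) 0 :=
        (continuous_const.sub continuous_id).continuousAt
      exact (ContinuousAt.comp (g := logCoeff S.forms) h2 h3).sub continuousAt_const
    have h4 := pairing_logForm_mul_eq_zero hx T hcont (by simp)
      (η := meroMul (logForm T) (shiftForm J S) - logCoeff S.forms J • logForm T) (by
        rw [Submodule.coe_sub, coe_meroMul, Submodule.coe_smul]
        refine Germ.coe_eq.2 (Eventually.of_forall fun z => ?_)
        change logCoeff T.forms z * logCoeff S.forms (J - z) -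
          logCoeff S.forms J * logCoeff T.forms z = _
        ring) (torusClass hx S)
    rw [map_sub, LinearMap.sub_apply, pairing_smul, sub_eq_zero] at h4
    exact h4
  rw [Finset.sum_congr rfl fun S _ => h1 S]
  obtain ⟨k, hk, hk'⟩ := h.exists_eq_sum (logClass T)
  have hk : logForm T = ∑ S ∈ DB, k S • logForm S := hk
  have hk' : ∀ S ∈ DB, pairing hx (logForm T) (torusClass hx S) = k S := hk'
  -- The expansion of `b(T)` in the dual basis, written as a relation so that it can be evaluated at
  -- `J`.
  have h5 : ∑ S, ((if S = T then 1 else 0) - if S ∈ DB then k S else 0) • logForm S = 0 := by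
    simp only [sub_smul, ite_smul, one_smul, zero_smul, Finset.sum_sub_distrib, Finset.sum_ite_eq',
      Finset.mem_univ, if_true, Finset.sum_ite_mem, Finset.univ_inter]
    rw [← hk, sub_self]
  have h6 := sum_logCoeff_eq_zero h5 hJ
  push_cast at h6
  simp only [sub_mul, ite_mul, one_mul, zero_mul, Finset.sum_sub_distrib, Finset.sum_ite_eq',
    Finset.mem_univ, if_true, Finset.sum_ite_mem, Finset.univ_inter] at h6
  rw [sub_eq_zero.1 h6]
  exact Finset.sum_congr rfl fun S hS => by rw [hk' S hS, mul_comm]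

set_option maxHeartbeats 400000 in
/-- A torus integral that vanishes because the last radius may be sent to infinity. -/
lemma pairing_torusClass_eq_zero (hx : IsIntegralArrangement x) (S : OrdTuple x) {K : Fin n}
    (hK : ∀ l, l ≤ K) (J : Fin n → ℂ) {i' : ι} (hi' : formCoeffs S (x i') K ≠ 0)
    (s : Multiset ι) {η : meroForms x}
    (hη : (η : Germ (𝓝[arrCompl x] 0) ℂ) = ↑(fun z => invProd x (S.1 K ::ₘ i' ::ₘ s) z *
      ((formsDet S.forms : ℂ) * ∏ l ∈ Finset.univ.erase K, (evC (S.forms l) (J - z))⁻¹))) :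
    pairing hx η (torusClass hx S) = 0 := by
  classical
  obtain ⟨ε, hε, hεJ⟩ : ∃ ε > 0, ∀ l, evC (S.forms l) J ≠ 0 → ε ≤ ‖evC (S.forms l) J‖ := by
    have h1 : ∀ᶠ ε : ℝ in 𝓝[>] 0, ∀ l, evC (S.forms l) J ≠ 0 → ε ≤ ‖evC (S.forms l) J‖ :=
      eventually_all.2 fun l => by
        by_cases h : evC (S.forms l) J = 0
        · exact Eventually.of_forall fun _ h' => absurd h h'
        · filter_upwards [(eventually_le_nhds (norm_pos_iff.2 h)).filter_mono nhdsWithin_le_nhds]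
            with ε hε _ using hε
    obtain ⟨ε, h2, h3⟩ := (h1.and self_mem_nhdsWithin).exists
    exact ⟨ε, h3, h2⟩
  -- All coordinates except the last are kept below `ε`, which keeps the forms `x_l(J - z)`, `l ≠
  -- K`, away from `0`. No bound is put on the last coordinate.
  set W : Set (Fin n → ℂ) := {z | ∀ l, l ≠ K → ‖evC (S.forms l) z‖ < ε} with hW
  have hWo : IsOpen W := by
    have : W = ⋂ l, {z | l ≠ K → ‖evC (S.forms l) z‖ < ε} := by
      ext z
      simp [hW]
    rw [this]
    refine isOpen_iInter_of_finite fun l => ?_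
    by_cases hl : l = K
    · simp [hl]
    · simp only [hl, ne_eq, not_false_eq_true, true_imp_iff]
      exact isOpen_lt (continuous_evC _).norm continuous_const
  have hne : ∀ z ∈ arrCompl x ∩ W, ∀ l ∈ Finset.univ.erase K, evC (S.forms l) (J - z) ≠ 0 := by
    intro z hz l hl
    have hl := Finset.ne_of_mem_erase hl
    rw [evC_sub]
    by_cases hJ : evC (S.forms l) J = 0
    · rw [hJ, zero_sub]
      exact neg_ne_zero.2 (hz.1 _)
    · intro h
      have h1 := hεJ l hJ
      rw [sub_eq_zero.1 h] at h1
      exact absurd (hz.2 l hl) (not_lt.2 h1)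
  have han : AnalyticOnNhd ℂ (fun z => invProd x (S.1 K ::ₘ i' ::ₘ s) z *
      ((formsDet S.forms : ℂ) * ∏ l ∈ Finset.univ.erase K, (evC (S.forms l) (J - z))⁻¹))
      (arrCompl x ∩ W) := by
    intro z hz
    refine (analyticOnNhd_invProd _ z hz.1).mul (analyticAt_const.mul
      (Finset.analyticAt_fun_prod _ fun l hl => AnalyticAt.inv ?_ (hne z hz l hl)))
    have h1 : AnalyticAt ℂ (fun z : Fin n → ℂ => J - z) z := analyticAt_const.sub analyticAt_id
    exact (analyticAt_evC (S.forms l) (J - z)).comp_of_eq h1 rfl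
  obtain ⟨ρ, hρ, hρε⟩ : ∃ ρ ∈ torusDomain S, ∀ l, ρ l < ε := by
    obtain ⟨δ, hδ⟩ := (eventually_pow_mem_torusDomain hx S).exists
    set ρ : Fin n → ℝ := fun k : Fin n => δ ^ (n - 1 - (k : ℕ)) with hρdef
    have h1 : ∀ᶠ σ : ℝ in 𝓝[>] 0, ∀ l, (σ • ρ) l < ε := eventually_all.2 fun l => by
      have : Tendsto (fun σ : ℝ => (σ • ρ) l) (𝓝 0) (𝓝 (0 * ρ l)) := tendsto_id.mul_const (ρ l)
      rw [zero_mul] at this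
      exact (this.eventually_lt_const hε).filter_mono nhdsWithin_le_nhds
    obtain ⟨σ, h2, h3⟩ := (h1.and self_mem_nhdsWithin).exists
    exact ⟨σ • ρ, smul_mem_torusDomain S hδ h3, h2⟩
  choose L hL hlt using hρ.2
  set c : ι → ℝ := fun i => ‖formCoeffs S (x i) (L i)‖ * ρ (L i) -
    ∑ q ∈ Finset.Iio (L i), ‖formCoeffs S (x i) q‖ * ρ q with hc
  have hcpos : ∀ i, 0 < c i := fun i => sub_pos.2 (hlt i)
  -- Only the last radius grows. Forms that involve the last coordinate are bounded below by
  -- multiples of `r`; the others keep their bounds.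
  set ρr : ℝ → Fin n → ℝ := fun r q => if q = K then r * ρ q else ρ q with hρr
  have hpos : ∀ r : ℝ, 1 ≤ r → ∀ q, 0 < ρr r q := by
    intro r hr q
    simp only [hρr]
    split_ifs
    · exact mul_pos (by linarith) (hρ.1 q)
    · exact hρ.1 q
  have hlow : ∀ r : ℝ, 1 ≤ r → ∀ i, (if L i = K then r * c i else c i) ≤
      ‖formCoeffs S (x i) (L i)‖ * ρr r (L i) -
        ∑ q ∈ Finset.Iio (L i), ‖formCoeffs S (x i) q‖ * ρr r q := by
    intro r hr i
    have h1 : ∑ q ∈ Finset.Iio (L i), ‖formCoeffs S (x i) q‖ * ρr r q =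
        ∑ q ∈ Finset.Iio (L i), ‖formCoeffs S (x i) q‖ * ρ q := by
      refine Finset.sum_congr rfl fun q hq => ?_
      have : q ≠ K := ((Finset.mem_Iio.1 hq).trans_le (hK (L i))).ne
      simp only [hρr, if_neg this]
    rw [h1]
    have h2 : 0 ≤ ∑ q ∈ Finset.Iio (L i), ‖formCoeffs S (x i) q‖ * ρ q :=
      Finset.sum_nonneg fun q _ => mul_nonneg (norm_nonneg _) (hρ.1 q).le
    split_ifs with hi
    · simp only [hc, hρr, if_pos hi]
      nlinarith
    · simp only [hc, hρr, if_neg hi]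
      exact le_rfl
  have hlow' : ∀ r : ℝ, 1 ≤ r → ∀ i, 0 < (if L i = K then r * c i else c i) := by
    intro r hr i
    split_ifs
    · exact mul_pos (by linarith) (hcpos i)
    · exact hcpos i
  have hdom : ∀ r : ℝ, 1 ≤ r → ρr r ∈ torusDomain S := fun r hr =>
    ⟨hpos r hr, fun i => ⟨L i, hL i, by linarith [hlow r hr i, hlow' r hr i]⟩⟩
  have hi'K : L i' = K := by
    by_contra h
    exact hi' (hL i' K (lt_of_le_of_ne (hK _) h))
  set d : Fin n → ℝ := fun l => if evC (S.forms l) J = 0 then ρ l else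
    ‖evC (S.forms l) J‖ - ρ l with hd
  have hdpos : ∀ l, 0 < d l := by
    intro l
    simp only [hd]
    split_ifs with h
    · exact hρ.1 l
    · linarith [hεJ l h, hρε l]
  set v := pairing hx η (torusClass hx S) with hv
  set A : ℝ := (ρ K)⁻¹ * ((c i')⁻¹ * (s.map fun i => (c i)⁻¹).prod) *
    (‖(formsDet S.forms : ℂ)‖ * ∏ l ∈ Finset.univ.erase K, (d l)⁻¹) * ∏ q, ρ q with hA
  -- The inverses of the last form of `S` and of `x i'` give `r⁻²`, the product of the coordinates
  -- gives `r`, and all other factors stay bounded. Hence the decay `r⁻¹`.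
  have hbound : ∀ r : ℝ, 1 ≤ r → ‖v‖ ≤ (‖(formsDet S.forms : ℂ)⁻¹‖ * A) * r⁻¹ := by
    intro r hr
    have hr0 : 0 < r := by linarith
    have h1 := pairing_torusClass hx η hη hWo han S (hdom r hr) (by
      rintro σ ⟨hσ0, hσ1⟩ u l hl
      have h2 : evC (S.forms l) (radTorus S (ρr r) u) = polar (ρr r) (fun k => (u k : ℝ)) l :=
        evC_inv_mulVec S _ l
      rw [evC_smul, h2, norm_mul, norm_polar, abs_of_pos (hpos r hr l), Complex.norm_real,
        Real.norm_of_nonneg hσ0.le]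
      have h3 : ρr r l = ρ l := if_neg hl
      rw [h3]
      nlinarith [hρε l, hρ.1 l])
    rw [hv, h1, norm_mul, mul_assoc]
    refine mul_le_mul_of_nonneg_left ?_ (norm_nonneg _)
    rw [torusAvg]
    have hpt : ∀ u : Fin n → ℝ, ‖invProd x (S.1 K ::ₘ i' ::ₘ s)
          ((formsMatrix S.forms)⁻¹.mulVec (polar (ρr r) u)) *
        ((formsDet S.forms : ℂ) * ∏ l ∈ Finset.univ.erase K, (evC (S.forms l)
          (J - (formsMatrix S.forms)⁻¹.mulVec (polar (ρr r) u)))⁻¹) *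
        ∏ q, polar (ρr r) u q‖ ≤ A * r⁻¹ := by
      intro u
      set z := (formsMatrix S.forms)⁻¹.mulVec (polar (ρr r) u) with hz
      have hw : ∀ q, ‖polar (ρr r) u q‖ = ρr r q := fun q => by
        rw [norm_polar, abs_of_pos (hpos r hr q)]
      have hzl : ∀ l, evC (S.forms l) z = polar (ρr r) u l := fun l => evC_inv_mulVec S _ l
      have h2 : ∀ i, ‖(evC (x i) z)⁻¹‖ ≤ (if L i = K then r * c i else c i)⁻¹ := by
        intro i
        have h3 := (hlow r hr i).trans (Dominates.lower_bound (hL i) hw)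
        rw [hz, evC_mulVec_inv, norm_inv]
        exact inv_anti₀ (hlow' r hr i) h3
      have h2' : ∀ i, ‖(evC (x i) z)⁻¹‖ ≤ (c i)⁻¹ := by
        intro i
        refine (h2 i).trans (inv_anti₀ (hcpos i) ?_)
        split_ifs
        · nlinarith [hcpos i]
        · exact le_rfl
      have h4 : ‖invProd x s z‖ ≤ (s.map fun i => (c i)⁻¹).prod := by
        clear hη han h1 hA
        induction s using Multiset.induction_on with
        | empty => simp [invProd]
        | cons i s ih =>
          rw [invProd_cons, norm_mul, Multiset.map_cons, Multiset.prod_cons]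
          exact mul_le_mul (h2' i) ih (norm_nonneg _) (inv_nonneg.2 (hcpos i).le)
      have h5 : ‖(evC (x (S.1 K)) z)⁻¹‖ = r⁻¹ * (ρ K)⁻¹ := by
        have h6 := hzl K
        rw [OrdTuple.forms] at h6
        rw [h6, norm_inv, hw]
        simp only [hρr, if_true, mul_inv]
      have h7 : ‖(evC (x i') z)⁻¹‖ ≤ r⁻¹ * (c i')⁻¹ := by
        have := h2 i'
        rwa [if_pos hi'K, mul_inv] at this
      have h8 : ∏ q, ρr r q = r * ∏ q, ρ q := by
        rw [← Finset.mul_prod_erase _ _ (Finset.mem_univ K),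
          ← Finset.mul_prod_erase _ ρ (Finset.mem_univ K), ← mul_assoc]
        congr 1
        · simp only [hρr, if_true]
        · exact Finset.prod_congr rfl fun l hl => if_neg (Finset.ne_of_mem_erase hl)
      have h9 : ∏ l ∈ Finset.univ.erase K, ‖(evC (S.forms l) (J - z))⁻¹‖ ≤
          ∏ l ∈ Finset.univ.erase K, (d l)⁻¹ := by
        refine Finset.prod_le_prod (fun _ _ => norm_nonneg _) fun l hl => ?_
        rw [norm_inv]
        refine inv_anti₀ (hdpos l) ?_
        have h10 : ‖evC (S.forms l) z‖ = ρ l := by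
          rw [hzl, hw]
          exact if_neg (Finset.ne_of_mem_erase hl)
        rw [evC_sub]
        simp only [hd]
        split_ifs with h
        · rw [h, zero_sub, norm_neg, h10]
        · have := norm_sub_norm_le (evC (S.forms l) J) (evC (S.forms l) z)
          rwa [h10] at this
      rw [norm_mul, norm_mul, norm_mul, norm_prod, norm_prod, Finset.prod_congr rfl fun q _ => hw q,
        h8, invProd_cons, invProd_cons, norm_mul, norm_mul, h5]
      have hρ0 : 0 ≤ ∏ q, ρ q := Finset.prod_nonneg fun q _ => (hρ.1 q).le
      have hρK := inv_nonneg.2 (hρ.1 K).le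
      have hci := inv_nonneg.2 (hcpos i').le
      have hr1 := inv_nonneg.2 hr0.le
      have h11 : A * r⁻¹ = r⁻¹ * (ρ K)⁻¹ * ((r⁻¹ * (c i')⁻¹) * (s.map fun i => (c i)⁻¹).prod) *
            (‖(formsDet S.forms : ℂ)‖ * ∏ l ∈ Finset.univ.erase K, (d l)⁻¹) * (r * ∏ q, ρ q) := by
        calc A * r⁻¹ = A * r⁻¹ * (r⁻¹ * r) := by rw [inv_mul_cancel₀ hr0.ne', mul_one]
          _ = _ := by rw [hA]; ring
      have h12 : 0 ≤ ‖(formsDet S.forms : ℂ)‖ *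
          ∏ l ∈ Finset.univ.erase K, ‖(evC (S.forms l) (J - z))⁻¹‖ :=
        mul_nonneg (norm_nonneg _) (Finset.prod_nonneg fun l _ => norm_nonneg _)
      rw [h11]
      refine mul_le_mul_of_nonneg_right (mul_le_mul ?_ (mul_le_mul_of_nonneg_left h9 (norm_nonneg _))
        h12 ?_) (mul_nonneg hr0.le hρ0)
      · exact mul_le_mul_of_nonneg_left (mul_le_mul h7 h4 (norm_nonneg _) (mul_nonneg hr1 hci))
          (mul_nonneg hr1 hρK)
      · exact mul_nonneg (mul_nonneg hr1 hρK) (mul_nonneg (mul_nonneg hr1 hci)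
          ((norm_nonneg _).trans h4))
    have h8 := norm_setIntegral_le_of_norm_le_const (μ := volume) (s := Icc (0 : Fin n → ℝ) 1)
      (by rw [Real.volume_Icc_pi]; simp) (fun u _ => hpt u)
    have h9 : (volume : Measure (Fin n → ℝ)).real (Icc 0 1) = 1 := by
      rw [Measure.real, Real.volume_Icc_pi]; simp
    rwa [h9, mul_one] at h8
  have hlim : Tendsto (fun r : ℝ => (‖(formsDet S.forms : ℂ)⁻¹‖ * A) * r⁻¹) atTop (𝓝 0) := by
    have := tendsto_inv_atTop_zero (𝕜 := ℝ) |>.const_mul (‖(formsDet S.forms : ℂ)⁻¹‖ * A)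
    rwa [mul_zero] at this
  have : ‖v‖ ≤ 0 := ge_of_tendsto hlim (by
    filter_upwards [eventually_ge_atTop (1 : ℝ)] with r hr using hbound r hr)
  exact norm_le_zero_iff.1 this

/-- The functional `γ ↦ diagPairing hx (shiftMap J) γ` is multiplicative with respect to the
form `x i`. -/
lemma diagPairing_shiftMap_cons (hx : IsIntegralArrangement x) {K : Fin n} (hK : ∀ l, l ≤ K)
    (J : Fin n → ℂ) (i : ι) (s : Multiset ι)
    (hs : ∀ S : OrdTuple x, S.1 K = i → ∃ i' ∈ s, formCoeffs S (x i') K ≠ 0) :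
    diagPairing hx (shiftMap J) (invProdForm x s) =
      evC (x i) J * diagPairing hx (shiftMap J) (invProdForm x (i ::ₘ s)) := by
  classical
  -- The diagonal pairing can be computed in any dual basis; it is taken with all tuples ending in
  -- `i`, so that `x i` is the last coordinate of each torus.
  obtain ⟨DB, h, hDB⟩ := exists_isDualBasis hx i
  rw [h.diagPairing_eq, h.diagPairing_eq, Finset.mul_sum]
  refine Finset.sum_congr rfl fun S hS => ?_
  have hSK : S.1 K = i := hDB S hS K hK
  obtain ⟨i', hi's, hi'⟩ := hs S hSK
  obtain ⟨s', rfl⟩ := Multiset.exists_cons_of_mem hi's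
  -- Since `x_i(J) = x_i(J - z) + x_i(z)`, the difference of the two integrands acquires a factor
  -- `x_i(J - z)`, which cancels the last factor of `b(S)(J - z)`. No pole obstructs the growth of
  -- the last radius any more.
  rw [← pairing_smul, shiftMap_logClass, eq_comm, ← sub_eq_zero, ← LinearMap.sub_apply, ← map_sub]
  refine pairing_torusClass_eq_zero hx S hK J hi' s' ?_
  rw [Submodule.coe_sub, Submodule.coe_smul, coe_meroMul, coe_meroMul]
  refine Germ.coe_eq.2 ?_
  filter_upwards [eventually_sub_mem_arrCompl J, self_mem_nhdsWithin] with z hz hzU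
  have h1 : evC (x i) (J - z) ≠ 0 := hz i
  have h2 : evC (x i) z ≠ 0 := hzU i
  have h4 : evC (x i) J = evC (x i) (J - z) + evC (x i) z := by rw [evC_sub]; ring
  change evC (x i) J * (invProd x (i ::ₘ i' ::ₘ s') z * logCoeff S.forms (J - z)) -
    invProd x (i' ::ₘ s') z * logCoeff S.forms (J - z) = _
  rw [logCoeff, ← Finset.mul_prod_erase _ _ (Finset.mem_univ K), hSK, invProd_cons i]
  simp only [OrdTuple.forms, hSK]
  rw [h4]
  field_simp
  ring

/-- Induction on the additional factors, starting from a multiple of `b(T)`. The `n` independent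
forms of `T` remain in the product throughout: in the coordinates of any tuple at least one of them
involves the last coordinate, as the decay at infinity requires. -/
lemma diagPairing_shiftMap_invProdForm (hx : IsIntegralArrangement x) {J : Fin n → ℂ}
    (hJ : J ∈ arrCompl x) (T : OrdTuple x) (s : Multiset ι) :
    diagPairing hx (shiftMap J) (invProdForm x (s + Finset.univ.val.map T.1)) =
      invProd x (s + Finset.univ.val.map T.1) J := by
  induction s using Multiset.induction_on with
  | empty =>
    have h1 : ∀ z, invProd x (Finset.univ.val.map T.1) z =
        (formsDet T.forms : ℂ)⁻¹ * logCoeff T.forms z := by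
      intro z
      rw [invProd, Multiset.map_map, logCoeff, ← mul_assoc, inv_mul_cancel₀ (formsDet_ne_zero T),
        one_mul]
      rfl
    have h2 : invProdForm x (Finset.univ.val.map T.1) = (formsDet T.forms : ℂ)⁻¹ • logForm T := by
      refine Subtype.ext ?_
      rw [Submodule.coe_smul]
      exact congrArg (fun f : (Fin n → ℂ) → ℂ => (f : Germ (𝓝[arrCompl x] 0) ℂ)) (funext h1)
    rw [zero_add, h2, diagPairing_smul, diagPairing_shiftMap_logForm hx hJ, h1]
  | cons i s ih =>
    have hJi : evC (x i) J ≠ 0 := hJ i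
    obtain ⟨K, hK⟩ : ∃ K : Fin n, ∀ l, l ≤ K := by
      cases n with
      | zero => exact absurd (Subsingleton.elim _ _) (hx.ne_zero i)
      | succ m => exact ⟨Fin.last m, Fin.le_last⟩
    have h1 := diagPairing_shiftMap_cons hx hK J i (s + Finset.univ.val.map T.1) (by
      intro S hS
      by_contra! hcon
      have h2 := formCoeffs_trans S T (x i) K
      rw [← hS, formCoeffs_self, if_pos rfl, Finset.sum_eq_zero] at h2
      · exact one_ne_zero h2
      · intro p _
        rw [hcon _ (Multiset.mem_add.2 (Or.inr (Multiset.mem_map_of_mem _ (Finset.mem_univ p)))),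
          mul_zero])
    rw [ih] at h1
    rw [Multiset.cons_add, invProd_cons, h1]
    field_simp

/-- The reproducing property of the diagonal class. -/
theorem diagPairing_shiftMap_pow (hx : IsIntegralArrangement x) {N : ℕ} (hN : 1 ≤ N)
    (J : Fin n → ℂ) [Decidable (J ∈ arrCompl x)] :
    diagPairing hx (shiftMap J) (invProdForm x (N • Finset.univ.val)) =
      if J ∈ arrCompl x then (formsProd x J ^ N)⁻¹ else 0 := by
  split_ifs with hJ
  · obtain ⟨T⟩ := exists_ordTuple hx
    have h1 : Finset.univ.val.map T.1 ≤ N • (Finset.univ : Finset ι).val := by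
      have h2 : Finset.univ.val.map T.1 ≤ (Finset.univ : Finset ι).val := by
        rw [Multiset.le_iff_subset (Multiset.Nodup.map T.injective Finset.univ.nodup)]
        exact fun i _ => Finset.mem_univ i
      calc _ ≤ 1 • (Finset.univ : Finset ι).val := by rwa [one_smul]
        _ ≤ _ := nsmul_le_nsmul_left (Multiset.zero_le _) hN
    obtain ⟨s, hs⟩ := Multiset.le_iff_exists_add.1 h1
    rw [← invProd_nsmul_univ, hs, add_comm]
    exact diagPairing_shiftMap_invProdForm hx hJ T s
  -- `J` lies on the hyperplane of some `x i`. One multiplicativity step with this form gives the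
  -- factor `x_i(J) = 0`; as `N ≥ 1`, the product already contains `x i`, which provides the second
  -- factor involving the last coordinate.
  · simp only [arrCompl, mem_ofPred_eq, not_forall, not_not] at hJ
    obtain ⟨i, hi⟩ := hJ
    obtain ⟨K, hK⟩ : ∃ K : Fin n, ∀ l, l ≤ K := by
      cases n with
      | zero => exact absurd (Subsingleton.elim _ _) (hx.ne_zero i)
      | succ m => exact ⟨Fin.last m, Fin.le_last⟩
    have h1 := diagPairing_shiftMap_cons hx hK J i (N • Finset.univ.val) (by
      intro S hS
      refine ⟨i, Multiset.mem_nsmul.2 ⟨by omega, Finset.mem_univ i⟩, ?_⟩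
      rw [← hS, formCoeffs_self, if_pos rfl]
      exact one_ne_zero)
    rw [h1, hi, zero_mul]

end Kernel

/-! ### Uniqueness of Fourier coefficients on a unit box. -/

section FourierUniqueness

open MeasureTheory

/-- The Haar probability measure on the unit circle. -/
abbrev circleMeasureSpace : MeasureSpace UnitAddCircle := ⟨AddCircle.haarAddCircle⟩

attribute [local instance] circleMeasureSpace

lemma circleProbability : IsProbabilityMeasure (volume : Measure UnitAddCircle) :=
  inferInstanceAs (IsProbabilityMeasure AddCircle.haarAddCircle)

attribute [local instance] circleProbability

variable {n : ℕ}

lemma ae_eq_zero_of_mFourierCoeff {F : UnitAddTorus (Fin n) → ℂ} (hF : MemLp F 2 volume)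
    (h : ∀ j, UnitAddTorus.mFourierCoeff F j = 0) : F =ᵐ[volume] 0 := by
  have h1 : hF.toLp = 0 := by
    apply UnitAddTorus.mFourierBasis.repr.injective
    rw [map_zero]
    ext j
    rw [UnitAddTorus.mFourierBasis_repr]
    refine Eq.trans ?_ (h j)
    refine integral_congr_ae ?_
    filter_upwards [hF.coeFn_toLp] with t ht
    rw [ht]
  have h2 := hF.coeFn_toLp
  rw [h1] at h2
  exact h2.symm.trans (Lp.coeFn_zero _ _ _)

/-- The half open unit box with lower corner `a`. -/
def unitBox (a : Fin n → ℝ) : Set (Fin n → ℝ) := {t | ∀ i, t i ∈ Ioc (a i) (a i + 1)}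

lemma measurableSet_unitBox (a : Fin n → ℝ) : MeasurableSet (unitBox a) :=
  MeasurableSet.univ_pi' fun _ => measurableSet_Ioc

lemma volume_unitBox (a : Fin n → ℝ) : volume (unitBox a) = 1 := by
  have : unitBox a = Set.univ.pi fun i => Ioc (a i) (a i + 1) := by ext; simp [unitBox]
  rw [this, Real.volume_pi_Ioc]
  simp

lemma mFourier_coe (j : Fin n → ℤ) (t : Fin n → ℝ) :
    UnitAddTorus.mFourier (-j) (fun i => (t i : UnitAddCircle)) =
      Complex.exp (-pair t (twoPiI j)) := by
  simp only [UnitAddTorus.mFourier, ContinuousMap.coe_mk, fourier_coe_apply, pair, twoPiI]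
  rw [← Complex.exp_sum, ← Finset.sum_neg_distrib]
  congr 1
  refine Finset.sum_congr rfl fun i _ => ?_
  simp only [Pi.neg_apply]
  push_cast
  ring

/-- A bounded function on the unit box is determined by its Fourier coefficients. -/
theorem ae_eq_zero_of_fourier (a : Fin n → ℝ) {g : (Fin n → ℝ) → ℂ} (hg : Measurable g) {B : ℝ}
    (hB : ∀ t ∈ unitBox a, ‖g t‖ ≤ B)
    (h : ∀ j : Fin n → ℤ, ∫ t in unitBox a, Complex.exp (-pair t (twoPiI j)) * g t = 0) :
    ∀ᵐ t ∂volume.restrict (unitBox a), g t = 0 := by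
  set F : UnitAddTorus (Fin n) → ℂ := fun t => g (UnitAddTorus.measurableEquivPiIoc a t).1 with hF
  have hFm : Measurable F :=
    hg.comp (measurable_subtype_coe.comp (UnitAddTorus.measurableEquivPiIoc a).measurable)
  have hFc : ∀ t ∈ unitBox a, F (fun i => (t i : UnitAddCircle)) = g t := by
    intro t ht
    have h1 : UnitAddTorus.measurableEquivPiIoc a (fun i => (t i : UnitAddCircle)) = ⟨t, ht⟩ :=
      (UnitAddTorus.measurableEquivPiIoc a).apply_symm_apply ⟨t, ht⟩
    rw [hF]
    simp only [h1]
  have hL : MemLp F 2 volume := by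
    refine MemLp.of_bound hFm.aestronglyMeasurable B (Eventually.of_forall fun t => ?_)
    exact hB _ (UnitAddTorus.measurableEquivPiIoc a t).2
  have h1 : F =ᵐ[volume] 0 := by
    refine ae_eq_zero_of_mFourierCoeff hL fun j => ?_
    rw [UnitAddTorus.mFourierCoeff_eq_integral F j a, ← h j]
    refine setIntegral_congr_fun (measurableSet_unitBox a) fun t ht => ?_
    simp only [mFourier_coe, smul_eq_mul]
    rw [hFc t ht]
  have h2 := (UnitAddTorus.measurePreserving_equivPiIoc a).symm.quasiMeasurePreserving.ae_eq_comp h1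
  rw [ae_restrict_iff_subtype (measurableSet_unitBox a)]
  filter_upwards [h2] with t ht
  rw [← hFc t.1 t.2]
  exact ht

end FourierUniqueness

/-! ### The Fourier coefficients of `exp(t) μ_t`. -/

section Cube

open MeasureTheory

variable {n : ℕ}

lemma pair_add_left (s t : Fin n → ℝ) (z : Fin n → ℂ) : pair (s + t) z = pair s z + pair t z := by
  simp [pair, add_mul, Finset.sum_add_distrib]

lemma pair_sub_right (t : Fin n → ℝ) (z w : Fin n → ℂ) : pair t (z - w) = pair t z - pair t w := by
  simp [pair, mul_sub, Finset.sum_sub_distrib]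

lemma pair_intCast (p : Fin n → ℤ) (z : Fin n → ℂ) : pair (fun l => (p l : ℝ)) z = evC p z := by
  simp [pair, evC]

lemma continuous_pair (z : Fin n → ℂ) : Continuous fun t : Fin n → ℝ => pair t z := by
  unfold pair
  fun_prop

lemma exp_evC_twoPiI (p j : Fin n → ℤ) : Complex.exp (evC p (twoPiI j)) = 1 := by
  have h : evC p (twoPiI j) = ((∑ k, p k * j k : ℤ) : ℂ) * (2 * Real.pi * Complex.I) := by
    simp only [evC, twoPiI]
    push_cast
    rw [Finset.sum_mul]
    exact Finset.sum_congr rfl fun k _ => by ring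
  rw [h]
  exact Complex.exp_int_mul_two_pi_mul_I _

/-- The matrix whose rows are the forms in `y`, with real coefficients. -/
def realMatrix (y : Fin n → Fin n → ℤ) : Matrix (Fin n) (Fin n) ℝ := Matrix.of fun k l => (y k l : ℝ)

lemma det_realMatrix (y : Fin n → Fin n → ℤ) : (realMatrix y).det = formsDet y :=
  (RingHom.map_det (Int.castRingHom ℝ) (Matrix.of y)).symm

lemma isUnit_det_realMatrix {y : Fin n → Fin n → ℤ} (hy : formsDet y ≠ 0) :
    IsUnit (realMatrix y).det := by
  rw [det_realMatrix, isUnit_iff_ne_zero]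
  exact_mod_cast hy

/-- The coordinates with respect to the forms in `y`. -/
def cubeCoord (y : Fin n → Fin n → ℤ) (τ : Fin n → ℝ) : Fin n → ℝ := Matrix.vecMul τ (realMatrix y)⁻¹

lemma continuous_cubeCoord (y : Fin n → Fin n → ℤ) (k : Fin n) :
    Continuous fun τ => cubeCoord y τ k := by
  unfold cubeCoord Matrix.vecMul dotProduct
  fun_prop

/-- The half open parallelepiped spanned by the forms in `y`. -/
def cube (y : Fin n → Fin n → ℤ) : Set (Fin n → ℝ) := {τ | ∀ k, cubeCoord y τ k ∈ Ico (0 : ℝ) 1}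

lemma measurableSet_cube (y : Fin n → Fin n → ℤ) : MeasurableSet (cube y) := by
  have : cube y = ⋂ k, (fun τ => cubeCoord y τ k) ⁻¹' Ico 0 1 := by ext; simp [cube]
  rw [this]
  exact MeasurableSet.iInter fun k => (continuous_cubeCoord y k).measurable measurableSet_Ico

lemma cubeCoord_vecMul {y : Fin n → Fin n → ℤ} (hy : formsDet y ≠ 0) (a : Fin n → ℝ) :
    cubeCoord y (Matrix.vecMul a (realMatrix y)) = a := by
  rw [cubeCoord, Matrix.vecMul_vecMul, Matrix.mul_nonsing_inv _ (isUnit_det_realMatrix hy),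
    Matrix.vecMul_one]

lemma vecMul_cubeCoord {y : Fin n → Fin n → ℤ} (hy : formsDet y ≠ 0) (τ : Fin n → ℝ) :
    Matrix.vecMul (cubeCoord y τ) (realMatrix y) = τ := by
  rw [cubeCoord, Matrix.vecMul_vecMul, Matrix.nonsing_inv_mul _ (isUnit_det_realMatrix hy),
    Matrix.vecMul_one]

lemma cube_eq_image {y : Fin n → Fin n → ℤ} (hy : formsDet y ≠ 0) :
    cube y = (fun a => Matrix.vecMul a (realMatrix y)) '' (Set.univ.pi fun _ => Ico (0 : ℝ) 1) := by
  ext τ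
  constructor
  · exact fun h => ⟨cubeCoord y τ, fun k _ => h k, vecMul_cubeCoord hy τ⟩
  · rintro ⟨a, ha, rfl⟩ k
    rw [cubeCoord_vecMul hy]
    exact ha k trivial

lemma mem_cubePoints_iff {y : Fin n → Fin n → ℤ} (hy : formsDet y ≠ 0) {t : Fin n → ℝ}
    {p : Fin n → ℤ} : p ∈ cubePoints y t ↔ t + (fun l => (p l : ℝ)) ∈ cube y := by
  rw [cube_eq_image hy]
  constructor
  · rintro ⟨a, ha, h⟩
    refine ⟨a, fun k _ => ha k, funext fun l => ?_⟩
    rw [Pi.add_apply, add_comm, h l]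
    rfl
  · rintro ⟨a, ha, h⟩
    refine ⟨a, fun k => ha k trivial, fun l => ?_⟩
    have := congrFun h l
    rw [Pi.add_apply, add_comm] at this
    exact this.symm

lemma pair_vecMul (y : Fin n → Fin n → ℤ) (a : Fin n → ℝ) (w : Fin n → ℂ) :
    pair (Matrix.vecMul a (realMatrix y)) w = ∑ k, (a k : ℂ) * evC (y k) w := by
  simp only [pair, Matrix.vecMul, dotProduct, evC, realMatrix, Matrix.of_apply]
  push_cast
  simp only [Finset.sum_mul, Finset.mul_sum]
  rw [Finset.sum_comm]
  exact Finset.sum_congr rfl fun k _ => Finset.sum_congr rfl fun l _ => by ring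

/-- A linear change of variables turns the parallelepiped into the unit cube and the exponential
into a product of functions of one variable. -/
lemma integral_cube_exp {y : Fin n → Fin n → ℤ} (hy : formsDet y ≠ 0) {w : Fin n → ℂ}
    (hw : ∀ k, evC (y k) w ≠ 0) :
    ∫ τ in cube y, Complex.exp (pair τ w) =
      (vol y : ℂ) * ∏ k, (Complex.exp (evC (y k) w) - 1) / evC (y k) w := by
  set L : (Fin n → ℝ) →L[ℝ] (Fin n → ℝ) :=
    LinearMap.toContinuousLinearMap (Matrix.toLin' (realMatrix y).transpose) with hL
  have hLa : ∀ a, L a = Matrix.vecMul a (realMatrix y) := fun a => by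
    rw [hL, LinearMap.coe_toContinuousLinearMap', Matrix.toLin'_apply, Matrix.mulVec_transpose]
  have hdet : |L.det| = (vol y : ℝ) := by
    have : L.det = (formsDet y : ℝ) := by
      rw [hL, LinearMap.det_toContinuousLinearMap, LinearMap.det_toLin', Matrix.det_transpose,
        det_realMatrix]
    rw [this, vol, Nat.cast_natAbs, Int.cast_abs]
  have himg : cube y = L '' (Set.univ.pi fun _ => Ico (0 : ℝ) 1) := by
    rw [cube_eq_image hy]
    exact Set.image_congr fun a _ => (hLa a).symm
  rw [himg, integral_image_eq_integral_abs_det_fderiv_smul volume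
    (MeasurableSet.univ_pi fun _ => measurableSet_Ico) (f' := fun _ => L)
    (fun a _ => L.hasFDerivWithinAt) (fun a _ b _ hab => by
      rw [hLa, hLa] at hab
      rw [← cubeCoord_vecMul hy a, hab, cubeCoord_vecMul hy]), integral_smul, hdet]
  rw [Complex.real_smul, Complex.ofReal_natCast]
  congr 1
  have h1 : ∀ a : Fin n → ℝ, Complex.exp (pair (L a) w) =
      ∏ k, Complex.exp (evC (y k) w * (a k : ℂ)) := by
    intro a
    rw [hLa, pair_vecMul, Complex.exp_sum]
    exact Finset.prod_congr rfl fun k _ => by rw [mul_comm]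
  simp only [h1]
  rw [volume_pi, Measure.restrict_pi_pi,
    integral_fintype_prod_eq_prod (fun k (a : ℝ) => Complex.exp (evC (y k) w * (a : ℂ)))]
  refine Finset.prod_congr rfl fun k _ => ?_
  rw [integral_Ico_eq_integral_Ioc, ← intervalIntegral.integral_of_le zero_le_one,
    integral_exp_mul_complex (hw k)]
  simp

lemma volume_cube_lt_top {y : Fin n → Fin n → ℤ} (hy : formsDet y ≠ 0) : volume (cube y) < ⊤ := by
  have h1 : cube y ⊆ (fun a => Matrix.vecMul a (realMatrix y)) '' Icc 0 1 := by
    rw [cube_eq_image hy]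
    exact Set.image_mono fun a ha => ⟨fun k => (ha k trivial).1, fun k => (ha k trivial).2.le⟩
  have h2 : IsCompact ((fun a => Matrix.vecMul a (realMatrix y)) '' Icc 0 1) := by
    refine isCompact_Icc.image ?_
    unfold Matrix.vecMul dotProduct
    fun_prop
  exact (measure_mono h1).trans_lt h2.measure_lt_top

lemma exists_bound_exp_cube {y : Fin n → Fin n → ℤ} (hy : formsDet y ≠ 0) (w : Fin n → ℂ) :
    ∃ B : ℝ, ∀ τ ∈ cube y, ‖Complex.exp (pair τ w)‖ ≤ B := by
  have h1 : cube y ⊆ (fun a => Matrix.vecMul a (realMatrix y)) '' Icc 0 1 := by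
    rw [cube_eq_image hy]
    exact Set.image_mono fun a ha => ⟨fun k => (ha k trivial).1, fun k => (ha k trivial).2.le⟩
  have h2 : IsCompact ((fun a => Matrix.vecMul a (realMatrix y)) '' Icc 0 1) := by
    refine isCompact_Icc.image ?_
    unfold Matrix.vecMul dotProduct
    fun_prop
  obtain ⟨B, hB⟩ := h2.exists_bound_of_continuousOn (continuous_pair w).cexp.continuousOn
  exact ⟨B, fun τ hτ => hB τ (h1 hτ)⟩

/-- Lattice points containing all those by which the unit box must be translated to meet the
parallelepiped. -/
def boxPoints (y : Fin n → Fin n → ℤ) (a : Fin n → ℝ) : Finset (Fin n → ℤ) :=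
  Finset.Icc (fun _ => -⌈∑ l, (|a l| + 1 + ∑ k, |(y k l : ℝ)|)⌉)
    (fun _ => ⌈∑ l, (|a l| + 1 + ∑ k, |(y k l : ℝ)|)⌉)

lemma mem_boxPoints {y : Fin n → Fin n → ℤ} {a t : Fin n → ℝ} (ht : t ∈ unitBox a)
    {p : Fin n → ℤ} (hp : p ∈ cubePoints y t) : p ∈ boxPoints y a := by
  obtain ⟨b, hb, hp⟩ := hp
  set R : ℝ := ∑ l, (|a l| + 1 + ∑ k, |(y k l : ℝ)|) with hR
  have key : ∀ l, |(p l : ℝ)| ≤ R := by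
    intro l
    have h1 : (p l : ℝ) = (∑ k, b k * (y k l : ℝ)) - t l := by rw [← hp l]; ring
    have h0 : |t l| ≤ |a l| + 1 := by
      have h2 := ht l
      rw [abs_le]
      constructor <;> linarith [h2.1, h2.2, neg_abs_le (a l), le_abs_self (a l)]
    have h2 : |(p l : ℝ)| ≤ |a l| + 1 + ∑ k, |(y k l : ℝ)| := by
      rw [h1, sub_eq_add_neg, add_comm]
      refine (abs_add_le _ _).trans ?_
      rw [abs_neg]
      refine add_le_add h0 ?_
      refine (Finset.abs_sum_le_sum_abs _ _).trans (Finset.sum_le_sum fun k _ => ?_)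
      rw [abs_mul, abs_of_nonneg (hb k).1]
      exact mul_le_of_le_one_left (abs_nonneg _) (hb k).2.le
    refine h2.trans ?_
    exact Finset.single_le_sum (f := fun l => |a l| + 1 + ∑ k, |(y k l : ℝ)|)
      (fun l _ => by positivity) (Finset.mem_univ l)
  rw [boxPoints, Finset.mem_Icc, ← hR]
  refine ⟨fun l => ?_, fun l => ?_⟩
  · have := (neg_le_of_abs_le (key l))
    have h3 : (-(⌈R⌉ : ℤ) : ℝ) ≤ (p l : ℝ) := by linarith [Int.le_ceil R]
    exact_mod_cast h3
  · have h3 : (p l : ℝ) ≤ (⌈R⌉ : ℝ) := (le_of_abs_le (key l)).trans (Int.le_ceil R)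
    exact_mod_cast h3

/-- The function `exp(t)` times the coefficient of `μ(y)`. -/
def toddExp (y : Fin n → Fin n → ℤ) (z : Fin n → ℂ) (t : Fin n → ℝ) : ℂ :=
  toddCoeff y t z * Complex.exp (pair t z)

/-- The function `exp(τ)` on the parallelepiped. -/
def cubeExp (y : Fin n → Fin n → ℤ) (z : Fin n → ℂ) : (Fin n → ℝ) → ℂ :=
  (cube y).indicator fun τ => Complex.exp (pair τ z)

lemma measurable_cubeExp (y : Fin n → Fin n → ℤ) (z : Fin n → ℂ) : Measurable (cubeExp y z) :=
  (continuous_pair z).cexp.measurable.indicator (measurableSet_cube y)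

lemma integrable_cubeExp {y : Fin n → Fin n → ℤ} (hy : formsDet y ≠ 0) (z : Fin n → ℂ) :
    Integrable (cubeExp y z) := by
  obtain ⟨B, hB⟩ := exists_bound_exp_cube hy z
  rw [cubeExp, integrable_indicator_iff (measurableSet_cube y)]
  exact Measure.integrableOn_of_bounded (volume_cube_lt_top hy).ne
    (continuous_pair z).cexp.aestronglyMeasurable
    ((ae_restrict_iff' (measurableSet_cube y)).2 (Eventually.of_forall hB))

/-- `exp⟨t, z⟩` times the character sum is the periodisation of `exp⟨τ, z⟩` on the parallelepiped.
For `t` in one unit box, a finite set of translates independent of `t` is enough, which makes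
measurability and integration evident. -/
lemma toddExp_eq_sum {y : Fin n → Fin n → ℤ} (hy : formsDet y ≠ 0) {a t : Fin n → ℝ}
    (ht : t ∈ unitBox a) (z : Fin n → ℂ) :
    toddExp y z t = ((vol y : ℂ)⁻¹ * ((formsDet y : ℂ) * ∏ k, (1 - Complex.exp (evC (y k) z))⁻¹)) *
      ∑ p ∈ boxPoints y a, cubeExp y z (t + fun l => (p l : ℝ)) := by
  classical
  have h1 : cubeCharacter y t z = ∑ p ∈ boxPoints y a,
      if p ∈ cubePoints y t then Complex.exp (evC p z) else 0 := by
    rw [cubeCharacter, finsum_mem_eq_finite_toFinset_sum _ (cubePoints_finite y t),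
      ← Finset.sum_filter]
    refine Finset.sum_congr ?_ fun _ _ => rfl
    ext p
    simp only [Set.Finite.mem_toFinset, Finset.mem_filter]
    exact ⟨fun h => ⟨mem_boxPoints ht h, h⟩, fun h => h.2⟩
  have h2 : cubeCharacter y t z * Complex.exp (pair t z) =
      ∑ p ∈ boxPoints y a, cubeExp y z (t + fun l => (p l : ℝ)) := by
    rw [h1, Finset.sum_mul]
    refine Finset.sum_congr rfl fun p _ => ?_
    rw [cubeExp, Set.indicator_apply, ite_mul, zero_mul]
    refine if_congr (mem_cubePoints_iff hy) ?_ rfl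
    rw [pair_add_left, pair_intCast, Complex.exp_add, mul_comm]
  rw [toddExp, toddCoeff, ← h2]
  ring

/-- Integration over space by integration over the translates of the unit box. -/
lemma integral_unitBox_tiling (a : Fin n → ℝ) {G : (Fin n → ℝ) → ℂ} (hG : Integrable G)
    (P : Finset (Fin n → ℤ))
    (hP : ∀ t ∈ unitBox a, ∀ p ∉ P, G (t + fun l => (p l : ℝ)) = 0) :
    ∫ t in unitBox a, ∑ p ∈ P, G (t + fun l => (p l : ℝ)) = ∫ τ, G τ := by
  have h1 : ∀ p : Fin n → ℤ, ∫ t in unitBox a, G (t + fun l => (p l : ℝ)) =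
      ∫ τ in unitBox (a + fun l => (p l : ℝ)), G τ := by
    intro p
    have h2 := (measurePreserving_add_right (volume : Measure (Fin n → ℝ))
      (fun l => (p l : ℝ))).setIntegral_preimage_emb
      (measurableEmbedding_addRight _) G (unitBox (a + fun l => (p l : ℝ)))
    rw [← h2]
    congr 2
    ext t
    simp only [unitBox, mem_ofPred_eq, mem_preimage, Pi.add_apply, mem_Ioc]
    refine forall_congr' fun i => and_congr ?_ ?_ <;> constructor <;> intro h <;> linarith
  rw [integral_finsetSum _ fun p _ => (hG.comp_add_right _).integrableOn,
    Finset.sum_congr rfl fun p _ => h1 p, ← integral_biUnion_finset P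
    (fun p _ => measurableSet_unitBox _) ?_ (fun p _ => hG.integrableOn)]
  · refine setIntegral_eq_integral_of_forall_compl_eq_zero fun τ hτ => ?_
    -- The translate of the box containing `τ`; the box is open below and closed above, whence the
    -- ceiling minus one.
    set p : Fin n → ℤ := fun l => ⌈τ l - a l⌉ - 1 with hp
    have h3 : (τ - fun l => (p l : ℝ)) ∈ unitBox a := by
      intro l
      simp only [hp, Pi.sub_apply]
      push_cast
      constructor
      · linarith [Int.ceil_lt_add_one (τ l - a l)]
      · linarith [Int.le_ceil (τ l - a l)]
    have h4 : p ∉ P := by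
      intro hpP
      refine hτ (Set.mem_iUnion₂.2 ⟨p, hpP, fun l => ?_⟩)
      have := h3 l
      simp only [Pi.sub_apply, mem_Ioc] at this
      simp only [Pi.add_apply, mem_Ioc]
      constructor <;> linarith [this.1, this.2]
    have h5 := hP _ h3 p h4
    rwa [sub_add_cancel] at h5
  · intro p _ q _ hpq
    refine Set.disjoint_left.2 fun τ hτ hτ' => hpq (funext fun l => ?_)
    have h3 := hτ l
    have h4 := hτ' l
    simp only [Pi.add_apply, mem_Ioc] at h3 h4
    have h5 : (p l : ℝ) < q l + 1 := by linarith [h3.1, h4.2]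
    have h6 : (q l : ℝ) < p l + 1 := by linarith [h4.1, h3.2]
    have h7 : p l < q l + 1 := by exact_mod_cast h5
    have h8 : q l < p l + 1 := by exact_mod_cast h6
    omega

/-- The Fourier coefficients of `t ↦ exp(t) μ_t(y)`. -/
theorem fourierCoeff_toddExp {y : Fin n → Fin n → ℤ} (hy : formsDet y ≠ 0) {z : Fin n → ℂ}
    (hz : ∀ k, Complex.exp (evC (y k) z) ≠ 1) (a : Fin n → ℝ) (j : Fin n → ℤ) :
    ∫ t in unitBox a, Complex.exp (-pair t (twoPiI j)) * toddExp y z t =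
      logCoeff y (twoPiI j - z) := by
  have hexp : ∀ k, Complex.exp (evC (y k) (z - twoPiI j)) = Complex.exp (evC (y k) z) := by
    intro k
    rw [evC_sub, Complex.exp_sub, exp_evC_twoPiI, div_one]
  have hw : ∀ k, evC (y k) (z - twoPiI j) ≠ 0 := by
    intro k h
    have := hexp k
    rw [h, Complex.exp_zero] at this
    exact hz k this.symm
  set c : ℂ := (vol y : ℂ)⁻¹ * ((formsDet y : ℂ) * ∏ k, (1 - Complex.exp (evC (y k) z))⁻¹) with hc
  -- Lattice points pair with `twoPiI j` to multiples of `2π√-1`. The Fourier character therefore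
  -- just replaces `z` by `z - twoPiI j` in the exponentials, while the constant `c` is unaffected.
  have h1 : ∀ t ∈ unitBox a, Complex.exp (-pair t (twoPiI j)) * toddExp y z t =
      c * ∑ p ∈ boxPoints y a, cubeExp y (z - twoPiI j) (t + fun l => (p l : ℝ)) := by
    intro t ht
    rw [toddExp_eq_sum hy ht, ← hc, mul_left_comm, Finset.mul_sum]
    congr 1
    refine Finset.sum_congr rfl fun p _ => ?_
    simp only [cubeExp]
    by_cases hmem : (t + fun l => (p l : ℝ)) ∈ cube y
    · rw [Set.indicator_of_mem hmem, Set.indicator_of_mem hmem, ← Complex.exp_add, pair_sub_right, pair_add_left t _ (twoPiI j), pair_intCast p (twoPiI j)]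
      have h2 : Complex.exp (pair (t + fun l => (p l : ℝ)) z - (pair t (twoPiI j) + evC p (twoPiI j))) =
          Complex.exp (-pair t (twoPiI j) + pair (t + fun l => (p l : ℝ)) z) *
            (Complex.exp (evC p (twoPiI j)))⁻¹ := by
        rw [← Complex.exp_neg, ← Complex.exp_add]
        congr 1
        ring
      rw [h2, exp_evC_twoPiI, inv_one, mul_one]
    · rw [Set.indicator_of_notMem hmem, Set.indicator_of_notMem hmem, mul_zero]
  rw [setIntegral_congr_fun (measurableSet_unitBox a) h1, integral_const_mul,
    integral_unitBox_tiling a (integrable_cubeExp hy _), cubeExp,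
    integral_indicator (measurableSet_cube y), integral_cube_exp hy hw, hc, logCoeff]
  · have hvol : (vol y : ℂ) ≠ 0 := by
      rw [vol]
      exact_mod_cast Int.natAbs_ne_zero.2 hy
    -- The numerators from the integral cancel the Todd denominators and leave the simple poles of
    -- `b(y)`.
    have h3 : ∀ k, (1 - Complex.exp (evC (y k) z))⁻¹ *
        ((Complex.exp (evC (y k) (z - twoPiI j)) - 1) / evC (y k) (z - twoPiI j)) =
        (evC (y k) (twoPiI j - z))⁻¹ := by
      intro k
      have h4 : 1 - Complex.exp (evC (y k) z) ≠ 0 := sub_ne_zero.2 (hz k).symm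
      have h5 : evC (y k) (twoPiI j - z) = -evC (y k) (z - twoPiI j) := by
        rw [evC_sub, evC_sub]; ring
      have h6 := hw k
      rw [h5, hexp]
      field_simp
      ring
    rw [Finset.prod_congr rfl fun k _ => (h3 k).symm, Finset.prod_mul_distrib]
    field_simp
  · intro t ht p hp
    rw [cubeExp, Set.indicator_of_notMem]
    exact fun h => hp (mem_boxPoints ht ((mem_cubePoints_iff hy).2 h))

end Cube

/-! ### From relations between logarithmic forms to relations between the forms `μ`. -/

section Relations

open MeasureTheory

variable {n : ℕ}

/-- No lattice translate of `t` lies on a wall of the parallelepiped spanned by `y`, or on a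
translate of a wall. -/
def IsCubeRegular (y : Fin n → Fin n → ℤ) (t : Fin n → ℝ) : Prop :=
  ∀ (p : Fin n → ℤ) (k : Fin n) (m : ℤ), cubeCoord y (t + fun l => (p l : ℝ)) k ≠ m

lemma continuousAt_cubeExp (y : Fin n → Fin n → ℤ) (z : Fin n → ℂ) {τ : Fin n → ℝ}
    (hτ : ∀ (k : Fin n) (m : ℤ), cubeCoord y τ k ≠ m) : ContinuousAt (cubeExp y z) τ := by
  by_cases h : τ ∈ cube y
  · have h1 : ∀ᶠ σ in 𝓝 τ, σ ∈ cube y := eventually_all.2 fun k => by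
      refine (continuous_cubeCoord y k).continuousAt.eventually (Ico_mem_nhds ?_ (h k).2)
      refine lt_of_le_of_ne (h k).1 fun h0 => hτ k 0 ?_
      rw [Int.cast_zero]
      exact h0.symm
    refine (continuous_pair z).cexp.continuousAt.congr ?_
    filter_upwards [h1] with σ hσ
    rw [cubeExp, Set.indicator_of_mem hσ]
  · have h1 : ∀ᶠ σ in 𝓝 τ, σ ∉ cube y := by
      have h2 : ∃ k, cubeCoord y τ k ∉ Ico (0 : ℝ) 1 := by
        by_contra! hcon
        exact h hcon
      obtain ⟨k, hk⟩ := h2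
      have h3 : ∀ᶠ r in 𝓝 (cubeCoord y τ k), r ∉ Ico (0 : ℝ) 1 := by
        rcases lt_or_ge (cubeCoord y τ k) 0 with h0 | h0
        · filter_upwards [Iio_mem_nhds h0] with r hr hr'
          exact absurd hr'.1 (not_le.2 hr)
        · have h4 : 1 < cubeCoord y τ k := by
            refine lt_of_le_of_ne (not_lt.1 fun h1 => hk ⟨h0, h1⟩) fun h1 => hτ k 1 ?_
            rw [Int.cast_one]
            exact h1.symm
          filter_upwards [Ioi_mem_nhds h4] with r hr hr'
          exact absurd hr'.2 (not_lt.2 (le_of_lt hr))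
      filter_upwards [(continuous_cubeCoord y k).continuousAt.eventually h3] with σ hσ hσ'
      exact hσ (hσ' k)
    refine (continuousAt_const (y := (0 : ℂ))).congr ?_
    filter_upwards [h1] with σ hσ
    rw [cubeExp, Set.indicator_of_notMem hσ]

lemma norm_cubeExp_le {y : Fin n → Fin n → ℤ} (hy : formsDet y ≠ 0) (z : Fin n → ℂ) :
    ∃ B : ℝ, ∀ τ, ‖cubeExp y z τ‖ ≤ B := by
  obtain ⟨B, hB⟩ := exists_bound_exp_cube hy z
  refine ⟨max B 0, fun τ => ?_⟩
  by_cases h : τ ∈ cube y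
  · rw [cubeExp, Set.indicator_of_mem h]
    exact (hB τ h).trans (le_max_left _ _)
  · rw [cubeExp, Set.indicator_of_notMem h, norm_zero]
    exact le_max_right _ _

lemma unitBox_mem_nhds (t : Fin n → ℝ) : unitBox (fun l => t l - 1 / 2) ∈ 𝓝 t := by
  have : Set.univ.pi (fun l => Ioo (t l - 1 / 2) (t l + 1 / 2)) ∈ 𝓝 t :=
    set_pi_mem_nhds Set.finite_univ fun l _ => Ioo_mem_nhds (by linarith) (by linarith)
  filter_upwards [this] with s hs l
  have := hs l trivial
  constructor
  · exact this.1
  · linarith [this.2]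

/-- Linear relations between logarithmic forms carry over to the forms `μ`. -/
theorem sum_toddCoeff_eq_zero {A : Type*} [Fintype A] (c : A → ℂ) (y : A → Fin n → Fin n → ℤ)
    (hy : ∀ α, formsDet (y α) ≠ 0) {t : Fin n → ℝ} (ht : ∀ α, IsCubeRegular (y α) t)
    {z : Fin n → ℂ} (hz : ∀ α k, Complex.exp (evC (y α k) z) ≠ 1)
    (hc : ∀ j : Fin n → ℤ, ∑ α, c α * logCoeff (y α) (twoPiI j - z) = 0) :
    ∑ α, c α * toddCoeff (y α) t z = 0 := by
  set a : Fin n → ℝ := fun l => t l - 1 / 2 with ha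
  set κ : A → ℂ := fun α => c α * ((vol (y α) : ℂ)⁻¹ *
    ((formsDet (y α) : ℂ) * ∏ k, (1 - Complex.exp (evC (y α k) z))⁻¹)) with hκ
  set g : (Fin n → ℝ) → ℂ := fun s => ∑ α, κ α *
    ∑ p ∈ boxPoints (y α) a, cubeExp (y α) z (s + fun l => (p l : ℝ)) with hg
  have hgE : ∀ s ∈ unitBox a, g s = ∑ α, c α * toddExp (y α) z s := by
    intro s hs
    refine Finset.sum_congr rfl fun α _ => ?_
    rw [toddExp_eq_sum (hy α) hs, hκ]
    ring
  have hmeas : Measurable g := Finset.measurable_sum _ fun α _ => Measurable.const_mul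
    (Finset.measurable_sum _ fun p _ => (measurable_cubeExp _ _).comp (measurable_add_const _)) _
  obtain ⟨B, hB⟩ : ∃ B : ℝ, ∀ s, ‖g s‖ ≤ B := by
    choose B hB using fun α => norm_cubeExp_le (hy α) z
    refine ⟨∑ α, ‖κ α‖ * ∑ p ∈ boxPoints (y α) a, B α, fun s => ?_⟩
    refine (norm_sum_le _ _).trans (Finset.sum_le_sum fun α _ => ?_)
    rw [norm_mul]
    refine mul_le_mul_of_nonneg_left ?_ (norm_nonneg _)
    exact (norm_sum_le _ _).trans (Finset.sum_le_sum fun p _ => hB α _)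
  have hcont : ContinuousAt g t := by
    refine tendsto_finsetSum _ fun α _ => Tendsto.const_mul _ (tendsto_finsetSum _ fun p _ => ?_)
    have h1 : ContinuousAt (cubeExp (y α) z) (t + fun l => (p l : ℝ)) :=
      continuousAt_cubeExp _ _ (ht α p)
    have h2 : ContinuousAt (fun s : Fin n → ℝ => s + fun l => (p l : ℝ)) t :=
      (continuous_id.add continuous_const).continuousAt
    exact ContinuousAt.comp (g := cubeExp (y α) z) h1 h2
  -- The `j`th Fourier coefficient of `g` is the given relation at `twoPiI j - z`, so all of them
  -- vanish.
  have hzero := ae_eq_zero_of_fourier a hmeas (fun s _ => hB s) fun j => by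
    have h1 : ∀ s ∈ unitBox a, Complex.exp (-pair s (twoPiI j)) * g s =
        ∑ α, c α * (Complex.exp (-pair s (twoPiI j)) * toddExp (y α) z s) := by
      intro s hs
      rw [hgE s hs, Finset.mul_sum]
      exact Finset.sum_congr rfl fun α _ => by ring
    rw [setIntegral_congr_fun (measurableSet_unitBox a) h1, integral_finsetSum]
    · rw [← hc j]
      refine Finset.sum_congr rfl fun α _ => ?_
      rw [integral_const_mul, fourierCoeff_toddExp (hy α) (hz α)]
    · intro α _
      refine Integrable.const_mul ?_ _
      have h2 : ∀ s ∈ unitBox a, ((vol (y α) : ℂ)⁻¹ *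
          ((formsDet (y α) : ℂ) * ∏ k, (1 - Complex.exp (evC (y α k) z))⁻¹)) *
          ∑ p ∈ boxPoints (y α) a, Complex.exp (-pair s (twoPiI j)) *
            cubeExp (y α) z (s + fun l => (p l : ℝ)) =
          Complex.exp (-pair s (twoPiI j)) * toddExp (y α) z s := by
        intro s hs
        rw [toddExp_eq_sum (hy α) hs, ← Finset.mul_sum]
        ring
      refine IntegrableOn.congr_fun (Integrable.const_mul ?_ _) h2 (measurableSet_unitBox a)
      refine integrable_finsetSum _ fun p _ => ?_
      refine (((integrable_cubeExp (hy α) z).comp_add_right _).integrableOn).bdd_mul (c := 1)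
        ((continuous_pair _).neg.cexp.aestronglyMeasurable) (Eventually.of_forall fun s => ?_)
      rw [Complex.norm_exp]
      have : (-pair s (twoPiI j)).re = 0 := by
        simp [pair, twoPiI]
      rw [this, Real.exp_zero]
  -- No translate of `t` meets a wall, so `g` is continuous at `t`; vanishing almost everywhere on a
  -- neighbourhood of `t` gives vanishing at `t`.
  have hgt : g t = 0 := by
    by_contra hne
    have h1 : {s | g s ≠ 0} ∩ unitBox a ∈ 𝓝 t :=
      inter_mem (hcont.eventually_ne hne) (unitBox_mem_nhds t)
    have h2 := MeasureTheory.Measure.measure_pos_of_mem_nhds (volume : Measure (Fin n → ℝ)) h1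
    rw [ae_restrict_iff' (measurableSet_unitBox a), ae_iff] at hzero
    refine h2.ne' (measure_mono_null ?_ hzero)
    rintro s ⟨hs1, hs2⟩ hs3
    exact hs1 (hs3 hs2)
  rw [hgE t (mem_of_mem_nhds (unitBox_mem_nhds t))] at hgt
  simp only [toddExp, ← mul_assoc] at hgt
  rw [← Finset.sum_mul] at hgt
  exact (mul_eq_zero.1 hgt).resolve_right (Complex.exp_ne_zero _)

end Relations

/-! ### Chambers and the homomorphism `q_Δ`. -/

section Chambers

variable {n : ℕ} {ι : Type*} [Fintype ι] {x : ι → Fin n → ℤ}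

/-- The vector with entries `y' l₀` at `l` and `-y' l` at `l₀` lies on the hyperplane of `y'`, hence
on that of `y`; the resulting equations say that the coefficients are proportional. -/
lemma SameHyperplane.exists_smul {y y' : Fin n → ℤ} (h : SameHyperplane y y') :
    ∃ c : ℝ, c ≠ 0 ∧ ∀ l, (y l : ℝ) = c * y' l := by
  classical
  obtain ⟨hy, hy', h⟩ := h
  obtain ⟨l₀, hl₀⟩ := Function.ne_iff.1 hy'
  have hl₀ : (y' l₀ : ℝ) ≠ 0 := by exact_mod_cast hl₀
  have key : ∀ l, (y l : ℝ) = (y l₀ / y' l₀ : ℝ) * y' l := by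
    intro l
    have h1 : ∀ w : Fin n → ℤ, evR w (Pi.single l (y' l₀ : ℝ) - Pi.single l₀ (y' l : ℝ)) =
        w l * y' l₀ - w l₀ * y' l := by
      intro w
      simp only [evR, Pi.sub_apply, mul_sub, Finset.sum_sub_distrib, Pi.single_apply, mul_ite, mul_zero,
        Finset.sum_ite_eq', Finset.mem_univ, if_true]
    have h2 := (h (Pi.single l (y' l₀ : ℝ) - Pi.single l₀ (y' l : ℝ))).2 (by rw [h1]; ring)
    rw [h1] at h2
    field_simp
    linarith
  refine ⟨_, fun h0 => hy (funext fun l => ?_), key⟩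
  have h1 := key l
  rw [h0, zero_mul] at h1
  exact_mod_cast h1

lemma represents_self (hx : IsIntegralArrangement x) (S : OrdTuple x) : Represents S S.forms :=
  fun _ => ⟨hx.ne_zero _, hx.ne_zero _, fun _ => Iff.rfl⟩

lemma Represents.exists_smul {S : OrdTuple x} {y : Fin n → Fin n → ℤ} (h : Represents S y) :
    ∃ c : Fin n → ℝ, (∀ k, c k ≠ 0) ∧ (∀ k l, (y k l : ℝ) = c k * x (S.1 k) l) ∧
      (formsDet y : ℝ) = (∏ k, c k) * formsDet S.forms := by
  choose c hc hcy using fun k => (h k).exists_smul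
  refine ⟨c, hc, hcy, ?_⟩
  rw [← det_realMatrix, ← det_realMatrix, ← Matrix.det_mul_column]
  congr 1
  ext k l
  exact hcy k l

lemma Represents.formsDet_ne_zero {S : OrdTuple x} {y : Fin n → Fin n → ℤ} (h : Represents S y) :
    formsDet y ≠ 0 := by
  obtain ⟨c, hc, -, hdet⟩ := h.exists_smul
  intro h0
  rw [h0, Int.cast_zero] at hdet
  have h1 : (formsDet S.forms : ℝ) ≠ 0 := by
    have := MultipleBernoulli.formsDet_ne_zero S
    exact_mod_cast this
  exact mul_ne_zero (Finset.prod_ne_zero_iff.2 fun k _ => hc k) h1 hdet.symm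

lemma evC_eq_of_smul {y y' : Fin n → ℤ} {c : ℝ} (h : ∀ l, (y l : ℝ) = c * y' l) (z : Fin n → ℂ) :
    evC y z = c * evC y' z := by
  rw [evC, evC, Finset.mul_sum]
  refine Finset.sum_congr rfl fun l _ => ?_
  have : (y l : ℂ) = (c : ℂ) * (y' l : ℂ) := by
    have := congrArg (fun r : ℝ => (r : ℂ)) (h l)
    push_cast at this
    exact this
  rw [this, mul_assoc]

lemma Represents.logCoeff_eq {S : OrdTuple x} {y : Fin n → Fin n → ℤ} (h : Represents S y)
    (z : Fin n → ℂ) : logCoeff y z = logCoeff S.forms z := by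
  obtain ⟨c, hc, hcy, hdet⟩ := h.exists_smul
  have hdet' : (formsDet y : ℂ) = (∏ k, (c k : ℂ)) * formsDet S.forms := by
    have := congrArg (fun r : ℝ => (r : ℂ)) hdet
    push_cast at this
    exact this
  have h1 : (∏ k, (c k : ℂ)) ≠ 0 := Finset.prod_ne_zero_iff.2 fun k _ => by exact_mod_cast hc k
  have h2 : ∏ k, (evC (y k) z)⁻¹ = (∏ k, (c k : ℂ))⁻¹ * ∏ k, (evC (S.forms k) z)⁻¹ := by
    rw [← Finset.prod_inv_distrib, ← Finset.prod_mul_distrib]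
    refine Finset.prod_congr rfl fun k _ => ?_
    rw [evC_eq_of_smul (hcy k), mul_inv]
    rfl
  rw [logCoeff, logCoeff, hdet', h2]
  field_simp

lemma evR_eq_of_smul {y y' : Fin n → ℤ} {c : ℝ} (h : ∀ l, (y l : ℝ) = c * y' l) (v : Fin n → ℝ) :
    evR y v = c * evR y' v := by
  rw [evR, evR, Finset.mul_sum]
  exact Finset.sum_congr rfl fun l _ => by rw [h l, mul_assoc]

lemma mem_flat (I : Set ι) (v : Fin n → ℝ) : v ∈ flat x I ↔ ∀ i ∈ I, evR (x i) v = 0 := by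
  simp only [flat, Submodule.mem_iInf, LinearMap.mem_ker]
  refine forall₂_congr fun i _ => ?_
  rw [evR]
  simp

/-- The `k`th coordinate with respect to `y` is the pairing with the vector dual to `y k`, which
spans the intersection of the other hyperplanes of `S`. An integral value `m` of this coordinate at
`t + p` would put `t` on the translate by `m * y k - p` of the annihilator of this line. -/
lemma isCubeRegular_of_mem_regularSet {t : Fin n → ℝ} (ht : t ∈ regularSet x) {S : OrdTuple x}
    {y : Fin n → Fin n → ℤ} (h : Represents S y) : IsCubeRegular y t := by
  classical
  intro p k m hm
  have hy := h.formsDet_ne_zero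
  obtain ⟨c, hc, hcy, -⟩ := h.exists_smul
  set v : Fin n → ℝ := fun l => (realMatrix y)⁻¹ l k with hv
  have hyv : ∀ q, evR (y q) v = if q = k then 1 else 0 := by
    intro q
    have := congrFun (congrFun (Matrix.mul_nonsing_inv _ (isUnit_det_realMatrix hy)) q) k
    rw [Matrix.one_apply] at this
    rw [← this]
    rfl
  have hflat : flat x (S.1 '' {q | q ≠ k}) = Submodule.span ℝ {v} := by
    ext w
    rw [mem_flat, Submodule.mem_span_singleton]
    constructor
    · intro hw
      have hw' : ∀ q, q ≠ k → evR (y q) w = 0 := fun q hq => by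
        rw [evR_eq_of_smul (hcy q), hw _ ⟨q, hq, rfl⟩, mul_zero]
      refine ⟨evR (y k) w, ?_⟩
      have h1 : (realMatrix y).mulVec w = Pi.single k (evR (y k) w) := by
        funext q
        rcases eq_or_ne q k with rfl | hq
        · rw [Pi.single_eq_same]; rfl
        · rw [Pi.single_eq_of_ne hq]; exact hw' q hq
      have h2 : w = (realMatrix y)⁻¹.mulVec ((realMatrix y).mulVec w) := by
        rw [Matrix.mulVec_mulVec, Matrix.nonsing_inv_mul _ (isUnit_det_realMatrix hy),
          Matrix.one_mulVec]
      conv_rhs => rw [h2, h1]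
      funext l
      rw [Matrix.mulVec_single, Pi.smul_apply, smul_eq_mul]
      simp [hv, mul_comm]
    · rintro ⟨r, rfl⟩ _ ⟨q, hq, rfl⟩
      have h1 : evR (y q) v = 0 := by rw [hyv, if_neg hq]
      rw [evR_eq_of_smul (hcy q)] at h1
      have h2 : evR (x (S.1 q)) v = 0 := (mul_eq_zero.1 h1).resolve_left (hc q)
      have h3 : evR (x (S.1 q)) (r • v) = r * evR (x (S.1 q)) v := by
        simp only [evR, Pi.smul_apply, smul_eq_mul, Finset.mul_sum]
        exact Finset.sum_congr rfl fun l _ => by ring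
      rw [h3, h2, mul_zero]
  have hv0 : v ≠ 0 := by
    intro h0
    have h1 := hyv k
    rw [if_pos rfl, h0] at h1
    simp [evR] at h1
  have hrank : Module.finrank ℝ (flat x (S.1 '' {q | q ≠ k})) = 1 := by
    rw [hflat]
    exact finrank_span_singleton hv0
  refine ht _ hrank (fun l => m * y k l - p l) fun w hw => ?_
  rw [hflat, Submodule.mem_span_singleton] at hw
  obtain ⟨r, rfl⟩ := hw
  have h1 : cubeCoord y (t + fun l => (p l : ℝ)) k = ∑ l, (t l + p l) * v l := rfl
  have h2 := hyv k
  rw [if_pos rfl, evR] at h2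
  have h3 : ∑ l, (t l - ((m * y k l - p l : ℤ) : ℝ)) * (r • v) l =
      r * (∑ l, (t l + p l) * v l - m * ∑ l, (y k l : ℝ) * v l) := by
    rw [Finset.mul_sum, ← Finset.sum_sub_distrib, Finset.mul_sum]
    refine Finset.sum_congr rfl fun l _ => ?_
    simp only [Pi.smul_apply, smul_eq_mul]
    push_cast
    ring
  rw [h3, ← h1, hm, h2, mul_one, sub_self, mul_zero]

lemma chamber_subset {Δ : Set (Fin n → ℝ)} (hΔ : Δ ∈ chambers x) : Δ ⊆ regularSet x := by
  obtain ⟨t, -, rfl⟩ := hΔ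
  exact connectedComponentIn_subset _ _

lemma chamber_nonempty {Δ : Set (Fin n → ℝ)} (hΔ : Δ ∈ chambers x) : Δ.Nonempty := by
  obtain ⟨t, ht, rfl⟩ := hΔ
  exact ⟨t, mem_connectedComponentIn ht⟩

lemma isPreconnected_chamber {Δ : Set (Fin n → ℝ)} (hΔ : Δ ∈ chambers x) : IsPreconnected Δ := by
  obtain ⟨t, ht, rfl⟩ := hΔ
  exact isPreconnected_connectedComponentIn

/-- The sets `Λ ∩ (Cube(y) - t)` are constant on chambers. -/
lemma cubePoints_eq_of_mem_chamber {Δ : Set (Fin n → ℝ)} (hΔ : Δ ∈ chambers x) {S : OrdTuple x}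
    {y : Fin n → Fin n → ℤ} (h : Represents S y) {t t' : Fin n → ℝ} (ht : t ∈ Δ) (ht' : t' ∈ Δ) :
    cubePoints y t = cubePoints y t' := by
  have hy := h.formsDet_ne_zero
  -- A coordinate leaving `[0, 1)` inside the connected set `Δ` would take the value `0` or `1`
  -- there, which regular points exclude.
  have key : ∀ t ∈ Δ, ∀ t' ∈ Δ, cubePoints y t ⊆ cubePoints y t' := by
    intro t ht t' ht' p hp
    rw [mem_cubePoints_iff hy] at hp ⊢
    intro k
    have hcont : ContinuousOn (fun s => cubeCoord y (s + fun l => (p l : ℝ)) k) Δ :=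
      ((continuous_cubeCoord y k).comp (continuous_id.add continuous_const)).continuousOn
    have hreg : ∀ s ∈ Δ, ∀ m : ℤ, cubeCoord y (s + fun l => (p l : ℝ)) k ≠ m := fun s hs m =>
      isCubeRegular_of_mem_regularSet (chamber_subset hΔ hs) h p k m
    have hp := hp k
    constructor
    · by_contra hlt
      obtain ⟨s, hs, hs0⟩ := (isPreconnected_chamber hΔ).intermediate_value ht' ht hcont
        ⟨(not_le.1 hlt).le, hp.1⟩
      refine hreg s hs 0 ?_
      rw [Int.cast_zero]
      exact hs0
    · by_contra hlt
      obtain ⟨s, hs, hs1⟩ := (isPreconnected_chamber hΔ).intermediate_value ht ht' hcont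
        ⟨hp.2.le, not_lt.1 hlt⟩
      refine hreg s hs 1 ?_
      rw [Int.cast_one]
      exact hs1
  exact Subset.antisymm (key t ht t' ht') (key t' ht' t ht)

lemma toddCoeff_eq_of_mem_chamber {Δ : Set (Fin n → ℝ)} (hΔ : Δ ∈ chambers x) {S : OrdTuple x}
    {y : Fin n → Fin n → ℤ} (h : Represents S y) {t t' : Fin n → ℝ} (ht : t ∈ Δ) (ht' : t' ∈ Δ)
    (z : Fin n → ℂ) : toddCoeff y t z = toddCoeff y t' z := by
  rw [toddCoeff, toddCoeff, cubeCharacter, cubeCharacter, cubePoints_eq_of_mem_chamber hΔ h ht ht']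

/-- The points of the complement that are close to `0`. -/
def IsSmallPoint (x : ι → Fin n → ℤ) (z : Fin n → ℂ) : Prop := ∀ i, Complex.exp (evC (x i) z) ≠ 1

lemma exp_ne_one_of_norm_lt {w : ℂ} (h0 : w ≠ 0) (h : ‖w‖ < 2 * Real.pi) : Complex.exp w ≠ 1 := by
  intro h1
  obtain ⟨m, hm⟩ := Complex.exp_eq_one_iff.1 h1
  have h2 : m ≠ 0 := by
    rintro rfl
    exact h0 (by simpa using hm)
  have h3 : (1 : ℝ) ≤ |(m : ℝ)| := by exact_mod_cast Int.one_le_abs h2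
  rw [hm, norm_mul, norm_mul, norm_mul, Complex.norm_intCast, Complex.norm_I, Complex.norm_real,
    Complex.norm_ofNat, Real.norm_of_nonneg Real.pi_pos.le] at h
  nlinarith [Real.pi_pos]

lemma eventually_isSmallPoint : ∀ᶠ z in 𝓝[arrCompl x] 0, IsSmallPoint x z := by
  refine eventually_all.2 fun i => ?_
  have h1 : ∀ᶠ z in 𝓝[arrCompl x] (0 : Fin n → ℂ), ‖evC (x i) z‖ < 2 * Real.pi := by
    have h2 := (continuous_evC (x i)).norm.continuousAt (x := 0)
    refine (h2.eventually (Iio_mem_nhds ?_)).filter_mono nhdsWithin_le_nhds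
    simp only [evC_zero, norm_zero]
    positivity
  filter_upwards [h1, self_mem_nhdsWithin] with z hz hzU
  exact exp_ne_one_of_norm_lt (hzU i) hz

/-- It guarantees that the relations between the `b(S)` can be evaluated at every point occurring as
a Fourier coefficient. -/
lemma IsSmallPoint.twoPiI_sub_mem {z : Fin n → ℂ} (hz : IsSmallPoint x z) (j : Fin n → ℤ) :
    twoPiI j - z ∈ arrCompl x := by
  intro i h
  rw [evC_sub, sub_eq_zero] at h
  apply hz i
  rw [← h, exp_evC_twoPiI]

/-- The existence of `q_Δ`. -/
theorem existsUnique_isDeformation (hx : IsIntegralArrangement x) {Δ : Set (Fin n → ℝ)}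
    (hΔ : Δ ∈ chambers x) : ∃! q : OS x →ₗ[ℤ] meroForms x, IsDeformation Δ q := by
  obtain ⟨t, ht⟩ := chamber_nonempty hΔ
  obtain ⟨q, hq⟩ := exists_linearMap_of_relations (fun S : OrdTuple x => toddForm t S) fun c hc => by
    have h1 : ∀ S : OrdTuple x, ((c S • toddForm t S : meroForms x) : Germ (𝓝[arrCompl x] 0) ℂ) =
        ↑(fun z => (c S : ℂ) * toddCoeff S.forms t z) := by
      intro S
      rw [Submodule.coe_smul_of_tower]
      change (c S • ((toddCoeff S.forms t : (Fin n → ℂ) → ℂ) : Germ (𝓝[arrCompl x] 0) ℂ)) = _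
      rw [← Germ.coe_smul]
      congr 1
      funext z
      simp
    refine Subtype.ext ?_
    rw [Submodule.coe_sum, Finset.sum_congr rfl fun S _ => h1 S]
    refine ((map_sum (Germ.coeAddHom (𝓝[arrCompl x] (0 : Fin n → ℂ)) (M := ℂ))
      (fun S : OrdTuple x => fun z => (c S : ℂ) * toddCoeff S.forms t z) Finset.univ).symm).trans ?_
    refine Germ.coe_eq.2 ?_
    filter_upwards [eventually_isSmallPoint] with z hz
    rw [Finset.sum_apply]
    exact sum_toddCoeff_eq_zero (fun S : OrdTuple x => (c S : ℂ)) (fun S => S.forms)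
      (fun S => (represents_self hx S).formsDet_ne_zero)
      (fun S => isCubeRegular_of_mem_regularSet (chamber_subset hΔ ht) (represents_self hx S))
      (fun S k => hz _) fun j => hc _ (hz.twoPiI_sub_mem j)
  refine ⟨q, fun t' ht' S => ?_, fun q' hq' => linearMap_ext_logClass fun S => ?_⟩
  · rw [hq S]
    refine Subtype.ext ?_
    change ((toddCoeff S.forms t : (Fin n → ℂ) → ℂ) : Germ (𝓝[arrCompl x] 0) ℂ) = toddCoeff S.forms t'
    congr 1
    funext z
    exact toddCoeff_eq_of_mem_chamber hΔ (represents_self hx S) ht ht' z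
  · rw [hq S, hq' t ht S]

/-- The forms `μ_Δ(S)` do not depend on the choice of the defining forms. -/
lemma Represents.toddCoeff_eq (hx : IsIntegralArrangement x) {S : OrdTuple x}
    {y : Fin n → Fin n → ℤ} (h : Represents S y) {t : Fin n → ℝ} (ht : t ∈ regularSet x)
    {z : Fin n → ℂ} (hz : IsSmallPoint x z) (hzy : ∀ k, Complex.exp (evC (y k) z) ≠ 1) :
    toddCoeff y t z = toddCoeff S.forms t z := by
  -- The forms `b(y)` and `b(S)` coincide, so the transfer of relations is applied to a relation
  -- with the two coefficients `1` and `-1`.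
  have h1 := sum_toddCoeff_eq_zero (A := Bool) (fun b => if b then 1 else -1)
    (fun b => if b then y else S.forms) (t := t) (z := z)
    (by rintro (_ | _)
        · exact (represents_self hx S).formsDet_ne_zero
        · exact h.formsDet_ne_zero)
    (by rintro (_ | _)
        · exact isCubeRegular_of_mem_regularSet ht (represents_self hx S)
        · exact isCubeRegular_of_mem_regularSet ht h)
    (by rintro (_ | _) k
        · exact hz _
        · exact hzy k)
    (fun j => by simp [h.logCoeff_eq])
  simp only [Fintype.sum_bool, if_true, Bool.false_eq_true, if_false, one_mul, neg_mul,
    ← sub_eq_add_neg] at h1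
  exact sub_eq_zero.1 h1

end Chambers

/-! ### Polynomial dependence on `t`. -/

section Exponentials

variable {n : ℕ} {ι : Type*} [Fintype ι] {x : ι → Fin n → ℤ}

lemma analyticAt_pair (t : Fin n → ℝ) (z : Fin n → ℂ) : AnalyticAt ℂ (pair t) z :=
  Finset.analyticAt_fun_sum _ fun k _ => analyticAt_const.mul
    ((ContinuousLinearMap.proj (R := ℂ) (φ := fun _ : Fin n => ℂ) k).analyticAt z)

/-- The germ of an analytic function. -/
def analyticForm (x : ι → Fin n → ℤ) {F : (Fin n → ℂ) → ℂ} (hF : AnalyticAt ℂ F 0) : meroForms x :=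
  ⟨(F : Germ (𝓝[arrCompl x] 0) ℂ), coe_mem_meroForms hF⟩

/-- The germ of `exp(t)`. -/
def expForm (x : ι → Fin n → ℤ) (t : Fin n → ℝ) : meroForms x :=
  analyticForm x (F := fun z => Complex.exp (pair t z)) (analyticAt_pair t 0).cexp

/-- The germ of the `m`th power of the linear form `t`. -/
def pairPowForm (x : ι → Fin n → ℤ) (t : Fin n → ℝ) (m : ℕ) : meroForms x :=
  analyticForm x (F := fun z => pair t z ^ m) ((analyticAt_pair t 0).pow m)

lemma norm_pair_le (t : Fin n → ℝ) (z : Fin n → ℂ) : ‖pair t z‖ ≤ (∑ k, |t k|) * ‖z‖ := by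
  rw [pair, Finset.sum_mul]
  refine (norm_sum_le _ _).trans (Finset.sum_le_sum fun k _ => ?_)
  rw [norm_mul, Complex.norm_real, Real.norm_eq_abs]
  exact mul_le_mul_of_nonneg_left (norm_le_pi_norm z k) (abs_nonneg _)

/-- In the pairing of `exp(t) η` only finitely many terms of the exponential series matter. -/
lemma exists_pairing_expForm (hx : IsIntegralArrangement x) (η : meroForms x) :
    ∃ M : ℕ, ∀ M' ≥ M, ∀ (t : Fin n → ℝ) (C : Homology (arrCompl x) n),
      pairing hx (meroMul (expForm x t) η) C =
        ∑ m ∈ Finset.range M', (m.factorial : ℂ)⁻¹ * pairing hx (meroMul (pairPowForm x t m) η) C := by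
  obtain ⟨η, N, F, hF, rfl⟩ := η
  set η : meroForms x := ⟨_, N, F, hF, rfl⟩ with hη
  -- The pole at the origin has order at most `N * Fintype.card ι`. A remainder of the exponential
  -- series vanishing to one order more gives scaled integrals of size `O(s)`, so it pairs to `0`;
  -- the number of terms depends neither on `t` nor on `C`.
  refine ⟨N * Fintype.card ι + 1, fun M hM t C => ?_⟩
  set θ : meroForms x := meroMul (expForm x t) η -
    ∑ m ∈ Finset.range M, (m.factorial : ℂ)⁻¹ • meroMul (pairPowForm x t m) η with hθ
  set R : (Fin n → ℂ) → ℂ := fun z => Complex.exp (pair t z) -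
    ∑ m ∈ Finset.range M, pair t z ^ m / m.factorial with hR
  have h1 : (θ : Germ (𝓝[arrCompl x] 0) ℂ) = ↑(fun z => R z * (F z / (∏ i, evC (x i) z) ^ N)) := by
    rw [hθ, Submodule.coe_sub, Submodule.coe_sum]
    have h2 : ∀ m ∈ Finset.range M, (((m.factorial : ℂ)⁻¹ • meroMul (pairPowForm x t m) η :
        meroForms x) : Germ (𝓝[arrCompl x] 0) ℂ) =
        ↑(fun z => pair t z ^ m / m.factorial * (F z / (∏ i, evC (x i) z) ^ N)) := by
      intro m _
      have h3 : (fun z => pair t z ^ m / (m.factorial : ℂ) * (F z / (∏ i, evC (x i) z) ^ N)) =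
          fun z => (m.factorial : ℂ)⁻¹ * (pair t z ^ m * (F z / (∏ i, evC (x i) z) ^ N)) := by
        funext z
        ring
      rw [h3]
      rfl
    rw [Finset.sum_congr rfl h2]
    have h4 := (map_sum (Germ.coeAddHom (𝓝[arrCompl x] (0 : Fin n → ℂ)) (M := ℂ))
      (fun (m : ℕ) z => pair t z ^ m / (m.factorial : ℂ) * (F z / (∏ i, evC (x i) z) ^ N))
      (Finset.range M)).symm
    have h5 : (((meroMul (expForm x t) η : meroForms x)) : Germ (𝓝[arrCompl x] 0) ℂ) =
        ↑(fun z => Complex.exp (pair t z) * (F z / (∏ i, evC (x i) z) ^ N)) := rfl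
    refine (congrArg₂ (· - ·) h5 h4).trans ?_
    refine Germ.coe_eq.2 (Eventually.of_forall fun z => ?_)
    simp only [Finset.sum_apply, hR, sub_mul, Finset.sum_mul]
  have h2 : pairing hx θ C = 0 := by
    refine pairing_eq_zero_of_tendstoUniformlyOn hx h1 (fun K hKU hK => ?_) C
    obtain ⟨ρ, hρ⟩ := hK.exists_bound_of_continuousOn (f := id) continuousOn_id
    obtain ⟨B, hB⟩ := hK.exists_bound_of_continuousOn (f := fun z => (formsProd x z ^ N)⁻¹)
      (((continuous_formsProd (x := x)).continuousOn.pow N).inv₀ fun z hz =>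
        pow_ne_zero _ (formsProd_ne_zero (hKU hz)))
    set T : ℝ := ∑ k, |t k| with hT
    have hT0 : 0 ≤ T := Finset.sum_nonneg fun _ _ => abs_nonneg _
    obtain ⟨δ, hδ, hδF⟩ := Metric.continuousAt_iff.1 hF.continuousAt 1 one_pos
    set A : ℝ := (T * |ρ|) ^ M * Real.exp (T * |ρ|) * (‖F 0‖ + 1) * |B| with hA
    have hlim : Tendsto (fun s : ℝ => A * s) (𝓝[>] 0) (𝓝 0) := by
      have : Tendsto (fun s : ℝ => A * s) (𝓝 0) (𝓝 (A * 0)) := tendsto_id.const_mul A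
      rw [mul_zero] at this
      exact this.mono_left nhdsWithin_le_nhds
    have hsδ : ∀ᶠ s : ℝ in 𝓝[>] 0, s * (|ρ| + 1) < δ := by
      have : Tendsto (fun s : ℝ => s * (|ρ| + 1)) (𝓝 0) (𝓝 (0 * (|ρ| + 1))) :=
        tendsto_id.mul_const _
      rw [zero_mul] at this
      exact (this.eventually_lt_const hδ).filter_mono nhdsWithin_le_nhds
    rw [Metric.tendstoUniformlyOn_iff]
    intro ε hε
    filter_upwards [hlim.eventually_lt_const hε, hsδ, Ioc_mem_nhdsGT (zero_lt_one' ℝ)]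
      with s hs hsδ hs01 z hz
    have hs0 := hs01.1
    have hz' : ‖z‖ ≤ |ρ| := (hρ z hz).trans (le_abs_self _)
    have hsz : ‖(s : ℂ) • z‖ = s * ‖z‖ := by
      rw [norm_smul, Complex.norm_real, Real.norm_of_nonneg hs0.le]
    have hFz : ‖F ((s : ℂ) • z)‖ ≤ ‖F 0‖ + 1 := by
      have h3 := @hδF ((s : ℂ) • z) (by
        rw [dist_zero_right, hsz]
        nlinarith)
      rw [dist_eq_norm] at h3
      linarith [norm_le_insert' (F ((s : ℂ) • z)) (F 0)]
    have hpz : ‖pair t ((s : ℂ) • z)‖ ≤ s * (T * |ρ|) := by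
      refine (norm_pair_le _ _).trans ?_
      rw [hsz]
      nlinarith [mul_le_mul_of_nonneg_left hz' hT0]
    have hpz' : ‖pair t ((s : ℂ) • z)‖ ≤ T * |ρ| :=
      hpz.trans (mul_le_of_le_one_left (by positivity) hs01.2)
    have hRz : ‖R ((s : ℂ) • z)‖ ≤ s ^ M * ((T * |ρ|) ^ M * Real.exp (T * |ρ|)) := by
      refine (Complex.norm_exp_sub_sum_le_norm_mul_exp _ _).trans ?_
      rw [← mul_assoc, ← mul_pow]
      gcongr
    have hprod : (∏ i, evC (x i) ((s : ℂ) • z)) ^ N =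
        (s : ℂ) ^ (N * Fintype.card ι) * formsProd x z ^ N := by
      have := formsProd_smul (x := x) (s : ℂ) z
      rw [formsProd] at this
      rw [this, mul_pow, ← pow_mul, mul_comm (Fintype.card ι)]
    rw [Pi.zero_apply, dist_zero_left, hprod, div_eq_mul_inv, mul_inv, norm_mul, norm_mul, norm_mul,
      norm_mul, norm_pow, norm_inv, norm_pow, Complex.norm_real, Real.norm_of_nonneg hs0.le]
    have hBz : ‖(formsProd x z ^ N)⁻¹‖ ≤ |B| := (hB z hz).trans (le_abs_self _)
    obtain ⟨L, rfl⟩ := Nat.exists_eq_add_of_le hM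
    have hsL : s ^ n * (s ^ (N * Fintype.card ι + 1 + L) * (s ^ (N * Fintype.card ι))⁻¹) ≤ s := by
      have h3 : s ^ n * (s ^ (N * Fintype.card ι + 1 + L) * (s ^ (N * Fintype.card ι))⁻¹) =
          s ^ (n + L) * s := by
        rw [pow_add, pow_add, pow_add]
        field_simp
      rw [h3]
      exact mul_le_of_le_one_left hs0.le (pow_le_one₀ hs0.le hs01.2)
    calc s ^ n * (‖R ((s : ℂ) • z)‖ * (‖F ((s : ℂ) • z)‖ *
          ((s ^ (N * Fintype.card ι))⁻¹ * ‖(formsProd x z ^ N)⁻¹‖)))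
        ≤ s ^ n * ((s ^ (N * Fintype.card ι + 1 + L) *
            ((T * |ρ|) ^ (N * Fintype.card ι + 1 + L) * Real.exp (T * |ρ|))) * ((‖F 0‖ + 1) *
          ((s ^ (N * Fintype.card ι))⁻¹ * |B|))) := by gcongr
      _ = A * (s ^ n * (s ^ (N * Fintype.card ι + 1 + L) * (s ^ (N * Fintype.card ι))⁻¹)) := by
          rw [hA]; ring
      _ ≤ A * s := by gcongr
      _ < ε := hs
  rw [hθ, map_sub, LinearMap.sub_apply, sub_eq_zero] at h2
  rw [h2, map_sum, LinearMap.sum_apply]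
  exact Finset.sum_congr rfl fun m _ => pairing_smul hx _ _ _

lemma coe_sum_germ {A : Type*} (s : Finset A) (f : A → (Fin n → ℂ) → ℂ) :
    ∑ a ∈ s, ((f a : (Fin n → ℂ) → ℂ) : Germ (𝓝[arrCompl x] (0 : Fin n → ℂ)) ℂ) =
      ↑(fun z => ∑ a ∈ s, f a z) := by
  refine (map_sum (Germ.coeAddHom (𝓝[arrCompl x] (0 : Fin n → ℂ)) (M := ℂ)) f s).symm.trans ?_
  change ((∑ a ∈ s, f a : (Fin n → ℂ) → ℂ) : Germ (𝓝[arrCompl x] (0 : Fin n → ℂ)) ℂ) = _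
  congr 1
  funext z
  rw [Finset.sum_apply]

/-- The pairing of `exp(t) η` with a homology class is a polynomial in `t`. -/
theorem exists_polynomial_pairing_expForm (hx : IsIntegralArrangement x) (η : meroForms x)
    (C : Homology (arrCompl x) n) : ∃ p : MvPolynomial (Fin n) ℂ, ∀ t : Fin n → ℝ,
      pairing hx (meroMul (expForm x t) η) C = MvPolynomial.eval (fun k => (t k : ℂ)) p := by
  obtain ⟨M, hM⟩ := exists_pairing_expForm hx η
  have key : ∀ m : ℕ, ∃ p : MvPolynomial (Fin n) ℂ, ∀ t : Fin n → ℝ,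
      pairing hx (meroMul (pairPowForm x t m) η) C = MvPolynomial.eval (fun k => (t k : ℂ)) p := by
    intro m
    obtain ⟨h, hh⟩ := exists_rep η
    set μ : (Fin m → Fin n) → meroForms x := fun κ => meroMul (analyticForm x
      (F := fun z => ∏ i, z (κ i)) (Finset.analyticAt_fun_prod _ fun i _ =>
        (ContinuousLinearMap.proj (R := ℂ) (φ := fun _ : Fin n => ℂ) (κ i)).analyticAt 0)) η with hμ
    refine ⟨∑ κ : Fin m → Fin n, MvPolynomial.C (pairing hx (μ κ) C) *
      ∏ i, MvPolynomial.X (κ i), fun t => ?_⟩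
    -- Multinomial expansion: `t` enters through monomials in its coordinates, with the pairings of
    -- monomials in `z` as coefficients.
    have h1 : meroMul (pairPowForm x t m) η =
        ∑ κ : Fin m → Fin n, (∏ i, (t (κ i) : ℂ)) • μ κ := by
      refine Subtype.ext ?_
      have h2 : ∀ κ : Fin m → Fin n, (((∏ i, (t (κ i) : ℂ)) • μ κ : meroForms x) :
          Germ (𝓝[arrCompl x] 0) ℂ) =
          ↑(fun z => (∏ i, (t (κ i) : ℂ)) * ((∏ i, z (κ i)) * h z)) := by
        intro κ
        rw [Submodule.coe_smul, hμ]
        simp only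
        rw [coe_meroMul, hh]
        rfl
      rw [Submodule.coe_sum, Finset.sum_congr rfl fun κ _ => h2 κ, coe_sum_germ, coe_meroMul, hh]
      refine Germ.coe_eq.2 (Eventually.of_forall fun z => ?_)
      change pair t z ^ m * h z = _
      rw [pair, Fintype.sum_pow, Finset.sum_mul]
      refine Finset.sum_congr rfl fun κ _ => ?_
      rw [Finset.prod_mul_distrib, mul_assoc]
    rw [h1, map_sum, LinearMap.sum_apply, map_sum]
    refine Finset.sum_congr rfl fun κ _ => ?_
    rw [pairing_smul, map_mul, MvPolynomial.eval_C, map_prod, mul_comm]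
    simp only [MvPolynomial.eval_X]
  choose p hp using key
  refine ⟨∑ m ∈ Finset.range M, MvPolynomial.C ((m.factorial : ℂ)⁻¹) * p m, fun t => ?_⟩
  rw [hM M le_rfl, map_sum]
  refine Finset.sum_congr rfl fun m _ => ?_
  rw [hp, map_mul, MvPolynomial.eval_C]

lemma meroMul_assoc (γ γ' η : meroForms x) : meroMul γ (meroMul γ' η) = meroMul (meroMul γ γ') η :=
  Subtype.ext (mul_assoc _ _ _).symm

lemma meroMul_comm (γ γ' : meroForms x) : meroMul γ γ' = meroMul γ' γ :=
  Subtype.ext (mul_comm _ _)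

/-- The germ of a coordinate function. -/
def coordForm (x : ι → Fin n → ℤ) (k : Fin n) : meroForms x :=
  analyticForm x (F := fun z => z k)
    ((ContinuousLinearMap.proj (R := ℂ) (φ := fun _ : Fin n => ℂ) k).analyticAt 0)

/-- Along the line, the factor `exp(s zₖ)` is expanded; only finitely many terms matter, so the
pairing is a polynomial in `s` and its derivative at `0` is the term with one factor `zₖ`. -/
lemma hasLineDerivAt_pairing_expForm (hx : IsIntegralArrangement x) (η : meroForms x)
    (C : Homology (arrCompl x) n) (t : Fin n → ℝ) (k : Fin n) :
    HasLineDerivAt ℝ (fun t => pairing hx (meroMul (expForm x t) η) C)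
      (pairing hx (meroMul (expForm x t) (meroMul (coordForm x k) η)) C) t (Pi.single k 1) := by
  set θ := meroMul (expForm x t) η with hθ
  obtain ⟨M, hM⟩ := exists_pairing_expForm hx θ
  have hpair : ∀ (s : ℝ) z, pair (s • (Pi.single k 1 : Fin n → ℝ)) z = s * z k := by
    intro s z
    rw [pair, Finset.sum_eq_single k]
    · simp
    · intro l _ hl
      simp [Pi.single_eq_of_ne hl]
    · simp
  have h1 : ∀ s : ℝ, pairing hx (meroMul (expForm x (t + s • Pi.single k 1)) η) C =
      ∑ m ∈ Finset.range (M + 2), (s : ℂ) ^ m * ((m.factorial : ℂ)⁻¹ *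
        pairing hx (meroMul (pairPowForm x (Pi.single k 1) m) θ) C) := by
    intro s
    have h2 : meroMul (expForm x (t + s • Pi.single k 1)) η =
        meroMul (expForm x (s • Pi.single k 1)) θ := by
      rw [hθ, meroMul_assoc]
      congr 2
      refine Subtype.ext (congrArg (fun F : (Fin n → ℂ) → ℂ => (F : Germ (𝓝[arrCompl x] 0) ℂ))
        (funext fun z => ?_))
      change Complex.exp (pair (t + s • Pi.single k 1) z) =
        Complex.exp (pair (s • (Pi.single k 1 : Fin n → ℝ)) z) * Complex.exp (pair t z)
      rw [pair_add_left, add_comm, Complex.exp_add]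
    rw [h2, hM (M + 2) (by omega)]
    refine Finset.sum_congr rfl fun m _ => ?_
    have h3 : meroMul (pairPowForm x (s • Pi.single k 1) m) θ =
        ((s : ℂ) ^ m) • meroMul (pairPowForm x (Pi.single k 1) m) θ := by
      obtain ⟨h, hh⟩ := exists_rep θ
      refine Subtype.ext ?_
      rw [Submodule.coe_smul, coe_meroMul (pairPowForm x (s • Pi.single k 1) m) θ,
        coe_meroMul (pairPowForm x (Pi.single k 1) m) θ, hh]
      refine Germ.coe_eq.2 (Eventually.of_forall fun z => ?_)
      change pair (s • (Pi.single k 1 : Fin n → ℝ)) z ^ m * h z =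
        (s : ℂ) ^ m * (pair (Pi.single k 1 : Fin n → ℝ) z ^ m * h z)
      have h4 := hpair 1 z
      rw [one_smul] at h4
      rw [hpair, h4, mul_pow]
      push_cast
      ring
    rw [h3, pairing_smul]
    ring
  have h2 : meroMul (pairPowForm x (Pi.single k 1) 1) θ =
      meroMul (expForm x t) (meroMul (coordForm x k) η) := by
    rw [hθ, meroMul_assoc, meroMul_assoc, meroMul_comm (expForm x t)]
    congr 2
    refine Subtype.ext (congrArg (fun F : (Fin n → ℂ) → ℂ => (F : Germ (𝓝[arrCompl x] 0) ℂ))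
      (funext fun z => ?_))
    have h4 := hpair 1 z
    rw [one_smul] at h4
    change pair (Pi.single k 1 : Fin n → ℝ) z ^ 1 * Complex.exp (pair t z) =
      z k * Complex.exp (pair t z)
    rw [pow_one, h4, Complex.ofReal_one, one_mul]
  have h3 : HasDerivAt (fun s : ℝ => ∑ m ∈ Finset.range (M + 2), (s : ℂ) ^ m * ((m.factorial : ℂ)⁻¹ *
      pairing hx (meroMul (pairPowForm x (Pi.single k 1) m) θ) C))
      (∑ m ∈ Finset.range (M + 2), ((m : ℂ) * (0 : ℂ) ^ (m - 1)) * ((m.factorial : ℂ)⁻¹ *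
        pairing hx (meroMul (pairPowForm x (Pi.single k 1) m) θ) C)) 0 := by
    refine HasDerivAt.fun_sum fun m _ => HasDerivAt.mul_const ?_ _
    have h4 := (hasDerivAt_pow m ((0 : ℝ) : ℂ)).comp_ofReal
    simpa using h4
  rw [HasLineDerivAt]
  refine (h3.congr_deriv ?_).congr_of_eventuallyEq (Eventually.of_forall h1)
  rw [Finset.sum_eq_single 1]
  · rw [h2]
    simp
  · intro m _ hm
    rcases m with _ | _ | m
    · simp
    · exact absurd rfl hm
    · simp
  · simp

end Exponentials

/-! ### `𝒜`-rational functions as quotients by powers of the product of the forms. -/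

section Rational

variable {n : ℕ} {ι : Type*} [Fintype ι] {x : ι → Fin n → ℤ}

/-- An `𝒜`-rational function is the quotient of a polynomial by a power of the product of the
forms. -/
lemma IsARational.exists_eq_div {f : (Fin n → ℂ) → ℂ} (hf : IsARational x f) :
    ∃ (P : MvPolynomial (Fin n) ℂ) (N : ℕ), 2 ≤ N ∧ ∀ z ∈ arrCompl x,
      f z = MvPolynomial.eval z P / formsProd x z ^ N := by
  obtain ⟨P, Q, hPQ⟩ := hf
  set H : MvPolynomial (Fin n) ℂ := ∏ i, ∑ k, MvPolynomial.C (x i k : ℂ) * MvPolynomial.X k with hH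
  have hHe : ∀ z, MvPolynomial.eval z H = formsProd x z := by
    intro z
    rw [hH, map_prod, formsProd]
    refine Finset.prod_congr rfl fun i _ => ?_
    rw [map_sum, evC]
    exact Finset.sum_congr rfl fun k _ => by simp
  -- Nullstellensatz: `Q` has zeros only on the hyperplanes, where `H` vanishes, so a power of `H`
  -- is a multiple of `Q`.
  have h1 : H ∈ (Ideal.span {Q}).radical := by
    rw [← MvPolynomial.vanishingIdeal_zeroLocus_eq_radical (K := ℂ), MvPolynomial.mem_vanishingIdeal_iff]
    intro z hz
    rw [MvPolynomial.mem_zeroLocus_iff] at hz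
    have h2 := hz Q (Ideal.subset_span rfl)
    by_contra hne
    have hne : MvPolynomial.eval z H ≠ 0 := hne
    rw [hHe] at hne
    have hzU : z ∈ arrCompl x := fun i => (Finset.prod_ne_zero_iff.1 hne) i (Finset.mem_univ i)
    exact (hPQ z hzU).1 h2
  obtain ⟨N, hN⟩ := h1
  obtain ⟨A, hA⟩ := Ideal.mem_span_singleton'.1 hN
  -- The superfluous factor `H ^ 2` makes the exponent at least `2`, as absolute convergence of the
  -- series will require.
  refine ⟨P * A * H ^ 2, N + 2, by omega, fun z hz => ?_⟩
  obtain ⟨hQ, hfz⟩ := hPQ z hz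
  have h3 := congrArg (MvPolynomial.eval z) hA
  rw [map_mul, map_pow, hHe] at h3
  have h4 := formsProd_ne_zero hz
  rw [hfz, map_mul, map_mul, map_pow, hHe, div_eq_div_iff hQ (pow_ne_zero _ h4), pow_add, ← h3]
  ring

lemma analyticAt_eval (P : MvPolynomial (Fin n) ℂ) (z : Fin n → ℂ) :
    AnalyticAt ℂ (fun z => MvPolynomial.eval z P) z := by
  induction P using MvPolynomial.induction_on with
  | C a => simpa using analyticAt_const
  | add P Q hP hQ =>
    simp only [map_add]
    exact hP.fun_add hQ
  | mul_X P k hP =>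
    simp only [map_mul, MvPolynomial.eval_X]
    exact hP.mul ((ContinuousLinearMap.proj (R := ℂ) (φ := fun _ : Fin n => ℂ) k).analyticAt z)

/-- The germ of the rational function with numerator `P` and denominator the `N`th power of the
product of the forms. -/
def ratForm (x : ι → Fin n → ℤ) (N : ℕ) (P : MvPolynomial (Fin n) ℂ) : meroForms x :=
  ⟨((fun z => MvPolynomial.eval z P / formsProd x z ^ N : (Fin n → ℂ) → ℂ) :
    Germ (𝓝[arrCompl x] 0) ℂ), N, fun z => MvPolynomial.eval z P, analyticAt_eval P 0, rfl⟩

lemma ratForm_add (N : ℕ) (P Q : MvPolynomial (Fin n) ℂ) :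
    ratForm x N (P + Q) = ratForm x N P + ratForm x N Q := by
  refine Subtype.ext (congrArg (fun F : (Fin n → ℂ) → ℂ => (F : Germ (𝓝[arrCompl x] 0) ℂ))
    (funext fun z => ?_))
  change _ = MvPolynomial.eval z P / formsProd x z ^ N + MvPolynomial.eval z Q / formsProd x z ^ N
  rw [map_add, add_div]

lemma ratForm_mul_X (N : ℕ) (P : MvPolynomial (Fin n) ℂ) (k : Fin n) :
    ratForm x N (P * MvPolynomial.X k) = meroMul (coordForm x k) (ratForm x N P) := by
  refine Subtype.ext (congrArg (fun F : (Fin n → ℂ) → ℂ => (F : Germ (𝓝[arrCompl x] 0) ℂ))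
    (funext fun z => ?_))
  change _ = z k * (MvPolynomial.eval z P / formsProd x z ^ N)
  rw [map_mul, MvPolynomial.eval_X]
  ring

lemma ratForm_C (N : ℕ) (a : ℂ) :
    ratForm x N (MvPolynomial.C a) = a • invProdForm x (N • Finset.univ.val) := by
  refine Subtype.ext (congrArg (fun F : (Fin n → ℂ) → ℂ => (F : Germ (𝓝[arrCompl x] 0) ℂ))
    (funext fun z => ?_))
  rw [MvPolynomial.eval_C]
  change _ = a * invProd x (N • Finset.univ.val) z
  rw [invProd_nsmul_univ, div_eq_mul_inv]

end Rational

/-! ### Fourier coefficients of torus integrals. -/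

section TorusAverage

open MeasureTheory

variable {n : ℕ} {ι : Type*} [Fintype ι] {x : ι → Fin n → ℤ}

/-- The point of the torus `|xₖ| = ρₖ` with arguments `2πu`. -/
def torusPoint (S : OrdTuple x) (ρ u : Fin n → ℝ) : Fin n → ℂ :=
  (formsMatrix S.forms)⁻¹.mulVec (polar ρ u)

lemma continuous_polar (ρ : Fin n → ℝ) : Continuous (polar ρ) := by
  unfold polar
  fun_prop

lemma continuous_torusPoint (S : OrdTuple x) (ρ : Fin n → ℝ) : Continuous (torusPoint S ρ) :=
  (Continuous.matrix_mulVec continuous_const continuous_id).comp (continuous_polar ρ)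

lemma torusPoint_mem_arrCompl (S : OrdTuple x) {ρ : Fin n → ℝ} (hρ : ρ ∈ torusDomain S)
    (u : Fin n → ℝ) : torusPoint S ρ u ∈ arrCompl x := fun i => by
  rw [torusPoint, evC_mulVec_inv]
  exact (hρ.2 i).ne_zero fun k => by rw [norm_polar, abs_of_pos (hρ.1 k)]

/-- If the radii are small the torus is contained in a given neighbourhood of `0`. -/
lemma exists_pos_torusPoint_mem (S : OrdTuple x) {W : Set (Fin n → ℂ)} (hW : W ∈ 𝓝 0) :
    ∃ ε : ℝ, 0 < ε ∧ ∀ ρ : Fin n → ℝ, (∀ k, |ρ k| < ε) → ∀ s ∈ Ioc (0 : ℝ) 1, ∀ u,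
      (s : ℂ) • torusPoint S ρ u ∈ W := by
  have h1 : Continuous fun w : Fin n → ℂ => (formsMatrix S.forms)⁻¹.mulVec w :=
    Continuous.matrix_mulVec continuous_const continuous_id
  have h2 : (fun w : Fin n → ℂ => (formsMatrix S.forms)⁻¹.mulVec w) ⁻¹' W ∈ 𝓝 0 :=
    h1.continuousAt.preimage_mem_nhds (by rwa [Matrix.mulVec_zero])
  obtain ⟨ε, hε, hsub⟩ := Metric.mem_nhds_iff.1 h2
  refine ⟨ε, hε, fun ρ hρ s hs u => ?_⟩
  rw [torusPoint, ← Matrix.mulVec_smul]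
  refine hsub ?_
  rw [mem_ball_zero_iff, pi_norm_lt_iff hε]
  intro k
  rw [Pi.smul_apply, norm_smul, norm_polar, Complex.norm_real, Real.norm_of_nonneg hs.1.le]
  exact (mul_le_of_le_one_left (abs_nonneg _) hs.2).trans_lt (hρ k)

lemma exists_small_mem_torusDomain (hx : IsIntegralArrangement x) (S : OrdTuple x) {ε : ℝ}
    (hε : 0 < ε) : ∃ ρ ∈ torusDomain S, ∀ k, |ρ k| < ε := by
  obtain ⟨δ, hδ⟩ := (eventually_pow_mem_torusDomain hx S).exists
  set ρ : Fin n → ℝ := fun k : Fin n => δ ^ (n - 1 - (k : ℕ))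
  have h1 : ∀ᶠ σ : ℝ in 𝓝[>] 0, ∀ l, |(σ • ρ) l| < ε := eventually_all.2 fun l => by
    have : Tendsto (fun σ : ℝ => |(σ • ρ) l|) (𝓝 0) (𝓝 |0 * ρ l|) := (tendsto_id.mul_const (ρ l)).abs
    rw [zero_mul, abs_zero] at this
    exact (this.eventually_lt_const hε).filter_mono nhdsWithin_le_nhds
  obtain ⟨σ, hσ, hσ0⟩ := (h1.and self_mem_nhdsWithin).exists
  exact ⟨σ • ρ, smul_mem_torusDomain S hδ hσ0, hσ⟩

/-- A neighbourhood of `0` in which all points of the complement are small. -/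
def smallNhd (x : ι → Fin n → ℤ) : Set (Fin n → ℂ) := {z | ∀ i, ‖evC (x i) z‖ < 2 * Real.pi}

lemma isOpen_smallNhd : IsOpen (smallNhd x) := by
  have : smallNhd x = ⋂ i, {z | ‖evC (x i) z‖ < 2 * Real.pi} := by
    ext z
    simp [smallNhd]
  rw [this]
  exact isOpen_iInter_of_finite fun i => isOpen_lt (continuous_evC _).norm continuous_const

lemma smallNhd_mem_nhds : smallNhd x ∈ 𝓝 (0 : Fin n → ℂ) :=
  isOpen_smallNhd.mem_nhds fun i => by
    rw [evC_zero, norm_zero]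
    positivity

lemma isSmallPoint_of_mem {z : Fin n → ℂ} (hz : z ∈ arrCompl x) (hz' : z ∈ smallNhd x) :
    IsSmallPoint x z := fun i => exp_ne_one_of_norm_lt (hz i) (hz' i)

lemma analyticAt_toddCoeff (S : OrdTuple x) (t : Fin n → ℝ) {z : Fin n → ℂ}
    (hz : IsSmallPoint x z) : AnalyticAt ℂ (toddCoeff S.forms t) z := by
  have h1 : cubeCharacter S.forms t = fun z =>
      ∑ p ∈ (cubePoints_finite S.forms t).toFinset, Complex.exp (evC p z) := by
    funext z
    exact finsum_mem_eq_finite_toFinset_sum _ _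
  have h2 : AnalyticAt ℂ (cubeCharacter S.forms t) z := by
    rw [h1]
    exact Finset.analyticAt_fun_sum _ fun p _ => (analyticAt_evC p z).cexp
  have h3 : AnalyticAt ℂ (fun z => (formsDet S.forms : ℂ) *
      ∏ k, (1 - Complex.exp (evC (S.forms k) z))⁻¹) z :=
    analyticAt_const.mul (Finset.analyticAt_fun_prod _ fun k _ =>
      (analyticAt_const.sub (analyticAt_evC _ _).cexp).inv (sub_ne_zero.2 (hz _).symm))
  exact (analyticAt_const.mul h2).mul h3

set_option maxHeartbeats 400000 in
/-- The Fourier coefficients of an average of the functions `t ↦ exp(t) μ_t(y)`. -/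
lemma exists_average_toddExp {y : Fin n → Fin n → ℤ} (hy : formsDet y ≠ 0)
    {A : (Fin n → ℝ) → ℂ} (hA : Continuous A) {Z : (Fin n → ℝ) → Fin n → ℂ} (hZ : Continuous Z)
    (hne : ∀ u k, Complex.exp (evC (y k) (Z u)) ≠ 1) (a : Fin n → ℝ) :
    ∃ G : (Fin n → ℝ) → ℂ, Measurable G ∧
      (∀ t ∈ unitBox a, G t = ∫ u in Icc (0 : Fin n → ℝ) 1, A u * toddExp y (Z u) t) ∧
      (∃ B : ℝ, ∀ t ∈ unitBox a, ‖G t‖ ≤ B) ∧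
      ∀ j : Fin n → ℤ, ∫ t in unitBox a, Complex.exp (-pair t (twoPiI j)) * G t =
        ∫ u in Icc (0 : Fin n → ℝ) 1, A u * logCoeff y (twoPiI j - Z u) := by
  set κ : (Fin n → ℝ) → ℂ := fun u => A u * ((vol y : ℂ)⁻¹ * ((formsDet y : ℂ) *
    ∏ k, (1 - Complex.exp (evC (y k) (Z u)))⁻¹)) with hκ
  have hκc : Continuous κ := by
    refine hA.mul (continuous_const.mul (continuous_const.mul (continuous_finsetProd _ fun k _ => ?_)))
    refine Continuous.inv₀ (continuous_const.sub ((continuous_evC (y k)).comp hZ).cexp) fun u => ?_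
    exact sub_ne_zero.2 (hne u k).symm
  have hEc : Continuous fun q : (Fin n → ℝ) × (Fin n → ℝ) => Complex.exp (pair q.1 (Z q.2)) := by
    refine Continuous.cexp ?_
    unfold pair
    refine continuous_finsetSum _ fun k _ => ?_
    exact (Complex.continuous_ofReal.comp ((continuous_apply k).comp continuous_fst)).mul
      ((continuous_apply k).comp (hZ.comp continuous_snd))
  -- A jointly measurable version of the integrand, equal to it for `t` in the box; this is what
  -- Fubini's theorem needs.
  set F : (Fin n → ℝ) × (Fin n → ℝ) → ℂ := fun q =>
    κ q.2 * ∑ p ∈ boxPoints y a, cubeExp y (Z q.2) (q.1 + fun l => (p l : ℝ)) with hF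
  have hFp : ∀ p : Fin n → ℤ, (fun q : (Fin n → ℝ) × (Fin n → ℝ) =>
      cubeExp y (Z q.2) (q.1 + fun l => (p l : ℝ))) =
      Set.indicator {q | (q.1 + fun l => (p l : ℝ)) ∈ cube y}
        fun q => Complex.exp (pair (q.1 + fun l => (p l : ℝ)) (Z q.2)) := by
    intro p
    funext q
    rfl
  have hshift : ∀ p : Fin n → ℤ, Continuous fun q : (Fin n → ℝ) × (Fin n → ℝ) =>
      ((q.1 + fun l => (p l : ℝ)), q.2) := fun p =>
    (continuous_fst.add continuous_const).prodMk continuous_snd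
  have hFm : Measurable F := by
    refine (hκc.measurable.comp measurable_snd).mul (Finset.measurable_fun_sum _ fun p _ => ?_)
    rw [hFp]
    refine Measurable.indicator (hEc.comp (hshift p)).measurable ?_
    exact (measurable_fst.add_const _) (measurableSet_cube y)
  have hFeq : ∀ t ∈ unitBox a, ∀ u, F (t, u) = A u * toddExp y (Z u) t := by
    intro t ht u
    rw [toddExp_eq_sum hy ht, hF]
    simp only [hκ, mul_assoc]
  obtain ⟨B, hB⟩ : ∃ B : ℝ, ∀ t ∈ unitBox a, ∀ u ∈ Icc (0 : Fin n → ℝ) 1, ‖F (t, u)‖ ≤ B := by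
    have hK : IsCompact ((Icc a (a + 1)) ×ˢ (Icc (0 : Fin n → ℝ) 1)) := isCompact_Icc.prod isCompact_Icc
    obtain ⟨B₁, hB₁⟩ := hK.exists_bound_of_continuousOn (hκc.comp continuous_snd).continuousOn
    have h1 : ∀ p : Fin n → ℤ, ∃ B₂ : ℝ, ∀ q ∈ (Icc a (a + 1)) ×ˢ (Icc (0 : Fin n → ℝ) 1),
        ‖Complex.exp (pair (q.1 + fun l => (p l : ℝ)) (Z q.2))‖ ≤ B₂ := fun p =>
      hK.exists_bound_of_continuousOn (hEc.comp (hshift p)).continuousOn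
    choose B₂ hB₂ using h1
    refine ⟨B₁ * ∑ p ∈ boxPoints y a, B₂ p, fun t ht u hu => ?_⟩
    have hq : (t, u) ∈ (Icc a (a + 1)) ×ˢ (Icc (0 : Fin n → ℝ) 1) :=
      ⟨⟨fun i => (ht i).1.le, fun i => (ht i).2⟩, hu⟩
    rw [hF]
    simp only [norm_mul]
    have h3 : ∀ p, ‖cubeExp y (Z u) (t + fun l => (p l : ℝ))‖ ≤ B₂ p := by
      intro p
      have := congrFun (hFp p) (t, u)
      simp only at this
      rw [this]
      exact (norm_indicator_le_norm_self _ _).trans (hB₂ p _ hq)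
    refine mul_le_mul (hB₁ _ hq) ((norm_sum_le _ _).trans (Finset.sum_le_sum fun p _ => h3 p))
      (norm_nonneg _) ((norm_nonneg _).trans (hB₁ _ hq))
  have hvol : volume (Icc (0 : Fin n → ℝ) 1) = 1 := by
    rw [Real.volume_Icc_pi]
    simp
  refine ⟨fun t => ∫ u in Icc (0 : Fin n → ℝ) 1, F (t, u), ?_, ?_, ?_, ?_⟩
  · exact (hFm.stronglyMeasurable.integral_prod_right).measurable
  · intro t ht
    exact setIntegral_congr_fun measurableSet_Icc fun u _ => hFeq t ht u
  · refine ⟨B, fun t ht => ?_⟩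
    have := norm_setIntegral_le_of_norm_le_const (μ := volume) (s := Icc (0 : Fin n → ℝ) 1)
      (f := fun u => F (t, u)) (by rw [hvol]; exact ENNReal.one_lt_top) (hB t ht)
    rwa [measureReal_def, hvol, ENNReal.toReal_one, mul_one] at this
  · intro j
    have hbox : volume (unitBox a) ≠ ⊤ := by rw [volume_unitBox]; exact ENNReal.one_ne_top
    have : IsFiniteMeasure ((volume : Measure (Fin n → ℝ)).restrict (unitBox a)) :=
      ⟨by rw [Measure.restrict_apply_univ, volume_unitBox]; exact ENNReal.one_lt_top⟩
    have : IsFiniteMeasure ((volume : Measure (Fin n → ℝ)).restrict (Icc 0 1)) :=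
      ⟨by rw [Measure.restrict_apply_univ, hvol]; exact ENNReal.one_lt_top⟩
    have hpm : Measurable fun q : (Fin n → ℝ) × (Fin n → ℝ) =>
        Complex.exp (-pair q.1 (twoPiI j)) :=
      ((continuous_pair (twoPiI j)).neg.cexp.measurable).comp measurable_fst
    have hpn : ∀ t : Fin n → ℝ, ‖Complex.exp (-pair t (twoPiI j))‖ = 1 := by
      intro t
      have : -pair t (twoPiI j) = ((-(∑ k, t k * (2 * Real.pi * j k)) : ℝ) : ℂ) * Complex.I := by
        simp only [pair, twoPiI]
        push_cast
        rw [neg_mul, Finset.sum_mul]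
        congr 1
        exact Finset.sum_congr rfl fun k _ => by ring
      rw [this, Complex.norm_exp_ofReal_mul_I]
    have hint : Integrable (Function.uncurry fun t u => Complex.exp (-pair t (twoPiI j)) * F (t, u))
        ((volume.restrict (unitBox a)).prod (volume.restrict (Icc 0 1))) := by
      refine Integrable.of_bound (hpm.mul hFm).aestronglyMeasurable B ?_
      rw [Measure.prod_restrict, ae_restrict_iff' ((measurableSet_unitBox a).prod measurableSet_Icc)]
      refine Eventually.of_forall fun q hq => ?_
      rw [Function.uncurry, norm_mul, hpn, one_mul]
      exact hB q.1 hq.1 q.2 hq.2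
    calc ∫ t in unitBox a, Complex.exp (-pair t (twoPiI j)) * ∫ u in Icc (0 : Fin n → ℝ) 1, F (t, u)
        = ∫ t in unitBox a, ∫ u in Icc (0 : Fin n → ℝ) 1,
            Complex.exp (-pair t (twoPiI j)) * F (t, u) := by
          refine integral_congr_ae (Eventually.of_forall fun t => ?_)
          exact (integral_const_mul _ _).symm
      _ = ∫ u in Icc (0 : Fin n → ℝ) 1, ∫ t in unitBox a,
            Complex.exp (-pair t (twoPiI j)) * F (t, u) := integral_integral_swap hint
      _ = _ := by
          refine integral_congr_ae (Eventually.of_forall fun u => ?_)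
          simp only
          rw [← fourierCoeff_toddExp hy (hne u) a j, ← integral_const_mul]
          refine setIntegral_congr_fun (measurableSet_unitBox a) fun t ht => ?_
          simp only [hFeq t ht]
          ring

/-- The contribution of `S` to the distribution, as a function on a unit box. -/
lemma exists_average_pairing (hx : IsIntegralArrangement x) (S : OrdTuple x) (s : Multiset ι)
    (a : Fin n → ℝ) :
    ∃ G : (Fin n → ℝ) → ℂ, Measurable G ∧
      (∀ t ∈ unitBox a, G t = pairing hx
        (meroMul (expForm x t) (meroMul (invProdForm x s) (toddForm t S))) (torusClass hx S)) ∧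
      (∃ B : ℝ, ∀ t ∈ unitBox a, ‖G t‖ ≤ B) ∧
      ∀ j : Fin n → ℤ, ∫ t in unitBox a, Complex.exp (-pair t (twoPiI j)) * G t =
        pairing hx (meroMul (invProdForm x s) (shiftForm (twoPiI j) S)) (torusClass hx S) := by
  -- One torus serves all `t` and all `j`: inside `smallNhd` both `μ_t(S)` and `b(S)(twoPiI j - z)`
  -- are holomorphic off the arrangement.
  obtain ⟨ε, hε, hεW⟩ := exists_pos_torusPoint_mem S (smallNhd_mem_nhds (x := x))
  obtain ⟨ρ, hρ, hρε⟩ := exists_small_mem_torusDomain hx S hε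
  have hW := hεW ρ hρε
  have hU := torusPoint_mem_arrCompl S hρ
  have hsm : ∀ u, IsSmallPoint x (torusPoint S ρ u) := fun u =>
    isSmallPoint_of_mem (hU u) (by simpa using hW 1 ⟨one_pos, le_rfl⟩ u)
  have hy := (represents_self hx S).formsDet_ne_zero
  have hA : Continuous fun u => (formsDet S.forms : ℂ)⁻¹ *
      (invProd x s (torusPoint S ρ u) * ∏ k, polar ρ u k) := by
    refine continuous_const.mul (Continuous.mul ?_ (continuous_finsetProd _ fun k _ =>
      (continuous_apply k).comp (continuous_polar ρ)))
    exact (analyticOnNhd_invProd s).continuousOn.comp_continuous (continuous_torusPoint S ρ) hU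
  obtain ⟨G, hGm, hG, hGb, hGf⟩ := exists_average_toddExp (y := S.forms) (by exact_mod_cast hy) hA
    (continuous_torusPoint S ρ) (fun u k => hsm u _) a
  refine ⟨G, hGm, fun t ht => ?_, hGb, fun j => ?_⟩
  · rw [hG t ht, pairing_torusClass hx _ (h := fun z => Complex.exp (pair t z) *
      (invProd x s z * toddCoeff S.forms t z)) rfl isOpen_smallNhd (fun z hz =>
        (analyticAt_pair t z).cexp.mul ((analyticOnNhd_invProd s z hz.1).mul
          (analyticAt_toddCoeff S t (isSmallPoint_of_mem hz.1 hz.2)))) S hρ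
      (fun σ hσ u => hW σ hσ fun k => (u k : ℝ)), torusAvg, ← integral_const_mul]
    refine integral_congr_ae (Eventually.of_forall fun u => ?_)
    simp only [toddExp, torusPoint]
    ring
  · rw [hGf j, pairing_torusClass hx _ (h := fun z =>
      invProd x s z * logCoeff S.forms (twoPiI j - z)) rfl isOpen_smallNhd (fun z hz => ?_) S hρ
      (fun σ hσ u => hW σ hσ fun k => (u k : ℝ)), torusAvg, ← integral_const_mul]
    · refine integral_congr_ae (Eventually.of_forall fun u => ?_)
      simp only [torusPoint]
      ring
    · have h1 := (isSmallPoint_of_mem hz.1 hz.2).twoPiI_sub_mem j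
      have h2 : AnalyticAt ℂ (fun z : Fin n → ℂ => twoPiI j - z) z := analyticAt_const.sub analyticAt_id
      exact (analyticOnNhd_invProd s z hz.1).mul
        ((analyticOnNhd_logCoeff S _ h1).comp_of_eq h2 rfl)

end TorusAverage

/-! ### The absolutely convergent series. -/

section Series

open MeasureTheory

variable {n : ℕ} {ι : Type*} [Fintype ι] {x : ι → Fin n → ℤ}

lemma summable_prod_apply {f : ℤ → ℝ} (hf0 : ∀ m, 0 ≤ f m) (hf : Summable f) :
    ∀ d : ℕ, Summable fun m : Fin d → ℤ => ∏ k, f (m k) := by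
  intro d
  induction d with
  | zero => exact Summable.of_finite
  | succ d ih =>
    have h1 := hf.mul_of_nonneg ih (fun m => hf0 m) fun m => Finset.prod_nonneg fun k _ => hf0 _
    rw [← (Fin.consEquiv fun _ : Fin (d + 1) => ℤ).summable_iff]
    refine h1.congr fun q => ?_
    simp [Fin.consEquiv, Fin.prod_univ_succ]

lemma one_le_prod_real {A : Type*} {s : Finset A} {f : A → ℝ} (h : ∀ i, 1 ≤ f i) :
    1 ≤ ∏ i ∈ s, f i :=
  Finset.prod_induction f (1 ≤ ·) (fun _ _ => one_le_mul_of_one_le_of_one_le) le_rfl fun i _ => h i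

/-- The Fourier coefficients of the Bernoulli series of the `N`th power of the product of the
inverses of the forms. -/
def bernCoeff (x : ι → Fin n → ℤ) (N : ℕ) (j : Fin n → ℤ) : ℂ :=
  (arrCompl x).indicator (fun z => (formsProd x z ^ N)⁻¹) (twoPiI j)

lemma evC_twoPiI (y j : Fin n → ℤ) :
    evC y (twoPiI j) = 2 * Real.pi * Complex.I * ((∑ k, y k * j k : ℤ) : ℂ) := by
  simp only [evC, twoPiI]
  push_cast
  rw [Finset.mul_sum]
  exact Finset.sum_congr rfl fun k _ => by ring

lemma norm_evC_twoPiI_ge (y j : Fin n → ℤ) :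
    |((∑ k, y k * j k : ℤ) : ℝ)| ≤ ‖evC y (twoPiI j)‖ := by
  rw [evC_twoPiI, norm_mul, norm_mul, norm_mul, Complex.norm_intCast, Complex.norm_I,
    Complex.norm_real, Complex.norm_ofNat, Real.norm_of_nonneg Real.pi_pos.le]
  nlinarith [Real.pi_gt_three, abs_nonneg ((∑ k, y k * j k : ℤ) : ℝ)]

/-- On the complement each form is a nonzero integral multiple of `2π√-1` at `twoPiI j`. Forms
outside a basis can therefore be dropped from a lower bound of the product, and what remains is the
product of the integral coordinates of `j` in that basis. These determine `j`, so the series is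
dominated by a product of series `∑ m⁻²`. -/
lemma summable_bernCoeff (hx : IsIntegralArrangement x) {N : ℕ} (hN : 2 ≤ N) :
    Summable fun j => ‖bernCoeff x N j‖ := by
  classical
  obtain ⟨S⟩ : Nonempty (OrdTuple x) := exists_ordTuple hx
  have h1 : Summable fun m : ℤ => ((m : ℝ) ^ 2)⁻¹ := by
    simpa using (Real.summable_one_div_int_pow (p := 2)).2 (by norm_num)
  have h2 := summable_prod_apply (fun m => by positivity) h1 n
  set L : (Fin n → ℤ) → Fin n → ℤ := fun j k => ∑ l, S.forms k l * j l with hL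
  have hLi : Function.Injective L := by
    have h3 : formsDet S.forms ≠ 0 := by exact_mod_cast (represents_self hx S).formsDet_ne_zero
    intro j j' h
    refine sub_eq_zero.1 (Matrix.eq_zero_of_mulVec_eq_zero (M := Matrix.of S.forms) h3 ?_)
    rw [Matrix.mulVec_sub, sub_eq_zero]
    exact h
  refine Summable.of_nonneg_of_le (fun _ => norm_nonneg _) (fun j => ?_) (h2.comp_injective hLi)
  by_cases hj : twoPiI j ∈ arrCompl x
  · have hm : ∀ i, 1 ≤ |((∑ k, x i k * j k : ℤ) : ℝ)| := by
      intro i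
      have h4 : (∑ k, x i k * j k : ℤ) ≠ 0 := by
        intro h
        apply hj i
        rw [evC_twoPiI, h]
        simp
      exact_mod_cast Int.one_le_abs h4
    have hp : ∏ k, |(L j k : ℝ)| ≤ ‖formsProd x (twoPiI j)‖ := by
      have h4 : ∏ k, |(L j k : ℝ)| =
          ∏ i ∈ Finset.univ.image S.1, |((∑ k, x i k * j k : ℤ) : ℝ)| :=
        (Finset.prod_image (f := fun i => |((∑ k, x i k * j k : ℤ) : ℝ)|)
          fun a _ b _ h => S.injective h).symm
      rw [formsProd, norm_prod, h4]
      refine le_trans ?_ (Finset.prod_le_prod (fun i _ => abs_nonneg _)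
        fun i _ => norm_evC_twoPiI_ge (x i) j)
      rw [← Finset.prod_sdiff (Finset.subset_univ (Finset.univ.image S.1))]
      exact le_mul_of_one_le_left (Finset.prod_nonneg fun _ _ => abs_nonneg _)
        (one_le_prod_real fun i => hm i)
    have hp1 : (1 : ℝ) ≤ ∏ k, |(L j k : ℝ)| := one_le_prod_real fun k => hm (S.1 k)
    rw [bernCoeff, Set.indicator_of_mem hj, norm_inv, norm_pow]
    simp only [Function.comp_apply]
    have h5 : ∏ k, ((L j k : ℝ) ^ 2)⁻¹ = ((∏ k, |(L j k : ℝ)|) ^ 2)⁻¹ := by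
      rw [Finset.prod_inv_distrib, ← Finset.prod_pow]
      simp only [sq_abs]
    rw [h5]
    refine inv_anti₀ (by positivity) ?_
    calc (∏ k, |(L j k : ℝ)|) ^ 2 ≤ (∏ k, |(L j k : ℝ)|) ^ N := pow_le_pow_right₀ hp1 hN
      _ ≤ _ := by gcongr
  · rw [bernCoeff, Set.indicator_of_notMem hj, norm_zero]
    exact Finset.prod_nonneg fun k _ => by positivity

lemma norm_exp_pair_twoPiI (t : Fin n → ℝ) (j : Fin n → ℤ) :
    ‖Complex.exp (pair t (twoPiI j))‖ = 1 := by
  have : pair t (twoPiI j) = (((∑ k, t k * (2 * Real.pi * j k)) : ℝ) : ℂ) * Complex.I := by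
    simp only [pair, twoPiI]
    push_cast
    rw [Finset.sum_mul]
    exact Finset.sum_congr rfl fun k _ => by ring
  rw [this, Complex.norm_exp_ofReal_mul_I]

lemma integral_unitBox_exp (a : Fin n → ℝ) (j : Fin n → ℤ) [Decidable (j = 0)] :
    ∫ t in unitBox a, Complex.exp (pair t (twoPiI j)) = if j = 0 then 1 else 0 := by
  have h1 : ∀ t : Fin n → ℝ, Complex.exp (pair t (twoPiI j)) =
      ∏ k, Complex.exp (twoPiI j k * (t k : ℂ)) := by
    intro t
    rw [pair, Complex.exp_sum]
    exact Finset.prod_congr rfl fun k _ => by rw [mul_comm]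
  have h2 : unitBox a = Set.univ.pi fun i => Ioc (a i) (a i + 1) := by ext; simp [unitBox]
  simp only [h1]
  rw [h2, volume_pi, Measure.restrict_pi_pi,
    integral_fintype_prod_eq_prod (fun k (s : ℝ) => Complex.exp (twoPiI j k * (s : ℂ)))]
  split_ifs with hj
  · refine Finset.prod_eq_one fun k _ => ?_
    simp [hj, twoPiI]
  · obtain ⟨k, hk⟩ := Function.ne_iff.1 hj
    refine Finset.prod_eq_zero (Finset.mem_univ k) ?_
    have hc : twoPiI j k ≠ 0 := by
      simp only [twoPiI]
      exact mul_ne_zero Complex.two_pi_I_ne_zero (by exact_mod_cast hk)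
    rw [← intervalIntegral.integral_of_le (by linarith), integral_exp_mul_complex hc]
    have h3 : Complex.exp (twoPiI j k * ((a k + 1 : ℝ) : ℂ)) =
        Complex.exp (twoPiI j k * ((a k : ℝ) : ℂ)) := by
      push_cast
      rw [mul_add, mul_one, Complex.exp_add]
      have : Complex.exp (twoPiI j k) = 1 := by
        rw [twoPiI, mul_comm]
        exact Complex.exp_int_mul_two_pi_mul_I _
      rw [this, mul_one]
    rw [h3, sub_self, zero_div]

/-- The sum of the Bernoulli series. -/
def bernSeries (x : ι → Fin n → ℤ) (N : ℕ) (t : Fin n → ℝ) : ℂ :=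
  ∑' j, bernCoeff x N j * Complex.exp (pair t (twoPiI j))

lemma norm_bernTerm (N : ℕ) (t : Fin n → ℝ) (j : Fin n → ℤ) :
    ‖bernCoeff x N j * Complex.exp (pair t (twoPiI j))‖ = ‖bernCoeff x N j‖ := by
  rw [norm_mul, norm_exp_pair_twoPiI, mul_one]

lemma continuous_bernSeries (hx : IsIntegralArrangement x) {N : ℕ} (hN : 2 ≤ N) :
    Continuous (bernSeries x N) :=
  continuous_tsum (fun _ => continuous_const.mul (continuous_pair _).cexp) (summable_bernCoeff hx hN)
    fun _ _ => (norm_bernTerm N _ _).le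

lemma norm_bernSeries_le (hx : IsIntegralArrangement x) {N : ℕ} (hN : 2 ≤ N) (t : Fin n → ℝ) :
    ‖bernSeries x N t‖ ≤ ∑' j, ‖bernCoeff x N j‖ :=
  tsum_of_norm_bounded (summable_bernCoeff hx hN).hasSum fun j => (norm_bernTerm N t j).le

lemma hasSum_integral_bernSeries (hx : IsIntegralArrangement x) {N : ℕ} (hN : 2 ≤ N)
    {μ : Measure (Fin n → ℝ)} {g : (Fin n → ℝ) → ℂ} (hg : Integrable g μ) :
    HasSum (fun j => ∫ t, g t * (bernCoeff x N j * Complex.exp (pair t (twoPiI j))) ∂μ)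
      (∫ t, g t * bernSeries x N t ∂μ) := by
  have h1 : ∀ j, Integrable (fun t => g t * (bernCoeff x N j * Complex.exp (pair t (twoPiI j)))) μ := by
    intro j
    refine hg.mul_bdd (c := ‖bernCoeff x N j‖)
      (continuous_const.mul (continuous_pair _).cexp).aestronglyMeasurable
      (Eventually.of_forall fun t => (norm_bernTerm N t j).le)
  have h2 := hasSum_integral_of_summable_integral_norm h1 (by
    refine ((summable_bernCoeff hx hN).mul_left (∫ t, ‖g t‖ ∂μ)).congr fun j => ?_
    rw [← integral_mul_const]
    refine integral_congr_ae (Eventually.of_forall fun t => ?_)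
    simp only [norm_mul (g t), norm_bernTerm])
  simp only [tsum_mul_left] at h2
  exact h2

/-- Termwise integration and orthogonality of the characters. -/
lemma fourierCoeff_bernSeries (hx : IsIntegralArrangement x) {N : ℕ} (hN : 2 ≤ N) (a : Fin n → ℝ)
    (l : Fin n → ℤ) :
    ∫ t in unitBox a, Complex.exp (-pair t (twoPiI l)) * bernSeries x N t = bernCoeff x N l := by
  classical
  have hfin : IsFiniteMeasure ((volume : Measure (Fin n → ℝ)).restrict (unitBox a)) :=
    ⟨by rw [Measure.restrict_apply_univ, volume_unitBox]; exact ENNReal.one_lt_top⟩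
  have hneg : ∀ t : Fin n → ℝ, Complex.exp (-pair t (twoPiI l)) = Complex.exp (pair t (twoPiI (-l))) := by
    intro t
    congr 1
    simp [pair, twoPiI]
  have h1 : Integrable (fun t : Fin n → ℝ => Complex.exp (-pair t (twoPiI l)))
      (volume.restrict (unitBox a)) := by
    refine Integrable.of_bound (continuous_pair (twoPiI l)).neg.cexp.aestronglyMeasurable 1
      (Eventually.of_forall fun t => ?_)
    rw [hneg, norm_exp_pair_twoPiI]
  have h2 := hasSum_integral_bernSeries hx hN h1
  refine h2.unique ?_
  have h3 : ∀ j, ∫ t in unitBox a, Complex.exp (-pair t (twoPiI l)) *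
      (bernCoeff x N j * Complex.exp (pair t (twoPiI j))) = if j = l then bernCoeff x N l else 0 := by
    intro j
    have h4 : ∀ t : Fin n → ℝ, Complex.exp (-pair t (twoPiI l)) *
        (bernCoeff x N j * Complex.exp (pair t (twoPiI j))) =
        bernCoeff x N j * Complex.exp (pair t (twoPiI (j - l))) := by
      intro t
      rw [mul_left_comm, ← Complex.exp_add]
      congr 2
      simp only [pair, twoPiI, Pi.sub_apply]
      rw [← Finset.sum_neg_distrib, ← Finset.sum_add_distrib]
      refine Finset.sum_congr rfl fun k _ => ?_
      push_cast
      ring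
    simp only [h4]
    rw [integral_const_mul, integral_unitBox_exp]
    by_cases hjl : j = l
    · simp [hjl]
    · simp [hjl, sub_eq_zero]
  simp only [h3]
  exact hasSum_ite_eq l _

/-- Almost everywhere the Bernoulli series is given by the residue formula. -/
theorem bernSeries_eq (hx : IsIntegralArrangement x) {DB : Finset (OrdTuple x)}
    (hDB : IsDualBasis hx DB) {N : ℕ} (hN : 2 ≤ N) :
    ∀ᵐ t : Fin n → ℝ, bernSeries x N t = ∑ S ∈ DB, pairing hx (meroMul (expForm x t)
      (meroMul (invProdForm x (N • Finset.univ.val)) (toddForm t S))) (torusClass hx S) := by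
  classical
  -- Uniqueness is applied on one half open box at a time; the countably many integral translates
  -- cover the space.
  have key : ∀ a : Fin n → ℤ, ∀ᵐ t : Fin n → ℝ, t ∈ unitBox (fun k => (a k : ℝ)) →
      bernSeries x N t = ∑ S ∈ DB, pairing hx (meroMul (expForm x t)
        (meroMul (invProdForm x (N • Finset.univ.val)) (toddForm t S))) (torusClass hx S) := by
    intro a
    set b : Fin n → ℝ := fun k => (a k : ℝ) with hb
    choose G hGm hG hGb hGf using fun S =>
      exists_average_pairing hx S (N • Finset.univ.val) b
    choose B hB using hGb
    have hfin : IsFiniteMeasure ((volume : Measure (Fin n → ℝ)).restrict (unitBox b)) :=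
      ⟨by rw [Measure.restrict_apply_univ, volume_unitBox]; exact ENNReal.one_lt_top⟩
    have hen : ∀ (l : Fin n → ℤ) (t : Fin n → ℝ), ‖Complex.exp (-pair t (twoPiI l))‖ = 1 := by
      intro l t
      rw [Complex.exp_neg, norm_inv, norm_exp_pair_twoPiI, inv_one]
    have hi : ∀ (l : Fin n → ℤ) (g : (Fin n → ℝ) → ℂ) (C : ℝ), Measurable g →
        (∀ t ∈ unitBox b, ‖g t‖ ≤ C) →
        Integrable (fun t => Complex.exp (-pair t (twoPiI l)) * g t)
          (volume.restrict (unitBox b)) := by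
      intro l g C hg hC
      refine Integrable.of_bound (((continuous_pair _).neg.cexp.measurable.mul hg)).aestronglyMeasurable
        C ((ae_restrict_iff' (measurableSet_unitBox b)).2 (Eventually.of_forall fun t ht => ?_))
      rw [norm_mul, hen, one_mul]
      exact hC t ht
    -- The Fourier coefficients agree by the reproducing property: the torus integrals give the
    -- value at `twoPiI l` off the hyperplanes, and `0` at the lattice points which the series
    -- omits.
    have h1 := ae_eq_zero_of_fourier b (g := fun t => bernSeries x N t - ∑ S ∈ DB, G S t)
      (B := (∑' j, ‖bernCoeff x N j‖) + ∑ S ∈ DB, B S)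
      ((continuous_bernSeries hx hN).measurable.sub (Finset.measurable_fun_sum _ fun S _ => hGm S))
      (fun t ht => by
        have h2 := (norm_sum_le DB fun S => G S t).trans (Finset.sum_le_sum fun S _ => hB S t ht)
        linarith [norm_sub_le (bernSeries x N t) (∑ S ∈ DB, G S t), norm_bernSeries_le hx hN t])
      (fun l => by
        simp only [mul_sub, Finset.mul_sum]
        rw [integral_sub (hi l _ _ (continuous_bernSeries hx hN).measurable
            fun t _ => norm_bernSeries_le hx hN t)
          (integrable_finsetSum _ fun S _ => hi l _ _ (hGm S) (hB S)),
          integral_finsetSum _ fun S _ => hi l _ _ (hGm S) (hB S), fourierCoeff_bernSeries hx hN,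
          Finset.sum_congr rfl fun S _ => hGf S l, sub_eq_zero]
        have h2 := hDB.diagPairing_eq (shiftMap (twoPiI l)) (invProdForm x (N • Finset.univ.val))
        rw [diagPairing_shiftMap_pow hx (by omega)] at h2
        rw [bernCoeff, Set.indicator_apply, h2]
        exact Finset.sum_congr rfl fun S _ => by rw [shiftMap_logClass])
    rw [ae_restrict_iff' (measurableSet_unitBox b)] at h1
    filter_upwards [h1] with t ht htb
    rw [sub_eq_zero.1 (ht htb)]
    exact Finset.sum_congr rfl fun S _ => hG S t htb
  filter_upwards [ae_all_iff.2 key] with t ht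
  refine ht (fun k => ⌈t k⌉ - 1) fun k => ?_
  push_cast
  constructor
  · linarith [Int.ceil_lt_add_one (t k)]
  · linarith [Int.le_ceil (t k)]

end Series

/-! ### The Fourier series as a distribution. -/

section Distributions

open MeasureTheory

variable {n : ℕ} {ι : Type*} [Fintype ι] {x : ι → Fin n → ℤ}

/-- Test functions on `ℝⁿ`. -/
abbrev Test (n : ℕ) : Type := TestFunction (⊤ : TopologicalSpace.Opens (Fin n → ℝ)) ℝ ⊤

lemma integrable_test_mul (φ : Test n) {g : (Fin n → ℝ) → ℂ} (hg : Continuous g) :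
    Integrable fun t => (φ t : ℂ) * g t := by
  have h1 : Continuous fun t => (φ t : ℂ) * g t :=
    (Complex.continuous_ofReal.comp φ.contDiff.continuous).mul hg
  refine h1.integrable_of_hasCompactSupport ?_
  have h2 : HasCompactSupport fun t => (φ t : ℂ) :=
    φ.hasCompactSupport.comp_left (g := fun r : ℝ => (r : ℂ)) Complex.ofReal_zero
  exact h2.mul_right

lemma integral_test_lineDeriv (φ : Test n) (v : Fin n → ℝ) {g g' : (Fin n → ℝ) → ℂ}
    (hg : Continuous g) (hg' : Continuous g') (h : ∀ t, HasLineDerivAt ℝ g (g' t) t v) :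
    ∫ t, (φ t : ℂ) * g' t =
      -∫ t, ((TestFunction.lineDerivCLM ℝ v φ : Test n) t : ℂ) * g t := by
  have h1 : ∀ t, HasLineDerivAt ℝ φ ((TestFunction.lineDerivCLM ℝ v φ : Test n) t) t v := by
    intro t
    rw [TestFunction.lineDerivCLM_apply_of_le (by simp)]
    exact ((φ.contDiff.differentiable (by simp)) t).lineDifferentiableAt.hasLineDerivAt
  have h2 := integral_bilinear_hasLineDerivAt_right_eq_neg_left_of_integrable (μ := volume)
    (f := φ) (f' := (TestFunction.lineDerivCLM ℝ v φ : Test n)) (g := g) (g' := g') (v := v)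
    (B := ContinuousLinearMap.lsmul ℝ ℝ) (by
      simpa [-TestFunction.lineDerivCLM_apply] using
        integrable_test_mul (TestFunction.lineDerivCLM ℝ v φ : Test n) hg)
    (by simpa using integrable_test_mul φ hg') (by simpa using integrable_test_mul φ hg)
    (fun t _ => h1 t) (fun t _ => h t)
  simpa using h2

lemma diagPairing_add (hx : IsIntegralArrangement x) (q : OS x →ₗ[ℤ] meroForms x)
    (γ γ' : meroForms x) : diagPairing hx q (γ + γ') = diagPairing hx q γ + diagPairing hx q γ' := by
  obtain ⟨DB, h⟩ := exists_isDualBasis' hx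
  rw [h.diagPairing_eq, h.diagPairing_eq, h.diagPairing_eq, ← Finset.sum_add_distrib]
  refine Finset.sum_congr rfl fun S _ => ?_
  rw [← LinearMap.add_apply, ← map_add]
  congr 2
  exact Subtype.ext (add_mul _ _ _)

lemma meroMul_add (γ η η' : meroForms x) : meroMul γ (η + η') = meroMul γ η + meroMul γ η' :=
  Subtype.ext (mul_add _ _ _)

lemma meroMul_smul (c : ℂ) (γ η : meroForms x) : meroMul γ (c • η) = c • meroMul γ η := by
  refine Subtype.ext ?_
  obtain ⟨f, hf⟩ := exists_rep γ
  obtain ⟨g, hg⟩ := exists_rep η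
  rw [coe_meroMul, Submodule.coe_smul, Submodule.coe_smul, coe_meroMul, hf, hg]
  exact congrArg (fun F : (Fin n → ℂ) → ℂ => (F : Germ (𝓝[arrCompl x] 0) ℂ))
    (funext fun z => mul_left_comm (f z) c (g z))

lemma exists_polynomial_diagPairing (hx : IsIntegralArrangement x) (q : OS x →ₗ[ℤ] meroForms x)
    (γ : meroForms x) : ∃ p : MvPolynomial (Fin n) ℂ, ∀ t : Fin n → ℝ,
      diagPairing hx q (meroMul (expForm x t) γ) = MvPolynomial.eval (fun k => (t k : ℂ)) p := by
  obtain ⟨DB, h⟩ := exists_isDualBasis' hx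
  choose p hp using fun S : OrdTuple x =>
    exists_polynomial_pairing_expForm hx (meroMul γ (q (logClass S))) (torusClass hx S)
  refine ⟨∑ S ∈ DB, p S, fun t => ?_⟩
  rw [h.diagPairing_eq, map_sum]
  exact Finset.sum_congr rfl fun S _ => by rw [← meroMul_assoc, hp]

lemma continuous_diagPairing (hx : IsIntegralArrangement x) (q : OS x →ₗ[ℤ] meroForms x)
    (γ : meroForms x) : Continuous fun t => diagPairing hx q (meroMul (expForm x t) γ) := by
  obtain ⟨p, hp⟩ := exists_polynomial_diagPairing hx q γ
  simp only [hp]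
  exact (MvPolynomial.continuous_eval p).comp
    (continuous_pi fun k => Complex.continuous_ofReal.comp (continuous_apply k))

lemma hasLineDerivAt_diagPairing (hx : IsIntegralArrangement x) (q : OS x →ₗ[ℤ] meroForms x)
    (γ : meroForms x) (t : Fin n → ℝ) (k : Fin n) :
    HasLineDerivAt ℝ (fun t => diagPairing hx q (meroMul (expForm x t) γ))
      (diagPairing hx q (meroMul (expForm x t) (meroMul (coordForm x k) γ))) t (Pi.single k 1) := by
  obtain ⟨DB, h⟩ := exists_isDualBasis' hx
  simp only [h.diagPairing_eq]
  refine HasDerivAt.fun_sum fun S _ => ?_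
  have := hasLineDerivAt_pairing_expForm hx (meroMul γ (q (logClass S))) (torusClass hx S) t k
  simp only [← meroMul_assoc]
  exact this

/-- The Fourier series of a rational function is a distribution, given on each chamber by the
pairing with the diagonal class. -/
theorem exists_distribution_ratForm (hx : IsIntegralArrangement x) {N : ℕ} (hN : 2 ≤ N)
    (P : MvPolynomial (Fin n) ℂ) :
    ∃ B : Distribution (⊤ : TopologicalSpace.Opens (Fin n → ℝ)) ℂ ⊤,
      IsFourierSeries x (fun z => MvPolynomial.eval z P / formsProd x z ^ N) B ∧
      ∀ (Δ : Set (Fin n → ℝ)) (q : OS x →ₗ[ℤ] meroForms x), IsDeformation Δ q →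
        ∀ φ : Test n, tsupport φ ⊆ Δ →
          B φ = ∫ t, (φ t : ℂ) * diagPairing hx q (meroMul (expForm x t) (ratForm x N P)) := by
  induction P using MvPolynomial.induction_on with
  -- For a constant numerator the series converges absolutely to a continuous function, which
  -- defines the distribution.
  | C a =>
    have hcont := continuous_bernSeries hx hN
    have hloc : LocallyIntegrableOn (fun t => a * bernSeries x N t)
        ((⊤ : TopologicalSpace.Opens (Fin n → ℝ)) : Set (Fin n → ℝ)) volume :=
      (continuous_const.mul hcont).locallyIntegrable.locallyIntegrableOn _
    set B : Distribution (⊤ : TopologicalSpace.Opens (Fin n → ℝ)) ℂ ⊤ :=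
      TestFunction.integralAgainstBilinCLM (ContinuousLinearMap.lsmul ℝ ℝ) volume
        (fun t => a * bernSeries x N t) with hB
    have hBφ : ∀ φ : Test n, B φ = a * ∫ t, (φ t : ℂ) * bernSeries x N t := by
      intro φ
      have h1 : B φ = ∫ t, (ContinuousLinearMap.lsmul ℝ ℝ (φ t)) (a * bernSeries x N t) :=
        TestFunction.integralAgainstBilinCLM_eq_integral hloc
      rw [h1, ← integral_const_mul]
      refine integral_congr_ae (Eventually.of_forall fun t => ?_)
      simp only [ContinuousLinearMap.lsmul_apply, Complex.real_smul]
      ring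
    refine ⟨B, fun φ => ?_, fun Δ q hq φ hφ => ?_⟩
    · rw [hBφ]
      have h1 : Integrable fun t => (φ t : ℂ) := by
        simpa using integrable_test_mul φ (continuous_const (y := (1 : ℂ)))
      have h2 := (hasSum_integral_bernSeries hx hN h1).mul_left a
      have h3 : Function.support (fun j => a * ∫ t, (φ t : ℂ) *
          (bernCoeff x N j * Complex.exp (pair t (twoPiI j)))) ⊆ {j | twoPiI j ∈ arrCompl x} := by
        intro j hj
        by_contra hne
        apply hj
        simp [bernCoeff, Set.indicator_of_notMem (show twoPiI j ∉ arrCompl x from hne)]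
      rw [← hasSum_subtype_iff_of_support_subset h3] at h2
      refine (congrArg (HasSum · _) (funext fun j => ?_)).mp h2
      change a * ∫ t, (φ t : ℂ) * (bernCoeff x N j * Complex.exp (pair t (twoPiI j))) = _
      rw [← integral_const_mul, bernCoeff, Set.indicator_of_mem j.2]
      congr 1
      funext t
      simp only [MvPolynomial.eval_C]
      ring
    · rw [hBφ, ← integral_const_mul]
      obtain ⟨DB, hDB⟩ := exists_isDualBasis' hx
      refine integral_congr_ae ?_
      filter_upwards [bernSeries_eq hx hDB hN] with t ht
      by_cases hφt : φ t = 0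
      · simp [hφt]
      have htΔ : t ∈ Δ := hφ (subset_tsupport _ hφt)
      rw [ht, ratForm_C, meroMul_smul, diagPairing_smul, hDB.diagPairing_eq]
      have h1 : ∀ S, q (logClass S) = toddForm t S := hq t htΔ
      simp only [h1, meroMul_assoc]
      ring
  | add P Q hP hQ =>
    obtain ⟨B, hB, hB'⟩ := hP
    obtain ⟨E, hE, hE'⟩ := hQ
    refine ⟨B + E, fun φ => ?_, fun Δ q hq φ hφ => ?_⟩
    · have hint : ∀ (R : MvPolynomial (Fin n) ℂ) (j : Fin n → ℤ), Integrable fun t => (φ t : ℂ) *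
          (Complex.exp (pair t (twoPiI j)) *
            (MvPolynomial.eval (twoPiI j) R / formsProd x (twoPiI j) ^ N)) := fun R j =>
        integrable_test_mul φ ((continuous_pair _).cexp.mul continuous_const)
      refine (congrArg (HasSum · _) (funext fun j => ?_)).mp ((hB φ).add (hE φ))
      refine (integral_add (hint P j) (hint Q j)).symm.trans ?_
      congr 1
      funext t
      simp only [map_add]
      ring
    · change B φ + E φ = _
      rw [hB' Δ q hq φ hφ, hE' Δ q hq φ hφ, ← integral_add
        (integrable_test_mul φ (continuous_diagPairing hx q _))
        (integrable_test_mul φ (continuous_diagPairing hx q _))]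
      refine integral_congr_ae (Eventually.of_forall fun t => ?_)
      simp only [ratForm_add, meroMul_add, diagPairing_add]
      ring
  -- A further factor `zₖ` in the numerator is the derivative in the direction `tₖ`, both for the
  -- terms of the series and for the pairing with the diagonal class; it is moved to the test
  -- function by integration by parts.
  | mul_X P k hP =>
    obtain ⟨B, hB, hB'⟩ := hP
    set v : Fin n → ℝ := Pi.single k 1 with hv
    refine ⟨Distribution.lineDerivCLM v B, fun φ => ?_, fun Δ q hq φ hφ => ?_⟩
    · rw [Distribution.lineDerivCLM_apply]
      refine (congrArg (HasSum · _) (funext fun j => ?_)).mp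
        (hB (TestFunction.lineDerivCLM ℝ v φ)).neg
      set J := twoPiI j.1 with hJ
      set c := MvPolynomial.eval J P / formsProd x J ^ N with hc
      have hd : ∀ t : Fin n → ℝ, HasLineDerivAt ℝ (fun t => Complex.exp (pair t J) * c)
          (Complex.exp (pair t J) * J k * c) t v := by
        intro t
        have h1 : ∀ s : ℝ, pair (t + s • v) J = pair t J + s * J k := by
          intro s
          rw [pair_add_left]
          congr 1
          rw [pair, Finset.sum_eq_single k]
          · simp [hv]
          · intro l _ hl
            simp [hv, Pi.single_eq_of_ne hl]
          · simp
        have h2 : HasDerivAt (fun s : ℝ => pair t J + (s : ℂ) * J k) (J k) 0 := by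
          have := ((hasDerivAt_id ((0 : ℝ) : ℂ)).comp_ofReal.mul_const (J k)).const_add (pair t J)
          simpa using this
        rw [HasLineDerivAt]
        simp only [h1]
        have h3 := (h2.cexp.mul_const c)
        simpa using h3
      refine (integral_test_lineDeriv φ v ((continuous_pair J).cexp.mul continuous_const)
        (((continuous_pair J).cexp.mul continuous_const).mul continuous_const) hd).symm.trans ?_
      congr 1
      funext t
      change (φ t : ℂ) * (Complex.exp (pair t J) * J k * c) = (φ t : ℂ) * (Complex.exp (pair t J) *
        (MvPolynomial.eval J (P * MvPolynomial.X k) / formsProd x J ^ N))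
      rw [map_mul, MvPolynomial.eval_X, hc]
      ring
    · rw [Distribution.lineDerivCLM_apply, hB' Δ q hq]
      · rw [← integral_test_lineDeriv φ v (continuous_diagPairing hx q _)
          (continuous_diagPairing hx q _) fun t => hasLineDerivAt_diagPairing hx q _ t k, ratForm_mul_X]
      · refine Subset.trans ?_ hφ
        refine (closure_mono fun t ht => ?_).trans (tsupport_fderiv_subset ℝ (f := φ))
        rw [Function.mem_support, TestFunction.lineDerivCLM_eq_fderivCLM] at ht
        rw [Function.mem_support]
        intro h
        apply ht
        rw [TestFunction.fderivCLM_apply_of_le _ (by simp), h]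
        rfl

end Distributions

/-! ### Constant terms, circle averages and iterated smallness. -/

section ConstantTerm

open MeasureTheory

/-- The circle average of `Φ / z ^ K` is a Taylor coefficient. -/
lemma circleAverage_div_pow {Φ : ℂ → ℂ} {δ r : ℝ} (hΦ : DifferentiableOn ℂ Φ (Metric.ball 0 δ))
    (hr : r ≠ 0) (hrδ : |r| < δ) (K : ℕ) {g : ℂ → ℂ}
    (hg : ∀ u : ℂ, u ≠ 0 → ‖u‖ < δ → g u = Φ u / u ^ K) :
    Real.circleAverage g 0 r = iteratedDeriv K Φ 0 / K.factorial := by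
  have hr' : 0 < |r| := abs_pos.2 hr
  rw [← Real.circleAverage_abs_radius, Real.circleAverage_eq_circleIntegral hr'.ne']
  have h1 : DiffContOnCl ℂ Φ (Metric.ball 0 |r|) := by
    refine (hΦ.mono ?_).diffContOnCl
    rw [closure_ball _ hr'.ne']
    exact Metric.closedBall_subset_ball hrδ
  have h2 := h1.circleIntegral_one_div_sub_center_pow_smul hr' K
  have h3 : (∮ z in C(0, |r|), (z - 0)⁻¹ • g z) = ∮ z in C(0, |r|), (1 / (z - 0) ^ (K + 1)) • Φ z := by
    refine circleIntegral.integral_congr hr'.le fun z hz => ?_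
    have hz' : ‖z‖ = |r| := by simpa using hz
    have hz0 : z ≠ 0 := by
      rw [← norm_pos_iff, hz']
      exact hr'
    simp only [sub_zero, smul_eq_mul]
    rw [hg z hz0 (by rwa [hz']), pow_succ]
    field_simp
  rw [h3, h2, smul_eq_mul, smul_eq_mul]
  have := Complex.two_pi_I_ne_zero
  field_simp

/-- The constant term is the average over small circles. -/
lemma constTerm_eq {g Φ : ℂ → ℂ} {δ : ℝ} (hδ : 0 < δ) (hΦ : DifferentiableOn ℂ Φ (Metric.ball 0 δ))
    {K : ℕ} (hg : ∀ u : ℂ, u ≠ 0 → ‖u‖ < δ → g u = Φ u / u ^ K) :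
    constTerm g = iteratedDeriv K Φ 0 / K.factorial := by
  have hex : ∃ N : ℕ, AnalyticAt ℂ (fun z => z ^ N * g z) 0 := by
    -- The exponent is `K + 1` because `g 0` is arbitrary: the additional factor makes both
    -- functions vanish at `0`.
    refine ⟨K + 1, ?_⟩
    have h1 : AnalyticAt ℂ (fun z => z * Φ z) 0 :=
      analyticAt_id.mul (hΦ.analyticAt (Metric.ball_mem_nhds 0 hδ))
    refine h1.congr ?_
    filter_upwards [Metric.ball_mem_nhds (0 : ℂ) hδ] with z hz
    by_cases hz0 : z = 0
    · simp [hz0]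
    · rw [hg z hz0 (by simpa using hz), pow_succ]
      field_simp
  rw [constTerm, dif_pos hex]
  obtain ⟨δ', hδ', hball⟩ := Metric.eventually_nhds_iff_ball.1 hex.choose_spec.eventually_analyticAt
  set r := min δ δ' / 2 with hr
  have hr0 : 0 < r := by positivity
  have hrlt : r < min δ δ' := half_lt_self (by positivity)
  -- The exponent chosen in the definition of `constTerm` may differ from `K`; both expressions
  -- equal the average of `g` over one small circle.
  rw [← circleAverage_div_pow (r := r) hΦ hr0.ne'
    (by rw [abs_of_pos hr0]; exact hrlt.trans_le (min_le_left _ _)) K hg]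
  refine (circleAverage_div_pow (r := r) (δ := δ')
    (fun z hz => (hball z hz).differentiableAt.differentiableWithinAt) hr0.ne'
    (by rw [abs_of_pos hr0]; exact hrlt.trans_le (min_le_right _ _)) hex.choose
    fun u hu _ => ?_).symm
  field_simp

variable {n : ℕ}

/-- The property `P` holds if the last coordinate is close to the limit with respect to `l`, the
coordinate before is close to the limit depending on the last one, and so on. -/
def IterEventually (l : Filter ℝ) : (n : ℕ) → ((Fin n → ℝ) → Prop) → Prop
  | 0, P => P 0
  | n + 1, P => IterEventually l n fun ρ => ∀ᶠ r in l, P (Fin.cons r ρ)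

lemma IterEventually.mono {l : Filter ℝ} : ∀ {n : ℕ} {P Q : (Fin n → ℝ) → Prop},
    IterEventually l n P → (∀ ρ, P ρ → Q ρ) → IterEventually l n Q
  | 0, _, _, h, hPQ => hPQ _ h
  | n + 1, _, _, h, hPQ => IterEventually.mono (n := n) h fun _ hρ => hρ.mono fun _ => hPQ _

lemma IterEventually.and {l : Filter ℝ} : ∀ {n : ℕ} {P Q : (Fin n → ℝ) → Prop},
    IterEventually l n P → IterEventually l n Q → IterEventually l n fun ρ => P ρ ∧ Q ρ
  | 0, _, _, h, h' => ⟨h, h'⟩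
  | n + 1, _, _, h, h' => (IterEventually.and (n := n) h h').mono fun _ hρ => hρ.1.and hρ.2

lemma IterEventually.of_forall {l : Filter ℝ} : ∀ {n : ℕ} {P : (Fin n → ℝ) → Prop},
    (∀ ρ, P ρ) → IterEventually l n P
  | 0, _, h => h _
  | n + 1, _, h => IterEventually.of_forall (n := n) fun _ => Eventually.of_forall fun _ => h _

lemma IterEventually.exists {l : Filter ℝ} [l.NeBot] : ∀ {n : ℕ} {P : (Fin n → ℝ) → Prop},
    IterEventually l n P → ∃ ρ, P ρ
  | 0, _, h => ⟨_, h⟩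
  | n + 1, _, h => by
    obtain ⟨ρ, hρ⟩ := IterEventually.exists (n := n) h
    obtain ⟨r, hr⟩ := hρ.exists
    exact ⟨_, hr⟩

lemma IterEventually.finset_forall {l : Filter ℝ} {A : Type*} {P : A → (Fin n → ℝ) → Prop}
    (s : Finset A) (h : ∀ i ∈ s, IterEventually l n (P i)) :
    IterEventually l n fun ρ => ∀ i ∈ s, P i ρ := by
  classical
  induction s using Finset.induction_on with
  | empty => exact IterEventually.of_forall fun _ i hi => absurd hi (Finset.notMem_empty i)
  | insert a s ha ih =>
    refine ((h a (Finset.mem_insert_self a s)).and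
      (ih fun i hi => h i (Finset.mem_insert_of_mem hi))).mono fun ρ hρ i hi => ?_
    rcases Finset.mem_insert.1 hi with rfl | hi
    · exact hρ.1
    · exact hρ.2 i hi

/-- Two defining forms of a hyperplane differ by a real factor of either sign, so radii have to be
rescaled by possibly negative constants; this is why the punctured neighbourhood is two-sided. -/
lemma IterEventually.comp_mul : ∀ {n : ℕ} {P : (Fin n → ℝ) → Prop} {c : Fin n → ℝ},
    (∀ k, c k ≠ 0) → IterEventually (𝓝[≠] 0) n P → IterEventually (𝓝[>] 0) n fun ρ => P (c * ρ)
  | 0, P, c, _, h => by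
    rw [IterEventually, Subsingleton.elim (c * 0) 0]
    exact h
  | n + 1, P, c, hc, h => by
    refine (IterEventually.comp_mul (n := n) (fun k => hc k.succ) h).mono fun ρ hρ => ?_
    have h1 : Tendsto (fun r : ℝ => c 0 * r) (𝓝[>] 0) (𝓝[≠] 0) := by
      refine tendsto_nhdsWithin_iff.2 ⟨?_, ?_⟩
      · have : Tendsto (fun r : ℝ => c 0 * r) (𝓝 0) (𝓝 (c 0 * 0)) := tendsto_id.const_mul _
        rw [mul_zero] at this
        exact this.mono_left nhdsWithin_le_nhds
      · filter_upwards [self_mem_nhdsWithin] with r hr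
        exact mul_ne_zero (hc 0) (ne_of_gt hr)
    filter_upwards [h1.eventually hρ] with r hr
    have h2 : c * Fin.cons (α := fun _ => ℝ) r ρ = Fin.cons (c 0 * r) ((fun k => c k.succ) * ρ) := by
      funext k
      refine Fin.cases ?_ (fun k => ?_) k <;> simp
    rw [h2]
    exact hr

lemma iterEventually_pos : ∀ n : ℕ, IterEventually (𝓝[>] 0) n fun ρ => ∀ k, 0 < ρ k
  | 0 => fun k => k.elim0
  | n + 1 => by
    refine (iterEventually_pos n).mono fun ρ hρ => ?_
    filter_upwards [self_mem_nhdsWithin] with r hr k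
    refine Fin.cases ?_ (fun k => ?_) k
    · simpa using hr
    · simpa using hρ k

lemma iterEventually_lt {l : Filter ℝ} (hl : l ≤ 𝓝 0) {ε : ℝ} (hε : 0 < ε) :
    ∀ n : ℕ, IterEventually l n fun ρ => ∀ k, |ρ k| < ε
  | 0 => fun k => k.elim0
  | n + 1 => by
    refine (iterEventually_lt hl hε n).mono fun ρ hρ => ?_
    have h1 : ∀ᶠ r : ℝ in 𝓝 0, |r| < ε := by
      have := (continuous_abs (G := ℝ)).continuousAt (x := (0 : ℝ))
      exact this.eventually_lt_const (by simpa using hε)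
    filter_upwards [hl h1] with r hr k
    refine Fin.cases ?_ (fun k => ?_) k
    · simpa using hr
    · simpa using hρ k

/-- Induction on the number of variables. If a later coefficient is nonzero, domination in the later
variables is a strict inequality that survives the small term of the first one; otherwise the first
variable stands alone. -/
lemma iterEventually_dominates {l : Filter ℝ} (hl : l ≤ 𝓝[≠] 0) : ∀ {n : ℕ} {a : Fin n → ℂ}, a ≠ 0 →
    IterEventually l n fun ρ => Dominates a fun k => |ρ k|
  | 0, a, ha => absurd (Subsingleton.elim a 0) ha
  | n + 1, a, ha => by
    have hsum : ∀ (ρ : Fin n → ℝ) (r : ℝ) (K : Fin n),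
        ∑ k ∈ Finset.Iio K.succ, ‖a k‖ * |(Fin.cons r ρ : Fin (n + 1) → ℝ) k| =
          ‖a 0‖ * |r| + ∑ k ∈ Finset.Iio K, ‖a k.succ‖ * |ρ k| := by
      intro ρ r K
      have h1 : (Finset.Iio K.succ : Finset (Fin (n + 1))) =
          insert 0 ((Finset.Iio K).map (Fin.succEmb n)) := by
        ext k
        refine Fin.cases ?_ (fun k => ?_) k <;> simp
      rw [h1, Finset.sum_insert (by simp), Finset.sum_map]
      simp
    by_cases ht : (fun k : Fin n => a k.succ) = 0
    · have ha0 : a 0 ≠ 0 := by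
        intro h
        exact ha (funext fun k => Fin.cases h (fun k => congrFun ht k) k)
      refine IterEventually.of_forall (n := n) fun ρ => ?_
      filter_upwards [hl self_mem_nhdsWithin] with r hr
      refine ⟨0, fun k hk => ?_, ?_⟩
      · obtain ⟨k, rfl⟩ := Fin.exists_succ_eq.2 (ne_of_gt hk)
        exact congrFun ht k
      · have : (Finset.Iio (0 : Fin (n + 1))) = ∅ := by ext k; simp
        rw [this, Finset.sum_empty]
        change 0 < ‖a 0‖ * |(Fin.cons r ρ : Fin (n + 1) → ℝ) 0|
        rw [Fin.cons_zero]
        exact mul_pos (norm_pos_iff.2 ha0) (abs_pos.2 hr)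
    · refine (iterEventually_dominates hl ht).mono fun ρ => ?_
      rintro ⟨K, hK, hlt⟩
      have h1 : Tendsto (fun r : ℝ => ‖a 0‖ * |r|) l (𝓝 0) := by
        have : Tendsto (fun r : ℝ => ‖a 0‖ * |r|) (𝓝 0) (𝓝 (‖a 0‖ * |0|)) :=
          (continuous_abs.tendsto 0).const_mul _
        rw [abs_zero, mul_zero] at this
        exact this.mono_left (hl.trans nhdsWithin_le_nhds)
      filter_upwards [h1.eventually_lt_const (sub_pos.2 hlt)] with r hr
      refine ⟨K.succ, fun k hk => ?_, ?_⟩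
      · obtain ⟨k, rfl⟩ := Fin.exists_succ_eq.2 (ne_of_gt ((Fin.zero_le _).trans_lt hk))
        exact hK k (Fin.succ_lt_succ_iff.1 hk)
      · rw [hsum]
        change _ < ‖a K.succ‖ * |(Fin.cons r ρ : Fin (n + 1) → ℝ) K.succ|
        rw [Fin.cons_succ]
        linarith

lemma torusAvg_zero (g : (Fin 0 → ℂ) → ℂ) (ρ : Fin 0 → ℝ) : torusAvg g ρ = g 0 := by
  rw [torusAvg]
  have h1 : ∀ u, polar ρ u = 0 := fun u => Subsingleton.elim _ _
  simp only [h1]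
  have h2 : (volume (Icc (0 : Fin 0 → ℝ) 1)) = 1 := by
    rw [Real.volume_Icc_pi]
    simp
  rw [setIntegral_const, measureReal_def, h2]
  simp

lemma circleAverage_eq_integral (g : ℂ → ℂ) (r : ℝ) :
    Real.circleAverage g 0 r =
      ∫ s in Icc (0 : ℝ) 1, g ((r : ℂ) * Complex.exp (2 * Real.pi * Complex.I * (s : ℂ))) := by
  have h0 : (2 * Real.pi : ℝ) ≠ 0 := by positivity
  rw [integral_Icc_eq_integral_Ioc, ← intervalIntegral.integral_of_le zero_le_one,
    Real.circleAverage_def]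
  have h1 := intervalIntegral.integral_comp_mul_left (a := 0) (b := 1)
    (fun θ => g (circleMap 0 r θ)) h0
  rw [mul_zero, mul_one] at h1
  rw [← h1]
  refine intervalIntegral.integral_congr fun s _ => ?_
  simp only [circleMap, zero_add]
  congr 3
  push_cast
  ring

/-- A torus average as an iterated average. -/
lemma torusAvg_cons {g : (Fin (n + 1) → ℂ) → ℂ} {r : ℝ} {ρ : Fin n → ℝ}
    (hg : ContinuousOn (fun v => g (polar (Fin.cons r ρ) v)) (Icc 0 1)) :
    torusAvg g (Fin.cons r ρ) =
      torusAvg (fun w => Real.circleAverage (fun u => g (Fin.cons u w)) 0 r) ρ := by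
  set e : ℝ × (Fin n → ℝ) ≃ᵐ (Fin (n + 1) → ℝ) :=
    (MeasurableEquiv.piFinSuccAbove (fun _ => ℝ) 0).symm with he
  have hem : MeasurePreserving e :=
    (volume_preserving_piFinSuccAbove (fun _ : Fin (n + 1) => ℝ) 0).symm _
  have heπ : (e ⁻¹' Icc 0 1) = Icc (0 : ℝ) 1 ×ˢ Icc (0 : Fin n → ℝ) 1 :=
    ((Fin.insertNthOrderIso (fun _ => ℝ) 0).preimage_Icc _ _).trans (Icc_prod_eq _ _)
  have hpol : ∀ q : ℝ × (Fin n → ℝ), polar (Fin.cons r ρ) (e q) =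
      Fin.cons ((r : ℂ) * Complex.exp (2 * Real.pi * Complex.I * (q.1 : ℂ))) (polar ρ q.2) := by
    intro q
    funext k
    refine Fin.cases ?_ (fun k => ?_) k <;> simp [polar, he, MeasurableEquiv.piFinSuccAbove]
  have hint : IntegrableOn (fun v => g (polar (Fin.cons r ρ) v)) (Icc 0 1) :=
    hg.integrableOn_compact isCompact_Icc
  rw [← hem.integrableOn_comp_preimage e.measurableEmbedding, heπ] at hint
  rw [torusAvg, ← hem.map_eq, setIntegral_map_equiv, heπ, Measure.volume_eq_prod]
  simp only [torusAvg, circleAverage_eq_integral]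
  rw [← integral_integral_swap]
  · refine (setIntegral_prod _ hint).trans ?_
    refine integral_congr_ae (Eventually.of_forall fun s => ?_)
    refine integral_congr_ae (Eventually.of_forall fun u => ?_)
    simp only [Function.comp_apply, hpol]
  · rw [IntegrableOn, Measure.volume_eq_prod, ← Measure.prod_restrict] at hint
    refine hint.congr (Eventually.of_forall fun q => ?_)
    simp only [Function.comp_apply, hpol, Function.uncurry]

end ConstantTerm

/-! ### Iterated constant terms as torus averages. -/

section IteratedConstantTerm

open MeasureTheory

variable {n : ℕ} {A : Type*}

/-- The linear form with coefficients `a`. -/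
def linForm (a w : Fin n → ℂ) : ℂ := ∑ k, a k * w k

lemma linForm_cons (a : Fin (n + 1) → ℂ) (u : ℂ) (w : Fin n → ℂ) :
    linForm a (Fin.cons u w) = a 0 * u + linForm (Fin.tail a) w := by
  rw [linForm, Fin.sum_univ_succ]
  simp [linForm, Fin.tail]

lemma analyticAt_linForm (a w : Fin n → ℂ) : AnalyticAt ℂ (linForm a) w :=
  Finset.analyticAt_fun_sum _ fun k _ => analyticAt_const.mul
    ((ContinuousLinearMap.proj (R := ℂ) (φ := fun _ : Fin n => ℂ) k).analyticAt w)

/-- Near `0` the function `G` is meromorphic, with poles along the zero sets of the linear forms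
with coefficients `a i`, `i ∈ s`. -/
def IsFormQuotient (a : A → Fin n → ℂ) (s : Finset A) (G : (Fin n → ℂ) → ℂ) : Prop :=
  ∃ (N : ℕ) (F : (Fin n → ℂ) → ℂ), AnalyticAt ℂ F 0 ∧
    ∀ᶠ w in 𝓝 0, (∀ i ∈ s, linForm (a i) w ≠ 0) → G w = F w / (∏ i ∈ s, linForm (a i) w) ^ N

lemma hasDerivAt_cons (u : ℂ) (w : Fin n → ℂ) :
    HasDerivAt (fun u : ℂ => (Fin.cons u w : Fin (n + 1) → ℂ)) (Pi.single 0 1) u := by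
  rw [hasDerivAt_pi]
  intro k
  refine Fin.cases ?_ (fun k => ?_) k
  · simp only [Fin.cons_zero, Pi.single_eq_same]
    exact hasDerivAt_id' u
  · simpa using hasDerivAt_const u (w k)

lemma analyticAt_cons_right (u : ℂ) (w : Fin n → ℂ) :
    AnalyticAt ℂ (fun w : Fin n → ℂ => (Fin.cons u w : Fin (n + 1) → ℂ)) w := by
  rw [analyticAt_pi_iff]
  intro k
  refine Fin.cases ?_ (fun k => ?_) k
  · simpa using analyticAt_const
  · simp only [Fin.cons_succ]
    exact (ContinuousLinearMap.proj (R := ℂ) (φ := fun _ : Fin n => ℂ) k).analyticAt w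

lemma cons_zero_zero : (Fin.cons 0 0 : Fin (n + 1) → ℂ) = 0 := by
  funext k
  refine Fin.cases ?_ (fun k => ?_) k <;> simp

/-- The derivatives of a quotient with respect to the first variable. -/
lemma exists_iteratedDeriv_quotient {F B : (Fin (n + 1) → ℂ) → ℂ} (hF : AnalyticAt ℂ F 0)
    (hB : ∀ p, AnalyticAt ℂ B p) (N K : ℕ) :
    ∃ F' : (Fin (n + 1) → ℂ) → ℂ, AnalyticAt ℂ F' 0 ∧ ∀ᶠ p in 𝓝 0, B p ≠ 0 →
      iteratedDeriv K (fun u => F (Fin.cons u (Fin.tail p)) / B (Fin.cons u (Fin.tail p)) ^ N) (p 0) =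
        F' p / B p ^ (N + K) := by
  induction K with
  | zero =>
    refine ⟨F, hF, Eventually.of_forall fun p _ => ?_⟩
    rw [iteratedDeriv_zero, Fin.cons_self_tail, add_zero]
  | succ K ih =>
    obtain ⟨F', hF', h⟩ := ih
    -- The numerator given by the quotient rule; each derivative raises the exponent of `B` by one.
    refine ⟨fun p => fderiv ℂ F' p (Pi.single 0 1) * B p -
      ((N + K : ℕ) : ℂ) * F' p * fderiv ℂ B p (Pi.single 0 1), ?_, ?_⟩
    · have h1 : AnalyticAt ℂ (fun p => fderiv ℂ F' p (Pi.single 0 1)) 0 :=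
        ((ContinuousLinearMap.apply ℂ ℂ (Pi.single 0 1 : Fin (n + 1) → ℂ)).analyticAt _).comp hF'.fderiv
      have h2 : AnalyticAt ℂ (fun p => fderiv ℂ B p (Pi.single 0 1)) 0 :=
        ((ContinuousLinearMap.apply ℂ ℂ (Pi.single 0 1 : Fin (n + 1) → ℂ)).analyticAt _).comp (hB 0).fderiv
      exact (h1.mul (hB 0)).sub ((analyticAt_const.mul hF').mul h2)
    · filter_upwards [h.eventually_nhds, hF'.eventually_analyticAt] with p hp hpF hpB
      set c : ℂ → Fin (n + 1) → ℂ := fun u => Fin.cons u (Fin.tail p) with hc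
      have hcp : c (p 0) = p := Fin.cons_self_tail p
      have hcd : HasDerivAt c (Pi.single 0 1) (p 0) := hasDerivAt_cons _ _
      have hcc : Tendsto c (𝓝 (p 0)) (𝓝 p) := by
        have := hcd.continuousAt.tendsto
        rwa [hcp] at this
      have h1 : ∀ᶠ u in 𝓝 (p 0), iteratedDeriv K (fun u => F (c u) / B (c u) ^ N) u =
          F' (c u) / B (c u) ^ (N + K) := by
        filter_upwards [hcc.eventually hp, hcc.eventually ((hB p).continuousAt.eventually_ne hpB)]
          with u hu huB
        have := hu huB
        simpa only [hc, Fin.tail_cons, Fin.cons_zero] using this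
      have h2 : HasDerivAt (fun u => F' (c u)) (fderiv ℂ F' p (Pi.single 0 1)) (p 0) := by
        have h3 : HasFDerivAt F' (fderiv ℂ F' p) (c (p 0)) := by
          rw [hcp]
          exact hpF.differentiableAt.hasFDerivAt
        exact h3.comp_hasDerivAt _ hcd
      have h3 : HasDerivAt (fun u => B (c u)) (fderiv ℂ B p (Pi.single 0 1)) (p 0) := by
        have h3 : HasFDerivAt B (fderiv ℂ B p) (c (p 0)) := by
          rw [hcp]
          exact (hB p).differentiableAt.hasFDerivAt
        exact h3.comp_hasDerivAt _ hcd
      have h4 := h2.fun_div (h3.fun_pow (N + K)) (by rw [hcp]; exact pow_ne_zero _ hpB)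
      rw [iteratedDeriv_succ, Filter.EventuallyEq.deriv_eq h1, h4.deriv, hcp]
      rw [div_eq_div_iff (pow_ne_zero _ (pow_ne_zero _ hpB)) (pow_ne_zero _ hpB), ← add_assoc]
      rcases N + K with _ | M
      · simp
      · rw [Nat.add_sub_cancel]
        ring

/-- The behaviour of a meromorphic function on small discs in the first variable. -/
lemma IsFormQuotient.exists_disc {a : A → Fin (n + 1) → ℂ} {s s' : Finset A}
    {G : (Fin (n + 1) → ℂ) → ℂ} (h : IsFormQuotient a s G) (ha : ∀ i ∈ s, a i ≠ 0)
    (hs' : ∀ i, i ∈ s' ↔ i ∈ s ∧ Fin.tail (a i) ≠ 0) :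
    ∃ (N K : ℕ) (F : (Fin (n + 1) → ℂ) → ℂ) (ε M : ℝ), AnalyticAt ℂ F 0 ∧ 0 < ε ∧ 0 < M ∧
      ∀ η > 0, ∀ w : Fin n → ℂ, ‖w‖ < ε → (∀ i ∈ s', η ≤ ‖linForm (Fin.tail (a i)) w‖) →
        ∀ u : ℂ, ‖u‖ < min ε (η / M) →
          AnalyticAt ℂ (fun p => F p / (∏ i ∈ s', linForm (a i) p) ^ N) (Fin.cons u w) ∧
          (u ≠ 0 → G (Fin.cons u w) =
            F (Fin.cons u w) / (∏ i ∈ s', linForm (a i) (Fin.cons u w)) ^ N / u ^ K) := by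
  classical
  obtain ⟨N, F, hF, hG⟩ := h
  obtain ⟨ε, hε, hball⟩ := Metric.eventually_nhds_iff_ball.1 (hG.and hF.eventually_analyticAt)
  -- The forms outside `s'` are multiples of the first variable. Their coefficients are collected in
  -- `β`, and their powers account for the pole `u ^ K`.
  set β : ℂ := ((∏ i ∈ s \ s', a i 0) ^ N)⁻¹ with hβ
  -- With `M = 1 + ∑ ‖a i 0‖` the bound `‖u‖ < η / M` makes the contribution of the first variable
  -- to a form in `s'` smaller than `η`, so these forms do not vanish on the disc.
  refine ⟨N, N * (s \ s').card, fun p => β * F p, ε, 1 + ∑ i ∈ s', ‖a i 0‖, analyticAt_const.mul hF,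
    hε, by positivity, fun η hη w hw hwη u hu => ?_⟩
  have hM : 0 < 1 + ∑ i ∈ s', ‖a i 0‖ := by positivity
  have hmem : (Fin.cons u w : Fin (n + 1) → ℂ) ∈ Metric.ball 0 ε := by
    rw [mem_ball_zero_iff, pi_norm_lt_iff hε]
    intro k
    refine Fin.cases ?_ (fun k => ?_) k
    · simpa using hu.trans_le (min_le_left _ _)
    · simpa using (norm_le_pi_norm w k).trans_lt hw
  obtain ⟨hGu, hFu⟩ := hball _ hmem
  have hne : ∀ i ∈ s', linForm (a i) (Fin.cons u w) ≠ 0 := by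
    intro i hi h0
    rw [linForm_cons] at h0
    have h1 : ‖linForm (Fin.tail (a i)) w‖ = ‖a i 0‖ * ‖u‖ := by
      rw [← norm_mul, ← norm_neg, ← eq_neg_of_add_eq_zero_left h0]
    have h2 := hwη i hi
    have h3 : ‖u‖ * (1 + ∑ i ∈ s', ‖a i 0‖) < η :=
      (lt_div_iff₀ hM).1 (hu.trans_le (min_le_right _ _))
    have h4 : ‖a i 0‖ ≤ ∑ i ∈ s', ‖a i 0‖ :=
      Finset.single_le_sum (f := fun i => ‖a i 0‖) (fun _ _ => norm_nonneg _) hi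
    nlinarith [norm_nonneg u]
  refine ⟨(analyticAt_const.mul hFu).div ((Finset.analyticAt_fun_prod _ fun i _ =>
    analyticAt_linForm _ _).pow N) (pow_ne_zero _ (Finset.prod_ne_zero_iff.2 hne)), fun hu0 => ?_⟩
  have hsub : s' ⊆ s := fun i hi => ((hs' i).1 hi).1
  have htail : ∀ i ∈ s \ s', linForm (a i) (Fin.cons u w) = a i 0 * u ∧ a i 0 ≠ 0 := by
    intro i hi
    obtain ⟨his, hi'⟩ := Finset.mem_sdiff.1 hi
    have h1 : Fin.tail (a i) = 0 := by
      by_contra h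
      exact hi' ((hs' i).2 ⟨his, h⟩)
    refine ⟨by rw [linForm_cons, h1]; simp [linForm], fun h0 => ha i his ?_⟩
    rw [← Fin.cons_self_tail (a i), h1, h0, cons_zero_zero]
  have hall : ∀ i ∈ s, linForm (a i) (Fin.cons u w) ≠ 0 := by
    intro i hi
    by_cases hi' : i ∈ s'
    · exact hne i hi'
    · obtain ⟨h1, h2⟩ := htail i (Finset.mem_sdiff.2 ⟨hi, hi'⟩)
      rw [h1]
      exact mul_ne_zero h2 hu0
  rw [hGu hall, ← Finset.prod_sdiff hsub, Finset.prod_congr rfl fun i hi => (htail i hi).1,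
    Finset.prod_mul_distrib, Finset.prod_const, hβ, mul_pow, mul_pow, ← pow_mul,
    mul_comm N]
  have h5 : (∏ i ∈ s \ s', a i 0) ≠ 0 := Finset.prod_ne_zero_iff.2 fun i hi => (htail i hi).2
  have h6 := Finset.prod_ne_zero_iff.2 hne
  field_simp

lemma exists_pos_le {s : Finset A} {f : A → ℝ} (hf : ∀ i ∈ s, 0 < f i) :
    ∃ η > 0, ∀ i ∈ s, η ≤ f i := by
  have h1 : ∀ᶠ η : ℝ in 𝓝[>] 0, ∀ i ∈ s, η ≤ f i :=
    (Filter.eventually_all_finset s).2 fun i hi =>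
      (eventually_le_nhds (hf i hi)).filter_mono nhdsWithin_le_nhds
  obtain ⟨η, h2, h3⟩ := (h1.and self_mem_nhdsWithin).exists
  exact ⟨η, h3, h2⟩

/-- The constant term of a meromorphic function in the first variable is meromorphic. -/
lemma IsFormQuotient.constTerm {a : A → Fin (n + 1) → ℂ} {s s' : Finset A}
    {G : (Fin (n + 1) → ℂ) → ℂ} (h : IsFormQuotient a s G) (ha : ∀ i ∈ s, a i ≠ 0)
    (hs' : ∀ i, i ∈ s' ↔ i ∈ s ∧ Fin.tail (a i) ≠ 0) :
    IsFormQuotient (fun i => Fin.tail (a i)) s'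
      fun w => MultipleBernoulli.constTerm fun u => G (Fin.cons u w) := by
  obtain ⟨N, K, F, ε, M, hF, hε, hM, hdisc⟩ := h.exists_disc ha hs'
  obtain ⟨F', hF', hd⟩ := exists_iteratedDeriv_quotient hF
    (B := fun p => ∏ i ∈ s', linForm (a i) p)
    (fun p => Finset.analyticAt_fun_prod _ fun i _ => analyticAt_linForm _ _) N K
  -- The constant term is the `K`th Taylor coefficient in `u` of the factor regular at `u = 0`; its
  -- poles are along the restrictions of the forms to `u = 0`.
  refine ⟨N + K, fun w => F' (Fin.cons 0 w) / K.factorial, ?_, ?_⟩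
  · have h1 : AnalyticAt ℂ (fun w : Fin n → ℂ => F' (Fin.cons 0 w)) 0 :=
      hF'.comp_of_eq (analyticAt_cons_right 0 0) cons_zero_zero
    exact h1.div_const
  · have hcont : Tendsto (fun w : Fin n → ℂ => (Fin.cons 0 w : Fin (n + 1) → ℂ)) (𝓝 0) (𝓝 0) := by
      have := (analyticAt_cons_right (0 : ℂ) (0 : Fin n → ℂ)).continuousAt.tendsto
      rwa [cons_zero_zero] at this
    filter_upwards [hcont.eventually hd, Metric.ball_mem_nhds (0 : Fin n → ℂ) hε] with w hw hwε hne
    have hwε : ‖w‖ < ε := by simpa using hwε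
    obtain ⟨η, hη, hηle⟩ := exists_pos_le (f := fun i => ‖linForm (Fin.tail (a i)) w‖)
      fun i hi => norm_pos_iff.2 (hne i hi)
    have hδ : 0 < min ε (η / M) := lt_min hε (div_pos hη hM)
    have h1 := fun u hu => hdisc η hη w hwε hηle u hu
    have h0 : ∀ i, linForm (a i) (Fin.cons 0 w) = linForm (Fin.tail (a i)) w := fun i => by
      rw [linForm_cons, mul_zero, zero_add]
    rw [constTerm_eq hδ (Φ := fun u => F (Fin.cons u w) /
      (∏ i ∈ s', linForm (a i) (Fin.cons u w)) ^ N) ?_ fun u hu0 hu => (h1 u hu).2 hu0]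
    · have h2 := hw (Finset.prod_ne_zero_iff.2 fun i hi => by rw [h0]; exact hne i hi)
      simp only [Fin.tail_cons, Fin.cons_zero] at h2
      rw [h2]
      simp only [h0]
      ring
    · intro u hu
      have hu : ‖u‖ < min ε (η / M) := by simpa using hu
      have h2 := (h1 u hu).1.differentiableAt
      exact (h2.comp u (hasDerivAt_cons u w).differentiableAt).differentiableWithinAt

/-- The iterated constant term of a meromorphic function is an average over tori. -/
theorem IsFormQuotient.iterEventually_torusAvg_eq : ∀ {n : ℕ} {a : A → Fin n → ℂ} {s : Finset A}
    {G : (Fin n → ℂ) → ℂ}, IsFormQuotient a s G → (∀ i ∈ s, a i ≠ 0) →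
      IterEventually (𝓝[≠] 0) n fun ρ => torusAvg G ρ = iterConst n G
  | 0, _, _, G, _, _ => torusAvg_zero G 0
  | n + 1, a, s, G, h, ha => by
    classical
    set s' := s.filter fun i => Fin.tail (a i) ≠ 0 with hs'
    have hmem : ∀ i, i ∈ s' ↔ i ∈ s ∧ Fin.tail (a i) ≠ 0 := fun i => Finset.mem_filter
    have h1 := IsFormQuotient.iterEventually_torusAvg_eq (h.constTerm ha hmem)
      fun i hi => ((hmem i).1 hi).2
    obtain ⟨N, K, F, ε, M, hF, hε, hM, hdisc⟩ := h.exists_disc ha hmem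
    have h2 : IterEventually (𝓝[≠] 0) n fun ρ => ∀ i ∈ s', Dominates (Fin.tail (a i)) fun k => |ρ k| :=
      IterEventually.finset_forall s' fun i hi =>
        iterEventually_dominates le_rfl ((hmem i).1 hi).2
    have h3 := iterEventually_lt (l := 𝓝[≠] 0) nhdsWithin_le_nhds hε n
    refine ((h1.and h2).and h3).mono ?_
    rintro ρ ⟨⟨hρ, hdom⟩, hρε⟩
    -- Domination bounds the restricted forms from below on the torus of the later variables,
    -- uniformly in the angles. A single disc in the first variable then works over the whole torus.
    have hη : ∀ i : s', ∃ η > 0, ∀ u, η ≤ ‖linForm (Fin.tail (a i)) (polar ρ u)‖ := by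
      rintro ⟨i, hi⟩
      obtain ⟨K, hK, hlt⟩ := hdom i hi
      exact ⟨_, sub_pos.2 hlt, fun u => Dominates.lower_bound hK (norm_polar ρ u)⟩
    choose η hη0 hη using hη
    obtain ⟨η', hη', hηle⟩ := exists_pos_le (s := s'.attach) (f := η) fun i _ => hη0 i
    have hw : ∀ u, ‖polar ρ u‖ < ε := fun u => by
      rw [pi_norm_lt_iff hε]
      intro k
      rw [norm_polar]
      exact hρε k
    have hlow : ∀ u, ∀ i ∈ s', η' ≤ ‖linForm (Fin.tail (a i)) (polar ρ u)‖ := fun u i hi =>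
      (hηle ⟨i, hi⟩ (Finset.mem_attach _ _)).trans (hη ⟨i, hi⟩ u)
    have hδ : 0 < min ε (η' / M) := lt_min hε (div_pos hη' hM)
    have h4 : ∀ᶠ r : ℝ in 𝓝[≠] 0, |r| < min ε (η' / M) := by
      have := (continuous_abs (G := ℝ)).continuousAt (x := (0 : ℝ))
      exact (this.eventually_lt_const (by simpa using hδ)).filter_mono nhdsWithin_le_nhds
    filter_upwards [h4, self_mem_nhdsWithin] with r hr hr0
    have hr0 : r ≠ 0 := hr0
    have hpol : ∀ v, polar (Fin.cons r ρ) v =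
        Fin.cons ((r : ℂ) * Complex.exp (2 * Real.pi * Complex.I * (v 0 : ℂ))) (polar ρ (Fin.tail v)) := by
      intro v
      funext k
      refine Fin.cases ?_ (fun k => ?_) k <;> simp [polar, Fin.tail]
    have hexp : ∀ y : ℝ, ‖(r : ℂ) * Complex.exp (2 * Real.pi * Complex.I * (y : ℂ))‖ = |r| := by
      intro y
      have := norm_polar (fun _ : Fin 1 => r) (fun _ => y) 0
      exact this
    -- Over every point of the smaller torus the circle average in the first variable is the
    -- constant term, and the induction hypothesis handles the remaining average.
    rw [iterConst, ← hρ, torusAvg_cons]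
    · rw [torusAvg, torusAvg]
      refine integral_congr_ae (Eventually.of_forall fun v => ?_)
      have h5 := fun u hu => hdisc η' hη' _ (hw v) (hlow v) u hu
      have h6 : DifferentiableOn ℂ (fun u => F (Fin.cons u (polar ρ v)) /
          (∏ i ∈ s', linForm (a i) (Fin.cons u (polar ρ v))) ^ N) (Metric.ball 0 (min ε (η' / M))) := by
        intro u hu
        have hu : ‖u‖ < min ε (η' / M) := by simpa using hu
        have h2 := (h5 u hu).1.differentiableAt
        exact (h2.comp u (hasDerivAt_cons u _).differentiableAt).differentiableWithinAt
      simp only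
      rw [constTerm_eq hδ h6 fun u hu0 hu => (h5 u hu).2 hu0,
        circleAverage_div_pow h6 hr0 hr K fun u hu0 hu => (h5 u hu).2 hu0]
    · have h5 := fun v : Fin (n + 1) → ℝ => hdisc η' hη' _ (hw (Fin.tail v)) (hlow (Fin.tail v))
        ((r : ℂ) * Complex.exp (2 * Real.pi * Complex.I * (v 0 : ℂ))) (by rw [hexp]; exact hr)
      have hne : ∀ v : Fin (n + 1) → ℝ,
          (r : ℂ) * Complex.exp (2 * Real.pi * Complex.I * (v 0 : ℂ)) ≠ 0 := fun v =>
        mul_ne_zero (by exact_mod_cast hr0) (Complex.exp_ne_zero _)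
      have h7 : (fun v => G (polar (Fin.cons r ρ) v)) = fun v =>
          F (polar (Fin.cons r ρ) v) / (∏ i ∈ s', linForm (a i) (polar (Fin.cons r ρ) v)) ^ N /
            ((r : ℂ) * Complex.exp (2 * Real.pi * Complex.I * (v 0 : ℂ))) ^ K := by
        funext v
        simp only [hpol]
        exact (h5 v).2 (hne v)
      rw [h7]
      refine Continuous.continuousOn (Continuous.div ?_ ?_ fun v => pow_ne_zero _ (hne v))
      · rw [continuous_iff_continuousAt]
        intro v
        have h8 := (h5 v).1.continuousAt
        rw [← hpol] at h8
        exact ContinuousAt.comp (g := fun p => F p / (∏ i ∈ s', linForm (a i) p) ^ N) h8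
          (continuous_polar _).continuousAt
      · fun_prop

end IteratedConstantTerm

/-! ### The iterated residue formula. -/

section IteratedResidue

open MeasureTheory

variable {n : ℕ} {ι : Type*} [Fintype ι] {x : ι → Fin n → ℤ}

lemma isUnit_det_formsMatrix_of_ne_zero {y : Fin n → Fin n → ℤ} (hy : formsDet y ≠ 0) :
    IsUnit (formsMatrix y).det := by
  have h : (formsMatrix y).det = formsDet y := (RingHom.map_det (Int.castRingHom ℂ) (Matrix.of y)).symm
  rw [h, isUnit_iff_ne_zero]
  exact_mod_cast hy

lemma evC_inv_mulVec_self {y : Fin n → Fin n → ℤ} (hy : formsDet y ≠ 0) (k : Fin n)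
    (w : Fin n → ℂ) : evC (y k) ((formsMatrix y)⁻¹.mulVec w) = w k := by
  have h : (formsMatrix y).mulVec ((formsMatrix y)⁻¹.mulVec w) = w := by
    rw [Matrix.mulVec_mulVec, Matrix.mul_nonsing_inv _ (isUnit_det_formsMatrix_of_ne_zero hy),
      Matrix.one_mulVec]
  exact congrFun h k

/-- The factor `det⁻¹ ∏ yₖ` is the one by which a form is multiplied when its integral over a torus
is written as an average. -/
lemma toddIntegrand_eq {y : Fin n → Fin n → ℤ} (hy : formsDet y ≠ 0) (t : Fin n → ℝ)
    (f : (Fin n → ℂ) → ℂ) (z : Fin n → ℂ) :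
    toddIntegrand y t f z =
      (formsDet y : ℂ)⁻¹ * (∏ k, evC (y k) z) * (Complex.exp (pair t z) * (f z * toddCoeff y t z)) := by
  have hy' : (formsDet y : ℂ) ≠ 0 := by exact_mod_cast hy
  simp only [toddIntegrand, todd, toddCoeff, expMul, div_eq_mul_inv, Finset.prod_mul_distrib]
  field_simp

/-- The integrand of the iterated residue is meromorphic in the coordinates given by `y`. -/
lemma isFormQuotient_toddIntegrand {S : OrdTuple x} {y : Fin n → Fin n → ℤ} (h : Represents S y)
    (t : Fin n → ℝ) {f : (Fin n → ℂ) → ℂ} {P : MvPolynomial (Fin n) ℂ} {N : ℕ}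
    (hf : ∀ z ∈ arrCompl x, f z = MvPolynomial.eval z P / formsProd x z ^ N) :
    IsFormQuotient (fun i => Matrix.vecMul (fun l => (x i l : ℂ)) (formsMatrix y)⁻¹) Finset.univ
      fun w => toddIntegrand y t f ((formsMatrix y)⁻¹.mulVec w) := by
  obtain ⟨c, hc, hcy, -⟩ := h.exists_smul
  set F : (Fin n → ℂ) → ℂ := fun z => (vol y : ℂ)⁻¹ *
    (∏ k, -(dslope Complex.exp 0 (evC (y k) z))⁻¹) * cubeCharacter y t z *
      (Complex.exp (pair t z) * MvPolynomial.eval z P) with hF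
  have hFa : AnalyticAt ℂ F 0 :=
    ((analyticAt_const.mul (Finset.analyticAt_fun_prod _ fun k _ => analyticAt_toddFactor _)).mul
      (analyticAt_cubeCharacter y t)).mul ((analyticAt_pair t 0).cexp.mul (analyticAt_eval P 0))
  have hL : AnalyticAt ℂ (fun w : Fin n → ℂ => (formsMatrix y)⁻¹.mulVec w) 0 :=
    (LinearMap.toContinuousLinearMap (Matrix.toLin' (formsMatrix y)⁻¹)).analyticAt 0
  have hform : ∀ (i : ι) (w : Fin n → ℂ), linForm (Matrix.vecMul (fun l => (x i l : ℂ))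
      (formsMatrix y)⁻¹) w = evC (x i) ((formsMatrix y)⁻¹.mulVec w) := fun i w =>
    (Matrix.dotProduct_mulVec _ _ _).symm
  refine ⟨N, fun w => F ((formsMatrix y)⁻¹.mulVec w), hFa.comp_of_eq hL (Matrix.mulVec_zero _),
    Eventually.of_forall fun w hw => ?_⟩
  simp only [hform] at hw ⊢
  set z := (formsMatrix y)⁻¹.mulVec w with hz
  have hzU : z ∈ arrCompl x := fun i => hw i (Finset.mem_univ i)
  have hne : ∀ k, evC (y k) z ≠ 0 := fun k => by
    rw [evC_eq_of_smul (hcy k)]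
    exact mul_ne_zero (by exact_mod_cast hc k) (hzU _)
  have htodd : ∀ k, todd (evC (y k) z) = -(dslope Complex.exp 0 (evC (y k) z))⁻¹ := fun k => by
    have h1 := hne k
    rw [todd, div_eq_mul_inv, one_sub_exp_inv]
    field_simp
  rw [toddIntegrand, expMul, hf z hzU, hF]
  simp only [htodd]
  rw [mul_div_assoc', mul_div_assoc']
  rfl

/-- The iterated residue is the pairing with the torus cycle. -/
theorem iRes_eq_pairing (hx : IsIntegralArrangement x) {t : Fin n → ℝ} (ht : t ∈ regularSet x)
    {S : OrdTuple x} {y : Fin n → Fin n → ℤ} (h : Represents S y) {f : (Fin n → ℂ) → ℂ}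
    {P : MvPolynomial (Fin n) ℂ} {N : ℕ}
    (hf : ∀ z ∈ arrCompl x, f z = MvPolynomial.eval z P / formsProd x z ^ N) :
    iRes y (toddIntegrand y t f) = pairing hx
      (meroMul (expForm x t) (meroMul (ratForm x N P) (toddForm t S))) (torusClass hx S) := by
  have hy := h.formsDet_ne_zero
  have hS := MultipleBernoulli.formsDet_ne_zero S
  have hyU := isUnit_det_formsMatrix_of_ne_zero hy
  obtain ⟨c, hc, hcy, hdet⟩ := h.exists_smul
  have hdet' : (formsDet y : ℂ) = (∏ k, (c k : ℂ)) * formsDet S.forms := by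
    have := congrArg (fun r : ℝ => (r : ℂ)) hdet
    push_cast at this
    exact this
  have hcprod : (∏ k, (c k : ℂ)) ≠ 0 := Finset.prod_ne_zero_iff.2 fun k _ => by exact_mod_cast hc k
  have ha : ∀ i ∈ (Finset.univ : Finset ι),
      Matrix.vecMul (fun l => (x i l : ℂ)) (formsMatrix y)⁻¹ ≠ 0 := by
    intro i _ h0
    have h1 : Matrix.vecMul (Matrix.vecMul (fun l => (x i l : ℂ)) (formsMatrix y)⁻¹)
        (formsMatrix y) = fun l => (x i l : ℂ) := by
      rw [Matrix.vecMul_vecMul, Matrix.nonsing_inv_mul _ hyU, Matrix.vecMul_one]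
    rw [h0, Matrix.zero_vecMul] at h1
    apply hx.ne_zero i
    funext l
    have := congrFun h1 l
    simpa using this.symm
  obtain ⟨ε, hε, hεW⟩ := exists_pos_torusPoint_mem S
    (inter_mem (smallNhd_mem_nhds (x := x)) (smallNhd_mem_nhds (x := y)))
  -- The coordinates `y k` are the constants `c k` times those given by `S`. Rescaling the radii by
  -- `c` expresses both constructions on the same torus.
  have h1 := ((isFormQuotient_toddIntegrand h t hf).iterEventually_torusAvg_eq ha).comp_mul hc
  have h2 : IterEventually (𝓝[>] 0) n fun ρ => ∀ i ∈ (Finset.univ : Finset ι),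
      Dominates (formCoeffs S (x i)) fun k => |ρ k| :=
    IterEventually.finset_forall _ fun i _ => iterEventually_dominates
      (nhdsWithin_mono _ fun r hr => ne_of_gt hr) (formCoeffs_ne_zero S (hx.ne_zero i))
  -- One choice of radii computes the iterated constant term, represents `Z(S)` and lies in the
  -- region where the integrand is holomorphic off the hyperplanes.
  obtain ⟨ρ, ⟨⟨⟨hρ, hdom⟩, hpos⟩, hρε⟩⟩ := (((h1.and h2).and (iterEventually_pos n)).and
    (iterEventually_lt nhdsWithin_le_nhds hε n)).exists
  have hρS : ρ ∈ torusDomain S := by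
    refine ⟨hpos, fun i => ?_⟩
    have := hdom i (Finset.mem_univ i)
    simpa only [abs_of_pos (hpos _)] using this
  have hW := hεW ρ hρε
  rw [iRes, ← hρ, pairing_torusClass hx _ (h := fun z => Complex.exp (pair t z) *
      (MvPolynomial.eval z P / formsProd x z ^ N * toddCoeff S.forms t z)) rfl isOpen_smallNhd
      (fun z hz => (analyticAt_pair t z).cexp.mul (((analyticAt_eval P z).div
        ((Finset.analyticAt_fun_prod _ fun i _ => analyticAt_evC _ _).pow N)
        (pow_ne_zero _ (formsProd_ne_zero hz.1))).mul
          (analyticAt_toddCoeff S t (isSmallPoint_of_mem hz.1 hz.2)))) S hρS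
      (fun σ hσ u => (hW σ hσ fun k => (u k : ℝ)).1), torusAvg, torusAvg, ← integral_const_mul]
  refine integral_congr_ae (Eventually.of_forall fun u => ?_)
  simp only
  have hz : (formsMatrix y)⁻¹.mulVec (polar (c * ρ) u) = torusPoint S ρ u := by
    have h3 : (formsMatrix y).mulVec (torusPoint S ρ u) = polar (c * ρ) u := by
      funext k
      change evC (y k) (torusPoint S ρ u) = _
      rw [evC_eq_of_smul (hcy k), torusPoint]
      have h4 : evC (x (S.1 k)) ((formsMatrix S.forms)⁻¹.mulVec (polar ρ u)) = polar ρ u k :=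
        evC_inv_mulVec_self (y := S.forms) (by exact_mod_cast hS) k (polar ρ u)
      rw [h4]
      simp [polar, mul_assoc]
    rw [← h3, Matrix.mulVec_mulVec, Matrix.nonsing_inv_mul _ hyU, Matrix.one_mulVec]
  have hzU := torusPoint_mem_arrCompl S hρS u
  have hzW : torusPoint S ρ u ∈ smallNhd x ∩ smallNhd y := by
    simpa using hW 1 ⟨one_pos, le_rfl⟩ u
  have hzy : ∀ k, Complex.exp (evC (y k) (torusPoint S ρ u)) ≠ 1 := fun k => by
    refine exp_ne_one_of_norm_lt ?_ (hzW.2 k)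
    rw [evC_eq_of_smul (hcy k)]
    exact mul_ne_zero (by exact_mod_cast hc k) (hzU _)
  have hprod : ∏ k, evC (y k) (torusPoint S ρ u) = (∏ k, (c k : ℂ)) * ∏ k, polar ρ u k := by
    rw [← Finset.prod_mul_distrib]
    refine Finset.prod_congr rfl fun k _ => ?_
    rw [← hz, evC_inv_mulVec_self hy]
    simp [polar, mul_assoc]
  change _ = (formsDet S.forms : ℂ)⁻¹ * (Complex.exp (pair t (torusPoint S ρ u)) *
    (MvPolynomial.eval (torusPoint S ρ u) P / formsProd x (torusPoint S ρ u) ^ N *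
      toddCoeff S.forms t (torusPoint S ρ u)) * ∏ k, polar ρ u k)
  -- The integrands agree pointwise: the factors `c k` cancel, and `μ` does not depend on the choice
  -- of the defining forms at a regular `t`.
  rw [hz, toddIntegrand_eq hy, hprod, hdet', ← hf _ hzU,
    h.toddCoeff_eq hx ht (isSmallPoint_of_mem hzU hzW.1) hzy]
  field_simp

/-- The germ of `exp(t) f`. -/
lemma coe_meroMul_expForm_ratForm (t : Fin n → ℝ) {f : (Fin n → ℂ) → ℂ}
    {P : MvPolynomial (Fin n) ℂ} {N : ℕ}
    (hf : ∀ z ∈ arrCompl x, f z = MvPolynomial.eval z P / formsProd x z ^ N) :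
    ((meroMul (expForm x t) (ratForm x N P) : meroForms x) : Germ (𝓝[arrCompl x] 0) ℂ) =
      (expMul t f : (Fin n → ℂ) → ℂ) := by
  refine Germ.coe_eq.2 ?_
  filter_upwards [self_mem_nhdsWithin] with z hz
  change Complex.exp (pair t z) * (MvPolynomial.eval z P / formsProd x z ^ N) =
    Complex.exp (pair t z) * f z
  rw [hf z hz]

end IteratedResidue

end MultipleBernoulli

end

/-- The main theorem on multiple Bernoulli polynomials of an integral arrangement. -/
theorem mainTheorem1 {n : ℕ} {ι : Type*} [Fintype ι] (x : ι → Fin n → ℤ)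
    (hx : IsIntegralArrangement x) :
    (∃ D : OS x ⊗[ℤ] Homology (arrCompl x) n, IsDiag D) ∧
    (∀ Δ ∈ chambers x, ∃! q : OS x →ₗ[ℤ] meroForms x, IsDeformation Δ q) ∧
    ∀ f : (Fin n → ℂ) → ℂ, IsARational x f →
      ∃ B : Distribution (⊤ : TopologicalSpace.Opens (Fin n → ℝ)) ℂ ⊤, IsFourierSeries x f B ∧
        ∀ Δ ∈ chambers x, ∃ p : MvPolynomial (Fin n) ℂ, RestrictsTo B Δ p ∧
          -- Formula (A)
          (∀ q : OS x →ₗ[ℤ] meroForms x, IsDeformation Δ q →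
            ∀ D : OS x ⊗[ℤ] Homology (arrCompl x) n, IsDiag D → ∀ t ∈ Δ,
              HasPairing x (q.rTensor (Homology (arrCompl x) n) D) (expMul t f)
                (MvPolynomial.eval (fun k => (t k : ℂ)) p)) ∧
          ∀ DB : Finset (OrdTuple x), IsDiagonalBasis hx DB →
            -- Formula (B)
            (∀ t₀ ∈ Δ, ∀ t ∈ Δ, ∃ v : OrdTuple x → ℂ,
              (∀ S ∈ DB, HasPairing x (toddForm t₀ S ⊗ₜ[ℤ] torusClass hx S) (expMul t f) (v S)) ∧
              MvPolynomial.eval (fun k => (t k : ℂ)) p = ∑ S ∈ DB, v S) ∧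
            -- Formula (C)
            (∀ y : OrdTuple x → Fin n → Fin n → ℤ, (∀ S ∈ DB, Represents S (y S)) → ∀ t ∈ Δ,
              MvPolynomial.eval (fun k => (t k : ℂ)) p =
                ∑ S ∈ DB, iRes (y S) (toddIntegrand (y S) t f)) := by
  obtain ⟨DB₀, hDB₀⟩ := exists_isDualBasis' hx
  refine ⟨⟨diagClass hx, isDiag_diagClass hx⟩, fun Δ hΔ => existsUnique_isDeformation hx hΔ,
    fun f hf => ?_⟩
  obtain ⟨P, N, hN, hfP⟩ := hf.exists_eq_div
  obtain ⟨B, hB, hBΔ⟩ := exists_distribution_ratForm hx hN P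
  refine ⟨B, fun φ => ?_, fun Δ hΔ => ?_⟩
  · refine (congrArg (HasSum · _) (funext fun j => ?_)).mp (hB φ)
    simp only [hfP _ j.2]
  obtain ⟨q, hq, hquniq⟩ := existsUnique_isDeformation hx hΔ
  obtain ⟨p, hp⟩ := exists_polynomial_diagPairing hx q (ratForm x N P)
  -- Any point `t₀` of the chamber gives the same forms `μ_Δ(S)`, while `t` enters only through
  -- `exp(t)`; and any diagonal basis gives the same sum as the dual basis `DB₀`.
  have hsum : ∀ DB, IsDiagonalBasis hx DB → ∀ t₀ ∈ Δ, ∀ t : Fin n → ℝ,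
      MvPolynomial.eval (fun k => (t k : ℂ)) p = ∑ S ∈ DB, pairing hx
        (meroMul (meroMul (expForm x t) (ratForm x N P)) (toddForm t₀ S)) (torusClass hx S) := by
    intro DB hDB t₀ ht₀ t
    rw [← hp, hDB₀.diagPairing_eq, ← hDB₀.sum_pairing_eq hDB q]
    exact Finset.sum_congr rfl fun S _ => by rw [hq t₀ ht₀ S]
  refine ⟨p, fun φ hφ => ?_, fun q' hq' D hD t _ => ?_, fun DB hDB => ⟨fun t₀ ht₀ t _ => ?_,
    fun y hy t ht => ?_⟩⟩
  · rw [hBΔ Δ q hq φ hφ]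
    simp only [hp]
  · rw [hasPairing_iff hx (coe_meroMul_expForm_ratForm t hfP), hquniq q' hq', ← hp,
      hDB₀.tensorPairing_diag q _ hD, hDB₀.diagPairing_eq]
  · refine ⟨fun S => pairing hx (meroMul (meroMul (expForm x t) (ratForm x N P)) (toddForm t₀ S))
      (torusClass hx S), fun S _ => ?_, hsum DB hDB t₀ ht₀ t⟩
    rw [hasPairing_iff hx (coe_meroMul_expForm_ratForm t hfP), tensorPairing_tmul]
  · rw [hsum DB hDB t ht t]
    refine Finset.sum_congr rfl fun S hS => ?_
    rw [iRes_eq_pairing hx (chamber_subset hΔ ht) (hy S hS) hfP, meroMul_assoc]
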